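/- Let $\phi(t)=\big(\tfrac{p_1(t)}{q_1(t)},\dots,\tfrac{p_n(t)}{q_n(t)}\big)$ with $p_i,q_i\in\mathbb{Z}[t]$, $q_i\neq 0$, $\gcd(p_i,q_i)=1$ in $\mathbb{Q}[t]$, be a rational parametrization of a curve in $n$-space. Suppose that all $p_i,q_i$ have size $(d,\tau)$, i.e. degree at most $d$ and coefficients of absolute value at most $2^\tau$. Suppose that $\phi$ is proper, i.e. for all but finitely many $t\in\mathbb{C}$ that are not poles (zeros of some $q_i$), no other non-pole $s\in\mathbb{C}$ has $\phi(s)=\phi(t)$. Suppose finally that the point at infinity $\mathbf{p}_\infty^{\phi}=\lim_{t\to\pm\infty}\phi(t)\in\mathbb{R}^n$ exists. There is a Las Vegas algorithm that, given $n$, $d$ and the coefficients of the $p_i,q_i$, computes an integer $t_0$ and polynomials $P_i,Q_i\in\mathbb{Z}[t]$ with $Q_i\ne0$, coprime in $\mathbb{Q}[t]$, such that: 1. $\psi=(P_1/Q_1,\dots,P_n/Q_n)$ is the reparametrization $\psi(t)=\phi\big(\frac{t_0t+1}{t-t_0}\big)$ of the curve. 2. The point at infinity $\mathbf{p}_\infty^{\psi}=\lim_{t\to\pm\infty}\psi(t)$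 exists and is not a singular point of the curve: it is not a multiple point ($\psi(s)\neq \mathbf{p}_\infty^{\psi}$ for every $s\in\mathbb{C}$ that is not a pole of $\psi$) and it is not a cusp ($u\mapsto\psi(1/u)$, extended by $\mathbf{p}_\infty^{\psi}$ at $u=0$, has a nonzero derivative at $u=0$). 3. All $P_i,Q_i$ have size $(d,\widetilde{\mathcal{O}}(d+\tau))$. The algorithm halts with probability one, its output is always correct, and its expected bit complexity is $\widetilde{\mathcal{O}}_B\big(n(d^2+d\tau)\big)$. Precisely, there are one fixed program and constants $C,k$ such that, for all inputs as above, its expected bit cost is at most $C\,n(d^2+d\tau)\log^k(n+d+\tau+2)$ and the output coefficients have absolute value at most $2^{B}$ with $B=C(d+\tau)\log^k(n+d+\tau+2)$. The model is the random access machine with fair coin tosses and logarithmic cost: every instruction is charged the bit lengths of its operands and addresses, and a multiplication or division on $\ell$ bits is charged $\ell(\lfloor\log_2\ell\rfloor+1)$. -/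

import Mathlib

open Polynomial Filter Topology
open scoped ENNReal

/-! ## Random access machines with bit cost and fair coins

A program has finitely many integer registers and an integer memory with indirect addressing. Every
elementary operation is charged according to the bit lengths of all the integers (addresses
included) that it handles. -/

namespace BitRAM

/-- Binary arithmetic instructions. -/
inductive Op where
  | add
  | sub
  | mul
  | div
  | mod

/-- Division is Euclidean, and division by `0` returns `0`. -/
def Op.eval : Op → ℤ → ℤ → ℤ
  | .add, x, y => x + y
  | .sub, x, y => x - y
  | .mul, x, y => x * y
  | .div, x, y => x / y
  | .mod, x, y => x % y

/-- The bit length of an integer, sign included. -/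
def len (z : ℤ) : ℕ := z.natAbs.size + 1

/-- The bit cost of an arithmetic operation: linear in the number `l` of bits of the operands for
addition and subtraction, and `l * (⌊log₂ l⌋ + 1)` for multiplication and division. -/
def Op.cost : Op → ℤ → ℤ → ℕ
  | .add, x, y => len x + len y
  | .sub, x, y => len x + len y
  | .mul, x, y => (len x + len y) * (len x + len y).size
  | .div, x, y => (len x + len y) * (len x + len y).size
  | .mod, x, y => (len x + len y) * (len x + len y).size

/-- Programs; the natural numbers are names of registers. -/
inductive Cmd where
  | skip
  /-- `reg dst := c` -/
  | const (dst : ℕ) (c : ℤ)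
  /-- `reg dst := reg a op reg b` -/
  | arith (op : Op) (dst a b : ℕ)
  /-- `reg dst := mem (reg a)` -/
  | load (dst a : ℕ)
  /-- `mem (reg a) := reg src` -/
  | store (a src : ℕ)
  /-- `reg dst :=` a fair random bit -/
  | coin (dst : ℕ)
  /-- sequential composition -/
  | seq (c₁ c₂ : Cmd)
  /-- if `0 < reg a` then `c₁` else `c₂` -/
  | cond (a : ℕ) (c₁ c₂ : Cmd)
  /-- while `0 < reg a` do `c` -/
  | loop (a : ℕ) (c : Cmd)

/-- The state of the machine: registers and memory. -/
structure State where
  reg : ℕ → ℤ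
  mem : ℤ → ℤ

/-- Assignment to a register. -/
def State.setReg (σ : State) (r : ℕ) (z : ℤ) : State :=
  { σ with reg := Function.update σ.reg r z }

/-- Assignment to a memory cell. -/
def State.setMem (σ : State) (a z : ℤ) : State :=
  { σ with mem := Function.update σ.mem a z }

/-- `Exec c σ bits k σ'`: the program `c`, started in `σ`, halts in `σ'` at total bit cost `k`, and
`bits` is the list of results of the coin tosses that it has made, in this order. -/
inductive Exec : Cmd → State → List Bool → ℕ → State → Prop where
  | skip (σ : State) : Exec .skip σ [] 1 σ
  | const (σ : State) (dst : ℕ) (c : ℤ) :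
      Exec (.const dst c) σ [] (len c) (σ.setReg dst c)
  | arith (σ : State) (op : Op) (dst a b : ℕ) :
      Exec (.arith op dst a b) σ [] (op.cost (σ.reg a) (σ.reg b))
        (σ.setReg dst (op.eval (σ.reg a) (σ.reg b)))
  | load (σ : State) (dst a : ℕ) :
      Exec (.load dst a) σ [] (len (σ.reg a) + len (σ.mem (σ.reg a)))
        (σ.setReg dst (σ.mem (σ.reg a)))
  | store (σ : State) (a src : ℕ) :
      Exec (.store a src) σ [] (len (σ.reg a) + len (σ.reg src))
        (σ.setMem (σ.reg a) (σ.reg src))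
  | coin (σ : State) (dst : ℕ) (b : Bool) :
      Exec (.coin dst) σ [b] 1 (σ.setReg dst (if b then 1 else 0))
  | seq {c₁ c₂ : Cmd} {σ σ₁ σ₂ : State} {l₁ l₂ : List Bool} {k₁ k₂ : ℕ}
      (h₁ : Exec c₁ σ l₁ k₁ σ₁) (h₂ : Exec c₂ σ₁ l₂ k₂ σ₂) :
      Exec (.seq c₁ c₂) σ (l₁ ++ l₂) (k₁ + k₂) σ₂
  | condTrue {a : ℕ} {c₁ c₂ : Cmd} {σ σ' : State} {l : List Bool} {k : ℕ}
      (ha : 0 < σ.reg a) (h : Exec c₁ σ l k σ') :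
      Exec (.cond a c₁ c₂) σ l (len (σ.reg a) + k) σ'
  | condFalse {a : ℕ} {c₁ c₂ : Cmd} {σ σ' : State} {l : List Bool} {k : ℕ}
      (ha : σ.reg a ≤ 0) (h : Exec c₂ σ l k σ') :
      Exec (.cond a c₁ c₂) σ l (len (σ.reg a) + k) σ'
  | loopDone {a : ℕ} {c : Cmd} {σ : State} (ha : σ.reg a ≤ 0) :
      Exec (.loop a c) σ [] (len (σ.reg a)) σ
  | loopStep {a : ℕ} {c : Cmd} {σ σ₁ σ₂ : State} {l₁ l₂ : List Bool} {k₁ k₂ : ℕ}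
      (ha : 0 < σ.reg a) (h₁ : Exec c σ l₁ k₁ σ₁) (h₂ : Exec (.loop a c) σ₁ l₂ k₂ σ₂) :
      Exec (.loop a c) σ (l₁ ++ l₂) (len (σ.reg a) + k₁ + k₂) σ₂

/-- The halting runs of `c` from `σ`: coin tosses, bit cost and final state. -/
def Run (c : Cmd) (σ : State) : Type :=
  {x : List Bool × ℕ × State // Exec c σ x.1 x.2.1 x.2.2}

/-- The list of coin tosses of a run. -/
def Run.tosses {c : Cmd} {σ : State} (x : Run c σ) : List Bool := x.1.1

/-- The bit cost of a run. -/
def Run.cost {c : Cmd} {σ : State} (x : Run c σ) : ℕ := x.1.2.1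

/-- The final state of a run. -/
def Run.final {c : Cmd} {σ : State} (x : Run c σ) : State := x.1.2.2

/-- A run with `m` tosses of a fair coin has probability `2 ^ (-m)`. -/
noncomputable def Run.prob {c : Cmd} {σ : State} (x : Run c σ) : ℝ≥0∞ :=
  2⁻¹ ^ x.tosses.length

/-- Started in `σ`, the program halts with probability one, its result is correct (satisfies `post`)
in every halting run, and its expected bit cost is at most `B`. -/
structure IsLasVegas (c : Cmd) (σ : State) (post : State → Prop) (B : ℝ≥0∞) : Prop where
  halts : ∑' x : Run c σ, x.prob = 1
  correct : ∀ x : Run c σ, post x.final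
  expected_cost : ∑' x : Run c σ, x.prob * (x.cost : ℝ≥0∞) ≤ B

end BitRAM

/-! ## Rational parametrizations -/

/-- An integer polynomial of size `(d, τ)`: its degree is at most `d`, and the binary logarithm of
the maximal absolute value of its coefficients is at most `τ`. -/
def HasSize (f : ℤ[X]) (d : ℕ) (τ : ℝ) : Prop :=
  f.natDegree ≤ d ∧ ∀ j : ℕ, |(f.coeff j : ℝ)| ≤ (2 : ℝ) ^ τ

/-- The numerators and denominators of `t ↦ (p₁(t)/q₁(t), …, pₙ(t)/qₙ(t))`. -/
structure RatParam (n : ℕ) where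
  num : Fin n → ℤ[X]
  den : Fin n → ℤ[X]

namespace RatParam

variable {n : ℕ}

/-- All numerators and denominators have size `(d, τ)`. -/
def HasSize (φ : RatParam n) (d : ℕ) (τ : ℝ) : Prop :=
  ∀ i, _root_.HasSize (φ.num i) d τ ∧ _root_.HasSize (φ.den i) d τ

/-- The coordinates are fractions in lowest terms. -/
def IsReduced (φ : RatParam n) : Prop :=
  ∀ i, φ.den i ≠ 0 ∧
    IsCoprime ((φ.num i).map (Int.castRingHom ℚ)) ((φ.den i).map (Int.castRingHom ℚ))

/-- The parameters where the parametrization is not defined. -/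
def IsPole (φ : RatParam n) (t : ℂ) : Prop := ∃ i, aeval t (φ.den i) = 0

/-- The point with complex parameter `t` (meaningful when `t` is not a pole). -/
noncomputable def point (φ : RatParam n) (t : ℂ) : Fin n → ℂ :=
  fun i => aeval t (φ.num i) / aeval t (φ.den i)

/-- The point with real parameter `t` (meaningful when `t` is not a pole). -/
noncomputable def realPoint (φ : RatParam n) (t : ℝ) : Fin n → ℝ :=
  fun i => aeval t (φ.num i) / aeval t (φ.den i)

/-- All but finitely many parameters are determined by their point on the complex curve. -/
def IsProper (φ : RatParam n) : Prop :=
  {t : ℂ | ¬ φ.IsPole t ∧ ∃ s : ℂ, ¬ φ.IsPole s ∧ s ≠ t ∧ φ.point s = φ.point t}.Finite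

/-- `P` is the point at infinity: the limit of the point with parameter `t` for `t → ± ∞`. -/
def IsPointAtInfinity (φ : RatParam n) (P : Fin n → ℝ) : Prop :=
  Tendsto φ.realPoint (atBot ⊔ atTop) (𝓝 P)

/-- The point at infinity `P` is not a singular point of the curve. It is not a multiple point: no
complex parameter is mapped to it. It is not a cusp: the parametrization near `t = ∞`, in the local
parameter `u = 1/t`, has a nonzero tangent vector at `u = 0`. -/
def NonsingularAtInfinity (φ : RatParam n) (P : Fin n → ℝ) : Prop :=
  (∀ s : ℂ, ¬ φ.IsPole s → φ.point s ≠ fun i => (P i : ℂ)) ∧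
    ∃ v : Fin n → ℝ, v ≠ 0 ∧
      HasDerivAt (fun u : ℝ => if u = 0 then P else φ.realPoint u⁻¹) v 0

/-- `ψ = φ ∘ r` for the change of parameter `r(t) = (t₀ t + 1) / (t - t₀)`. -/
def IsReparam (φ ψ : RatParam n) (t₀ : ℤ) : Prop :=
  ∀ t : ℂ, t ≠ t₀ →
    (ψ.IsPole t ↔ φ.IsPole ((t₀ * t + 1) / (t - t₀))) ∧
    (¬ ψ.IsPole t → ψ.point t = φ.point ((t₀ * t + 1) / (t - t₀)))

/-- The memory consists of consecutive blocks of `d + 1` cells, which hold the coefficients (those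
of lower degree first) of `p₁, q₁, p₂, q₂, …, pₙ, qₙ`. -/
def StoredIn (φ : RatParam n) (d : ℕ) (mem : ℤ → ℤ) : Prop :=
  ∀ (i : Fin n) (j : ℕ), j ≤ d →
    mem ((2 * i * (d + 1) + j : ℕ) : ℤ) = (φ.num i).coeff j ∧
    mem (((2 * i + 1) * (d + 1) + j : ℕ) : ℤ) = (φ.den i).coeff j

/-- The memory that holds `φ` in the above format, and zeros elsewhere. -/
noncomputable def inputMem (φ : RatParam n) (d : ℕ) (a : ℤ) : ℤ :=
  if h : 0 ≤ a ∧ a.toNat / (d + 1) / 2 < n then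
    (if a.toNat / (d + 1) % 2 = 0 then φ.num ⟨_, h.2⟩ else φ.den ⟨_, h.2⟩).coeff
      (a.toNat % (d + 1))
  else 0

/-- The initial state on the input `φ`: register `0` holds `n`, register `1` holds `d`, the other
registers hold `0`, and the memory holds the coefficients. -/
noncomputable def input (φ : RatParam n) (d : ℕ) : BitRAM.State where
  reg r := if r = 0 then n else if r = 1 then d else 0
  mem := φ.inputMem d

end RatParam

/-! The change of parameter makes `φ(t₀)` the point at infinity, and a properly parametrized curve
has only finitely many singular points, so almost every `t₀` is good. What has to be arranged is
that goodness can be verified, that the verification succeeds often enough, and that everything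
stays within the bit budget.

Verification. Let `D_i` be the degree of `q_i`. It bounds the degrees of `P_i` and `Q_i`, because
finite limits force `deg p_i ≤ deg q_i`. Put `g_i = P_i [Q_i]_{D_i} - Q_i [P_i]_{D_i}`
(`RatParam.cross`), where `[f]_j` is the coefficient of `t^j`. If no `[Q_i]_{D_i}` vanishes, then
the finite parameters of the point at infinity are common roots of the `g_i`, and the tangent vector
at infinity has the entries `[g_i]_{D_i - 1} / [Q_i]_{D_i}²`. A certificate `RatParam.IsCert` is a
prime `r` modulo which the `g_i` generate the unit ideal and one of the `[g_k]_{D_k - 1}` is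
nonzero. Since this coefficient is the leading one of `g_k`, an integrality argument excludes common
roots in `ℂ` (`IsCert.exists_aeval_ne_zero`, `IsCert.nonsingular`). The program draws a modulus `l`
with `O(log)` bits and never tests it for primality: division-free elimination stays inside the
ideal for every `l`, and if the resulting constant times the coefficient is not nilpotent modulo
`l`, then some prime factor of `l` is a certificate (`exists_prime_not_dvd`). For prime `l` nothing
is lost.

Abundance. Properness gives a complex parameter at which the `g_i` have no common root
(`exists_generic_parameter`). Hence some `2d × 2d` determinant of coefficients of shifts `X^j g_i`
is a nonzero polynomial in the parameter, and where its value is prime to `r` it forces the unit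
ideal modulo `r` (`exists_det_ne_zero`, `span_gcross_eq_top`, `exists_minor`). Few parameters are
roots of a polynomial of low degree, few primes divide its value, and Chebyshev's bound provides
enough primes: one attempt succeeds with probability at least `1 / (4b)`, where `b` is logarithmic
(`exists_good_tosses`).

Computation. `P_i` and `Q_i` are found by Kronecker substitution. With `H` above all the
coefficients and `X = 2H`, the value at `X` is a binary form in `t₀ X + 1` and `X - t₀`; it is
evaluated by a merging tree, and its base `X` digits are extracted by a splitting tree
(`transform_tr`). Every level handles `Õ(d(d + τ))` bits. Elimination modulo `l` costs `Õ(d²)` for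
each coordinate.

The program is written in a small structured language whose translation to the machine respects cost
bounds (`Ev.exec`); the expected cost of repeating a uniform experiment is `isLasVegas_loop`. -/

namespace BitRAM

/-! ### Expressions -/

/-- Arithmetic expressions over registers and memory. -/
inductive AExp where
  | reg (r : ℕ)
  | lit (z : ℤ)
  | op (o : Op) (a b : AExp)
  | load (e : AExp)

namespace AExp

instance : Add AExp := ⟨.op .add⟩
instance : Sub AExp := ⟨.op .sub⟩
instance : Mul AExp := ⟨.op .mul⟩
instance : Div AExp := ⟨.op .div⟩
instance : Mod AExp := ⟨.op .mod⟩
instance (n : ℕ) : OfNat AExp n := ⟨.lit n⟩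

/-- The value of an expression. -/
def eval (σ : State) : AExp → ℤ
  | reg r => σ.reg r
  | lit z => z
  | op o a b => o.eval (a.eval σ) (b.eval σ)
  | load e => σ.mem (e.eval σ)

/-- All leaves of the expression (registers, constants, loaded cells) have at most `w` bits. -/
def Fits (σ : State) (w : ℕ) : AExp → Prop
  | reg r => len (σ.reg r) ≤ w
  | lit z => len z ≤ w
  | op _ a b => a.Fits σ w ∧ b.Fits σ w
  | load e => e.Fits σ w ∧ len (σ.mem (e.eval σ)) ≤ w

/-- The number of leaves. -/
def leaves : AExp → ℕ
  | reg _ => 1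
  | lit _ => 1
  | op _ a b => a.leaves + b.leaves
  | load e => e.leaves + 1

/-- A weighted number of nodes. -/
def weight : AExp → ℕ
  | reg _ => 3
  | lit _ => 1
  | op _ a b => a.weight + b.weight + 1
  | load e => e.weight + 1

/-- Only visible registers (below `100`) are mentioned. -/
def vis : AExp → Bool
  | reg r => decide (r < 100)
  | lit _ => true
  | op _ a b => a.vis && b.vis
  | load e => e.vis

/-- Code that puts the value of the expression into register `t`, using only registers `≥ t`. -/
def code : AExp → ℕ → Cmd
  | reg r, t => .seq (.const t 0) (.arith .add t r t)
  | lit z, t => .const t z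
  | op o a b, t => .seq (a.code t) (.seq (b.code (t + 1)) (.arith o t t (t + 1)))
  | load e, t => .seq (e.code t) (.load t t)

section
variable (σ : State) (w : ℕ) (a b : AExp) (r : ℕ) (z : ℤ) (n : ℕ)
@[simp] lemma eval_reg : (reg r).eval σ = σ.reg r := rfl
@[simp] lemma eval_lit : (lit z).eval σ = z := rfl
@[simp] lemma eval_load : (load a).eval σ = σ.mem (a.eval σ) := rfl
@[simp] lemma eval_add : (a + b).eval σ = a.eval σ + b.eval σ := rfl
@[simp] lemma eval_sub : (a - b).eval σ = a.eval σ - b.eval σ := rfl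
@[simp] lemma eval_mul : (a * b).eval σ = a.eval σ * b.eval σ := rfl
@[simp] lemma eval_div : (a / b).eval σ = a.eval σ / b.eval σ := rfl
@[simp] lemma eval_mod : (a % b).eval σ = a.eval σ % b.eval σ := rfl
@[simp] lemma eval_ofNat : (ofNat(n) : AExp).eval σ = (n : ℤ) := rfl
@[simp] lemma fits_reg : (reg r).Fits σ w ↔ len (σ.reg r) ≤ w := Iff.rfl
@[simp] lemma fits_lit : (lit z).Fits σ w ↔ len z ≤ w := Iff.rfl
@[simp] lemma fits_load : (load a).Fits σ w ↔ a.Fits σ w ∧ len (σ.mem (a.eval σ)) ≤ w := Iff.rfl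
@[simp] lemma fits_add : (a + b).Fits σ w ↔ a.Fits σ w ∧ b.Fits σ w := Iff.rfl
@[simp] lemma fits_sub : (a - b).Fits σ w ↔ a.Fits σ w ∧ b.Fits σ w := Iff.rfl
@[simp] lemma fits_mul : (a * b).Fits σ w ↔ a.Fits σ w ∧ b.Fits σ w := Iff.rfl
@[simp] lemma fits_div : (a / b).Fits σ w ↔ a.Fits σ w ∧ b.Fits σ w := Iff.rfl
@[simp] lemma fits_mod : (a % b).Fits σ w ↔ a.Fits σ w ∧ b.Fits σ w := Iff.rfl
@[simp] lemma fits_ofNat : (ofNat(n) : AExp).Fits σ w ↔ len (n : ℤ) ≤ w := Iff.rfl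
end

end AExp

/-! ### Bit lengths and costs -/

lemma one_le_len (z : ℤ) : 1 ≤ len z := by simp [len]

lemma len_le_iff {z : ℤ} {w : ℕ} : len z ≤ w + 1 ↔ |z| < 2 ^ w := by
  rw [len, Nat.add_le_add_iff_right, Nat.size_le, Int.abs_eq_natAbs]
  exact_mod_cast Iff.rfl

lemma len_mono {x y : ℤ} (h : |x| ≤ |y|) : len x ≤ len y := by
  have h' : x.natAbs ≤ y.natAbs := by
    rw [Int.abs_eq_natAbs, Int.abs_eq_natAbs] at h; exact_mod_cast h
  simpa [len] using Nat.size_le_size h'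

lemma abs_lt_two_pow_len (z : ℤ) : |z| < 2 ^ (len z - 1) := by
  rw [← len_le_iff]; have := one_le_len z; omega

lemma len_of_abs_le_mul {x a b : ℤ} (h : |x| ≤ |a| * |b|) : len x ≤ len a + len b := by
  have ha := abs_lt_two_pow_len a
  have hb := abs_lt_two_pow_len b
  have h1 := one_le_len a
  have h2 := one_le_len b
  obtain ⟨p, hp⟩ := Nat.exists_eq_add_of_le' h1
  obtain ⟨q, hq⟩ := Nat.exists_eq_add_of_le' h2
  rw [hp] at ha ⊢; rw [hq] at hb ⊢
  have : len x ≤ (p + q) + 1 := by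
    rw [len_le_iff, pow_add]
    calc |x| ≤ |a| * |b| := h
      _ < _ := by
        simp only [Nat.add_sub_cancel] at ha hb
        exact mul_lt_mul'' ha hb (abs_nonneg _) (abs_nonneg _)
  omega

lemma len_of_abs_le_add {x a b : ℤ} (h : |x| ≤ |a| + |b|) : len x ≤ len a + len b := by
  have ha := abs_lt_two_pow_len a
  have hb := abs_lt_two_pow_len b
  obtain ⟨p, hp⟩ := Nat.exists_eq_add_of_le' (one_le_len a)
  obtain ⟨q, hq⟩ := Nat.exists_eq_add_of_le' (one_le_len b)
  rw [hp] at ha ⊢; rw [hq] at hb ⊢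
  have : len x ≤ (p + q + 1) + 1 := by
    rw [len_le_iff]
    simp only [Nat.add_sub_cancel] at ha hb
    have h1 : (2 : ℤ) ^ p ≤ 2 ^ (p + q) := pow_le_pow_right₀ (by norm_num) (by omega)
    have h2 : (2 : ℤ) ^ q ≤ 2 ^ (p + q) := pow_le_pow_right₀ (by norm_num) (by omega)
    rw [pow_succ]; linarith
  omega

/-- A quotient is no longer than its numerator and a remainder is below the modulus, while `x / 0 =
0` and `x % 0 = x` cause no exception. Additivity of lengths over all operations bounds every
intermediate value of an expression by its number of leaves times the length of a leaf. -/
lemma len_opEval (o : Op) (x y : ℤ) : len (o.eval x y) ≤ len x + len y := by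
  cases o with
  | add => exact len_of_abs_le_add (abs_add_le x y)
  | sub => exact len_of_abs_le_add (abs_sub x y)
  | mul => exact len_of_abs_le_mul (abs_mul x y).le
  | div =>
    refine le_trans (len_mono ?_) (Nat.le_add_right _ _)
    exact Int.abs_ediv_le_abs x y
  | mod =>
    by_cases hy : y = 0
    · subst hy; simp [Op.eval]
    · refine le_trans (len_mono ?_) (Nat.le_add_left _ _)
      simp only [Op.eval]
      rw [abs_of_nonneg (Int.emod_nonneg _ hy)]
      exact (Int.emod_lt_abs x hy).le

/-- A submultiplicative bound for the cost of one operation on `w` bits. -/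
def opc (w : ℕ) : ℕ := w * (w.size + 1)

lemma opc_mono {v w : ℕ} (h : v ≤ w) : opc v ≤ opc w :=
  Nat.mul_le_mul h (Nat.add_le_add_right (Nat.size_le_size h) 1)

lemma size_mul_le (a b : ℕ) : (a * b).size ≤ a.size + b.size := by
  rw [Nat.size_le, pow_add]
  exact Nat.mul_lt_mul'' (Nat.lt_size_self a) (Nat.lt_size_self b)

/-- Submultiplicativity splits off the fixed size of an expression as the constant `AExp.κ`, so that
only `opc w` depends on the data. -/
lemma opc_mul (a b : ℕ) : opc (a * b) ≤ opc a * opc b := by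
  have h : (a * b).size + 1 ≤ (a.size + 1) * (b.size + 1) := by
    have := size_mul_le a b; nlinarith [Nat.zero_le (a.size * b.size)]
  calc opc (a * b) = a * b * ((a * b).size + 1) := rfl
    _ ≤ a * b * ((a.size + 1) * (b.size + 1)) := Nat.mul_le_mul_left _ h
    _ = _ := by simp only [opc]; ring

lemma le_opc (w : ℕ) : w ≤ opc w := Nat.le_mul_of_pos_right _ (Nat.succ_pos _)

lemma opCost_le (o : Op) (x y : ℤ) : o.cost x y ≤ opc (len x + len y) := by
  have h : len x + len y ≤ opc (len x + len y) := le_opc _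
  have h' : (len x + len y) * (len x + len y).size ≤ opc (len x + len y) :=
    Nat.mul_le_mul_left _ (Nat.le_succ _)
  cases o <;> simpa [Op.cost]

namespace AExp

lemma Fits.one_le {σ : State} {w : ℕ} {e : AExp} (h : e.Fits σ w) : 1 ≤ w := by
  induction e with
  | reg r => exact (one_le_len _).trans h
  | lit z => exact (one_le_len _).trans h
  | op o a b iha ihb => exact iha h.1
  | load e ih => exact ih h.1

lemma len_eval_le {σ : State} {w : ℕ} {e : AExp} (h : e.Fits σ w) :
    len (e.eval σ) ≤ e.leaves * w := by
  induction e with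
  | reg r => simpa [leaves] using h
  | lit z => simpa [leaves] using h
  | op o a b iha ihb =>
    refine (len_opEval _ _ _).trans ?_
    rw [leaves, add_mul]
    exact Nat.add_le_add (iha h.1) (ihb h.2)
  | load e ih =>
    rw [leaves, add_mul, one_mul]
    exact h.2.trans (Nat.le_add_left _ _)

/-- The constant in the cost of evaluating an expression. -/
def κ (e : AExp) : ℕ := (e.weight + 3) * opc e.leaves

end AExp

/-- Equality of the visible registers and of the memory. -/
def Sim (σ s : State) : Prop := (∀ r < 100, σ.reg r = s.reg r) ∧ σ.mem = s.mem

namespace AExp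

/-- The scratch registers from `t` on serve as a stack: the first operand waits in `t` while the
second is evaluated from `t + 1` on. Only the visible part of the state has to match `s`, so scratch
registers are never cleared. -/
lemma exec_code {s : State} {w : ℕ} (e : AExp) (hv : e.vis) (hf : e.Fits s w) :
    ∀ (t : ℕ) (σ : State), 100 ≤ t → Sim σ s →
      ∃ k σ', Exec (e.code t) σ [] k σ' ∧ k ≤ e.weight * opc (e.leaves * w) ∧
        σ'.reg t = e.eval s ∧ σ'.mem = s.mem ∧ ∀ r < t, σ'.reg r = σ.reg r := by
  have hw := hf.one_le
  induction e with
  | reg r =>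
    intro t σ ht hs
    simp only [vis, decide_eq_true_eq] at hv
    refine ⟨_, _, Exec.seq (Exec.const σ t 0) (Exec.arith _ .add t r t), ?_, ?_, hs.2, ?_⟩
    · have h1 : r ≠ t := by omega
      have h2 : len (0 : ℤ) = 1 := rfl
      simp only [Op.cost, State.setReg, Function.update_self, Function.update_of_ne h1, h2, weight,
        leaves, one_mul]
      rw [hs.1 r hv]
      have := le_opc w
      have h3 : len (s.reg r) ≤ w := hf
      omega
    · have h1 : r ≠ t := by omega
      simp [State.setReg, Op.eval, Function.update_of_ne h1, hs.1 r hv]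
    · intro r' hr'
      simp [State.setReg, Function.update_of_ne hr'.ne]
  | lit z =>
    intro t σ ht hs
    refine ⟨_, _, Exec.const σ t z, ?_, by simp [State.setReg], hs.2, ?_⟩
    · have h3 : len z ≤ w := hf
      have := le_opc w
      simp only [weight, leaves, one_mul]; omega
    · intro r' hr'
      simp [State.setReg, Function.update_of_ne hr'.ne]
  | op o a b iha ihb =>
    intro t σ ht hs
    simp only [vis, Bool.and_eq_true] at hv
    obtain ⟨k₁, σ₁, h₁, hk₁, hr₁, hm₁, hp₁⟩ := iha hv.1 hf.1 t σ ht hs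
    have hs₁ : Sim σ₁ s := ⟨fun r hr => (hp₁ r (by omega)).trans (hs.1 r hr), hm₁⟩
    obtain ⟨k₂, σ₂, h₂, hk₂, hr₂, hm₂, hp₂⟩ := ihb hv.2 hf.2 (t + 1) σ₁ (by omega) hs₁
    refine ⟨_, _, Exec.seq h₁ (Exec.seq h₂ (Exec.arith _ o t t (t + 1))), ?_, ?_, hm₂, ?_⟩
    · rw [hp₂ t (by omega), hr₁, hr₂]
      have h4 := opCost_le o (a.eval s) (b.eval s)
      have h5 : len (a.eval s) + len (b.eval s) ≤ (a.leaves + b.leaves) * w := by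
        rw [add_mul]; exact Nat.add_le_add (len_eval_le hf.1) (len_eval_le hf.2)
      have h6 := opc_mono h5
      have h7 : opc (a.leaves * w) ≤ opc ((a.leaves + b.leaves) * w) :=
        opc_mono (Nat.mul_le_mul_right _ (Nat.le_add_right _ _))
      have h8 : opc (b.leaves * w) ≤ opc ((a.leaves + b.leaves) * w) :=
        opc_mono (Nat.mul_le_mul_right _ (Nat.le_add_left _ _))
      have h9 := Nat.mul_le_mul_left a.weight h7
      have h10 := Nat.mul_le_mul_left b.weight h8
      simp only [weight, leaves]
      linarith
    · simp [State.setReg, Op.eval, hp₂ t (by omega), hr₁, hr₂, eval]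
    · intro r' hr'
      simp only [State.setReg, Function.update_of_ne hr'.ne]
      rw [hp₂ _ (by omega), hp₁ _ hr']
  | load e ih =>
    intro t σ ht hs
    obtain ⟨k₁, σ₁, h₁, hk₁, hr₁, hm₁, hp₁⟩ := ih hv hf.1 t σ ht hs
    refine ⟨_, _, Exec.seq h₁ (Exec.load _ t t), ?_, ?_, hm₁, ?_⟩
    · rw [hr₁, hm₁]
      have h5 := len_eval_le hf.1
      have h6 := hf.2
      have h7 : opc (e.leaves * w) ≤ opc ((e.leaves + 1) * w) :=
        opc_mono (Nat.mul_le_mul_right _ (Nat.le_add_right _ _))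
      have h8 := Nat.mul_le_mul_left e.weight h7
      have h9 := le_opc ((e.leaves + 1) * w)
      rw [add_mul, one_mul] at h9 h7 h8
      simp only [weight, leaves, add_mul, one_mul]
      linarith
    · simp [State.setReg, hr₁, hm₁, eval]
    · intro r' hr'
      simp only [State.setReg, Function.update_of_ne hr'.ne]
      rw [hp₁ _ hr']

end AExp

/-! ### Structured programs -/

/-- Structured programs whose elementary steps evaluate expressions. -/
inductive Stm where
  | skip
  | asg (r : ℕ) (e : AExp)
  | st (a v : AExp)
  | coin (r : ℕ)
  | seq (s₁ s₂ : Stm)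
  | ite (e : AExp) (s₁ s₂ : Stm)
  | iter (e : AExp) (s : Stm)

/-- Sequential composition. -/
notation:60 s₁:61 ";;" s₂:60 => Stm.seq s₁ s₂
/-- Assignment. -/
notation:61 r:62 "<~" e:62 => Stm.asg r e

namespace Stm

/-- Translation to machine code. -/
def code : Stm → Cmd
  | skip => .skip
  | asg r e => .seq (e.code 100) (.seq (.const 101 0) (.arith .add r 100 101))
  | st a v => .seq (a.code 100) (.seq (v.code 101) (.store 100 101))
  | coin r => .coin r
  | seq s₁ s₂ => .seq s₁.code s₂.code
  | ite e s₁ s₂ => .seq (e.code 100) (.cond 100 s₁.code s₂.code)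
  | .iter e s => .seq (e.code 100) (.loop 100 (.seq s.code (e.code 100)))

/-- Only visible registers are mentioned. -/
def vis : Stm → Bool
  | skip => true
  | asg r e => decide (r < 100) && e.vis
  | st a v => a.vis && v.vis
  | coin r => decide (r < 100)
  | seq s₁ s₂ => s₁.vis && s₂.vis
  | ite e s₁ s₂ => e.vis && s₁.vis && s₂.vis
  | .iter e s => e.vis && s.vis

/-- The registers that are assigned. -/
def writes : Stm → List ℕ
  | skip => []
  | asg r _ => [r]
  | st _ _ => []
  | coin r => [r]
  | seq s₁ s₂ => s₁.writes ++ s₂.writes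
  | ite _ s₁ s₂ => s₁.writes ++ s₂.writes
  | .iter _ s => s.writes

end Stm

/-- `Ev s σ l k σ'`: the structured program `s` leads from `σ` to `σ'` with coin tosses `l` and cost
bound `k`. -/
inductive Ev : Stm → State → List Bool → ℕ → State → Prop where
  | skip (σ : State) : Ev .skip σ [] 1 σ
  | asg {σ : State} {r : ℕ} {e : AExp} {w : ℕ} (h : e.Fits σ w) :
      Ev (.asg r e) σ [] (e.κ * opc w) (σ.setReg r (e.eval σ))
  | st {σ : State} {a v : AExp} {w : ℕ} (ha : a.Fits σ w) (hv : v.Fits σ w) :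
      Ev (.st a v) σ [] ((a.κ + v.κ) * opc w) (σ.setMem (a.eval σ) (v.eval σ))
  | coin (σ : State) (r : ℕ) (b : Bool) : Ev (.coin r) σ [b] 1 (σ.setReg r (if b then 1 else 0))
  | seq {s₁ s₂ : Stm} {σ σ₁ σ₂ : State} {l₁ l₂ : List Bool} {k₁ k₂ : ℕ}
      (h₁ : Ev s₁ σ l₁ k₁ σ₁) (h₂ : Ev s₂ σ₁ l₂ k₂ σ₂) : Ev (.seq s₁ s₂) σ (l₁ ++ l₂) (k₁ + k₂) σ₂
  | iteTrue {e : AExp} {s₁ s₂ : Stm} {σ σ' : State} {l : List Bool} {k w : ℕ} (hf : e.Fits σ w)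
      (he : 0 < e.eval σ) (h : Ev s₁ σ l k σ') : Ev (.ite e s₁ s₂) σ l (e.κ * opc w + k) σ'
  | iteFalse {e : AExp} {s₁ s₂ : Stm} {σ σ' : State} {l : List Bool} {k w : ℕ} (hf : e.Fits σ w)
      (he : e.eval σ ≤ 0) (h : Ev s₂ σ l k σ') : Ev (.ite e s₁ s₂) σ l (e.κ * opc w + k) σ'
  | whileFalse {e : AExp} {s : Stm} {σ : State} {w : ℕ} (hf : e.Fits σ w)
      (he : e.eval σ ≤ 0) : Ev (.iter e s) σ [] (e.κ * opc w) σ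
  | whileTrue {e : AExp} {s : Stm} {σ σ₁ σ₂ : State} {l₁ l₂ : List Bool} {k₁ k₂ w : ℕ}
      (hf : e.Fits σ w) (he : 0 < e.eval σ) (h₁ : Ev s σ l₁ k₁ σ₁)
      (h₂ : Ev (.iter e s) σ₁ l₂ k₂ σ₂) :
      Ev (.iter e s) σ (l₁ ++ l₂) (e.κ * opc w + k₁ + k₂) σ₂

/-- The slack `3 * len` pays for the use of the computed value: the move to its target by adding
zero, a store, or the test of a guard. -/
lemma AExp.exec_code' {s : State} {w : ℕ} (e : AExp) (hv : e.vis) (hf : e.Fits s w) (t : ℕ)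
    (σ : State) (ht : 100 ≤ t) (hs : Sim σ s) :
    ∃ k σ', Exec (e.code t) σ [] k σ' ∧ k + 3 * len (e.eval s) ≤ e.κ * opc w ∧
        σ'.reg t = e.eval s ∧ Sim σ' s ∧ ∀ r < t, σ'.reg r = σ.reg r := by
  obtain ⟨k, σ', h, hk, hr, hm, hp⟩ := e.exec_code hv hf t σ ht hs
  refine ⟨k, σ', h, ?_, hr, ⟨fun r hr => (hp r (by omega)).trans (hs.1 r hr), hm⟩, hp⟩
  have h1 := AExp.len_eval_le hf
  have h2 := le_opc (e.leaves * w)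
  calc k + 3 * len (e.eval s) ≤ (e.weight + 3) * opc (e.leaves * w) := by rw [add_mul]; omega
    _ ≤ (e.weight + 3) * (opc e.leaves * opc w) := Nat.mul_le_mul_left _ (opc_mul _ _)
    _ = _ := by rw [AExp.κ, mul_assoc]

lemma Sim.setReg {σ s : State} (h : Sim σ s) (r : ℕ) (z : ℤ) : Sim (σ.setReg r z) (s.setReg r z) := by
  refine ⟨fun r' hr' => ?_, h.2⟩
  by_cases hh : r' = r
  · subst hh; simp [State.setReg]
  · simp [State.setReg, Function.update_of_ne hh, h.1 _ (by assumption)]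

/-- The machine code simulates the structured program. -/
theorem Ev.exec {s : Stm} {σ σ' : State} {l : List Bool} {k : ℕ} (h : Ev s σ l k σ') (hv : s.vis) :
    ∀ τ, Sim τ σ → ∃ k' τ', Exec s.code τ l k' τ' ∧ k' ≤ k ∧ Sim τ' σ' := by
  induction h with
  | skip σ => exact fun τ hτ => ⟨_, _, Exec.skip τ, le_rfl, hτ⟩
  | @asg σ r e w hf =>
    intro τ hτ
    simp only [Stm.vis, Bool.and_eq_true, decide_eq_true_eq] at hv
    obtain ⟨k, σ', h, hk, hr, hsim, hp⟩ := e.exec_code' hv.2 hf 100 τ le_rfl hτ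
    refine ⟨_, _, Exec.seq h (Exec.seq (Exec.const _ 101 0) (Exec.arith _ .add r 100 101)), ?_, ?_⟩
    · have h1 : len (0 : ℤ) = 1 := rfl
      have := one_le_len (e.eval σ)
      simp [Op.cost, State.setReg, h1, hr]
      omega
    · have := hsim.setReg r (e.eval σ)
      refine ⟨fun r' hr' => ?_, this.2⟩
      rw [← this.1 r' hr']
      by_cases hh : r' = r
      · subst hh; simp [State.setReg, Op.eval, hr]
      · have h2 : r' ≠ 101 := by omega
        simp [State.setReg, Function.update_of_ne hh, Function.update_of_ne h2]
  | @st σ a v w ha hb =>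
    intro τ hτ
    simp only [Stm.vis, Bool.and_eq_true] at hv
    obtain ⟨k, σ₁, h, hk, hr, hsim, hp⟩ := a.exec_code' hv.1 ha 100 τ le_rfl hτ
    obtain ⟨k₂, σ₂, h₂, hk₂, hr₂, hsim₂, hp₂⟩ := v.exec_code' hv.2 hb 101 σ₁ (by omega) hsim
    refine ⟨_, _, Exec.seq h (Exec.seq h₂ (Exec.store _ 100 101)), ?_, hsim₂.1, ?_⟩
    · rw [hr₂, hp₂ 100 (by omega), hr, add_mul]; omega
    · simp [State.setMem, hsim₂.2, hr₂, hp₂ 100 (by omega), hr]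
  | coin σ r b => exact fun τ hτ => ⟨_, _, Exec.coin τ r b, le_rfl, hτ.setReg _ _⟩
  | seq h₁ h₂ ih₁ ih₂ =>
    intro τ hτ
    simp only [Stm.vis, Bool.and_eq_true] at hv
    obtain ⟨k₁, τ₁, e₁, hk₁, hs₁⟩ := ih₁ hv.1 τ hτ
    obtain ⟨k₂, τ₂, e₂, hk₂, hs₂⟩ := ih₂ hv.2 τ₁ hs₁
    exact ⟨_, _, Exec.seq e₁ e₂, by omega, hs₂⟩
  | iteTrue hf he h ih =>
    intro τ hτ
    simp only [Stm.vis, Bool.and_eq_true] at hv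
    obtain ⟨k₁, σ₁, h₁, hk₁, hr₁, hsim₁, -⟩ := AExp.exec_code' _ hv.1.1 hf 100 τ le_rfl hτ
    obtain ⟨k₂, τ₂, e₂, hk₂, hs₂⟩ := ih hv.1.2 σ₁ hsim₁
    refine ⟨_, _, Exec.seq h₁ (Exec.condTrue (by rwa [hr₁]) e₂), ?_, hs₂⟩
    rw [hr₁]; omega
  | iteFalse hf he h ih =>
    intro τ hτ
    simp only [Stm.vis, Bool.and_eq_true] at hv
    obtain ⟨k₁, σ₁, h₁, hk₁, hr₁, hsim₁, -⟩ := AExp.exec_code' _ hv.1.1 hf 100 τ le_rfl hτ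
    obtain ⟨k₂, τ₂, e₂, hk₂, hs₂⟩ := ih hv.2 σ₁ hsim₁
    refine ⟨_, _, Exec.seq h₁ (Exec.condFalse (by rwa [hr₁]) e₂), ?_, hs₂⟩
    rw [hr₁]; omega
  | whileFalse hf he =>
    intro τ hτ
    simp only [Stm.vis, Bool.and_eq_true] at hv
    obtain ⟨k₁, σ₁, h₁, hk₁, hr₁, hsim₁, -⟩ := AExp.exec_code' _ hv.1 hf 100 τ le_rfl hτ
    refine ⟨_, _, Exec.seq h₁ (Exec.loopDone (by rwa [hr₁])), ?_, hsim₁⟩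
    rw [hr₁]; omega
  | whileTrue hf he h₁ h₂ ih₁ ih₂ =>
    intro τ hτ
    have hv' := hv
    simp only [Stm.vis, Bool.and_eq_true] at hv'
    obtain ⟨ka, σa, ha, hka, hra, hsima, -⟩ := AExp.exec_code' _ hv'.1 hf 100 τ le_rfl hτ
    obtain ⟨kb, σb, eb, hkb, hsb⟩ := ih₁ hv'.2 σa hsima
    obtain ⟨kc, σc, ec, hkc, hsc⟩ := ih₂ hv σb hsb
    -- In machine code the guard is evaluated before the loop and again at the end of the body. The
    -- evaluation that opens the code of the remaining loop is therefore regrouped as the end of the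
    -- current pass.
    rw [Stm.code] at ec
    cases ec with
    | seq e₁ e₂ =>
      have h := Exec.seq ha (Exec.loopStep (by rwa [hra]) (Exec.seq eb e₁) e₂)
      rw [List.nil_append, List.append_assoc] at h
      refine ⟨_, _, h, ?_, hsc⟩
      rw [hra]; omega

theorem Ev.reg_eq {s : Stm} {σ σ' : State} {l : List Bool} {k : ℕ} (h : Ev s σ l k σ') :
    ∀ r ∉ s.writes, σ'.reg r = σ.reg r := by
  induction h with
  | skip σ => simp
  | asg h => intro r hr; simp only [Stm.writes, List.mem_singleton] at hr; simp [State.setReg, hr]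
  | st ha hv => simp [State.setMem]
  | coin σ r b => intro r hr; simp only [Stm.writes, List.mem_singleton] at hr; simp [State.setReg, hr]
  | seq h₁ h₂ ih₁ ih₂ =>
    intro r hr; simp only [Stm.writes, List.mem_append, not_or] at hr
    rw [ih₂ r hr.2, ih₁ r hr.1]
  | iteTrue hf he h ih =>
    intro r hr; simp only [Stm.writes, List.mem_append, not_or] at hr; exact ih r hr.1
  | iteFalse hf he h ih =>
    intro r hr; simp only [Stm.writes, List.mem_append, not_or] at hr; exact ih r hr.2
  | whileFalse hf he => simp
  | whileTrue hf he h₁ h₂ ih₁ ih₂ => intro r hr; rw [ih₂ r hr, ih₁ r hr]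

/-! ### Total correctness with cost bounds -/

/-- `Tr s σ l B Q`: with the coin tosses `l`, the program halts from `σ` at cost at most `B` in a
state that satisfies `Q`. -/
def Tr (s : Stm) (σ : State) (l : List Bool) (B : ℕ) (Q : State → Prop) : Prop :=
  ∃ k τ, Ev s σ l k τ ∧ k ≤ B ∧ Q τ

/-- The registers outside `L` agree. -/
def Agree (L : List ℕ) (σ σ' : State) : Prop := ∀ r ∉ L, σ'.reg r = σ.reg r

lemma Agree.trans {L L' : List ℕ} {σ σ₁ σ₂ : State} (h : Agree L σ σ₁) (h' : Agree L' σ₁ σ₂) :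
    Agree (L ++ L') σ σ₂ := by
  intro r hr
  simp only [List.mem_append, not_or] at hr
  rw [h' r hr.2, h r hr.1]

lemma Tr.mono {s : Stm} {σ : State} {l : List Bool} {B B' : ℕ} {Q Q' : State → Prop}
    (h : Tr s σ l B Q) (hB : B ≤ B') (hQ : ∀ σ', Agree s.writes σ σ' → Q σ' → Q' σ') :
    Tr s σ l B' Q' := by
  obtain ⟨k, σ', he, hk, hq⟩ := h
  exact ⟨k, σ', he, hk.trans hB, hQ σ' he.reg_eq hq⟩

lemma Tr.seq {s₁ s₂ : Stm} {σ : State} {l₁ l₂ : List Bool} {B₁ B₂ : ℕ} {Q₁ Q₂ : State → Prop}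
    (h₁ : Tr s₁ σ l₁ B₁ Q₁) (h₂ : ∀ σ₁, Agree s₁.writes σ σ₁ → Q₁ σ₁ → Tr s₂ σ₁ l₂ B₂ Q₂) :
    Tr (s₁ ;; s₂) σ (l₁ ++ l₂) (B₁ + B₂) Q₂ := by
  obtain ⟨k, σ', he, hk, hq⟩ := h₁
  obtain ⟨k', σ'', he', hk', hq'⟩ := h₂ σ' he.reg_eq hq
  exact ⟨_, _, .seq he he', Nat.add_le_add hk hk', hq'⟩

lemma Tr.seq' {s₁ s₂ : Stm} {σ : State} {B₁ B₂ : ℕ} {Q₁ Q₂ : State → Prop}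
    (h₁ : Tr s₁ σ [] B₁ Q₁) (h₂ : ∀ σ₁, Agree s₁.writes σ σ₁ → Q₁ σ₁ → Tr s₂ σ₁ [] B₂ Q₂) :
    Tr (s₁ ;; s₂) σ [] (B₁ + B₂) Q₂ := h₁.seq h₂

lemma Tr.ite {e : AExp} {s₁ s₂ : Stm} {σ : State} {l : List Bool} {w B : ℕ} {Q : State → Prop}
    (hf : e.Fits σ w) (h₁ : 0 < e.eval σ → Tr s₁ σ l B Q) (h₂ : e.eval σ ≤ 0 → Tr s₂ σ l B Q) :
    Tr (.ite e s₁ s₂) σ l (e.κ * opc w + B) Q := by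
  by_cases he : 0 < e.eval σ
  · obtain ⟨k, σ', he', hk, hq⟩ := h₁ he
    exact ⟨_, _, .iteTrue hf he he', by omega, hq⟩
  · obtain ⟨k, σ', he', hk, hq⟩ := h₂ (not_lt.mp he)
    exact ⟨_, _, .iteFalse hf (not_lt.mp he) he', by omega, hq⟩

/-- The rule for loops, with invariant `I` and variant `μ`. -/
theorem Tr.iter {e : AExp} {s : Stm} {w B : ℕ} {σ₀ : State} (I : State → Prop) (μ : State → ℕ)
    (h₀ : I σ₀) (hf : ∀ σ, Agree s.writes σ₀ σ → I σ → e.Fits σ w)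
    (hs : ∀ σ, Agree s.writes σ₀ σ → I σ → 0 < e.eval σ →
      Tr s σ [] B (fun σ' => I σ' ∧ μ σ' < μ σ)) :
    Tr (.iter e s) σ₀ [] ((μ σ₀ + 1) * (e.κ * opc w + B)) (fun σ => I σ ∧ e.eval σ ≤ 0) := by
  suffices H : ∀ m σ, μ σ ≤ m → Agree s.writes σ₀ σ → I σ →
      Tr (.iter e s) σ [] ((m + 1) * (e.κ * opc w + B)) (fun σ => I σ ∧ e.eval σ ≤ 0) from
    H _ _ le_rfl (fun _ _ => rfl) h₀
  intro m
  induction m with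
  | zero =>
    intro σ hm ha hi
    by_cases he : 0 < e.eval σ
    · obtain ⟨k, σ', -, -, -, h⟩ := hs σ ha hi he
      omega
    · exact ⟨_, _, .whileFalse (hf σ ha hi) (not_lt.mp he), by omega, hi, not_lt.mp he⟩
  | succ m ih =>
    intro σ hm ha hi
    by_cases he : 0 < e.eval σ
    · obtain ⟨k, σ', h', hk, hi', hlt⟩ := hs σ ha hi he
      have ha' : Agree s.writes σ₀ σ' := fun r hr => (h'.reg_eq r hr).trans (ha r hr)
      obtain ⟨k₂, σ₂, h₂, hk₂, hq⟩ := ih σ' (by omega) ha' hi'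
      refine ⟨_, _, .whileTrue (hf σ ha hi) he h' h₂, ?_, hq⟩
      rw [add_mul _ 1, one_mul]; omega
    · refine ⟨_, _, .whileFalse (hf σ ha hi) (not_lt.mp he), ?_, hi, not_lt.mp he⟩
      rw [add_mul _ 1, one_mul]; omega

/-! ### Loop-free programs, and costs of the form constant times a common bound -/

namespace Stm

/-- Programs without loops and coin tosses. -/
def basic : Stm → Bool
  | skip => true
  | asg _ _ => true
  | st _ _ => true
  | coin _ => false
  | seq s₁ s₂ => s₁.basic && s₂.basic
  | ite _ s₁ s₂ => s₁.basic && s₂.basic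
  | .iter _ _ => false

/-- The effect of a program without loops and coin tosses. -/
def run : Stm → State → State
  | skip, σ => σ
  | asg r e, σ => σ.setReg r (e.eval σ)
  | st a v, σ => σ.setMem (a.eval σ) (v.eval σ)
  | coin _, σ => σ
  | seq s₁ s₂, σ => s₂.run (s₁.run σ)
  | ite e s₁ s₂, σ => if 0 < e.eval σ then s₁.run σ else s₂.run σ
  | .iter _ _, σ => σ

/-- All numbers read by a program without loops and coin tosses have at most `w` bits. -/
def Fits (w : ℕ) : Stm → State → Prop
  | skip, _ => True
  | asg _ e, σ => e.Fits σ w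
  | st a v, σ => a.Fits σ w ∧ v.Fits σ w
  | coin _, _ => True
  | seq s₁ s₂, σ => s₁.Fits w σ ∧ s₂.Fits w (s₁.run σ)
  | ite e s₁ s₂, σ => e.Fits σ w ∧ if 0 < e.eval σ then s₁.Fits w σ else s₂.Fits w σ
  | .iter _ _, _ => True

/-- The constant in the cost of a program. -/
def κ : Stm → ℕ
  | skip => 1
  | asg _ e => e.κ
  | st a v => a.κ + v.κ
  | coin _ => 1
  | seq s₁ s₂ => s₁.κ + s₂.κ
  | ite e s₁ s₂ => e.κ + s₁.κ + s₂.κ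
  | .iter e s => e.κ + s.κ

theorem ev_run {w : ℕ} (hw : 1 ≤ w) (s : Stm) (hb : s.basic) :
    ∀ σ, s.Fits w σ → ∃ k, Ev s σ [] k (s.run σ) ∧ k ≤ s.κ * opc w := by
  induction s with
  | skip => exact fun σ _ => ⟨1, .skip σ, by simpa [κ] using hw.trans (le_opc w)⟩
  | asg r e => exact fun σ h => ⟨_, .asg h, le_rfl⟩
  | st a v => exact fun σ h => ⟨_, .st h.1 h.2, le_rfl⟩
  | coin r => simp [basic] at hb
  | seq s₁ s₂ ih₁ ih₂ =>
    intro σ h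
    simp only [basic, Bool.and_eq_true] at hb
    obtain ⟨k₁, h₁, hk₁⟩ := ih₁ hb.1 σ h.1
    obtain ⟨k₂, h₂, hk₂⟩ := ih₂ hb.2 _ h.2
    exact ⟨_, .seq h₁ h₂, by rw [κ, add_mul]; omega⟩
  | ite e s₁ s₂ ih₁ ih₂ =>
    intro σ h
    simp only [basic, Bool.and_eq_true] at hb
    simp only [Fits] at h
    by_cases he : 0 < e.eval σ
    · rw [if_pos he] at h
      obtain ⟨k₁, h₁, hk₁⟩ := ih₁ hb.1 σ h.2
      refine ⟨_, by rw [run, if_pos he]; exact .iteTrue h.1 he h₁, ?_⟩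
      rw [κ, add_mul, add_mul]; omega
    · rw [if_neg he] at h
      obtain ⟨k₁, h₁, hk₁⟩ := ih₂ hb.2 σ h.2
      refine ⟨_, by rw [run, if_neg he]; exact .iteFalse h.1 (not_lt.mp he) h₁, ?_⟩
      rw [κ, add_mul, add_mul]; omega
  | iter e s => simp [basic] at hb

end Stm

lemma Tr.basic {s : Stm} (hb : s.basic) {σ : State} {w : ℕ} (hw : 1 ≤ w) (hf : s.Fits w σ)
    {Q : State → Prop} (hq : Q (s.run σ)) : Tr s σ [] (s.κ * opc w) Q := by
  obtain ⟨k, h, hk⟩ := s.ev_run hw hb σ hf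
  exact ⟨k, _, h, hk, hq⟩

lemma Tr.basic' {s : Stm} (hb : s.basic) {σ : State} {w B : ℕ} (hw : 1 ≤ w) (hB : opc w ≤ B)
    (hf : s.Fits w σ) {Q : State → Prop} (hq : Q (s.run σ)) : Tr s σ [] (s.κ * B) Q :=
  (Tr.basic hb hw hf hq).mono (Nat.mul_le_mul_left _ hB) fun _ _ h => h

/-- With costs in the form `κ * B`, the constants add under composition and `B` is shared. The cost
of a large program is then one bound times a constant that depends only on its text. -/
lemma Tr.comp {s₁ s₂ : Stm} {σ : State} {B : ℕ} {Q₁ Q₂ : State → Prop}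
    (h₁ : Tr s₁ σ [] (s₁.κ * B) Q₁)
    (h₂ : ∀ σ₁, Agree s₁.writes σ σ₁ → Q₁ σ₁ → Tr s₂ σ₁ [] (s₂.κ * B) Q₂) :
    Tr (s₁ ;; s₂) σ [] ((s₁ ;; s₂).κ * B) Q₂ :=
  (h₁.seq' h₂).mono (by rw [Stm.κ, add_mul]) fun _ _ h => h

lemma Tr.cases {e : AExp} {s₁ s₂ : Stm} {σ : State} {w B : ℕ} {Q : State → Prop}
    (hB : opc w ≤ B) (hf : e.Fits σ w) (h₁ : 0 < e.eval σ → Tr s₁ σ [] (s₁.κ * B) Q)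
    (h₂ : e.eval σ ≤ 0 → Tr s₂ σ [] (s₂.κ * B) Q) :
    Tr (.ite e s₁ s₂) σ [] ((Stm.ite e s₁ s₂).κ * B) Q := by
  have h := Tr.ite (w := w) (B := s₁.κ * B + s₂.κ * B) hf
    (fun he => (h₁ he).mono (Nat.le_add_right _ _) fun _ _ h => h)
    (fun he => (h₂ he).mono (Nat.le_add_left _ _) fun _ _ h => h)
  refine h.mono ?_ fun _ _ h => h
  have := Nat.mul_le_mul_left e.κ hB
  rw [Stm.κ, add_mul, add_mul]; omega

theorem Tr.loop {e : AExp} {s : Stm} {w B N : ℕ} {σ₀ : State} (I : State → Prop) (μ : State → ℕ)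
    (hB : opc w ≤ B) (hN : μ σ₀ + 1 ≤ N) (h₀ : I σ₀)
    (hf : ∀ σ, Agree s.writes σ₀ σ → I σ → e.Fits σ w)
    (hs : ∀ σ, Agree s.writes σ₀ σ → I σ → 0 < e.eval σ →
      Tr s σ [] (s.κ * B) (fun σ' => I σ' ∧ μ σ' < μ σ)) :
    Tr (.iter e s) σ₀ [] ((Stm.iter e s).κ * (N * B)) (fun σ => I σ ∧ e.eval σ ≤ 0) := by
  refine (Tr.iter I μ h₀ hf hs).mono ?_ fun _ _ h => h
  calc (μ σ₀ + 1) * (e.κ * opc w + s.κ * B) ≤ N * (e.κ * B + s.κ * B) := by gcongr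
    _ = _ := by rw [Stm.κ]; ring

@[simp] lemma len_zero : len 0 = 1 := rfl
@[simp] lemma len_one : len 1 = 2 := rfl
@[simp] lemma len_two : len 2 = 3 := rfl

@[simp] lemma State.reg_setReg (σ : State) (r : ℕ) (z : ℤ) (r' : ℕ) :
    (σ.setReg r z).reg r' = if r' = r then z else σ.reg r' := by
  simp [State.setReg, Function.update_apply]
@[simp] lemma State.mem_setReg (σ : State) (r : ℕ) (z : ℤ) : (σ.setReg r z).mem = σ.mem := rfl
@[simp] lemma State.reg_setMem (σ : State) (a z : ℤ) : (σ.setMem a z).reg = σ.reg := rfl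
@[simp] lemma State.mem_setMem (σ : State) (a z a' : ℤ) :
    (σ.setMem a z).mem a' = if a' = a then z else σ.mem a' := by
  simp [State.setMem, Function.update_apply]

/-- `for c in 0, 1, …, e - 1 do s` -/
def Stm.for (c : ℕ) (e : AExp) (s : Stm) : Stm :=
  c <~ 0 ;; .iter (e - .reg c) (s ;; c <~ .reg c + 1)

/-- The bound `e` is evaluated anew in each pass, so it must keep its value on all states that
differ only in registers written by the loop. The invariant is required after the counter has been
advanced, so the body itself need not mention the increment. -/
theorem Tr.for {c : ℕ} {e : AExp} {s : Stm} {w B N N' : ℕ} {σ : State} (I : ℕ → State → Prop)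
    (hc : c ∉ s.writes) (hw : 3 ≤ w) (hN : len N ≤ w) (hB : opc w ≤ B) (hN' : N + 1 ≤ N')
    (h₀ : ∀ τ, Agree [c] σ τ → τ.mem = σ.mem → I 0 τ)
    (he : ∀ τ, Agree (c :: s.writes) σ τ → e.eval τ = N ∧ e.Fits τ w)
    (hs : ∀ i < N, ∀ τ, Agree (c :: s.writes) σ τ → τ.reg c = i → len i ≤ w → I i τ →
      Tr s τ [] (s.κ * B) (fun τ' => I (i + 1) (τ'.setReg c (i + 1)))) :
    Tr (.for c e s) σ [] ((Stm.for c e s).κ * (N' * B)) (I N) := by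
  have hlen : ∀ j : ℤ, 0 ≤ j → j ≤ N → len j ≤ w := fun j h0 h1 =>
    (len_mono (by rw [abs_of_nonneg h0]; exact h1.trans (le_abs_self _))).trans hN
  have hBN : B ≤ N' * B := Nat.le_mul_of_pos_left _ (by omega)
  refine Tr.comp (Q₁ := fun τ => τ.reg c = 0 ∧ τ.mem = σ.mem)
    (Tr.basic' rfl (w := w) (by omega) (hB.trans hBN) ?_ ?_) ?_
  · simp [Stm.Fits]; omega
  · simp [Stm.run]
  rintro σ₁ a₁ ⟨hj, hmem⟩
  have hag : ∀ τ, Agree (s ;; c <~ .reg c + 1).writes σ₁ τ → Agree (c :: s.writes) σ τ := by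
    intro τ h r hr
    simp only [List.mem_cons, not_or] at hr
    have h1 : r ∉ (s ;; c <~ .reg c + 1).writes := by simp [Stm.writes, hr.1, hr.2]
    have h2 : r ∉ (c <~ (0 : AExp)).writes := by simp [Stm.writes, hr.1]
    rw [h r h1, a₁ r h2]
  refine Tr.mono (Tr.loop (w := w) (B := B) (N := N')
    (fun τ => ∃ i : ℕ, i ≤ N ∧ τ.reg c = i ∧ I i τ) (fun τ => (N - τ.reg c).toNat) hB ?_ ?_ ?_ ?_)
    le_rfl ?_
  · omega
  · exact ⟨0, by omega, by simpa using hj, h₀ σ₁ a₁ hmem⟩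
  · rintro τ aτ ⟨i, h0, h1, -⟩
    have := he τ (hag τ aτ)
    simp [this.2, h1]
    exact hlen _ (by omega) (by omega)
  · rintro τ aτ ⟨i, h0, h1, h2⟩ hcc
    have := (he τ (hag τ aτ)).1
    simp [this, h1] at hcc
    refine Tr.comp (hs i (by omega) τ (hag τ aτ) h1 (hlen _ (by omega) (by omega)) h2) ?_
    intro τ' aτ' hI
    have h3 : τ'.reg c = i := (aτ' c hc).trans h1
    refine Tr.basic' rfl (w := w) (by omega) hB ?_ ?_
    · simp [Stm.Fits, h3]; exact ⟨hlen _ (by omega) (by omega), by omega⟩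
    · simp only [Stm.run, AExp.eval_add, AExp.eval_reg, h3, AExp.eval_ofNat, Nat.cast_one]
      refine ⟨⟨i + 1, by omega, by simp, hI⟩, by simp [h1]; omega⟩
  · rintro σ' aσ ⟨⟨i, h0, h1, h2⟩, hcc⟩
    have := (he σ' (hag σ' aσ)).1
    simp [this, h1] at hcc
    obtain rfl : i = N := by omega
    exact h2

end BitRAM

namespace BitRAM

/-! ### Runs and their probabilities -/

/-- Executions are deterministic, and no list of coin tosses is an initial segment of another one. -/
theorem Exec.det {c : Cmd} {σ σ' : State} {l : List Bool} {k : ℕ} (h : Exec c σ l k σ') :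
    ∀ {l' k' σ'' r r'}, Exec c σ l' k' σ'' → l ++ r = l' ++ r' → l = l' ∧ k = k' ∧ σ' = σ'' := by
  -- The tails `r` and `r'` continue both lists of tosses to one common list. The induction needs
  -- this freedom, since for a composition only the concatenated lists are known to agree.
  induction h with
  | skip σ => intro _ _ _ _ _ h' _; cases h'; simp
  | const σ => intro _ _ _ _ _ h' _; cases h'; simp
  | arith σ => intro _ _ _ _ _ h' _; cases h'; simp
  | load σ => intro _ _ _ _ _ h' _; cases h'; simp
  | store σ => intro _ _ _ _ _ h' _; cases h'; simp
  | coin σ => intro _ _ _ _ _ h' he; cases h'; simp_all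
  | seq h₁ h₂ ih₁ ih₂ =>
    intro _ _ _ _ _ h' he
    cases h' with
    | seq g₁ g₂ =>
      rw [List.append_assoc, List.append_assoc] at he
      obtain ⟨rfl, rfl, rfl⟩ := ih₁ g₁ he
      obtain ⟨rfl, rfl, rfl⟩ := ih₂ g₂ (List.append_cancel_left he)
      simp
  | condTrue ha h ih =>
    intro _ _ _ _ _ h' he
    cases h' with
    | condTrue ha' g => obtain ⟨rfl, rfl, rfl⟩ := ih g he; simp
    | condFalse ha' g => omega
  | condFalse ha h ih =>
    intro _ _ _ _ _ h' he
    cases h' with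
    | condTrue ha' g => omega
    | condFalse ha' g => obtain ⟨rfl, rfl, rfl⟩ := ih g he; simp
  | loopDone ha =>
    intro _ _ _ _ _ h' he
    cases h' with
    | loopDone _ => simp
    | loopStep ha' _ _ => omega
  | loopStep ha h₁ h₂ ih₁ ih₂ =>
    intro _ _ _ _ _ h' he
    cases h' with
    | loopDone ha' => omega
    | loopStep ha' g₁ g₂ =>
      rw [List.append_assoc, List.append_assoc] at he
      obtain ⟨rfl, rfl, rfl⟩ := ih₁ g₁ he
      obtain ⟨rfl, rfl, rfl⟩ := ih₂ g₂ (List.append_cancel_left he)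
      simp

lemma Run.ext_tosses {c : Cmd} {σ : State} {x y : Run c σ} (h : x.tosses = y.tosses) : x = y := by
  obtain ⟨⟨l, k, τ⟩, hx⟩ := x
  obtain ⟨⟨l', k', τ'⟩, hy⟩ := y
  obtain ⟨h₁, h₂, h₃⟩ := Exec.det hx (r := []) (r' := []) hy (by simpa [Run.tosses] using h)
  simp only at h₁ h₂ h₃
  subst h₁ h₂ h₃; rfl

/-- The runs of a sequential composition whose first part tosses no coin. -/
noncomputable def runSeqEquiv {c₁ c₂ : Cmd} {σ σ₁ : State} {k : ℕ} (h : Exec c₁ σ [] k σ₁) :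
    Run c₂ σ₁ ≃ Run (.seq c₁ c₂) σ :=
  Equiv.ofBijective (fun y => ⟨(y.tosses, k + y.cost, y.final), Exec.seq h y.2⟩) (by
    constructor
    · intro y y' hy
      apply Run.ext_tosses
      have := congrArg Run.tosses hy
      simpa [Run.tosses] using this
    · rintro ⟨⟨l, k', τ⟩, hx⟩
      cases hx with
      | @seq _ _ _ τ₁ _ l₁ l₂ k₁ k₂ g₁ g₂ =>
        obtain ⟨rfl, rfl, rfl⟩ := Exec.det h (r := l₁) (r' := []) g₁ (by simp)
        exact ⟨⟨(l₂, k₂, τ), g₂⟩, rfl⟩)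

theorem IsLasVegas.seq {c₁ c₂ : Cmd} {σ σ₁ : State} {k : ℕ} {post : State → Prop} {B : ℝ≥0∞}
    (h : Exec c₁ σ [] k σ₁) (h₂ : IsLasVegas c₂ σ₁ post B) :
    IsLasVegas (.seq c₁ c₂) σ post (k + B) := by
  have hp : ∀ y : Run c₂ σ₁, (runSeqEquiv h y).prob = y.prob := fun y => rfl
  have hc : ∀ y : Run c₂ σ₁, (runSeqEquiv h y).cost = k + y.cost := fun y => rfl
  refine ⟨?_, ?_, ?_⟩
  · rw [← (runSeqEquiv h).tsum_eq]; simpa [hp] using h₂.halts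
  · intro x
    obtain ⟨y, rfl⟩ := (runSeqEquiv h).surjective x
    exact h₂.correct y
  · rw [← (runSeqEquiv h).tsum_eq]
    simp only [hp, hc, Nat.cast_add, mul_add]
    rw [ENNReal.tsum_add, ENNReal.tsum_mul_right, h₂.halts, one_mul]
    exact add_le_add le_rfl h₂.expected_cost

/-- A body of a loop whose runs toss exactly `m` coins. -/
structure UniformBody (c : Cmd) (m : ℕ) (σ : State) where
  cost : List.Vector Bool m → ℕ
  final : List.Vector Bool m → State
  exec : ∀ l : List.Vector Bool m, Exec c σ l.toList (cost l) (final l)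

/-- The runs of a loop that is entered. -/
noncomputable def runLoopEquiv {a : ℕ} {c : Cmd} {m : ℕ} {σ : State} (ha : 0 < σ.reg a)
    (h : UniformBody c m σ) :
    (Σ l : List.Vector Bool m, Run (.loop a c) (h.final l)) ≃ Run (.loop a c) σ :=
  Equiv.ofBijective (fun y => ⟨(y.1.toList ++ y.2.tosses, len (σ.reg a) + h.cost y.1 + y.2.cost,
      y.2.final), Exec.loopStep ha (h.exec y.1) y.2.2⟩) (by
    constructor
    · rintro ⟨l, y⟩ ⟨l', y'⟩ hy
      have := congrArg Run.tosses hy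
      simp only [Run.tosses] at this
      have h2 := List.append_inj this (by simp)
      obtain rfl : l = l' := Subtype.ext h2.1
      obtain rfl : y = y' := Run.ext_tosses h2.2
      rfl
    · rintro ⟨⟨l, k', τ⟩, hx⟩
      have hx' : Exec (.loop a c) σ l k' τ := hx
      cases hx' with
      | loopDone h' => omega
      | @loopStep _ _ _ τ₁ _ l₁ l₂ k₁ k₂ _ g₁ g₂ =>
        -- The number of tosses of the given run of the body is not known beforehand. Padding its
        -- list and keeping the first `m` tosses yields a uniform run to which determinism compares
        -- it.
        obtain ⟨h₁, rfl, rfl⟩ := Exec.det g₁ (r := List.replicate m true)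
          (r' := (l₁ ++ List.replicate m true).drop m)
          (h.exec ⟨(l₁ ++ List.replicate m true).take m, by simp⟩)
          (by simp only [List.Vector.toList]; rw [List.take_append_drop])
        refine ⟨⟨_, ⟨(l₂, k₂, τ), g₂⟩⟩, ?_⟩
        apply Run.ext_tosses
        exact congrArg (· ++ l₂) h₁.symm)

lemma runLoop_done {a : ℕ} {c : Cmd} {σ : State} (ha : σ.reg a ≤ 0) (x : Run (.loop a c) σ) :
    x = ⟨([], len (σ.reg a), σ), Exec.loopDone ha⟩ := by
  obtain ⟨⟨l, k', τ⟩, hx⟩ := x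
  have hx' : Exec (.loop a c) σ l k' τ := hx
  cases hx' with
  | loopDone h' => rfl
  | loopStep h' => omega

lemma tsum_runLoop_done {a : ℕ} {c : Cmd} {σ : State} (ha : σ.reg a ≤ 0)
    (f : ℕ → ℝ≥0∞) : ∑' x : Run (.loop a c) σ, x.prob * f x.cost = f (len (σ.reg a)) := by
  have h := runLoop_done (c := c) ha
  rw [tsum_eq_single ⟨([], len (σ.reg a), σ), Exec.loopDone ha⟩ (fun x hx => absurd (h x) hx)]
  simp [Run.prob, Run.tosses, Run.cost]

lemma tsum_runLoop {a : ℕ} {c : Cmd} {m : ℕ} {σ : State} (ha : 0 < σ.reg a)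
    (h : UniformBody c m σ) (f : ℕ → ℝ≥0∞) :
    ∑' x : Run (.loop a c) σ, x.prob * f x.cost =
      2⁻¹ ^ m * ∑ l : List.Vector Bool m, ∑' y : Run (.loop a c) (h.final l),
        y.prob * f (len (σ.reg a) + h.cost l + y.cost) := by
  rw [← (runLoopEquiv ha h).tsum_eq, ENNReal.tsum_sigma', tsum_fintype, Finset.mul_sum]
  refine Finset.sum_congr rfl fun l _ => ?_
  rw [← ENNReal.tsum_mul_left]
  refine tsum_congr fun y => ?_
  have : (runLoopEquiv ha h ⟨l, y⟩).prob = 2⁻¹ ^ m * y.prob := by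
    have h1 : (runLoopEquiv ha h ⟨l, y⟩).tosses = l.toList ++ y.tosses := rfl
    rw [Run.prob, h1, List.length_append, pow_add, List.Vector.toList_length]; rfl
  rw [this, mul_assoc]; rfl

lemma two_inv_pow_mul (m : ℕ) : (2⁻¹ : ℝ≥0∞) ^ m * 2 ^ m = 1 := by
  rw [← mul_pow, ENNReal.inv_mul_cancel (by norm_num) (by norm_num), one_pow]

/-- Expected cost of a loop that repeats a uniform random experiment until it succeeds. -/
theorem isLasVegas_loop {a : ℕ} {c : Cmd} {m B B' N : ℕ} {I post : State → Prop} {σ : State}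
    (hN : 0 < N) (hσ : I σ) (hbody : ∀ σ, I σ → 0 < σ.reg a → ∃ h : UniformBody c m σ,
      (∀ l, I (h.final l) ∧ h.cost l ≤ B) ∧ ∃ G : Finset (List.Vector Bool m),
        2 ^ m ≤ N * G.card ∧ ∀ l ∈ G, (h.final l).reg a ≤ 0)
    (hlen : ∀ σ, I σ → len (σ.reg a) ≤ B') (hpost : ∀ σ, I σ → σ.reg a ≤ 0 → post σ) :
    IsLasVegas (.loop a c) σ post (N * (B + 2 * B')) := by
  set α : State → ℝ≥0∞ := fun σ => ∑' x : Run (.loop a c) σ, x.prob with hα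
  have hα_done : ∀ σ, σ.reg a ≤ 0 → α σ = 1 := by
    intro σ h
    simpa using tsum_runLoop_done (c := c) h (fun _ => 1)
  have hα_step : ∀ σ, 0 < σ.reg a → ∀ h : UniformBody c m σ,
      α σ = 2⁻¹ ^ m * ∑ l, α (h.final l) := by
    intro σ ha h
    simpa using tsum_runLoop ha h (fun _ => 1)
  -- The runs of cost at most `M` have total probability at most one, by induction on `M`, because a
  -- pass costs at least one. Any finite set of runs is covered by some `M`.
  have hα_le : ∀ σ, I σ → α σ ≤ 1 := by
    have key : ∀ M σ, I σ → ∑' x : Run (.loop a c) σ, x.prob * (if x.cost ≤ M then 1 else 0) ≤ 1 := by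
      intro M
      induction M with
      | zero =>
        intro σ hi
        by_cases ha : 0 < σ.reg a
        · obtain ⟨h, -⟩ := hbody σ hi ha
          rw [tsum_runLoop ha h (fun k => if k ≤ 0 then 1 else 0)]
          have : ∀ k k', ¬ (len (σ.reg a) + k + k' ≤ 0) := by
            intro k k'; have := one_le_len (σ.reg a); omega
          simp [this]
        · rw [tsum_runLoop_done (not_lt.mp ha) (fun k => if k ≤ 0 then 1 else 0)]
          split_ifs <;> simp
      | succ M ih =>
        intro σ hi
        by_cases ha : 0 < σ.reg a
        · obtain ⟨h, h1, -⟩ := hbody σ hi ha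
          rw [tsum_runLoop ha h (fun k => if k ≤ M + 1 then 1 else 0)]
          calc _ ≤ 2⁻¹ ^ m * ∑ l : List.Vector Bool m, (1 : ℝ≥0∞) := by
                gcongr with l
                refine le_trans (ENNReal.tsum_le_tsum fun y => ?_) (ih _ (h1 l).1)
                have := one_le_len (σ.reg a)
                gcongr
                split_ifs <;> first | omega | simp
            _ = 1 := by simpa [card_vector] using two_inv_pow_mul m
        · rw [tsum_runLoop_done (not_lt.mp ha) (fun k => if k ≤ M + 1 then 1 else 0)]
          split_ifs <;> simp
    intro σ hi
    simp only [hα]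
    rw [ENNReal.tsum_eq_iSup_sum]
    refine iSup_le fun F => ?_
    refine le_trans ?_ (key (F.sup Run.cost) σ hi)
    refine le_trans (le_of_eq ?_) (ENNReal.sum_le_tsum F)
    refine Finset.sum_congr rfl fun x hx => ?_
    have : x.cost ≤ F.sup Run.cost := Finset.le_sup (f := Run.cost) hx
    simp [this]
  -- The infimum `β` of the halting probabilities over the invariant satisfies `β ≥ β + (1 - β) /
  -- N`, since a share of at least `1 / N` of the tosses leaves the loop at once. Hence `β` cannot
  -- be less than one.
  have hα_ge : ∀ σ, I σ → 1 ≤ α σ := by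
    set β : ℝ≥0∞ := ⨅ σ : {σ // I σ}, α σ with hβ
    have hle : ∀ σ, I σ → β ≤ α σ := fun σ hi => iInf_le (fun σ : {σ // I σ} => α σ) ⟨σ, hi⟩
    have hβ1 : β ≤ 1 := (hle σ hσ).trans (hα_le σ hσ)
    suffices 1 ≤ β from fun σ hi => this.trans (hle σ hi)
    by_contra hlt
    rw [not_le] at hlt
    lift β to NNReal using hlt.ne_top with b hb
    have hb1 : b < 1 := by exact_mod_cast hlt
    by_cases hact : ∃ σ, I σ ∧ 0 < σ.reg a
    · have : ((b + (1 - b) / N : NNReal) : ℝ≥0∞) ≤ ⨅ σ : {σ // I σ}, α σ := by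
        refine le_iInf fun ⟨σ, hi⟩ => ?_
        by_cases ha : 0 < σ.reg a
        · obtain ⟨h, h1, G, hG, hg⟩ := hbody σ hi ha
          rw [hα_step σ ha h]
          have h2 : ∀ l, (((b + if l ∈ G then 1 - b else 0 : NNReal)) : ℝ≥0∞) ≤ α (h.final l) := by
            intro l
            split_ifs with hl
            · rw [hα_done _ (hg l hl), add_tsub_cancel_of_le hb1.le]; simp
            · rw [add_zero]; exact hle _ (h1 l).1
          refine le_trans ?_ (mul_le_mul_right (Finset.sum_le_sum fun l _ => h2 l) _)
          have e : (2⁻¹ : ℝ≥0∞) ^ m = (((2⁻¹ : NNReal) ^ m : NNReal) : ℝ≥0∞) := by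
            rw [ENNReal.coe_pow, ENNReal.coe_inv (by norm_num)]; norm_num
          rw [e]
          norm_cast
          rw [Finset.sum_add_distrib, Finset.sum_ite_mem]
          simp only [Finset.univ_inter, Finset.sum_const, Finset.card_univ, card_vector,
            Fintype.card_bool, nsmul_eq_mul]
          have e2 : (2⁻¹ : NNReal) ^ m * 2 ^ m = 1 := by
            rw [← mul_pow]; norm_num
          have hG' : ((2 : NNReal)) ^ m ≤ N * G.card := by exact_mod_cast hG
          rw [mul_add]
          push_cast
          rw [← mul_assoc, e2, one_mul]
          gcongr
          rw [← mul_assoc, div_eq_inv_mul]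
          gcongr
          have hN' : (0 : NNReal) < N := by exact_mod_cast hN
          rw [inv_le_iff_one_le_mul₀ hN', ← e2]
          calc (2⁻¹ : NNReal) ^ m * 2 ^ m ≤ 2⁻¹ ^ m * (N * G.card) := by gcongr
            _ = _ := by ring
        · rw [hα_done σ (not_lt.mp ha)]
          have hN' : (1 : NNReal) ≤ N := by exact_mod_cast hN
          have : b + (1 - b) / N ≤ 1 := by
            calc b + (1 - b) / N ≤ b + (1 - b) := by
                  gcongr; exact div_le_self zero_le hN'
              _ = 1 := add_tsub_cancel_of_le hb1.le
          exact_mod_cast this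
      rw [← hβ] at this
      have h3 : b + (1 - b) / N ≤ b := by exact_mod_cast this
      have h4 : 0 < (1 - b) / N := by
        have : 0 < 1 - b := tsub_pos_of_lt hb1
        positivity
      exact absurd h3 (not_le.mpr (lt_add_of_pos_right b h4))
    · push Not at hact
      have : (1 : ℝ≥0∞) ≤ ⨅ σ : {σ // I σ}, α σ :=
        le_iInf fun ⟨σ, hi⟩ => (hα_done σ (hact σ hi)).ge
      rw [← hβ] at this
      exact absurd this (not_le.mpr hlt)
  have hα1 : ∀ σ, I σ → α σ = 1 := fun σ hi => le_antisymm (hα_le σ hi) (hα_ge σ hi)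
  refine ⟨hα1 σ hσ, ?_, ?_⟩
  · have : ∀ (c' : Cmd) (σ σ' : State) (l : List Bool) (k : ℕ), Exec c' σ l k σ' → c' = .loop a c →
        I σ → post σ' := by
      intro c' σ σ' l k hx
      induction hx with
      | loopDone ha =>
        intro hc hi
        cases hc
        exact hpost _ hi ha
      | @loopStep a' c'' σ₀ σ₁ σ₂ l₁ l₂ k₁ k₂ ha h₁ h₂ ih₁ ih₂ =>
        intro hc hi
        cases hc
        refine ih₂ rfl ?_
        obtain ⟨h, h1, -⟩ := hbody _ hi ha
        obtain ⟨-, -, rfl⟩ := Exec.det h₁ (r := List.replicate m true)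
          (r' := (l₁ ++ List.replicate m true).drop m)
          (h.exec ⟨(l₁ ++ List.replicate m true).take m, by simp⟩)
          (by simp only [List.Vector.toList]; rw [List.take_append_drop])
        exact (h1 _).1
      | _ => intro hc; cases hc
    exact fun x => this _ _ _ _ _ x.2 rfl hσ
  -- Costs truncated at `M` have a finite supremum `ε` of expectations, so the inequality `ε ≤ B + 2
  -- B' + (ε - ε / N)` may be solved for `ε`. One `B'` pays for the guard of the pass, the other for
  -- the last guard after a success.
  · have key : ∀ M : ℕ, ∀ σ, I σ → ∑' x : Run (.loop a c) σ, x.prob * (min x.cost M : ℕ) ≤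
        N * (B + 2 * B') := by
      intro M
      set e : State → ℝ≥0∞ := fun σ => ∑' x : Run (.loop a c) σ, x.prob * (min x.cost M : ℕ) with he
      set ε : ℝ≥0∞ := ⨆ σ : {σ // I σ}, e σ with hε
      have hle : ∀ σ, I σ → e σ ≤ ε := fun σ hi => le_iSup (fun σ : {σ // I σ} => e σ) ⟨σ, hi⟩
      have hfin : ε ≤ M := by
        refine iSup_le fun ⟨σ, hi⟩ => ?_
        calc e σ ≤ ∑' x : Run (.loop a c) σ, x.prob * M := by
              refine ENNReal.tsum_le_tsum fun x => ?_
              gcongr; exact_mod_cast min_le_right _ _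
          _ = M := by rw [ENNReal.tsum_mul_right]; simp only [hα] at hα1; rw [hα1 σ hi, one_mul]
      have hdone : ∀ σ, I σ → σ.reg a ≤ 0 → e σ ≤ B' := by
        intro σ hi ha
        simp only [he]
        rw [tsum_runLoop_done ha (fun k => ((min k M : ℕ) : ℝ≥0∞))]
        exact_mod_cast (min_le_left _ _).trans (hlen σ hi)
      suffices ε ≤ N * (B + 2 * B') from fun σ hi => (hle σ hi).trans this
      lift ε to NNReal using ne_top_of_le_ne_top (by simp) hfin with b hb
      by_cases hact : ∃ σ, I σ ∧ 0 < σ.reg a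
      · have : ⨆ σ : {σ // I σ}, e σ ≤ ((B + 2 * B' + (b - b / N) : NNReal) : ℝ≥0∞) := by
          refine iSup_le fun ⟨σ, hi⟩ => ?_
          by_cases ha : 0 < σ.reg a
          · obtain ⟨h, h1, G, hG, hg⟩ := hbody σ hi ha
            simp only [he]
            rw [tsum_runLoop ha h (fun k => ((min k M : ℕ) : ℝ≥0∞))]
            have h2 : ∀ l, ∑' y : Run (.loop a c) (h.final l),
                y.prob * ((min (len (σ.reg a) + h.cost l + y.cost) M : ℕ) : ℝ≥0∞) ≤
                ((B + B' + (B' + if l ∈ G then 0 else b) : NNReal) : ℝ≥0∞) := by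
              intro l
              calc _ ≤ ∑' y : Run (.loop a c) (h.final l),
                    (y.prob * (B + B' : ℕ) + y.prob * (min y.cost M : ℕ)) := by
                    refine ENNReal.tsum_le_tsum fun y => ?_
                    rw [← mul_add]
                    gcongr
                    have := hlen σ hi
                    have := (h1 l).2
                    norm_cast
                    omega
                _ = (B + B' : ℕ) + e (h.final l) := by
                    rw [ENNReal.tsum_add, ENNReal.tsum_mul_right]
                    have := hα1 _ (h1 l).1
                    simp only [hα] at this
                    rw [this, one_mul]
                _ ≤ _ := by
                    push_cast
                    gcongr
                    split_ifs with hl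
                    · simpa using hdone _ (h1 l).1 (hg l hl)
                    · exact (hle _ (h1 l).1).trans (by simp)
            refine le_trans (mul_le_mul_right (Finset.sum_le_sum fun l _ => h2 l) _) ?_
            have e0 : (2⁻¹ : ℝ≥0∞) ^ m = (((2⁻¹ : NNReal) ^ m : NNReal) : ℝ≥0∞) := by
              rw [ENNReal.coe_pow, ENNReal.coe_inv (by norm_num)]; norm_num
            rw [e0]
            norm_cast
            have e1 : ∑ l : List.Vector Bool m, ((B + B' + (B' + if l ∈ G then 0 else b) : NNReal)) +
                G.card * b = 2 ^ m * (B + 2 * B' + b) := by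
              have : (G.card * b : NNReal) = ∑ l : List.Vector Bool m, if l ∈ G then b else 0 := by
                rw [Finset.sum_ite_mem]; simp
              rw [this, ← Finset.sum_add_distrib]
              rw [Finset.sum_congr rfl (g := fun _ => (B + 2 * B' + b : NNReal))]
              · simp [card_vector, mul_add]
              · intro l _
                split_ifs <;> ring
            have e2 : (2⁻¹ : NNReal) ^ m * 2 ^ m = 1 := by
              rw [← mul_pow]; norm_num
            have hG' : ((2 : NNReal)) ^ m ≤ N * G.card := by exact_mod_cast hG
            have hN' : (0 : NNReal) < N := by exact_mod_cast hN
            have e3 : b / N ≤ 2⁻¹ ^ m * (G.card * b) := by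
              rw [div_le_iff₀ hN']
              calc b = 2⁻¹ ^ m * 2 ^ m * b := by rw [e2, one_mul]
                _ ≤ 2⁻¹ ^ m * (N * G.card) * b := by gcongr
                _ = _ := by ring
            have e4 : b / N ≤ b := div_le_self zero_le (by exact_mod_cast hN)
            have e5 := congrArg (fun t => (2⁻¹ : NNReal) ^ m * t) e1
            simp only [mul_add _ (∑ l, _)] at e5
            rw [← mul_assoc _ ((2 : NNReal) ^ m), e2, one_mul] at e5
            push_cast at e5 ⊢
            rw [← NNReal.coe_le_coe] at *
            have e6 := congrArg (fun x : NNReal => (x : ℝ)) e5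
            simp only [NNReal.coe_add] at e6
            rw [NNReal.coe_add (_ + _), NNReal.coe_sub (by exact_mod_cast e4), NNReal.coe_add]
            linarith
          · refine (hdone σ hi (not_lt.mp ha)).trans ?_
            have : (B' : NNReal) ≤ B + 2 * B' + (b - b / N) := by
              have h5 : (0 : NNReal) ≤ B + B' + (b - b / N) := zero_le
              calc (B' : NNReal) ≤ B' + (B + B' + (b - b / N)) := le_add_of_nonneg_right h5
                _ = _ := by ring
            exact_mod_cast this
        rw [← hε] at this
        have h3 : b ≤ B + 2 * B' + (b - b / N) := by exact_mod_cast this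
        have hN' : (0 : NNReal) < N := by exact_mod_cast hN
        have e4 : b / N ≤ b := div_le_self zero_le (by exact_mod_cast hN)
        have h4 : b / N ≤ B + 2 * B' := by
          rw [← NNReal.coe_le_coe] at *
          rw [NNReal.coe_add, NNReal.coe_sub (by exact_mod_cast e4)] at h3
          linarith
        rw [div_le_iff₀ hN'] at h4
        rw [mul_comm] at h4
        exact_mod_cast h4
      · push Not at hact
        have : ⨆ σ : {σ // I σ}, e σ ≤ N * (B + 2 * B') := by
          refine iSup_le fun ⟨σ, hi⟩ => (hdone σ hi (hact σ hi)).trans ?_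
          norm_cast
          have : 1 ≤ N := by omega
          nlinarith
        rwa [← hε] at this
    rw [ENNReal.tsum_eq_iSup_sum]
    refine iSup_le fun F => ?_
    refine le_trans ?_ (key (F.sup Run.cost) σ hσ)
    refine le_trans (le_of_eq ?_) (ENNReal.sum_le_tsum F)
    refine Finset.sum_congr rfl fun x hx => ?_
    have : x.cost ≤ F.sup Run.cost := Finset.le_sup (f := Run.cost) hx
    rw [min_eq_left this]

end BitRAM

/-! ### Linear passes over the work array -/

namespace BitRAM

local notation "R" => AExp.reg
local notation "Mem" => AExp.load

/-- Merge all neighbouring blocks of the work array. -/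
def combineBody : Stm :=
  .st (R 9 + R 23) (Mem (R 9 + 2 * R 23) * R 26 + Mem (R 9 + 2 * R 23 + 1) * R 25)

/-- Merge all neighbouring blocks of the work array. -/
def combine : Stm := .for 23 (R 32) combineBody

/-- Merging in place is safe in increasing order: cell `W + k` is written when only cells below it
have changed, and the cells `W + 2k` and `W + 2k + 1` that are read still hold their old values. -/
lemma combine_tr {σ : State} {w : ℕ} {W : ℤ} {h : ℕ} (h9 : σ.reg 9 = W) (h32 : σ.reg 32 = h)
    (hw : 3 ≤ w) (hW : len W ≤ w) (hh : len h ≤ w) (hA : len (σ.reg 25) ≤ w)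
    (hB : len (σ.reg 26) ≤ w) (hm : ∀ i : ℕ, i < 2 * h → len (σ.mem (W + i)) ≤ w) :
    Tr combine σ [] (combine.κ * ((h + 1) * opc w)) (fun σ' =>
      (∀ i : ℕ, i < h → σ'.mem (W + i) =
        σ.mem (W + 2 * i) * σ.reg 26 + σ.mem (W + 2 * i + 1) * σ.reg 25) ∧
      ∀ x, x < W ∨ W + h ≤ x → σ'.mem x = σ.mem x) := by
  refine Tr.for (w := w) (B := opc w) (fun k τ => 
      (∀ i : ℕ, i < k → τ.mem (W + i) =
        σ.mem (W + 2 * i) * σ.reg 26 + σ.mem (W + 2 * i + 1) * σ.reg 25) ∧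
      ∀ x, x < W ∨ W + k ≤ x → τ.mem x = σ.mem x) (by decide) hw hh le_rfl le_rfl ?_ ?_ ?_
  · rintro τ - hm
    simp [hm]
  · rintro τ a
    simp [a 32 (by decide), h32, hh]
  · rintro k hk τ a hτ hlk ⟨h1, h2⟩
    have m1 := h2 (W + 2 * k) (by omega)
    have m2 := h2 (W + 2 * k + 1) (by omega)
    have := hm (2 * k) (by omega)
    have := hm (2 * k + 1) (by omega)
    have f9 := a 9 (by decide)
    have f25 := a 25 (by decide)
    have f26 := a 26 (by decide)
    refine Tr.basic' rfl (w := w) (by omega) le_rfl ?_ ?_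
    · simp_all [combineBody, Stm.Fits, ← add_assoc]; omega
    · simp [combineBody, Stm.run, hτ, f9, f25, f26, h9, m1, m2]
      constructor
      · intro i hi
        split_ifs with hh
        · subst hh; rfl
        · exact h1 i (by omega)
      · intro x hx
        rw [if_neg (by omega)]
        exact h2 x (by omega)

/-- Split a block of the work array into its high and low half. -/
def splitBody : Stm :=
  36 <~ R 32 - 1 - R 23 ;;
  24 <~ Mem (R 9 + R 36) ;;
  .st (R 9 + 2 * R 36 + 1) (R 24 / R 27) ;;
  .st (R 9 + 2 * R 36) (R 24 % R 27)

/-- Split all blocks of the work array into halves. -/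
def split : Stm := .for 23 (R 32) splitBody

/-- Splitting in place runs from the last block to the first: block `i` spreads over the cells `2i`
and `2i + 1`, which may overwrite only blocks already treated. The old value is kept in a register
while both halves are written. -/
lemma split_tr {σ : State} {w : ℕ} {W : ℤ} {h : ℕ} (h9 : σ.reg 9 = W) (h32 : σ.reg 32 = h)
    (hw : 3 ≤ w) (hW : len W ≤ w) (hh : len h ≤ w) (hX : len (σ.reg 27) ≤ w)
    (hm : ∀ i : ℕ, i < h → len (σ.mem (W + i)) ≤ w) :
    Tr split σ [] (split.κ * ((h + 1) * opc w)) (fun σ' =>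
      (∀ i : ℕ, i < h → σ'.mem (W + 2 * i) = σ.mem (W + i) % σ.reg 27 ∧
        σ'.mem (W + 2 * i + 1) = σ.mem (W + i) / σ.reg 27) ∧
      ∀ x, x < W ∨ W + 2 * h ≤ x → σ'.mem x = σ.mem x) := by
  refine Tr.mono (Tr.for (w := w) (B := opc w) (N := h) (fun k τ =>
      (∀ i : ℕ, h - k ≤ i → i < h → τ.mem (W + 2 * i) = σ.mem (W + i) % σ.reg 27 ∧
        τ.mem (W + 2 * i + 1) = σ.mem (W + i) / σ.reg 27) ∧
      ∀ x, x < W + 2 * (h - k) ∨ W + 2 * h ≤ x → τ.mem x = σ.mem x)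
      (by decide) hw hh le_rfl le_rfl ?_ ?_ ?_) le_rfl ?_
  · rintro τ - hm
    refine ⟨fun i _ _ => by omega, fun x _ => by rw [hm]⟩
  · rintro τ a
    simp [a 32 (by decide), h32, hh]
  · rintro k hk τ a hτ hlk ⟨h1, h2⟩
    have m1 := h2 (W + (h - 1 - k)) (by omega)
    have f9 := a 9 (by decide)
    have f27 := a 27 (by decide)
    have f32 := a 32 (by decide)
    obtain ⟨p, hp⟩ : ∃ p : ℕ, h = k + 1 + p := ⟨h - k - 1, by omega⟩
    have e1 : (h : ℤ) - 1 - k = p := by omega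
    rw [e1] at m1
    have hlp : len p ≤ w := (len_mono (by
      rw [abs_of_nonneg (by omega)]; exact le_trans (by omega) (le_abs_self _))).trans hh
    have := hm p (by omega)
    refine Tr.basic' rfl (w := w) (by omega) le_rfl ?_ ?_
    · simp [splitBody, Stm.Fits, Stm.run, hτ, f9, f27, f32, h9, h32, e1, m1, hh, hW, hX, hlk, hlp, this]
      omega
    · simp [splitBody, Stm.run, hτ, f9, f27, f32, h9, h32, e1, m1]
      constructor
      · intro i hi hih
        by_cases hip : i = p
        · subst hip; simp
        · rw [if_neg (by omega), if_neg (by omega), if_neg (by omega), if_neg (by omega)]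
          exact h1 i (by omega) hih
      · intro x hx
        rw [if_neg (by omega), if_neg (by omega)]
        exact h2 x (by omega)
  · rintro σ' - ⟨h1, h2⟩
    exact ⟨fun i hi => h1 i (by omega) hi, fun x hx => h2 x (by omega)⟩

/-- Copy one coefficient to the work array. -/
def fillBody : Stm :=
  .ite (R 1 + 1 - R 23) (24 <~ Mem (R 21 + R 23)) (24 <~ 0) ;;
  .st (R 9 + R 23) (R 24)

/-- Copy the coefficients to the work array, padded with zeros. -/
def fill : Stm := .for 23 (R 8) fillBody

lemma fill_tr {σ : State} {w : ℕ} {W src : ℤ} {d Pw : ℕ} (h1 : σ.reg 1 = d) (h8 : σ.reg 8 = Pw)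
    (h9 : σ.reg 9 = W) (h21 : σ.reg 21 = src) (hsrc : src + d < W)
    (hw : 3 ≤ w) (hW : len W ≤ w) (hs : len src ≤ w) (hd : len d ≤ w) (hP : len Pw ≤ w)
    (hm : ∀ i : ℕ, i ≤ d → len (σ.mem (src + i)) ≤ w) :
    Tr fill σ [] (fill.κ * ((Pw + 1) * opc w)) (fun σ' =>
      (∀ i : ℕ, i < Pw → σ'.mem (W + i) = if i ≤ d then σ.mem (src + i) else 0) ∧
      ∀ x, x < W ∨ W + Pw ≤ x → σ'.mem x = σ.mem x) := by
  refine Tr.for (w := w) (B := opc w) (fun k τ =>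
      (∀ i : ℕ, i < k → τ.mem (W + i) = if i ≤ d then σ.mem (src + i) else 0) ∧
      ∀ x, x < W ∨ W + k ≤ x → τ.mem x = σ.mem x) (by decide) hw hP le_rfl le_rfl ?_ ?_ ?_
  · rintro τ - hm
    simp [hm]
  · rintro τ a
    simp [a 8 (by decide), h8, hP]
  · rintro k hk τ a hτ hlk ⟨g1, g2⟩
    have f1 := a 1 (by decide)
    have f9 := a 9 (by decide)
    have f21 := a 21 (by decide)
    refine Tr.basic' rfl (w := w) (by omega) le_rfl ?_ ?_
    · by_cases hkd : k ≤ d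
      · have m1 := g2 (src + k) (by omega)
        have := hm k hkd
        simp [fillBody, Stm.Fits, Stm.run, hτ, f1, f9, f21, h1, h9, h21, hd, hlk, hs, hkd, m1, this, hW]
        omega
      · simp [fillBody, Stm.Fits, Stm.run, hτ, f1, f9, h1, h9, hd, hlk, hkd, hW]
        omega
    · by_cases hkd : k ≤ d
      · have m1 := g2 (src + k) (by omega)
        simp [fillBody, Stm.run, hτ, f1, f9, f21, h1, h9, h21, hkd, m1]
        refine ⟨fun i hi => ?_, fun x hx => ?_⟩
        · by_cases hik : i = k
          · subst hik; simp [hkd]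
          · rw [if_neg hik]; exact g1 i (by omega)
        · rw [if_neg (by omega)]; exact g2 x (by omega)
      · simp [fillBody, Stm.run, hτ, f1, f9, h1, h9, hkd]
        refine ⟨fun i hi => ?_, fun x hx => ?_⟩
        · by_cases hik : i = k
          · subst hik; simp [hkd]
          · rw [if_neg hik]; exact g1 i (by omega)
        · rw [if_neg (by omega)]; exact g2 x (by omega)

/-- Write one digit to the output. -/
def emitBody : Stm := .st (R 22 + R 23) (Mem (R 9 + R 23) - R 6)

/-- Write the digits to the output. -/
def emit : Stm := .for 23 (R 1 + 1) emitBody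

lemma emit_tr {σ : State} {w : ℕ} {W dst : ℤ} {d : ℕ} (h1 : σ.reg 1 = d)
    (h9 : σ.reg 9 = W) (h22 : σ.reg 22 = dst) (hdst : dst + d < W)
    (hw : 3 ≤ w) (hW : len W ≤ w) (hs : len dst ≤ w) (hd : len (d + 1 : ℕ) ≤ w)
    (hH : len (σ.reg 6) ≤ w) (hm : ∀ i : ℕ, i ≤ d → len (σ.mem (W + i)) ≤ w) :
    Tr emit σ [] (emit.κ * ((d + 2) * opc w)) (fun σ' =>
      (∀ i : ℕ, i ≤ d → σ'.mem (dst + i) = σ.mem (W + i) - σ.reg 6) ∧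
      ∀ x, x < dst ∨ dst + d < x → σ'.mem x = σ.mem x) := by
  refine Tr.mono (Tr.for (w := w) (B := opc w) (N := d + 1) (fun k τ =>
      (∀ i : ℕ, i < k → τ.mem (dst + i) = σ.mem (W + i) - σ.reg 6) ∧
      ∀ x, x < dst ∨ dst + k ≤ x → τ.mem x = σ.mem x) (by decide) hw hd le_rfl le_rfl ?_ ?_ ?_)
      le_rfl ?_
  · rintro τ - hm
    simp [hm]
  · rintro τ a
    have hd' : len (d : ℤ) ≤ w := (len_mono (by
      rw [abs_of_nonneg (by omega), abs_of_nonneg (by omega)]; push_cast; omega)).trans hd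
    simp [a 1 (by decide), h1, hd']; omega
  · rintro k hk τ a hτ hlk ⟨g1, g2⟩
    have f6 := a 6 (by decide)
    have f9 := a 9 (by decide)
    have f22 := a 22 (by decide)
    have m1 := g2 (W + k) (by omega)
    have := hm k (by omega)
    refine Tr.basic' rfl (w := w) (by omega) le_rfl ?_ ?_
    · simp [emitBody, Stm.Fits, hτ, f6, f9, f22, h9, h22, hlk, hs, m1, this, hW, hH]
    · simp [emitBody, Stm.run, hτ, f6, f9, f22, h9, h22, m1]
      constructor
      · intro i hi
        split_ifs with hh
        · subst hh; rfl
        · exact g1 i (by omega)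
      · intro x hx
        rw [if_neg (by omega)]
        exact g2 x (by omega)
  · rintro σ' - ⟨h1, h2⟩
    exact ⟨fun i hi => h1 i (by omega), fun x hx => h2 x (by push_cast; omega)⟩

/-! ### Arithmetic of the merging and splitting trees -/

/-- The value of the `j`-th block of length `s`, as a binary form in `A` and `B`. -/
def blk (a : ℕ → ℤ) (A B : ℤ) (s j : ℕ) : ℤ :=
  ∑ i ∈ Finset.range s, a (j * s + i) * A ^ i * B ^ (s - 1 - i)

/-- Both halves are forms of degree `s - 1` and the whole has degree `2s - 1`, so the lower half
takes up a factor `B ^ s` and the upper half a factor `A ^ s`. -/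
lemma blk_two_mul (a : ℕ → ℤ) (A B : ℤ) (s j : ℕ) :
    blk a A B (2 * s) j = blk a A B s (2 * j) * B ^ s + blk a A B s (2 * j + 1) * A ^ s := by
  rw [blk, two_mul, Finset.sum_range_add, blk, blk, Finset.sum_mul, Finset.sum_mul]
  congr 1
  · refine Finset.sum_congr rfl fun i hi => ?_
    rw [Finset.mem_range] at hi
    rw [show s + s - 1 - i = s - 1 - i + s by omega, show j * (s + s) + i = 2 * j * s + i by ring]
    ring
  · refine Finset.sum_congr rfl fun i hi => ?_
    rw [Finset.mem_range] at hi
    rw [show s + s - 1 - (s + i) = s - 1 - i by omega,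
      show j * (s + s) + (s + i) = (2 * j + 1) * s + i by ring]
    ring

/-- Each of the `s` terms is at most `X ^ (2 * s)`, and `s ≤ 2 ^ s ≤ X ^ s`. So a block of length
`s` takes `O(s)` times the bits of `X`, and all levels of the tree have the same total size. -/
lemma abs_blk_le {a : ℕ → ℤ} {A B X : ℤ} (hX : 2 ≤ X) (ha : ∀ i, |a i| ≤ X) (hA : |A| ≤ X ^ 2)
    (hB : |B| ≤ X ^ 2) (s j : ℕ) : |blk a A B s j| ≤ X ^ (3 * s) := by
  have h0 : (0 : ℤ) ≤ X := by omega
  have h1 : (1 : ℤ) ≤ X := by omega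
  have h2 : |blk a A B s j| ≤ s * X ^ (2 * s) := by
    refine (Finset.abs_sum_le_sum_abs _ _).trans ?_
    calc _ ≤ ∑ i ∈ Finset.range s, X ^ (2 * s) := by
          refine Finset.sum_le_sum fun i hi => ?_
          rw [Finset.mem_range] at hi
          rw [abs_mul, abs_mul, abs_pow, abs_pow]
          calc _ ≤ X * (X ^ 2) ^ i * (X ^ 2) ^ (s - 1 - i) := by gcongr; exact ha _
            _ = X ^ (1 + 2 * i + 2 * (s - 1 - i)) := by rw [← pow_mul, ← pow_mul]; ring
            _ ≤ _ := pow_le_pow_right₀ h1 (by omega)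
      _ = _ := by simp
  have h3 : (s : ℤ) ≤ X ^ s := by
    calc (s : ℤ) ≤ 2 ^ s := by exact_mod_cast Nat.lt_two_pow_self.le
      _ ≤ _ := by gcongr
  calc _ ≤ _ := h2
    _ ≤ X ^ s * X ^ (2 * s) := by gcongr
    _ = _ := by ring

lemma len_le_of_abs_le_pow {z X : ℤ} {k : ℕ} (h : |z| ≤ X ^ k) : len z ≤ k * len X + 2 := by
  rw [len_le_iff]
  have h1 : |X| ≤ 2 ^ len X := (abs_lt_two_pow_len X).le.trans (pow_le_pow_right₀ (by norm_num) (by omega))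
  calc |z| ≤ |X ^ k| := h.trans (le_abs_self _)
    _ = |X| ^ k := abs_pow _ _
    _ ≤ (2 ^ len X) ^ k := by gcongr
    _ = 2 ^ (k * len X) := by rw [← pow_mul, mul_comm]
    _ < _ := pow_lt_pow_right₀ (by norm_num) (by omega)

lemma len_mono' {x y : ℤ} (h0 : 0 ≤ x) (h : x ≤ y) : len x ≤ len y :=
  len_mono (by rw [abs_of_nonneg h0]; exact h.trans (le_abs_self _))

/-- A pass over `c` numbers of `v` bits costs no more than one operation on `c * v` bits; this gives
all levels of a tree one common bound. -/
lemma mul_opc_le {c v : ℕ} (hc : 1 ≤ c) : c * opc v ≤ opc (c * v) := by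
  rw [opc, opc, ← mul_assoc]
  have := Nat.size_le_size (Nat.le_mul_of_pos_left v hc)
  gcongr

/-- One multiplication doubles the number of terms, in step with the squarings of the merging tree.
The full geometric sum serves to add `H` to all digits at once. -/
lemma sum_geom_pow_succ (X : ℤ) (s : ℕ) :
    (∑ i ∈ Finset.range s, X ^ i) * (X ^ s + 1) = ∑ i ∈ Finset.range (2 * s), X ^ i := by
  rw [two_mul, Finset.sum_range_add, mul_add, mul_one, add_comm]
  congr 1
  rw [Finset.sum_mul]
  exact Finset.sum_congr rfl fun i _ => by ring

/-- The digits of `∑ c j * X ^ j`. -/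
lemma digit_eq {X : ℤ} (c : ℕ → ℤ) (hc : ∀ i, 0 ≤ c i ∧ c i < X) (N j : ℕ) (hj : j < N) :
    (∑ i ∈ Finset.range N, c i * X ^ i) / X ^ j % X = c j := by
  have hX : 0 < X := (hc 0).1.trans_lt (hc 0).2
  induction j generalizing c N with
  | zero =>
    obtain ⟨M, rfl⟩ : ∃ M, N = M + 1 := ⟨N - 1, by omega⟩
    rw [Finset.sum_range_succ', pow_zero, Int.ediv_one, mul_one, ← Finset.sum_congr rfl
      (fun i _ => show c (i + 1) * X ^ i * X = c (i + 1) * X ^ (i + 1) by ring), ← Finset.sum_mul,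
      Int.mul_add_emod_self_right, Int.emod_eq_of_lt (hc 0).1 (hc 0).2]
  | succ j ih =>
    obtain ⟨M, rfl⟩ : ∃ M, N = M + 1 := ⟨N - 1, by omega⟩
    rw [← ih (fun i => c (i + 1)) (fun i => hc _) M (by omega)]
    rw [Finset.sum_range_succ', pow_zero, mul_one, ← Finset.sum_congr rfl
      (fun i _ => show c (i + 1) * X ^ i * X = c (i + 1) * X ^ (i + 1) by ring), ← Finset.sum_mul,
      pow_succ', ← Int.ediv_ediv_of_nonneg hX.le]
    congr 2
    rw [add_comm, Int.add_mul_ediv_right _ _ hX.ne', Int.ediv_eq_zero_of_lt (hc 0).1 (hc 0).2, zero_add]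

end BitRAM

/-! ### Change of parameter by Kronecker substitution -/

namespace BitRAM

local notation "R" => AExp.reg
local notation "Mem" => AExp.load

/-- The part of a merging step that updates the registers. -/
def upTail : Stm :=
  .ite (R 30 % 2) (29 <~ R 29 * R 26) .skip ;; 30 <~ R 30 / 2 ;;
  .st (R 10 + R 31) (R 27) ;; 31 <~ R 31 + 1 ;; 28 <~ R 28 * (R 27 + 1) ;;
  25 <~ R 25 * R 25 ;; 26 <~ R 26 * R 26 ;; 27 <~ R 27 * R 27 ;; 32 <~ R 32 / 2

/-- One level of the merging tree. -/
def upBody : Stm := combine ;; upTail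

/-- The state after `k` levels of the merging tree. -/
structure UpInv (a : ℕ → ℤ) (A B X W XT : ℤ) (e m : ℕ) (σ : State) (k : ℕ) (τ : State) : Prop where
  le : k ≤ m
  r31 : τ.reg 31 = k
  r32 : τ.reg 32 = (2 ^ m / 2 ^ (k + 1) : ℕ)
  r25 : τ.reg 25 = A ^ 2 ^ k
  r26 : τ.reg 26 = B ^ 2 ^ k
  r27 : τ.reg 27 = X ^ 2 ^ k
  r28 : τ.reg 28 = ∑ i ∈ Finset.range (2 ^ k), X ^ i
  r29 : τ.reg 29 = B ^ (e % 2 ^ k)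
  r30 : τ.reg 30 = (e / 2 ^ k : ℕ)
  blks : ∀ j : ℕ, j < 2 ^ (m - k) → τ.mem (W + j) = blk a A B (2 ^ k) j
  xt : ∀ i : ℕ, i < k → τ.mem (XT + i) = X ^ 2 ^ i
  frame : ∀ x, x < W ∨ XT + m ≤ x → τ.mem x = σ.mem x

lemma abs_pow_le_pow {A X : ℤ} (hX : 2 ≤ X) (hA : |A| ≤ X ^ 2) {i s : ℕ} (hi : i ≤ s) :
    |A ^ i| ≤ X ^ (2 * s) := by
  rw [abs_pow]
  calc |A| ^ i ≤ (X ^ 2) ^ i := by gcongr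
    _ = X ^ (2 * i) := by rw [← pow_mul]
    _ ≤ _ := pow_le_pow_right₀ (by omega) (by omega)

lemma sum_geom_le {X : ℤ} (hX : 2 ≤ X) (s : ℕ) :
    0 ≤ (∑ i ∈ Finset.range s, X ^ i) ∧ (∑ i ∈ Finset.range s, X ^ i) ≤ X ^ (2 * s) := by
  refine ⟨Finset.sum_nonneg fun i _ => by positivity, ?_⟩
  have h3 : (s : ℤ) ≤ X ^ s := by
    calc (s : ℤ) ≤ 2 ^ s := by exact_mod_cast Nat.lt_two_pow_self.le
      _ ≤ _ := by gcongr
  calc _ ≤ ∑ i ∈ Finset.range s, X ^ s :=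
        Finset.sum_le_sum fun i hi => pow_le_pow_right₀ (by omega) (Finset.mem_range.mp hi).le
    _ = s * X ^ s := by simp
    _ ≤ X ^ s * X ^ s := by gcongr
    _ = _ := by rw [← pow_add, two_mul]

/-- At level `k` the blocks need `3 * 2 ^ k * len X + 2` bits, so `4 * 2 ^ k * len X` bits suffice
for each, and twice the number of merged blocks times this width is `4 * 2 ^ m * len X` at every
level. Besides merging, a level consumes one binary digit of `e` towards `B ^ e` and records `X ^ 2
^ k` in the table at `XT` for the way down. -/
lemma up_step {a : ℕ → ℤ} {A B X W XT : ℤ} {e m : ℕ} {σ τ : State} {k : ℕ} {Bc : ℕ}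
    (hX : 4 ≤ X) (ha : ∀ i, |a i| ≤ X) (hA : |A| ≤ X ^ 2) (hB : |B| ≤ X ^ 2)
    (he : e < 2 ^ m) (hW : 0 ≤ W) (hXT : XT = W + 2 ^ m) (hXX : XT + 2 ^ m ≤ X)
    (hBc : opc (4 * 2 ^ m * len X) ≤ Bc)
    (h9 : τ.reg 9 = W) (h10 : τ.reg 10 = XT) (hi : UpInv a A B X W XT e m σ k τ) (hk : k < m) :
    Tr upBody τ [] (upBody.κ * Bc) (UpInv a A B X W XT e m σ (k + 1)) := by
  obtain ⟨n, rfl⟩ : ∃ n, m = k + 1 + n := ⟨m - (k + 1), by omega⟩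
  have hdiv : 2 ^ (k + 1 + n) / 2 ^ (k + 1) = 2 ^ n := by
    rw [pow_add]; exact Nat.mul_div_cancel_left _ (by positivity)
  have r32 := hi.r32
  rw [hdiv] at r32
  have hs1 : 1 ≤ 2 ^ k := Nat.one_le_two_pow
  have hn1 : 1 ≤ 2 ^ n := Nat.one_le_two_pow
  set s := 2 ^ k with hs
  set h := 2 ^ n with hh
  have hPw : 2 ^ (k + 1 + n) = 2 * s * h := by rw [hs, hh]; ring
  have hPwz : (2 : ℤ) ^ (k + 1 + n) = 2 * s * h := by exact_mod_cast hPw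
  have hlX : 3 ≤ len X := by
    have := len_mono' (x := 2) (y := X) (by norm_num) (by omega); simpa using this
  have hsX : 3 ≤ s * len X := le_trans hlX (Nat.le_mul_of_pos_left _ hs1)
  set w := 4 * s * len X with hw
  have hwX : 3 * (s * len X) + 2 ≤ w := by rw [hw, mul_assoc]; omega
  have hXw : len X ≤ w := by
    have := Nat.le_mul_of_pos_left (len X) hs1; omega
  have lenA : ∀ {A : ℤ} {i : ℕ}, |A| ≤ X ^ 2 → i ≤ s → len (A ^ i) ≤ w := by
    intro A i hA hi
    have := len_le_of_abs_le_pow (abs_pow_le_pow (by omega) hA hi)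
    rw [mul_assoc] at this; omega
  have lensm : ∀ z : ℤ, 0 ≤ z → z ≤ X → len z ≤ w := fun z h0 h1 => (len_mono' h0 h1).trans hXw
  have hh1 : (h : ℤ) ≤ 2 ^ (k + 1 + n) := by
    have : h ≤ 2 * s * h := Nat.le_mul_of_pos_left _ (by omega)
    rw [hPwz]; exact_mod_cast this
  have hkm : ((k + 1 + n : ℕ) : ℤ) ≤ 2 ^ (k + 1 + n) := by
    exact_mod_cast Nat.lt_two_pow_self.le
  have hopc : (h + 1) * opc w ≤ Bc := by
    refine le_trans (Nat.mul_le_mul_right _ (show h + 1 ≤ 2 * h by omega)) ?_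
    refine (mul_opc_le (by omega)).trans (le_trans (opc_mono ?_) hBc)
    rw [hw, hPw]; exact le_of_eq (by ring)
  have hX2 : |X| ≤ X ^ 2 := by
    rw [abs_of_nonneg (by omega)]; nlinarith
  refine Tr.comp ((combine_tr (w := w) h9 r32 (by omega) (lensm W hW (by omega))
    (lensm h (by omega) (by omega)) ?_ ?_ ?_).mono (Nat.mul_le_mul_left _ hopc) fun _ _ h => h) ?_
  · rw [hi.r25]; exact lenA hA le_rfl
  · rw [hi.r26]; exact lenA hB le_rfl
  · intro i hi'
    rw [hi.blks i (by rw [show k + 1 + n - k = n + 1 by omega, pow_succ]; omega), ← hs]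
    have := len_le_of_abs_le_pow (abs_blk_le (by omega) ha hA hB s i)
    rw [mul_assoc] at this; omega
  rintro τ₁ a₁ ⟨g1, g2⟩
  have f9 : τ₁.reg 9 = W := (a₁ 9 (by decide)).trans h9
  have f10 : τ₁.reg 10 = XT := (a₁ 10 (by decide)).trans h10
  have f25 : τ₁.reg 25 = A ^ s := (a₁ 25 (by decide)).trans hi.r25
  have f26 : τ₁.reg 26 = B ^ s := (a₁ 26 (by decide)).trans hi.r26
  have f27 : τ₁.reg 27 = X ^ s := (a₁ 27 (by decide)).trans hi.r27
  have f28 : τ₁.reg 28 = ∑ i ∈ Finset.range s, X ^ i := (a₁ 28 (by decide)).trans hi.r28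
  have f29 : τ₁.reg 29 = B ^ (e % s) := (a₁ 29 (by decide)).trans hi.r29
  have f30 : τ₁.reg 30 = (e / s : ℕ) := (a₁ 30 (by decide)).trans hi.r30
  have f31 : τ₁.reg 31 = k := (a₁ 31 (by decide)).trans hi.r31
  have f32 := (a₁ 32 (by decide)).trans r32
  have hes : e / s ≤ 2 ^ (k + 1 + n) := (Nat.div_le_self _ _).trans he.le
  have hes' : ((e / s : ℕ) : ℤ) ≤ 2 ^ (k + 1 + n) := by exact_mod_cast hes
  have hem : e % s ≤ s := (Nat.mod_lt _ (by omega)).le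
  have l25 := lenA hA le_rfl
  have l26 := lenA hB le_rfl
  have l27 : len (X ^ s) ≤ w := lenA hX2 le_rfl
  have l28 : len (∑ i ∈ Finset.range s, X ^ i) ≤ w := by
    have h1 := sum_geom_le (show 2 ≤ X by omega) s
    have := len_le_of_abs_le_pow (z := ∑ i ∈ Finset.range s, X ^ i) (X := X) (k := 2 * s)
      (by rw [abs_of_nonneg h1.1]; exact h1.2)
    rw [mul_assoc] at this; omega
  have l29 := lenA hB hem
  have l30 : len ((e / s : ℕ) : ℤ) ≤ w := lensm _ (Int.natCast_nonneg _) (by omega)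
  have l31 : len (k : ℤ) ≤ w := lensm _ (by omega) (by push_cast at hkm; omega)
  have l32 : len (h : ℤ) ≤ w := lensm _ (by omega) (by omega)
  have l10 : len XT ≤ w := lensm _ (by omega) (by omega)
  have hopc' : opc w ≤ Bc := le_trans (Nat.le_mul_of_pos_left _ (by omega)) hopc
  have hmod : e % 2 ^ (k + 1) = e % s + s * (e / s % 2) := by
    rw [pow_succ, Nat.mod_mul]
  have hdd : e / 2 ^ (k + 1) = e / s / 2 := by
    rw [pow_succ, Nat.div_div_eq_div_mul]
  have hdd2 : 2 ^ (k + 1 + n) / 2 ^ (k + 1 + 1) = h / 2 := by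
    rw [pow_succ 2 (k + 1), ← Nat.div_div_eq_div_mul, hdiv]
  have e32 : ((h : ℤ) / 2) = ((h / 2 : ℕ) : ℤ) := by push_cast; rfl
  have e30 : (((e / s : ℕ) : ℤ) / 2) = ((e / s / 2 : ℕ) : ℤ) := by push_cast; rfl
  have e30' : (((e / s : ℕ) : ℤ) % 2) = ((e / s % 2 : ℕ) : ℤ) := by push_cast; rfl
  have hblk : ∀ (y : ℤ) (j : ℕ), j < 2 ^ (k + 1 + n - (k + 1)) →
      (if W + (j : ℤ) = XT + k then y else τ₁.mem (W + j)) = blk a A B (2 ^ (k + 1)) j := by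
    intro y j hj
    rw [show k + 1 + n - (k + 1) = n by omega, ← hh] at hj
    rw [if_neg (by omega), g1 j hj, hi.r25, hi.r26]
    have h1 := hi.blks (2 * j) (by rw [show k + 1 + n - k = n + 1 by omega, pow_succ]; omega)
    have h2 := hi.blks (2 * j + 1) (by rw [show k + 1 + n - k = n + 1 by omega, pow_succ]; omega)
    push_cast at h1 h2
    rw [add_assoc, h1, h2, pow_succ, mul_comm (2 ^ k) 2, blk_two_mul]
  have hxt : ∀ i : ℕ, i < k + 1 →
      (if XT + (i : ℤ) = XT + k then X ^ s else τ₁.mem (XT + i)) = X ^ 2 ^ i := by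
    intro i hik
    by_cases h1 : i = k
    · subst h1; simp [hs]
    · rw [if_neg (by omega), g2 _ (by right; omega)]
      exact hi.xt i (by omega)
  have hfr : ∀ x, x < W ∨ XT + (k + 1 + n : ℕ) ≤ x →
      (if x = XT + (k : ℤ) then X ^ s else τ₁.mem x) = σ.mem x := by
    intro x hx
    rw [if_neg (by push_cast at hx; omega), g2 x (by push_cast at hx; omega)]
    exact hi.frame x hx
  have hq : e / s % 2 = 0 ∨ e / s % 2 = 1 := Nat.mod_two_eq_zero_or_one _
  refine Tr.basic' rfl (w := w) (by omega) hopc' ?_ ?_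
  · rcases hq with hq | hq <;>
    simp [-Nat.cast_pow, -Int.natCast_ediv, upTail, Stm.Fits, Stm.run, f10, f25, f26, f27, f28, f29, f30, f31,
      f32, l25, l26, l27, l28, l29, l30, l31, l32, l10, e30', hq] <;> omega
  · rcases hq with hq | hq <;> constructor <;>
    simp [-Nat.cast_pow, -Int.natCast_ediv, upTail, Stm.run, f10, f25, f26, f27, f28, f29, f30, f31,
      f32, e30', hq, hmod, hdd, hdd2]
    all_goals first
      | exact e32
      | exact e30
      | exact fun j hj => hblk _ j (by simpa using hj)
      | exact fun j hj => by simpa using hxt j (by omega)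
      | exact fun x hx => hfr x (by push_cast; exact hx)
      | rw [← pow_add, ← two_mul, pow_succ, mul_comm]
      | rw [sum_geom_pow_succ, pow_succ, mul_comm]
      | rw [← pow_add]

/-- One level of the splitting tree. -/
def downBody : Stm :=
  (31 <~ R 31 - 1 ;; 27 <~ Mem (R 10 + R 31)) ;; split ;; 32 <~ 2 * R 32

/-- The state after `k` levels of the splitting tree. -/
structure DownInv (V X W XT : ℤ) (m : ℕ) (σ : State) (k : ℕ) (τ : State) : Prop where
  le : k ≤ m
  r31 : τ.reg 31 = m - k
  r32 : τ.reg 32 = (2 ^ k : ℕ)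
  vals : ∀ j : ℕ, j < 2 ^ k → τ.mem (W + j) = V / X ^ (j * 2 ^ (m - k)) % X ^ 2 ^ (m - k)
  xt : ∀ i : ℕ, i < m → τ.mem (XT + i) = X ^ 2 ^ i
  frame : ∀ x, x < W ∨ XT + m ≤ x → τ.mem x = σ.mem x

/-- Writing `U % (Y * Y)` as `U - Y * Y * q`, division by `Y` gives `U / Y - Y * q`, where `q` is
also the quotient of `U / Y` by `Y`. -/
lemma emod_mul_ediv {U Y : ℤ} (hY : 0 < Y) : U % (Y * Y) / Y = U / Y % Y := by
  rw [Int.emod_def U, Int.emod_def (U / Y), sub_eq_add_neg,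
    show -(Y * Y * (U / (Y * Y))) = -(Y * (U / (Y * Y))) * Y by ring,
    Int.add_mul_ediv_right _ _ hY.ne', Int.ediv_ediv_of_nonneg hY.le]
  ring

/-- A block with `2s` digits is divided by `X ^ s`; the remainder holds its lower digits and the
quotient the upper ones. The divisor comes from the table filled during merging, so no power is
recomputed, and the bit count per level is as on the way up. -/
lemma down_step {V X W XT : ℤ} {m : ℕ} {σ τ : State} {k : ℕ} {Bc : ℕ}
    (hX : 4 ≤ X) (hW : 0 ≤ W) (hXT : XT = W + 2 ^ m) (hXX : XT + 2 ^ m ≤ X)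
    (hBc : opc (4 * 2 ^ m * len X) ≤ Bc)
    (h9 : τ.reg 9 = W) (h10 : τ.reg 10 = XT) (hi : DownInv V X W XT m σ k τ) (hk : k < m) :
    Tr downBody τ [] (downBody.κ * Bc) (DownInv V X W XT m σ (k + 1)) := by
  obtain ⟨n, rfl⟩ : ∃ n, m = k + 1 + n := ⟨m - (k + 1), by omega⟩
  obtain ⟨s, hs⟩ : ∃ s, s = 2 ^ n := ⟨_, rfl⟩
  obtain ⟨h, hh⟩ : ∃ h, h = 2 ^ k := ⟨_, rfl⟩
  have hs1 : 1 ≤ s := hs ▸ Nat.one_le_two_pow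
  have hn1 : 1 ≤ h := hh ▸ Nat.one_le_two_pow
  have hPw : 2 ^ (k + 1 + n) = 2 * s * h := by rw [hs, hh]; ring
  have hPwz : (2 : ℤ) ^ (k + 1 + n) = 2 * s * h := by exact_mod_cast hPw
  have hlX : 3 ≤ len X := by
    have := len_mono' (x := 2) (y := X) (by norm_num) (by omega); simpa using this
  have hsX : 3 ≤ s * len X := le_trans hlX (Nat.le_mul_of_pos_left _ hs1)
  obtain ⟨w, hw⟩ : ∃ w, w = 4 * s * len X := ⟨_, rfl⟩
  have hwX : 3 * (s * len X) + 2 ≤ w := by rw [hw, mul_assoc]; omega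
  have hXw : len X ≤ w := by
    have := Nat.le_mul_of_pos_left (len X) hs1; omega
  have lensm : ∀ z : ℤ, 0 ≤ z → z ≤ X → len z ≤ w := fun z h0 h1 => (len_mono' h0 h1).trans hXw
  have hh1 : (h : ℤ) ≤ 2 ^ (k + 1 + n) := by
    have : h ≤ 2 * s * h := Nat.le_mul_of_pos_left _ (by omega)
    rw [hPwz]; exact_mod_cast this
  have hkm : ((k + 1 + n : ℕ) : ℤ) < 2 ^ (k + 1 + n) := by
    exact_mod_cast Nat.lt_two_pow_self
  push_cast at hkm
  have hopc : (h + 1) * opc w ≤ Bc := by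
    refine le_trans (Nat.mul_le_mul_right _ (show h + 1 ≤ 2 * h by omega)) ?_
    refine (mul_opc_le (by omega)).trans (le_trans (opc_mono ?_) hBc)
    rw [hw, hPw]; exact le_of_eq (by ring)
  have hopc' : opc w ≤ Bc := le_trans (Nat.le_mul_of_pos_left _ (by omega)) hopc
  have r31 : τ.reg 31 = n + 1 := by rw [hi.r31]; push_cast; ring
  have r32 : τ.reg 32 = h := by rw [hi.r32, hh]
  have hmn : k + 1 + n - k = n + 1 := by omega
  have hmn' : k + 1 + n - (k + 1) = n := by omega
  have hxn := hi.xt n (by omega)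
  rw [← hs] at hxn
  have hX0 : (0 : ℤ) < X ^ s := by positivity
  have lenX : ∀ z : ℤ, 0 ≤ z → z ≤ X ^ (2 * s) → len z ≤ w := by
    intro z h0 h1
    have := len_le_of_abs_le_pow (z := z) (X := X) (k := 2 * s) (by rwa [abs_of_nonneg h0])
    rw [mul_assoc] at this; omega
  have lXs : len (X ^ s) ≤ w := lenX _ hX0.le (pow_le_pow_right₀ (by omega) (by omega))
  refine Tr.comp (Q₁ := fun τ' => τ'.reg 31 = n ∧ τ'.reg 27 = X ^ s ∧ τ'.mem = τ.mem)
    (Tr.basic' rfl (w := w) (by omega) hopc' ?_ ?_) ?_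
  · have l1 := lensm (n + 1) (by omega) (by omega)
    have l2 := lensm n (by omega) (by omega)
    have l3 := lensm XT (by omega) (by omega)
    simp [Stm.Fits, Stm.run, r31, h10, hxn, l1, l2, l3, lXs]; omega
  · simp [Stm.run, r31, h10, hxn]
  rintro τ₁ a₁ ⟨g31, g27, gm⟩
  have f9 : τ₁.reg 9 = W := (a₁ 9 (by decide)).trans h9
  have f32 : τ₁.reg 32 = h := (a₁ 32 (by decide)).trans r32
  have hv : ∀ i : ℕ, i < h → τ₁.mem (W + i) = V / X ^ (i * (2 * s)) % X ^ (2 * s) := by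
    intro i hih
    rw [gm, hi.vals i (by omega), hmn, pow_succ, hs, mul_comm (2 ^ n) 2]
  refine Tr.comp ((split_tr (w := w) f9 f32 (by omega) (lensm W hW (by omega))
    (lensm h (by omega) (by omega)) (by rw [g27]; exact lXs) ?_).mono (Nat.mul_le_mul_left _ hopc)
    fun _ _ h => h) ?_
  · intro i hih
    rw [hv i hih]
    exact lenX _ (Int.emod_nonneg _ (by positivity)) (Int.emod_lt_of_pos _ (by positivity)).le
  rintro τ₂ a₂ ⟨q1, q2⟩
  have e31 : τ₂.reg 31 = n := (a₂ 31 (by decide)).trans g31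
  have e32 : τ₂.reg 32 = h := (a₂ 32 (by decide)).trans f32
  refine Tr.basic' rfl (w := w) (by omega) hopc' ?_ ?_
  · have := lensm h (by omega) (by omega)
    simp [Stm.Fits, e32, this]; omega
  have hhs : (2 : ℤ) * h ≤ 2 ^ (k + 1 + n) := by
    have : 2 * h ≤ 2 * s * h := Nat.mul_le_mul_right _ (by omega)
    rw [hPwz]; exact_mod_cast this
  have hXs2 : X ^ (2 * s) = X ^ s * X ^ s := by rw [two_mul, pow_add]
  refine ⟨by omega, ?_, ?_, ?_, ?_, ?_⟩
  · simp [Stm.run, e31]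
  · simp [Stm.run, e32, hh, pow_succ, mul_comm]
  · intro j hj
    simp only [Stm.run, State.mem_setReg]
    rw [hmn', ← hs]
    rw [pow_succ, ← hh] at hj
    rcases Nat.even_or_odd' j with ⟨i, rfl | rfl⟩
    · have := (q1 i (by omega)).1
      rw [g27, hv i (by omega), hXs2, Int.emod_emod_of_dvd _ (dvd_mul_right _ _)] at this
      rw [show 2 * i * s = i * (2 * s) by ring]
      rw [← this]; push_cast; rfl
    · have := (q1 i (by omega)).2
      rw [g27, hv i (by omega), hXs2, emod_mul_ediv hX0,
        Int.ediv_ediv_of_nonneg (by positivity), ← pow_add] at this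
      rw [show (2 * i + 1) * s = i * (2 * s) + s by ring]
      rw [← this]; push_cast; rw [add_assoc]
  · intro i hi'
    simp only [Stm.run, State.mem_setReg]
    rw [q2 _ (by right; omega), gm, hi.xt i hi']
  · intro x hx
    simp only [Stm.run, State.mem_setReg]
    rw [q2 _ (by push_cast at hx; omega), gm, hi.frame x hx]

lemma up_loop {a : ℕ → ℤ} {A B X W XT : ℤ} {e m : ℕ} {σ σ₁ : State} {Bc : ℕ}
    (hX4 : 4 ≤ X) (haX : ∀ i, |a i| ≤ X) (hAX : |A| ≤ X ^ 2) (hBX : |B| ≤ X ^ 2)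
    (he : e < 2 ^ m) (hW : 0 ≤ W) (hXT : XT = W + 2 ^ m) (hXX : XT + 2 ^ m ≤ X)
    (hBc : opc (4 * 2 ^ m * len X) ≤ Bc)
    (c9 : σ₁.reg 9 = W) (c10 : σ₁.reg 10 = XT) (hup : UpInv a A B X W XT e m σ 0 σ₁) :
    Tr (.iter (R 32) upBody) σ₁ [] ((Stm.iter (R 32) upBody).κ * ((m + 1) * Bc))
      (UpInv a A B X W XT e m σ m) := by
  have hlX : 3 ≤ len X := by
    have := len_mono' (x := 2) (y := X) (by norm_num) (by omega); simpa using this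
  have lensm : ∀ z : ℤ, 0 ≤ z → z ≤ X → len z ≤ len X := fun z h0 h1 => len_mono' h0 h1
  have hP1 : 1 ≤ 2 ^ m := Nat.one_le_two_pow
  have hpc : ((2 ^ m : ℕ) : ℤ) = 2 ^ m := by push_cast; rfl
  have hB1 : opc (len X) ≤ Bc := le_trans (opc_mono (by
    rw [mul_comm]; exact Nat.le_mul_of_pos_right _ (by omega))) hBc
  refine (Tr.loop (w := len X) (B := Bc) (N := m + 1)
    (fun τ => ∃ k, UpInv a A B X W XT e m σ k τ) (fun τ => (m - τ.reg 31).toNat) hB1 ?_ ⟨0, hup⟩ ?_ ?_).mono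
    le_rfl ?_
  · rw [hup.r31]; simp
  · rintro τ aτ ⟨k, hk⟩
    simp only [AExp.fits_reg, hk.r32]
    refine lensm _ (Int.natCast_nonneg _) (le_trans ?_ (show ((2 ^ m : ℕ) : ℤ) ≤ X by omega))
    exact_mod_cast Nat.div_le_self _ _
  · rintro τ aτ ⟨k, hk⟩ hpos
    -- Register `32` holds `2 ^ m / 2 ^ (k + 1)`, which is positive exactly for `k < m`, so the
    -- guard needs no level counter.
    have hkm : k < m := by
      by_contra hcon
      obtain rfl : k = m := le_antisymm hk.le (not_lt.mp hcon)
      simp only [AExp.eval_reg, hk.r32] at hpos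
      rw [Nat.div_eq_of_lt (Nat.pow_lt_pow_right (by norm_num) (by omega))] at hpos
      simp at hpos
    refine (up_step hX4 haX hAX hBX he hW hXT hXX hBc ((aτ 9 (by decide)).trans c9)
      ((aτ 10 (by decide)).trans c10) hk hkm).mono le_rfl ?_
    rintro τ' - h
    refine ⟨⟨_, h⟩, ?_⟩
    rw [h.r31, hk.r31]; push_cast; omega
  · rintro τ - ⟨⟨k, hk⟩, hle⟩
    have hkm : ¬ k < m := by
      intro hcon
      simp only [AExp.eval_reg, hk.r32] at hle
      have : 0 < 2 ^ m / 2 ^ (k + 1) :=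
        Nat.div_pos (Nat.pow_le_pow_right (by norm_num) (by omega)) (by positivity)
      omega
    obtain rfl : k = m := le_antisymm hk.le (not_lt.mp hkm)
    exact hk

lemma down_loop {V X W XT : ℤ} {m : ℕ} {σ σ₁ : State} {Bc : ℕ}
    (hX4 : 4 ≤ X) (hW : 0 ≤ W) (hXT : XT = W + 2 ^ m) (hXX : XT + 2 ^ m ≤ X)
    (hBc : opc (4 * 2 ^ m * len X) ≤ Bc)
    (d9' : σ₁.reg 9 = W) (d10' : σ₁.reg 10 = XT) (d8' : σ₁.reg 8 = (2 ^ m : ℕ))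
    (hdn : DownInv V X W XT m σ 0 σ₁) :
    Tr (.iter (R 8 - R 32) downBody) σ₁ [] ((Stm.iter (R 8 - R 32) downBody).κ * ((m + 1) * Bc))
      (DownInv V X W XT m σ m) := by
  have hlX : 3 ≤ len X := by
    have := len_mono' (x := 2) (y := X) (by norm_num) (by omega); simpa using this
  have lensm : ∀ z : ℤ, 0 ≤ z → z ≤ X → len z ≤ len X := fun z h0 h1 => len_mono' h0 h1
  have hP1 : 1 ≤ 2 ^ m := Nat.one_le_two_pow
  have hpc : ((2 ^ m : ℕ) : ℤ) = 2 ^ m := by push_cast; rfl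
  have hB1 : opc (len X) ≤ Bc := le_trans (opc_mono (by
    rw [mul_comm]; exact Nat.le_mul_of_pos_right _ (by omega))) hBc
  refine (Tr.loop (w := len X) (B := Bc) (N := m + 1)
    (fun τ => ∃ k, DownInv V X W XT m σ k τ) (fun τ => (τ.reg 31).toNat) hB1 ?_ ⟨0, hdn⟩ ?_ ?_).mono
    le_rfl ?_
  · rw [hdn.r31]; simp
  · rintro τ aτ ⟨k, hk⟩
    have : 2 ^ k ≤ 2 ^ m := Nat.pow_le_pow_right (by norm_num) hk.le
    simp only [AExp.fits_sub, AExp.fits_reg, hk.r32, (aτ 8 (by decide)).trans d8']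
    exact ⟨lensm _ (Int.natCast_nonneg _) (by omega), lensm _ (Int.natCast_nonneg _) (by omega)⟩
  · rintro τ aτ ⟨k, hk⟩ hpos
    have hkm : k < m := by
      by_contra hcon
      obtain rfl : k = m := le_antisymm hk.le (not_lt.mp hcon)
      simp [hk.r32, (aτ 8 (by decide)).trans d8'] at hpos
    refine (down_step hX4 hW hXT hXX hBc ((aτ 9 (by decide)).trans d9')
      ((aτ 10 (by decide)).trans d10') hk hkm).mono le_rfl ?_
    rintro τ' - h
    refine ⟨⟨_, h⟩, ?_⟩
    rw [h.r31, hk.r31]; push_cast; omega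
  · rintro τ aτ ⟨⟨k, hk⟩, hle⟩
    have hkm : ¬ k < m := by
      intro hcon
      simp only [AExp.eval_sub, AExp.eval_reg, hk.r32, (aτ 8 (by decide)).trans d8'] at hle
      have : 2 ^ k < 2 ^ m := Nat.pow_lt_pow_right (by norm_num) hcon
      omega
    obtain rfl : k = m := le_antisymm hk.le (not_lt.mp hkm)
    exact hk

/-- Initialization of the merging tree. -/
def upInit : Stm :=
  25 <~ R 0 * R 7 + 1 ;; 26 <~ R 7 - R 0 ;; 27 <~ R 7 ;; 28 <~ 1 ;; 29 <~ 1 ;;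
  30 <~ R 8 - 1 - R 20 ;; 31 <~ 0 ;; 32 <~ R 8 / 2

/-- Remove the padding and make all digits nonnegative. -/
def turn : Stm := .st (R 9) (Mem (R 9) / R 29 + R 6 * R 28) ;; 32 <~ 1

/-- The change of parameter for one polynomial: the coefficients are read at the address in register
`21`, and the result is written at the address in register `22`. -/
def transform : Stm :=
  fill ;; upInit ;; .iter (R 32) upBody ;; turn ;; .iter (R 8 - R 32) downBody ;; emit

-- The hypothesis `hc` says that the form with coefficients `a`, evaluated at `A = t₀ X + 1` and `B
-- = X - t₀`, is the value at `X` of the polynomial with coefficients `c`. Because `|c j| < H` and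
-- `X = 2 H`, adding `H` to every coefficient gives numbers in `[0, X)`, which are therefore base
-- `X` digits and can be read off; `emit` subtracts `H` again. Padding the coefficients with zeros
-- to length `2 ^ m` multiplies the form by `B ^ e` with `e = 2 ^ m - (D + 1)`, and an exact
-- division removes this factor.
set_option maxHeartbeats 1000000 in
theorem transform_tr {σ : State} {m d D : ℕ} {t₀ H X W XT src dst : ℤ} {a c : ℕ → ℤ} {Bc : ℕ}
    (r0 : σ.reg 0 = t₀) (r1 : σ.reg 1 = d) (r6 : σ.reg 6 = H) (r7 : σ.reg 7 = X)
    (r8 : σ.reg 8 = (2 ^ m : ℕ)) (r9 : σ.reg 9 = W) (r10 : σ.reg 10 = XT) (r20 : σ.reg 20 = D)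
    (r21 : σ.reg 21 = src) (r22 : σ.reg 22 = dst)
    (hX : X = 2 * H) (hX4 : 4 ≤ X) (hd : d < 2 ^ m) (hD : D ≤ d)
    (ht0 : 0 ≤ t₀) (htX : t₀ + 1 < X)
    (hW : 0 ≤ W) (hXT : XT = W + 2 ^ m) (hXX : XT + 2 ^ m ≤ X)
    (hsrc0 : 0 ≤ src) (hsrc : src + d < W) (hdst0 : 0 ≤ dst) (hdst : dst + d < W)
    (hBc : opc (4 * 2 ^ m * len X) ≤ Bc)
    (ha : ∀ i : ℕ, i ≤ d → σ.mem (src + i) = a i) (ha0 : ∀ i, D < i → a i = 0)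
    (haX : ∀ i, |a i| ≤ X)
    (hc : ∑ i ∈ Finset.range (D + 1), a i * (t₀ * X + 1) ^ i * (X - t₀) ^ (D - i) =
      ∑ j ∈ Finset.range (2 ^ m), c j * X ^ j) (hcH : ∀ j, |c j| < H) :
    Tr transform σ [] (transform.κ * ((m + 1) * Bc)) (fun σ' =>
      (∀ i : ℕ, i ≤ d → σ'.mem (dst + i) = c i) ∧
      ∀ x, (x < W ∨ XT + 2 ^ m ≤ x) → (x < dst ∨ dst + d < x) → σ'.mem x = σ.mem x) := by
  have hm0 : (m : ℤ) < 2 ^ m := by exact_mod_cast Nat.lt_two_pow_self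
  have hdz : (d : ℤ) < 2 ^ m := by exact_mod_cast hd
  have hpc : ((2 ^ m : ℕ) : ℤ) = 2 ^ m := by push_cast; rfl
  have hP1 : 1 ≤ 2 ^ m := Nat.one_le_two_pow
  have hlX : 3 ≤ len X := by
    have := len_mono' (x := 2) (y := X) (by norm_num) (by omega); simpa using this
  have lensm : ∀ z : ℤ, 0 ≤ z → z ≤ X → len z ≤ len X := fun z h0 h1 => len_mono' h0 h1
  obtain ⟨A, hA⟩ : ∃ A, A = t₀ * X + 1 := ⟨_, rfl⟩
  obtain ⟨B, hB⟩ : ∃ B, B = X - t₀ := ⟨_, rfl⟩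
  have hB0 : 0 < B := by omega
  have hAX : |A| ≤ X ^ 2 := by
    rw [hA, abs_of_nonneg (by nlinarith)]; nlinarith
  have hBX : |B| ≤ X ^ 2 := by
    rw [abs_of_nonneg hB0.le]; nlinarith
  have hB1 : opc (len X) ≤ Bc := le_trans (opc_mono (by
    rw [mul_comm]; exact Nat.le_mul_of_pos_right _ (by omega))) hBc
  have hBm : Bc ≤ (m + 1) * Bc := Nat.le_mul_of_pos_left _ (by omega)
  have hBf : ∀ n, n ≤ 2 ^ m + 1 → n * opc (len X) ≤ Bc := by
    intro n hn
    refine le_trans (Nat.mul_le_mul_right _ (show n ≤ 4 * 2 ^ m by omega)) ?_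
    exact (mul_opc_le (by omega)).trans hBc
  have laX : ∀ i, len (a i) ≤ len X := fun i => len_mono (by
    rw [abs_of_nonneg (show 0 ≤ X by omega)]; exact haX i)
  refine Tr.comp ((fill_tr r1 r8 r9 r21 hsrc hlX (lensm _ hW (by omega)) (lensm _ hsrc0 (by omega))
    (lensm _ (by omega) (by omega)) (lensm _ (by omega) (by omega))
    (fun i hi => by rw [ha i hi]; exact laX i)).mono
    (Nat.mul_le_mul_left _ ((hBf _ le_rfl).trans hBm)) fun _ _ h => h) ?_
  rintro σ₁ a₁ ⟨g1, g2⟩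
  have hfill : ∀ j : ℕ, j < 2 ^ m → σ₁.mem (W + j) = a j := by
    intro j hj
    rw [g1 j hj]
    split_ifs with h
    · exact ha j h
    · rw [ha0 j (by omega)]
  have e9 : σ₁.reg 9 = W := (a₁ 9 (by decide)).trans r9
  have e10 : σ₁.reg 10 = XT := (a₁ 10 (by decide)).trans r10
  have e0 : σ₁.reg 0 = t₀ := (a₁ 0 (by decide)).trans r0
  have e1 : σ₁.reg 1 = d := (a₁ 1 (by decide)).trans r1
  have e6 : σ₁.reg 6 = H := (a₁ 6 (by decide)).trans r6
  have e7 : σ₁.reg 7 = X := (a₁ 7 (by decide)).trans r7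
  have e8 : σ₁.reg 8 = (2 ^ m : ℕ) := (a₁ 8 (by decide)).trans r8
  have e20 : σ₁.reg 20 = D := (a₁ 20 (by decide)).trans r20
  have e22 : σ₁.reg 22 = dst := (a₁ 22 (by decide)).trans r22
  obtain ⟨e, he⟩ : ∃ e, 2 ^ m = D + 1 + e := ⟨2 ^ m - (D + 1), by omega⟩
  have he' : ((2 ^ m : ℕ) : ℤ) - 1 - D = e := by rw [he]; push_cast; ring
  refine Tr.comp (Q₁ := UpInv a A B X W XT e m σ₁ 0)
    (Tr.basic' rfl (w := len X) (by omega) (hB1.trans hBm) ?_ ?_) ?_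
  · have l0 := lensm t₀ ht0 (by omega)
    have l8 := lensm (2 ^ m : ℕ) (by omega) (by omega)
    have l20 := lensm D (by omega) (by omega)
    simp [-Nat.cast_pow, upInit, Stm.Fits, Stm.run, e0, e7, e8, e20, l0, l20]
    rw [hpc] at l8
    omega
  · constructor <;> simp [-Nat.cast_pow, upInit, Stm.run, e0, e7, e8, e20, hA, hB, Nat.mod_one]
    · push_cast at he'; exact he'
    · intro j hj
      rw [hfill j hj, blk]; simp
  rintro σ₂ a₂ hup
  have c9 : σ₂.reg 9 = W := (a₂ 9 (by decide)).trans e9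
  have c10 : σ₂.reg 10 = XT := (a₂ 10 (by decide)).trans e10
  refine Tr.comp (up_loop hX4 haX hAX hBX (by omega) hW hXT hXX hBc c9 c10 hup) ?_
  rintro σ₃ a₃ hup
  have d9 : σ₃.reg 9 = W := (a₃ 9 (by decide)).trans c9
  have d10 : σ₃.reg 10 = XT := (a₃ 10 (by decide)).trans c10
  have d6 : σ₃.reg 6 = H := (a₃ 6 (by decide)).trans ((a₂ 6 (by decide)).trans e6)
  have d1 : σ₃.reg 1 = d := (a₃ 1 (by decide)).trans ((a₂ 1 (by decide)).trans e1)
  have d8 : σ₃.reg 8 = (2 ^ m : ℕ) := (a₃ 8 (by decide)).trans ((a₂ 8 (by decide)).trans e8)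
  have d22 : σ₃.reg 22 = dst := (a₃ 22 (by decide)).trans ((a₂ 22 (by decide)).trans e22)
  have hroot := hup.blks 0 (by positivity)
  have d29 := hup.r29
  rw [Nat.mod_eq_of_lt (show e < 2 ^ m by omega)] at d29
  have d28 := hup.r28
  have hlB : 3 * (2 ^ m * len X) + 2 ≤ 4 * 2 ^ m * len X := by
    have : 1 * len X ≤ 2 ^ m * len X := Nat.mul_le_mul_right _ hP1
    rw [mul_assoc]; omega
  have hXle : len X ≤ 4 * 2 ^ m * len X := by
    have : 1 * len X ≤ 2 ^ m * len X := Nat.mul_le_mul_right _ hP1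
    rw [mul_assoc]; omega
  obtain ⟨V, hV⟩ : ∃ V, V = ∑ j ∈ Finset.range (2 ^ m), (c j + H) * X ^ j := ⟨_, rfl⟩
  have hdig : ∀ j, 0 ≤ c j + H ∧ c j + H < X := by
    intro j; have := abs_lt.mp (hcH j); omega
  have hval : blk a A B (2 ^ m) 0 / B ^ e + H * ∑ i ∈ Finset.range (2 ^ m), X ^ i = V := by
    have h1 : blk a A B (2 ^ m) 0 = (∑ j ∈ Finset.range (2 ^ m), c j * X ^ j) * B ^ e := by
      rw [← hc, blk, he, Finset.sum_range_add, Finset.sum_mul, ← hA, ← hB]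
      rw [Finset.sum_eq_zero (s := Finset.range e), add_zero]
      · refine Finset.sum_congr rfl fun i hi => ?_
        rw [Finset.mem_range] at hi
        rw [show D + 1 + e - 1 - i = D - i + e by omega]
        simp; ring
      · intro i hi
        rw [ha0 _ (by omega)]; simp
    rw [h1, Int.mul_ediv_cancel _ (by positivity), hV, Finset.mul_sum, ← Finset.sum_add_distrib]
    exact Finset.sum_congr rfl fun i _ => by ring
  have hV0 : 0 ≤ V := by
    rw [hV]; exact Finset.sum_nonneg fun j _ => mul_nonneg (hdig j).1 (by positivity)
  have hVX : V < X ^ 2 ^ m := by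
    have h1 : ∀ N : ℕ, ∑ j ∈ Finset.range N, (c j + H) * X ^ j < X ^ N := by
      intro N
      induction N with
      | zero => simp
      | succ N ih =>
        rw [Finset.sum_range_succ, pow_succ]
        have h2 := (hdig N).2
        have h3 : 0 < X ^ N := by positivity
        have : (c N + H) * X ^ N ≤ (X - 1) * X ^ N := mul_le_mul_of_nonneg_right (by omega) h3.le
        linarith
    rw [hV]; exact h1 _
  refine Tr.comp (Q₁ := DownInv V X W XT m σ₁ 0)
    (Tr.basic' rfl (w := 4 * 2 ^ m * len X) (by omega) (hBc.trans hBm) ?_ ?_) ?_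
  · have l9 := (lensm W hW (by omega)).trans hXle
    have l6 := (lensm H (by omega) (by omega)).trans hXle
    have l28 : len (∑ i ∈ Finset.range (2 ^ m), X ^ i) ≤ 4 * 2 ^ m * len X := by
      have h1 := sum_geom_le (show 2 ≤ X by omega) (2 ^ m)
      have := len_le_of_abs_le_pow (z := ∑ i ∈ Finset.range (2 ^ m), X ^ i) (X := X) (k := 2 * 2 ^ m)
        (by rw [abs_of_nonneg h1.1]; exact h1.2)
      rw [mul_assoc] at this; omega
    have l29 : len (B ^ e) ≤ 4 * 2 ^ m * len X := by
      have := len_le_of_abs_le_pow (abs_pow_le_pow (show 2 ≤ X by omega) hBX (show e ≤ 2 ^ m by omega))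
      rw [mul_assoc] at this; omega
    have lr : len (blk a A B (2 ^ m) 0) ≤ 4 * 2 ^ m * len X := by
      have := len_le_of_abs_le_pow (abs_blk_le (show 2 ≤ X by omega) haX hAX hBX (2 ^ m) 0)
      rw [mul_assoc] at this; omega
    simp only [Nat.cast_zero, add_zero] at hroot
    simp [turn, Stm.Fits, d9, d6, d28, d29, hroot, l9, l6, l28, l29, lr]
    omega
  · simp only [Nat.cast_zero, add_zero] at hroot
    constructor
    · omega
    · simp [turn, Stm.run, hup.r31]
    · simp [turn, Stm.run]
    · intro j hj
      obtain rfl : j = 0 := by simpa using hj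
      simp [turn, Stm.run, d9, d6, d28, d29, hroot, hval]
      rw [Int.emod_eq_of_lt hV0 hVX]
    · intro i hi
      simp [turn, Stm.run, d9]
      rw [if_neg (by omega)]
      exact hup.xt i hi
    · intro x hx
      simp [turn, Stm.run, d9]
      rw [if_neg (by omega)]
      exact hup.frame x hx
  rintro σ₄ a₄ hdn
  have d9' : σ₄.reg 9 = W := (a₄ 9 (by decide)).trans d9
  have d10' : σ₄.reg 10 = XT := (a₄ 10 (by decide)).trans d10
  have d8' : σ₄.reg 8 = (2 ^ m : ℕ) := (a₄ 8 (by decide)).trans d8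
  refine Tr.comp (down_loop hX4 hW hXT hXX hBc d9' d10' d8' hdn) ?_
  rintro σ₅ a₅ hdn
  have b9 : σ₅.reg 9 = W := (a₅ 9 (by decide)).trans d9'
  have b1 : σ₅.reg 1 = d := (a₅ 1 (by decide)).trans ((a₄ 1 (by decide)).trans d1)
  have b6 : σ₅.reg 6 = H := (a₅ 6 (by decide)).trans ((a₄ 6 (by decide)).trans d6)
  have b22 : σ₅.reg 22 = dst := (a₅ 22 (by decide)).trans ((a₄ 22 (by decide)).trans d22)
  have hout : ∀ j : ℕ, j < 2 ^ m → σ₅.mem (W + j) = c j + H := by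
    intro j hj
    rw [hdn.vals j hj, Nat.sub_self, pow_zero, mul_one, pow_one, hV]
    exact digit_eq (fun j => c j + H) hdig _ j hj
  have l1 : len ((d + 1 : ℕ) : ℤ) ≤ len X := lensm _ (Int.natCast_nonneg _) (by push_cast; omega)
  refine ((emit_tr (w := len X) b1 b9 b22 hdst hlX (lensm _ hW (by omega)) (lensm _ hdst0 (by omega))
    l1 (by rw [b6]; exact lensm _ (by omega) (by omega)) ?_).mono
    (Nat.mul_le_mul_left _ ((hBf (d + 2) (by omega)).trans hBm)) ?_)
  · intro i hi
    rw [hout i (by omega)]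
    exact lensm _ (hdig i).1 (hdig i).2.le
  · rintro σ₆ - ⟨q1, q2⟩
    refine ⟨fun i hi => ?_, fun x hx hx' => ?_⟩
    · rw [q1 i hi, hout i (by omega), b6]; ring
    · rw [q2 x hx', hdn.frame x (by omega), g2 x (by omega)]

end BitRAM

/-! ### Division-free Euclidean algorithm modulo an arbitrary integer -/

namespace BitRAM

local notation "R" => AExp.reg
local notation "Mem" => AExp.load

/-- The polynomial whose `n` coefficients are stored from the address `p` on. -/
noncomputable def pol (K : Type*) [CommRing K] (mem : ℤ → ℤ) (p : ℤ) (n : ℕ) : Polynomial K :=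
  ∑ j ∈ Finset.range n, Polynomial.C ((mem (p + j) : ℤ) : K) * Polynomial.X ^ j

lemma coeff_pol {K : Type*} [CommRing K] (mem : ℤ → ℤ) (p : ℤ) (n j : ℕ) :
    (pol K mem p n).coeff j = if j < n then ((mem (p + j) : ℤ) : K) else 0 := by
  simp [pol, Polynomial.finsetSum_coeff, Polynomial.coeff_X_pow]

lemma pol_congr {K : Type*} [CommRing K] {mem mem' : ℤ → ℤ} {p : ℤ} {n : ℕ}
    (h : ∀ j : ℕ, j < n → mem (p + j) = mem' (p + j)) : pol K mem p n = pol K mem' p n :=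
  Finset.sum_congr rfl fun j hj => by rw [h j (Finset.mem_range.mp hj)]

@[simp] lemma pol_zero {K : Type*} [CommRing K] (mem : ℤ → ℤ) (p : ℤ) : pol K mem p 0 = 0 := rfl

lemma pol_pred {K : Type*} [CommRing K] {mem : ℤ → ℤ} {p : ℤ} {n : ℕ} (hn : 0 < n)
    (h : mem (p + n - 1) = 0) : pol K mem p (n - 1) = pol K mem p n := by
  obtain ⟨k, rfl⟩ : ∃ k, n = k + 1 := ⟨n - 1, by omega⟩
  rw [Nat.add_sub_cancel, pol, pol, Finset.sum_range_succ]
  rw [show p + ((k + 1 : ℕ) : ℤ) - 1 = p + k by push_cast; ring] at h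
  simp [h]

/-- An elimination step never enlarges the ideal, whatever the multiplier `y`, and it preserves the
ideal when `y` is a unit. The first half gives soundness for composite moduli, the second
completeness for prime ones. -/
lemma span_pair_elim {K : Type*} [CommRing K] (u v r : Polynomial K) (y : K) :
    Ideal.span {Polynomial.C y * u - r * v, v} ≤ Ideal.span {u, v} ∧
    (IsUnit y → Ideal.span {u, v} ≤ Ideal.span {Polynomial.C y * u - r * v, v}) := by
  have mem₁ : ∀ {a b : Polynomial K}, a ∈ Ideal.span {a, b} := Ideal.subset_span (by simp)
  have mem₂ : ∀ {a b : Polynomial K}, b ∈ Ideal.span {a, b} := Ideal.subset_span (by simp)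
  constructor
  · rw [Ideal.span_le]
    rintro x (rfl | rfl)
    · exact Ideal.sub_mem _ (Ideal.mul_mem_left _ _ mem₁) (Ideal.mul_mem_left _ _ mem₂)
    · exact mem₂
  · rintro ⟨y', rfl⟩
    rw [Ideal.span_le]
    rintro x (rfl | rfl)
    · set z := Polynomial.C (y' : K) * x - r * v with hz
      have : x = Polynomial.C (↑y'⁻¹ : K) * (z + r * v) := by
        rw [hz, sub_add_cancel, ← mul_assoc, ← Polynomial.C_mul]; simp
      rw [this]
      exact Ideal.mul_mem_left _ _ (Ideal.add_mem _ mem₁ (Ideal.mul_mem_left _ _ mem₂))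
    · exact mem₂

/-- Exchange the two polynomials of Euclid's algorithm. -/
def swap : Stm :=
  24 <~ R 12 ;; 12 <~ R 33 ;; 33 <~ R 24 ;; 24 <~ R 13 ;; 13 <~ R 14 ;; 14 <~ R 24

/-- Multiply the first polynomial by the leading coefficient of the second one. -/
def scaleBody : Stm := .st (R 13 + R 23) (Mem (R 13 + R 23) * R 34 % R 11)

/-- Subtract a multiple of the second polynomial from the first one. -/
def subBody : Stm :=
  .st (R 13 + R 35 + R 23) ((Mem (R 13 + R 35 + R 23) - R 24 * Mem (R 14 + R 23)) % R 11)

/-- Cancel the leading coefficient of the first polynomial. -/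
def elim : Stm :=
  (24 <~ Mem (R 13 + R 12 - 1) ;; 35 <~ R 12 - R 33) ;;
  .for 23 (R 12) scaleBody ;; .for 23 (R 33) subBody ;; 12 <~ R 12 - 1

/-- One step of Euclid's algorithm without divisions. -/
def eucBody : Stm :=
  .ite (R 33 - R 12) swap .skip ;; 34 <~ Mem (R 14 + R 33 - 1) ;; .ite (R 34) elim (33 <~ R 33 - 1)

/-- Euclid's algorithm without divisions. -/
def euclid : Stm := .iter (R 12 * R 33) eucBody ;; .ite (R 12) .skip swap

/-- The invariant of Euclid's algorithm, for polynomials modulo `l` with at most `d` coefficients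
and the ideal `I` that they generate. -/
structure EucInv (l d : ℕ) (U : ℤ) (mem₀ : ℤ → ℤ) (I : Ideal (Polynomial (ZMod l)))
    (a b : ℕ) (pu pv : ℤ) (τ : State) : Prop where
  r11 : τ.reg 11 = l
  r12 : τ.reg 12 = a
  r33 : τ.reg 33 = b
  r13 : τ.reg 13 = pu
  r14 : τ.reg 14 = pv
  ad : a ≤ d
  bd : b ≤ d
  ptr : (pu = U ∧ pv = U + (d + 1)) ∨ (pu = U + (d + 1) ∧ pv = U)
  ub : ∀ j : ℕ, j < a → 0 ≤ τ.mem (pu + j) ∧ τ.mem (pu + j) < l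
  vb : ∀ j : ℕ, j < b → 0 ≤ τ.mem (pv + j) ∧ τ.mem (pv + j) < l
  frame : ∀ x, x < U ∨ U + 2 * (d + 1) ≤ x → τ.mem x = mem₀ x
  sound : Ideal.span {pol (ZMod l) τ.mem pu a, pol (ZMod l) τ.mem pv b} ≤ I
  complete : l.Prime → I ≤ Ideal.span {pol (ZMod l) τ.mem pu a, pol (ZMod l) τ.mem pv b}

section
variable {l d w : ℕ} {U : ℤ} {mem₀ : ℤ → ℤ} {I : Ideal (Polynomial (ZMod l))}
  {a b : ℕ} {pu pv : ℤ} {τ : State}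

lemma EucInv.swap_tr (hw : 3 ≤ w) (hU0 : 0 ≤ U) (hU : len (U + 2 * (d + 1)) ≤ w) {B : ℕ}
    (hB : opc w ≤ B) (h : EucInv l d U mem₀ I a b pu pv τ) :
    Tr swap τ [] (swap.κ * B) (EucInv l d U mem₀ I b a pv pu) := by
  have lens : ∀ z : ℤ, 0 ≤ z → z ≤ U + 2 * (d + 1) → len z ≤ w := fun z h0 h1 =>
    (len_mono' h0 h1).trans hU
  have ha := h.ad
  have hb := h.bd
  have l1 := lens a (by omega) (by omega)
  have l2 := lens b (by omega) (by omega)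
  have l3 := lens pu (by rcases h.ptr with h | h <;> omega) (by rcases h.ptr with h | h <;> omega)
  have l4 := lens pv (by rcases h.ptr with h | h <;> omega) (by rcases h.ptr with h | h <;> omega)
  refine Tr.basic' rfl (w := w) (by omega) hB ?_ ?_
  · simp [swap, Stm.Fits, Stm.run, h.r12, h.r33, h.r13, h.r14, l1, l2, l3, l4]
  · have hp := h.ptr
    constructor <;> try simp [swap, Stm.run, h.r12, h.r33, h.r13, h.r14, h.r11, ha, hb]
    · omega
    · exact h.vb
    · exact h.ub
    · exact h.frame
    · rw [Set.pair_comm]; exact h.sound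
    · rw [Set.pair_comm]; exact h.complete

/-- With `x` and `y` the top coefficients of `u` and `v`, the first polynomial becomes `y * u - x *
X ^ sh * v`; the top terms cancel and the stored length drops by one. Since `0 < y < l`, the
multiplier is a unit if `l` is prime. -/
lemma EucInv.elim_tr (hl : 0 < l) (hw : 3 ≤ w) (hU0 : 0 ≤ U) (hU : len (U + 2 * (d + 1)) ≤ w)
    (hlw : len l ≤ w) {B : ℕ}
    (hB : (d + 1) * opc w ≤ B) (h : EucInv l d U mem₀ I a b pu pv τ) (hb0 : 0 < b) (hab : b ≤ a)
    {y : ℤ} (hy0 : 0 < y) (hyl : y < l) (hy : τ.mem (pv + b - 1) = y) (h34 : τ.reg 34 = y) :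
    Tr elim τ [] (elim.κ * B) (EucInv l d U mem₀ I (a - 1) b pu pv) := by
  have lens : ∀ z : ℤ, 0 ≤ z → z ≤ U + 2 * (d + 1) → len z ≤ w := fun z h0 h1 =>
    (len_mono' h0 h1).trans hU
  have lensl : ∀ z : ℤ, 0 ≤ z → z < l → len z ≤ w := fun z h0 h1 => (len_mono' h0 h1.le).trans hlw
  have ha := h.ad
  have hb := h.bd
  have hB1 : opc w ≤ B := le_trans (Nat.le_mul_of_pos_left _ (by omega)) hB
  have l1 := lens a (by omega) (by omega)
  have l2 := lens b (by omega) (by omega)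
  have l3 := lens pu (by rcases h.ptr with h | h <;> omega) (by rcases h.ptr with h | h <;> omega)
  have l4 := lens pv (by rcases h.ptr with h | h <;> omega) (by rcases h.ptr with h | h <;> omega)
  obtain ⟨n, rfl⟩ : ∃ n, a = n + 1 := ⟨a - 1, by omega⟩
  obtain ⟨sh, hsh⟩ : ∃ sh : ℕ, n + 1 = sh + b := ⟨n + 1 - b, by omega⟩
  have hxa : pu + ((n + 1 : ℕ) : ℤ) - 1 = pu + n := by push_cast; ring
  have hx := h.ub n (by omega)
  obtain ⟨x, hxe⟩ : ∃ x, x = τ.mem (pu + n) := ⟨_, rfl⟩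
  rw [← hxe] at hx
  have lx := lensl x hx.1 hx.2
  have ly := lensl y hy0.le hyl
  have hshz : ((n + 1 : ℕ) : ℤ) - b = sh := by omega
  have lsh := lens sh (by omega) (by omega)
  refine Tr.comp (Q₁ := fun τ' => τ'.reg 24 = x ∧ τ'.reg 35 = sh ∧ τ'.mem = τ.mem)
    (Tr.basic' rfl (w := w) (by omega) hB1 ?_ ?_) ?_
  · rw [Nat.cast_succ] at l1 hshz hxa
    simp [Stm.Fits, Stm.run, h.r12, h.r33, h.r13, hxa, ← hxe, l1, l2, l3, lx]; omega
  · rw [Nat.cast_succ] at hshz hxa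
    simp [Stm.run, h.r12, h.r33, h.r13, hxa, ← hxe, hshz]
  rintro τ₁ a₁ ⟨g24, g35, gm⟩
  have e12 : τ₁.reg 12 = (n + 1 : ℕ) := (a₁ 12 (by decide)).trans h.r12
  have e33 : τ₁.reg 33 = b := (a₁ 33 (by decide)).trans h.r33
  have e13 : τ₁.reg 13 = pu := (a₁ 13 (by decide)).trans h.r13
  have e14 : τ₁.reg 14 = pv := (a₁ 14 (by decide)).trans h.r14
  have e11 : τ₁.reg 11 = l := (a₁ 11 (by decide)).trans h.r11
  have e34 : τ₁.reg 34 = y := (a₁ 34 (by decide)).trans h34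
  have hlz : (l : ℤ) ≠ 0 := by omega
  have hmod : ∀ z : ℤ, 0 ≤ z % l ∧ z % l < l := fun z =>
    ⟨Int.emod_nonneg _ hlz, Int.emod_lt_of_pos _ (by omega)⟩
  refine Tr.comp ((Tr.for (w := w) (B := opc w) (N := n + 1) (fun k τ' =>
      (∀ j : ℕ, j < k → τ'.mem (pu + j) = τ.mem (pu + j) * y % l) ∧
      ∀ x, x < pu ∨ pu + k ≤ x → τ'.mem x = τ.mem x) (by decide) hw l1 le_rfl le_rfl
      ?_ ?_ ?_).mono (Nat.mul_le_mul_left _ (le_trans (Nat.mul_le_mul_right _ (by omega)) hB))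
      fun _ _ h => h) ?_
  · rintro τ' - hm
    simp [hm, gm]
  · rintro τ' a'
    simp only [AExp.eval_reg, AExp.fits_reg, a' 12 (by decide), e12]
    exact ⟨trivial, l1⟩
  · rintro k hk τ' a' hτ hlk ⟨q1, q2⟩
    have f13 := a' 13 (by decide)
    have f34 := a' 34 (by decide)
    have f11 := a' 11 (by decide)
    have m1 := q2 (pu + k) (by omega)
    have lm := lensl _ (h.ub k hk).1 (h.ub k hk).2
    refine Tr.basic' rfl (w := w) (by omega) le_rfl ?_ ?_
    · simp [scaleBody, Stm.Fits, f13, f34, f11, e13, e34, e11, hτ, m1, hlk, l3, lm, ly, hlw]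
    · simp [scaleBody, Stm.run, f13, f34, f11, e13, e34, e11, hτ, m1]
      refine ⟨fun j hj => ?_, fun x hx => ?_⟩
      · by_cases hjk : j = k
        · subst hjk; simp
        · rw [if_neg hjk]; exact q1 j (by omega)
      · rw [if_neg (by omega)]; exact q2 x (by omega)
  rintro τ₂ a₂ ⟨q1, q2⟩
  have c12 : τ₂.reg 12 = (n + 1 : ℕ) := (a₂ 12 (by decide)).trans e12
  have c33 : τ₂.reg 33 = b := (a₂ 33 (by decide)).trans e33
  have c13 : τ₂.reg 13 = pu := (a₂ 13 (by decide)).trans e13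
  have c14 : τ₂.reg 14 = pv := (a₂ 14 (by decide)).trans e14
  have c11 : τ₂.reg 11 = l := (a₂ 11 (by decide)).trans e11
  have c24 : τ₂.reg 24 = x := (a₂ 24 (by decide)).trans g24
  have c35 : τ₂.reg 35 = sh := (a₂ 35 (by decide)).trans g35
  have hpv : ∀ j : ℕ, j < b → τ₂.mem (pv + j) = τ.mem (pv + j) := fun j hj =>
    q2 _ (by rcases h.ptr with h | h <;> omega)
  refine Tr.comp ((Tr.for (w := w) (B := opc w) (N := b) (fun k τ' =>
      (∀ j : ℕ, j < k → τ'.mem (pu + sh + j) = (τ₂.mem (pu + sh + j) - x * τ.mem (pv + j)) % l) ∧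
      ∀ x, x < pu + sh ∨ pu + sh + k ≤ x → τ'.mem x = τ₂.mem x) (by decide) hw l2 le_rfl le_rfl
      ?_ ?_ ?_).mono (Nat.mul_le_mul_left _ (le_trans (Nat.mul_le_mul_right _ (by omega)) hB))
      fun _ _ h => h) ?_
  · rintro τ' - hm
    simp [hm]
  · rintro τ' a'
    simp only [AExp.eval_reg, AExp.fits_reg, a' 33 (by decide), c33]
    exact ⟨trivial, l2⟩
  · rintro k hk τ' a' hτ hlk ⟨s1, s2⟩
    have f13 := a' 13 (by decide)
    have f14 := a' 14 (by decide)
    have f24 := a' 24 (by decide)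
    have f35 := a' 35 (by decide)
    have f11 := a' 11 (by decide)
    have m1 := s2 (pu + sh + k) (by omega)
    have m2 := s2 (pv + k) (by rcases h.ptr with h | h <;> omega)
    rw [hpv k hk] at m2
    have lm := lensl _ (h.vb k hk).1 (h.vb k hk).2
    have lm' : len (τ₂.mem (pu + sh + k)) ≤ w := by
      have := q1 (sh + k) (by omega)
      push_cast at this
      rw [add_assoc, this]
      exact lensl _ (hmod _).1 (hmod _).2
    refine Tr.basic' rfl (w := w) (by omega) le_rfl ?_ ?_
    · simp [subBody, Stm.Fits, f13, f14, f24, f35, f11, c13, c14, c24, c35, c11, hτ, m1, m2, hlk,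
        l3, l4, lm, lm', lx, hlw, lsh]
    · simp [subBody, Stm.run, f13, f14, f24, f35, f11, c13, c14, c24, c35, c11, hτ, m1, m2]
      refine ⟨fun j hj => ?_, fun x hx => ?_⟩
      · by_cases hjk : j = k
        · subst hjk; simp
        · rw [if_neg hjk]; exact s1 j (by omega)
      · rw [if_neg (by omega)]; exact s2 x (by omega)
  rintro τ₃ a₃ ⟨s1, s2⟩
  have hval : ∀ j : ℕ, j < n + 1 → (0 ≤ τ₃.mem (pu + j) ∧ τ₃.mem (pu + j) < l) ∧
      ((τ₃.mem (pu + j) : ℤ) : ZMod l) = y * (τ.mem (pu + j) : ℤ) -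
        x * (if sh ≤ j then ((τ.mem (pv + (j - sh : ℕ)) : ℤ) : ZMod l) else 0) := by
    intro j hj
    have h1 := q1 j hj
    by_cases hjs : sh ≤ j
    · obtain ⟨i, rfl⟩ : ∃ i, j = sh + i := ⟨j - sh, by omega⟩
      have h2 := s1 i (by omega)
      push_cast at h1 ⊢
      rw [← add_assoc] at h1 ⊢
      rw [h2, h1]
      refine ⟨hmod _, ?_⟩
      rw [if_pos hjs, show sh + i - sh = i by omega]
      simp only [ZMod.intCast_mod, Int.cast_sub, Int.cast_mul]
      ring
    · rw [s2 _ (by omega), h1, if_neg hjs]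
      refine ⟨hmod _, ?_⟩
      simp only [ZMod.intCast_mod, Int.cast_mul]
      ring
  have hpv3 : ∀ j : ℕ, j < b → τ₃.mem (pv + j) = τ.mem (pv + j) := fun j hj => by
    rw [s2 _ (by rcases h.ptr with h | h <;> omega), hpv j hj]
  have hyb : τ.mem (pv + (b - 1 : ℕ)) = y := by rw [← hy]; congr 1; omega
  have hu : pol (ZMod l) τ₃.mem pu n = Polynomial.C (y : ZMod l) * pol (ZMod l) τ.mem pu (n + 1) -
      (Polynomial.C (x : ZMod l) * Polynomial.X ^ sh) * pol (ZMod l) τ.mem pv b := by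
    ext j
    rw [Polynomial.coeff_sub, Polynomial.coeff_C_mul, mul_assoc, Polynomial.coeff_C_mul,
      Polynomial.coeff_X_pow_mul', coeff_pol, coeff_pol, coeff_pol]
    rcases lt_trichotomy j n with hj | hj | hj
    · rw [if_pos hj, if_pos (by omega), (hval j (by omega)).2]
      by_cases hjs : sh ≤ j
      · rw [if_pos hjs, if_pos hjs, if_pos (by omega)]
      · rw [if_neg hjs, if_neg hjs]
    · subst hj
      rw [if_neg (by omega), if_pos (by omega), if_pos (by omega), if_pos (by omega),
        show j - sh = b - 1 by omega, hyb, ← hxe]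
      ring
    · rw [if_neg (by omega), if_neg (by omega)]
      by_cases hjs : sh ≤ j
      · rw [if_pos hjs, if_neg (by omega)]; simp
      · rw [if_neg hjs]; simp
  have hv : pol (ZMod l) τ₃.mem pv b = pol (ZMod l) τ.mem pv b := pol_congr hpv3
  obtain ⟨sp1, sp2⟩ := span_pair_elim (pol (ZMod l) τ.mem pu (n + 1)) (pol (ZMod l) τ.mem pv b)
    (Polynomial.C (x : ZMod l) * Polynomial.X ^ sh) (y : ZMod l)
  rw [← hu] at sp1 sp2
  refine Tr.basic' rfl (w := w) (by omega) hB1 ?_ ?_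
  · simp only [Stm.Fits, AExp.fits_sub, AExp.fits_reg, (a₃ 12 (by decide)).trans c12]
    refine ⟨l1, ?_⟩
    simp; omega
  · refine ⟨?_, ?_, ?_, ?_, ?_, ?_, hb, h.ptr, ?_, ?_, ?_, ?_, ?_⟩ <;>
      simp only [Stm.run, State.reg_setReg, State.mem_setReg, Nat.add_sub_cancel]
    · simpa using (a₃ 11 (by decide)).trans c11
    · simp [(a₃ 12 (by decide)).trans c12]
    · simpa using (a₃ 33 (by decide)).trans c33
    · simpa using (a₃ 13 (by decide)).trans c13
    · simpa using (a₃ 14 (by decide)).trans c14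
    · omega
    · exact fun j hj => (hval j (by omega)).1
    · intro j hj; rw [hpv3 j hj]; exact h.vb j hj
    · intro x hx
      rw [s2 _ (by rcases h.ptr with h | h <;> omega), q2 _ (by rcases h.ptr with h | h <;> omega), h.frame x hx]
    · rw [hv]; exact sp1.trans h.sound
    · intro hp
      rw [hv]
      refine (h.complete hp).trans (sp2 ?_)
      have := Fact.mk hp
      rw [isUnit_iff_ne_zero]
      intro h0
      rw [ZMod.intCast_zmod_eq_zero_iff_dvd] at h0
      exact absurd (Int.le_of_dvd hy0 h0) (by omega)

/-- The lengths count stored cells, so the top cell of the shorter polynomial may be zero; then only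
its length is reduced. In both cases the sum of the lengths decreases, also after an exchange. -/
lemma EucInv.eucBody_tr (hl : 0 < l) (hw : 4 ≤ w) (hU0 : 0 ≤ U) (hU : len (U + 2 * (d + 1)) ≤ w)
    (hlw : len l ≤ w) {B : ℕ} (hB : (d + 1) * opc w ≤ B) (h : EucInv l d U mem₀ I a b pu pv τ)
    (ha0 : 0 < a) (hb0 : 0 < b) :
    Tr eucBody τ [] (eucBody.κ * B) (fun τ' => ∃ a' b' pu' pv',
      EucInv l d U mem₀ I a' b' pu' pv' τ' ∧ a' + b' < a + b) := by
  have lens : ∀ z : ℤ, 0 ≤ z → z ≤ U + 2 * (d + 1) → len z ≤ w := fun z h0 h1 =>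
    (len_mono' h0 h1).trans hU
  have ha := h.ad
  have hb := h.bd
  have hB1 : opc w ≤ B := le_trans (Nat.le_mul_of_pos_left _ (by omega)) hB
  have l1 := lens a (by omega) (by omega)
  have l2 := lens b (by omega) (by omega)
  have main : ∀ {a b : ℕ} {pu pv : ℤ} {τ : State}, EucInv l d U mem₀ I a b pu pv τ → 0 < b →
      b ≤ a → Tr (34 <~ Mem (R 14 + R 33 - 1) ;; .ite (R 34) elim (33 <~ R 33 - 1)) τ []
        ((34 <~ Mem (R 14 + R 33 - 1) ;; .ite (R 34) elim (33 <~ R 33 - 1)).κ * B) (fun τ' =>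
          ∃ a' b' pu' pv', EucInv l d U mem₀ I a' b' pu' pv' τ' ∧ a' + b' < a + b) := by
    intro a b pu pv τ h hb0 hab
    have hb := h.bd
    have l2 := lens b (by omega) (by omega)
    have l4 := lens pv (by rcases h.ptr with h | h <;> omega) (by rcases h.ptr with h | h <;> omega)
    have hidx : pv + (b : ℤ) - 1 = pv + (b - 1 : ℕ) := by omega
    have hy := h.vb (b - 1) (by omega)
    rw [← hidx] at hy
    obtain ⟨y, hye⟩ : ∃ y, τ.mem (pv + b - 1) = y := ⟨_, rfl⟩
    rw [hye] at hy
    have ly : len y ≤ w := (len_mono' hy.1 hy.2.le).trans hlw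
    refine Tr.comp (Q₁ := fun τ' => τ'.reg 34 = y ∧ τ'.mem (pv + b - 1) = y ∧
        EucInv l d U mem₀ I a b pu pv τ')
      (Tr.basic' rfl (w := w) (by omega) hB1 ?_ ?_) ?_
    · simp [Stm.Fits, h.r33, h.r14, hye, l4, l2, ly]; omega
    · refine ⟨by simp [Stm.run, h.r33, h.r14, hye], hye, ?_⟩
      obtain ⟨r11, r12, r33, r13, r14, ad, bd, ptr, ub, vb, frame, sound, complete⟩ := h
      exact ⟨by simpa [Stm.run], by simpa [Stm.run], by simpa [Stm.run], by simpa [Stm.run],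
        by simpa [Stm.run], ad, bd, ptr, ub, vb, frame, sound, complete⟩
    rintro τ₁ a₁ ⟨g34, hye', h⟩
    refine Tr.cases (w := w) hB1 (by simp [g34, ly]) ?_ ?_
    · intro hy0
      rw [AExp.eval_reg, g34] at hy0
      refine (h.elim_tr hl (by omega) hU0 hU hlw hB hb0 hab hy0 hy.2 hye' g34).mono le_rfl ?_
      exact fun τ' _ h' => ⟨_, _, _, _, h', by omega⟩
    · intro hy0
      rw [AExp.eval_reg, g34] at hy0
      have hy0' : y = 0 := le_antisymm hy0 hy.1
      refine Tr.basic' rfl (w := w) (by omega) hB1 ?_ ⟨a, b - 1, pu, pv, ?_, by omega⟩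
      · simp [Stm.Fits, h.r33, l2]; omega
      · have hp : pol (ZMod l) τ₁.mem pv (b - 1) = pol (ZMod l) τ₁.mem pv b :=
          pol_pred hb0 (hye'.trans hy0')
        obtain ⟨r11, r12, r33, r13, r14, ad, bd, ptr, ub, vb, frame, sound, complete⟩ := h
        rw [← hp] at sound complete
        exact ⟨by simpa [Stm.run], by simpa [Stm.run], by simp [Stm.run, r33]; omega,
          by simpa [Stm.run], by simpa [Stm.run], ad, by omega, ptr, ub,
          fun j hj => vb j (by omega), frame, sound, complete⟩
  have hcond : (R 33 - R 12).Fits τ w := by simp [h.r33, h.r12, l1, l2]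
  refine Tr.comp (Q₁ := fun τ' => ∃ a' b' pu' pv', EucInv l d U mem₀ I a' b' pu' pv' τ' ∧
    a' + b' = a + b ∧ 0 < b' ∧ b' ≤ a') (Tr.cases (w := w) hB1 hcond ?_ ?_) ?_
  · intro hc
    simp [h.r33, h.r12] at hc
    refine (h.swap_tr (by omega) hU0 hU hB1).mono le_rfl ?_
    exact fun τ' _ h' => ⟨_, _, _, _, h', by omega, by omega, by omega⟩
  · intro hc
    simp [h.r33, h.r12] at hc
    exact Tr.basic' (s := .skip) rfl (w := w) (by omega) hB1 trivial ⟨a, b, pu, pv, h, rfl, hb0, hc⟩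
  · rintro τ₁ - ⟨a', b', pu', pv', h', h1, h2, h3⟩
    rw [← h1]
    exact main h' h2 h3

/-- The sum of the lengths starts at `2 * d` at most and falls in each pass. The final exchange
leaves the surviving polynomial in the first place and an empty second one, ready for another
generator. -/
theorem EucInv.euclid_tr (hl : 0 < l) (hw : 4 ≤ w) (hU0 : 0 ≤ U)
    (hU : len (U + 2 * (d + 1)) ≤ w) (hlw : len l ≤ w) {B : ℕ}
    (hB : (2 * d + 1) * ((d + 1) * opc w) ≤ B) (h : EucInv l d U mem₀ I a b pu pv τ) :
    Tr euclid τ [] (euclid.κ * B) (fun τ' => ∃ a' pu' pv',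
      EucInv l d U mem₀ I a' 0 pu' pv' τ') := by
  have lens : ∀ z : ℤ, 0 ≤ z → z ≤ U + 2 * (d + 1) → len z ≤ w := fun z h0 h1 =>
    (len_mono' h0 h1).trans hU
  have ha := h.ad
  have hb := h.bd
  have hB0 : opc w ≤ (d + 1) * opc w := Nat.le_mul_of_pos_left _ (by omega)
  have hB1 : opc w ≤ B := hB0.trans (le_trans (Nat.le_mul_of_pos_left _ (by omega)) hB)
  refine Tr.comp ((Tr.loop (w := w) (B := (d + 1) * opc w) (N := 2 * d + 1) (fun τ' =>
    ∃ a' b' pu' pv', EucInv l d U mem₀ I a' b' pu' pv' τ') (fun τ' => (τ'.reg 12 + τ'.reg 33).toNat)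
    hB0 (by simp [h.r12, h.r33]; omega) ⟨a, b, pu, pv, h⟩ ?_ ?_).mono (Nat.mul_le_mul_left _ hB)
    fun _ _ h => h) ?_
  · rintro τ' - ⟨a', b', pu', pv', h'⟩
    have ha := h'.ad
    have hb := h'.bd
    have l1 := lens a' (by omega) (by omega)
    have l2 := lens b' (by omega) (by omega)
    simp [h'.r12, h'.r33, l1, l2]
  · rintro τ' - ⟨a', b', pu', pv', h'⟩ hc
    simp [h'.r12, h'.r33] at hc
    refine (h'.eucBody_tr hl hw hU0 hU hlw le_rfl ?_ ?_).mono le_rfl ?_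
    · rcases Nat.eq_zero_or_pos a' with h | h <;> simp_all
    · rcases Nat.eq_zero_or_pos b' with h | h <;> simp_all
    · rintro τ'' - ⟨a'', b'', pu'', pv'', h'', hlt⟩
      refine ⟨⟨_, _, _, _, h''⟩, ?_⟩
      simp only [h'.r12, h'.r33, h''.r12, h''.r33]
      omega
  · rintro τ' - ⟨⟨a', b', pu', pv', h'⟩, hc⟩
    have ha := h'.ad
    have hb := h'.bd
    have l1 := lens a' (by omega) (by omega)
    have h0 : a' = 0 ∨ b' = 0 := by
      by_contra! hne
      simp [h'.r12, h'.r33] at hc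
      have := Nat.mul_pos (Nat.pos_of_ne_zero hne.1) (Nat.pos_of_ne_zero hne.2)
      have : (0 : ℤ) < a' * b' := by exact_mod_cast this
      omega
    refine Tr.cases (w := w) hB1 (by simp [h'.r12, l1]) ?_ ?_
    · intro hp
      simp [h'.r12] at hp
      obtain rfl : b' = 0 := by omega
      exact Tr.basic' (s := .skip) rfl (w := w) (by omega) hB1 trivial ⟨a', pu', pv', h'⟩
    · intro hp
      simp [h'.r12] at hp
      obtain rfl : a' = 0 := by omega
      exact (h'.swap_tr (by omega) hU0 hU hB1).mono le_rfl fun τ'' _ h'' => ⟨_, _, _, h''⟩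

end

end BitRAM

/-! ### The reparametrized fractions and the polynomials `cross` -/

namespace RatParam

/-- The polynomial `(X - t₀) ^ D * f ((t₀ X + 1) / (X - t₀))`. -/
noncomputable def moebius (t₀ : ℤ) (D : ℕ) (f : ℤ[X]) : ℤ[X] :=
  ∑ i ∈ Finset.range (D + 1),
    Polynomial.C (f.coeff i) * (Polynomial.C t₀ * Polynomial.X + 1) ^ i *
      (Polynomial.X - Polynomial.C t₀) ^ (D - i)

lemma natDegree_moebius_le (t₀ : ℤ) (D : ℕ) (f : ℤ[X]) : (moebius t₀ D f).natDegree ≤ D := by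
  refine natDegree_sum_le_of_forall_le _ _ fun i hi => ?_
  have hi := Finset.mem_range.mp hi
  refine natDegree_mul_le.trans ?_
  have h1 : (Polynomial.C (f.coeff i) * (Polynomial.C t₀ * Polynomial.X + 1) ^ i).natDegree ≤ i := by
    refine (natDegree_C_mul_le _ _).trans ((natDegree_pow_le).trans ?_)
    have : (Polynomial.C t₀ * Polynomial.X + 1 : ℤ[X]).natDegree ≤ 1 := by
      have := natDegree_linear_le (a := t₀) (b := 1)
      simpa using this
    calc _ ≤ i * 1 := Nat.mul_le_mul_left _ this
      _ = i := mul_one i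
  have h2 : ((Polynomial.X - Polynomial.C t₀ : ℤ[X]) ^ (D - i)).natDegree ≤ D - i := by
    rw [natDegree_pow, natDegree_X_sub_C, mul_one]
  omega

lemma eval_moebius (t₀ : ℤ) (D : ℕ) (f : ℤ[X]) (x : ℤ) : (moebius t₀ D f).eval x =
    ∑ i ∈ Finset.range (D + 1), f.coeff i * (t₀ * x + 1) ^ i * (x - t₀) ^ (D - i) := by
  simp [moebius, eval_finsetSum]

variable {n : ℕ}

/-- The reparametrization `t ↦ φ ((t₀ t + 1) / (t - t₀))`, when all the limits at infinity are
finite. -/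
noncomputable def reparam (φ : RatParam n) (t₀ : ℤ) : RatParam n where
  num i := moebius t₀ (φ.den i).natDegree (φ.num i)
  den i := moebius t₀ (φ.den i).natDegree (φ.den i)

/-- The polynomials whose common roots are the parameters of the point at infinity. -/
noncomputable def cross (φ : RatParam n) (t₀ : ℤ) (i : Fin n) : ℤ[X] :=
  (φ.reparam t₀).num i * Polynomial.C (((φ.reparam t₀).den i).coeff (φ.den i).natDegree) -
    (φ.reparam t₀).den i * Polynomial.C (((φ.reparam t₀).num i).coeff (φ.den i).natDegree)

lemma coeff_cross (φ : RatParam n) (t₀ : ℤ) (i : Fin n) (j : ℕ) : (φ.cross t₀ i).coeff j =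
    ((φ.reparam t₀).num i).coeff j * ((φ.reparam t₀).den i).coeff (φ.den i).natDegree -
    ((φ.reparam t₀).den i).coeff j * ((φ.reparam t₀).num i).coeff (φ.den i).natDegree := by
  rw [cross, coeff_sub, coeff_mul_C, coeff_mul_C]

/-- The products of the two top coefficients cancel in degree `D`, so `D` cells hold the polynomial,
and the coefficient of degree `D - 1`, when nonzero, is the leading one. -/
lemma coeff_cross_eq_zero (φ : RatParam n) (t₀ : ℤ) (i : Fin n) {j : ℕ}
    (hj : (φ.den i).natDegree ≤ j) : (φ.cross t₀ i).coeff j = 0 := by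
  rw [coeff_cross]
  rcases hj.eq_or_lt with rfl | hj
  · ring
  · have h1 : ((φ.reparam t₀).num i).coeff j = 0 :=
      coeff_eq_zero_of_natDegree_lt ((natDegree_moebius_le _ _ _).trans_lt hj)
    have h2 : ((φ.reparam t₀).den i).coeff j = 0 :=
      coeff_eq_zero_of_natDegree_lt ((natDegree_moebius_le _ _ _).trans_lt hj)
    rw [h1, h2]
    ring

/-- The ideal generated by the first `i` of the polynomials `φ.cross t₀` modulo `l`. -/
noncomputable def crossIdeal (φ : RatParam n) (t₀ : ℤ) (l i : ℕ) : Ideal (ZMod l)[X] :=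
  Ideal.span {f | ∃ k : Fin n, k.val < i ∧ f = (φ.cross t₀ k).map (Int.castRingHom (ZMod l))}

lemma crossIdeal_zero (φ : RatParam n) (t₀ : ℤ) (l : ℕ) : φ.crossIdeal t₀ l 0 = ⊥ := by
  rw [crossIdeal, Ideal.span_eq_bot]
  rintro f ⟨k, hk, -⟩
  omega

lemma crossIdeal_succ (φ : RatParam n) (t₀ : ℤ) (l : ℕ) (i : Fin n) : φ.crossIdeal t₀ l (i + 1) =
    φ.crossIdeal t₀ l i ⊔ Ideal.span {(φ.cross t₀ i).map (Int.castRingHom (ZMod l))} := by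
  rw [crossIdeal, crossIdeal, ← Ideal.span_union]
  congr 1
  ext f
  simp only [Set.mem_ofPred_eq, Set.mem_union, Set.mem_singleton_iff]
  constructor
  · rintro ⟨k, hk, rfl⟩
    rcases (Nat.lt_succ_iff.mp hk).eq_or_lt with h | h
    · right; rw [Fin.ext h]
    · exact Or.inl ⟨k, h, rfl⟩
  · rintro (⟨k, hk, rfl⟩ | rfl)
    · exact ⟨k, by omega, rfl⟩
    · exact ⟨i, by omega, rfl⟩

end RatParam

/-! ### Stages of the treatment of one coordinate -/

namespace BitRAM

local notation "R" => AExp.reg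
local notation "Mem" => AExp.load

/-- After elimination the second polynomial is empty, so its cells are free for the next generator
`g`. A single pair of arrays thus accumulates the ideal of all coordinates. The frame condition
restarts from the current memory. -/
lemma EucInv.adjoin {l d : ℕ} {U : ℤ} {mem₀ : ℤ → ℤ} {I : Ideal (ZMod l)[X]} {a D : ℕ}
    {pu pv : ℤ} {τ τ' : State} (h : EucInv l d U mem₀ I a 0 pu pv τ) {g : (ZMod l)[X]}
    (hD : D ≤ d) (r11 : τ'.reg 11 = τ.reg 11) (r12 : τ'.reg 12 = τ.reg 12)
    (r13 : τ'.reg 13 = τ.reg 13) (r14 : τ'.reg 14 = τ.reg 14) (r33 : τ'.reg 33 = D)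
    (hu : ∀ j : ℕ, j < a → τ'.mem (pu + j) = τ.mem (pu + j))
    (hv : ∀ j : ℕ, j < D → 0 ≤ τ'.mem (pv + j) ∧ τ'.mem (pv + j) < l)
    (hg : pol (ZMod l) τ'.mem pv D = g) :
    EucInv l d U τ'.mem (I ⊔ Ideal.span {g}) a D pu pv τ' where
  r11 := r11.trans h.r11
  r12 := r12.trans h.r12
  r33 := r33
  r13 := r13.trans h.r13
  r14 := r14.trans h.r14
  ad := h.ad
  bd := hD
  ptr := h.ptr
  ub j hj := by rw [hu j hj]; exact h.ub j hj
  vb := hv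
  frame x _ := rfl
  sound := by
    rw [hg, pol_congr hu, Ideal.span_insert]
    have := h.sound
    rw [pol_zero, Ideal.span_insert] at this
    exact sup_le_sup (le_sup_left.trans this) le_rfl
  complete hp := by
    rw [hg, pol_congr hu, Ideal.span_insert]
    have := h.complete hp
    rw [pol_zero, Ideal.span_insert] at this
    simp only [Ideal.span_singleton_zero, bot_le, sup_of_le_left] at this
    exact sup_le_sup this le_rfl

/-- Find the degree of a denominator. -/
def findDegree : Stm :=
  (19 <~ 2 * R 17 * (R 1 + 1) ;; 20 <~ R 1 ;; 38 <~ Mem (R 19 + R 1 + 1 + R 3 + R 20)) ;;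
  .iter (1 - R 38 * R 38) (20 <~ R 20 - 1 ;; 38 <~ Mem (R 19 + R 1 + 1 + R 3 + R 20))

/-- The guard `1 - z * z` is positive exactly for `z = 0`, which expresses a test for zero by a test
for positivity. The descent from `d` ends at the degree because the leading coefficient is nonzero.
-/
lemma findDegree_tr {σ : State} {w d D : ℕ} {i S : ℤ} {f : ℕ → ℤ} (r1 : σ.reg 1 = d)
    (r3 : σ.reg 3 = S) (r17 : σ.reg 17 = i) (hD : D ≤ d)
    (hf : ∀ j : ℕ, j ≤ d → σ.mem (2 * i * (d + 1) + d + 1 + S + j) = f j) (hfD : f D ≠ 0)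
    (hf0 : ∀ j, D < j → j ≤ d → f j = 0) (hw : 3 ≤ w) (ld : len d ≤ w) (lS : len S ≤ w)
    (li : len i ≤ w) (lpo : len (2 * i * (d + 1)) ≤ w) (lf : ∀ j, len (f j) ≤ w) {B : ℕ}
    (hB : (d + 1) * opc w ≤ B) :
    Tr findDegree σ [] (findDegree.κ * B) (fun τ => τ.mem = σ.mem ∧
      τ.reg 19 = 2 * i * (d + 1) ∧ τ.reg 20 = D) := by
  have hB1 : opc w ≤ B := le_trans (Nat.le_mul_of_pos_left _ (by omega)) hB
  obtain ⟨po, hpo⟩ : ∃ po, po = 2 * i * ((d : ℤ) + 1) := ⟨_, rfl⟩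
  rw [← hpo] at lpo hf ⊢
  refine Tr.comp (Q₁ := fun τ => τ.mem = σ.mem ∧ τ.reg 19 = po ∧ τ.reg 20 = d ∧ τ.reg 38 = f d)
    (Tr.basic' rfl (w := w) (by omega) hB1 ?_ ?_) ?_
  · simp [Stm.Fits, Stm.run, r1, r3, r17, ld, lS, li, lpo, ← hpo, hf d le_rfl, lf]; omega
  · simp [Stm.run, r1, r3, r17, ← hpo, hf d le_rfl]
  rintro τ₁ a₁ ⟨m1, e19, e20, e38⟩
  refine ((Tr.loop (w := w) (B := opc w) (N := d + 1) (fun τ => τ.mem = σ.mem ∧ τ.reg 19 = po ∧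
    ∃ j : ℕ, D ≤ j ∧ j ≤ d ∧ τ.reg 20 = j ∧ τ.reg 38 = f j) (fun τ => (τ.reg 20).toNat) le_rfl
    ?_ ⟨m1, e19, d, hD, le_rfl, e20, e38⟩ ?_ ?_).mono (Nat.mul_le_mul_left _ hB)
    fun _ _ h => h).mono le_rfl ?_
  · simp [e20]
  · rintro τ - ⟨-, -, j, -, -, -, h⟩
    simp [h, lf]; omega
  · rintro τ a ⟨m2, f19, j, h1, h2, f20, f38⟩ hc
    have hz : f j = 0 := by
      by_contra hne
      simp [f38] at hc
      nlinarith [Int.one_le_abs hne, sq_abs (f j), abs_nonneg (f j)]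
    have hj : D < j := lt_of_le_of_ne h1 (by rintro rfl; exact hfD hz)
    obtain ⟨k, rfl⟩ : ∃ k, j = k + 1 := ⟨j - 1, by omega⟩
    have g1 : τ.reg 1 = d := ((a 1 (by decide)).trans (a₁ 1 (by decide))).trans r1
    have g3 : τ.reg 3 = S := ((a 3 (by decide)).trans (a₁ 3 (by decide))).trans r3
    have lk : len k ≤ w := (len_mono' (by omega) (by omega)).trans ld
    have lk1 : len ((k : ℤ) + 1) ≤ w := (len_mono' (by omega) (by omega)).trans ld
    have hk := hf k (by omega)
    refine Tr.basic' rfl (w := w) (by omega) le_rfl ?_ ?_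
    · simp [Stm.Fits, Stm.run, g1, g3, f19, f20, ld, lS, lpo, lk, lk1, m2, hk, lf]; omega
    · simp [Stm.run, g1, g3, f19, f20, m2, hk]
      exact ⟨by omega, by omega⟩
  · rintro τ a ⟨⟨m2, f19, j, h1, h2, f20, f38⟩, hc⟩
    refine ⟨m2, f19, ?_⟩
    by_contra hne
    have hz : f j = 0 := hf0 j (lt_of_le_of_ne h1 (by rintro rfl; exact hne f20)) h2
    simp [f38, hz] at hc

/-- Compute the residues that measure whether the point at infinity is multiple. -/
def crossStage : Stm :=
  (39 <~ Mem (R 19 + R 20) ;; 40 <~ Mem (R 19 + R 1 + 1 + R 20) ;;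
    .ite (R 40 * R 40) .skip (16 <~ 0)) ;;
  .for 23 (R 20) (.st (R 14 + R 23)
    ((Mem (R 19 + R 23) * R 40 - Mem (R 19 + R 1 + 1 + R 23) * R 39) % R 11)) ;;
  33 <~ R 20 ;; .ite (R 20) (24 <~ Mem (R 14 + R 20 - 1) ;; .ite (R 24) (15 <~ R 24) .skip) .skip

/-- Register `16` is cleared when the top coefficient of the denominator vanishes, that is, when
`t₀` is a pole of this coordinate. Register `15` keeps the most recent nonzero residue in degree `D
- 1`: one witness for a nonzero tangent vector is enough. For `D = 0` there is no such coefficient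
and nothing is recorded. -/
lemma crossStage_tr {σ : State} {w d D l : ℕ} {po pv : ℤ} {P Q : ℕ → ℤ} {ok lam : ℤ}
    (r1 : σ.reg 1 = d) (r19 : σ.reg 19 = po) (r20 : σ.reg 20 = D) (r14 : σ.reg 14 = pv)
    (r11 : σ.reg 11 = l) (r15 : σ.reg 15 = lam) (r16 : σ.reg 16 = ok) (hl : 0 < l) (hD : D ≤ d)
    (hP : ∀ j : ℕ, j ≤ d → σ.mem (po + j) = P j)
    (hQ : ∀ j : ℕ, j ≤ d → σ.mem (po + d + 1 + j) = Q j)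
    (hpo : 0 ≤ po) (hpv : po + 2 * (d + 1) ≤ pv) (hw : 4 ≤ w) (lpv : len (pv + d) ≤ w)
    (ll : len l ≤ w) (lP : ∀ j, len (P j) ≤ w) (lQ : ∀ j, len (Q j) ≤ w) {B : ℕ}
    (hB : (d + 1) * opc w ≤ B) :
    Tr crossStage σ [] (crossStage.κ * B) (fun τ =>
      (∀ j : ℕ, j < D → τ.mem (pv + j) = (P j * Q D - Q j * P D) % l) ∧
      (∀ x, x < pv ∨ pv + D ≤ x → τ.mem x = σ.mem x) ∧
      τ.reg 33 = D ∧ τ.reg 16 = (if Q D = 0 then 0 else ok) ∧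
      τ.reg 15 = if 0 < D ∧ 0 < (P (D - 1) * Q D - Q (D - 1) * P D) % l then
        (P (D - 1) * Q D - Q (D - 1) * P D) % l else lam) := by
  have lens : ∀ z : ℤ, 0 ≤ z → z ≤ pv + d → len z ≤ w := fun z h0 h1 =>
    (len_mono' h0 h1).trans lpv
  have hB1 : opc w ≤ B := le_trans (Nat.le_mul_of_pos_left _ (by omega)) hB
  have lpo := lens po hpo (by omega)
  have lpv := lens pv (by omega) (by omega)
  have ld := lens d (by omega) (by omega)
  have lD := lens D (by omega) (by omega)
  refine Tr.comp (Q₁ := fun τ => τ.mem = σ.mem ∧ τ.reg 39 = P D ∧ τ.reg 40 = Q D ∧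
      τ.reg 16 = (if Q D = 0 then 0 else ok))
    (Tr.basic' rfl (w := w) (by omega) hB1 ?_ ?_) ?_
  · simp [Stm.Fits, Stm.run, r1, r19, r20, hP D hD, hQ D hD, lpo, ld, lD, lP, lQ]
    omega
  · by_cases h0 : Q D = 0
    · simp [Stm.run, r1, r19, r20, hP D hD, hQ D hD, h0]
    · have : 0 < Q D * Q D := mul_self_pos.mpr h0
      simp [Stm.run, r1, r19, r20, hP D hD, hQ D hD, h0, this, r16]
  rintro τ₁ a₁ ⟨m1, e39, e40, e16⟩
  have e1 : τ₁.reg 1 = d := (a₁ 1 (by decide)).trans r1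
  have e11 : τ₁.reg 11 = l := (a₁ 11 (by decide)).trans r11
  have e14 : τ₁.reg 14 = pv := (a₁ 14 (by decide)).trans r14
  have e15 : τ₁.reg 15 = lam := (a₁ 15 (by decide)).trans r15
  have e19 : τ₁.reg 19 = po := (a₁ 19 (by decide)).trans r19
  have e20 : τ₁.reg 20 = D := (a₁ 20 (by decide)).trans r20
  refine Tr.comp ((Tr.for (w := w) (B := opc w) (N := D) (fun k τ' =>
      (∀ j : ℕ, j < k → τ'.mem (pv + j) = (P j * Q D - Q j * P D) % l) ∧
      ∀ x, x < pv ∨ pv + k ≤ x → τ'.mem x = σ.mem x) (by decide) (by omega) lD le_rfl le_rfl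
      ?_ ?_ ?_).mono (Nat.mul_le_mul_left _ (le_trans (Nat.mul_le_mul_right _ (by omega)) hB))
      fun _ _ h => h) ?_
  · rintro τ' - hm
    simp [hm, m1]
  · rintro τ' a'
    simp only [AExp.eval_reg, AExp.fits_reg, a' 20 (by decide), e20]
    exact ⟨trivial, lD⟩
  · rintro k hk τ' a' hτ hlk ⟨q1, q2⟩
    have g1 := (a' 1 (by decide)).trans e1
    have g11 := (a' 11 (by decide)).trans e11
    have g14 := (a' 14 (by decide)).trans e14
    have g19 := (a' 19 (by decide)).trans e19
    have g39 := (a' 39 (by decide)).trans e39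
    have g40 := (a' 40 (by decide)).trans e40
    have hk1 := (q2 (po + k) (by omega)).trans (hP k (by omega))
    have hk2 := (q2 (po + d + 1 + k) (by omega)).trans (hQ k (by omega))
    refine Tr.basic' rfl (w := w) (by omega) le_rfl ?_ ?_
    · simp [Stm.Fits, g1, g11, g14, g19, g39, g40, hτ, hk1, hk2, lpv, lpo, ld, hlk, lP, lQ, ll]
      omega
    · simp [Stm.run, g1, g11, g14, g19, g39, g40, hτ, hk1, hk2]
      refine ⟨fun j hj => ?_, fun x hx => ?_⟩
      · by_cases hjk : j = k
        · subst hjk; simp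
        · rw [if_neg hjk]; exact q1 j (by omega)
      · rw [if_neg (by omega)]; exact q2 x (by omega)
  rintro τ₂ a₂ ⟨q1, q2⟩
  have g14 := (a₂ 14 (by decide)).trans e14
  have g15 := (a₂ 15 (by decide)).trans e15
  have g16 := (a₂ 16 (by decide)).trans e16
  have g20 := (a₂ 20 (by decide)).trans e20
  rcases Nat.eq_zero_or_pos D with rfl | hD0
  · refine Tr.basic' rfl (w := w) (by omega) hB1 ?_ ?_
    · simp [Stm.Fits, Stm.run, g20]; omega
    · simp [Stm.run, g20, g15, g16]
      exact fun x hx => q2 x (by simpa using hx)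
  · have hidx : pv + (D : ℤ) - 1 = pv + (D - 1 : ℕ) := by omega
    have hval := q1 (D - 1) (by omega)
    rw [← hidx] at hval
    obtain ⟨z, hz⟩ : ∃ z, z = (P (D - 1) * Q D - Q (D - 1) * P D) % l := ⟨_, rfl⟩
    rw [← hz] at hval ⊢
    have lz : len z ≤ w := by
      rw [hz]
      exact (len_mono' (Int.emod_nonneg _ (by omega)) (Int.emod_lt_of_pos _ (by omega)).le).trans ll
    have hDz : (0 : ℤ) < D := by omega
    refine Tr.basic' rfl (w := w) (by omega) hB1 ?_ ?_
    · by_cases hz0 : 0 < z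
      · simp [Stm.Fits, Stm.run, g20, g14, hD0, hval, lz, hz0, lD, lpv]; omega
      · simp [Stm.Fits, Stm.run, g20, g14, hD0, hval, lz, hz0, lD, lpv]; omega
    · by_cases hz0 : 0 < z
      · simp [Stm.run, g20, g14, hD0, hval, hz0, g16]
        exact ⟨q1, q2⟩
      · simp [Stm.run, g20, g14, hD0, hval, hz0, g16, g15]
        exact ⟨q1, q2⟩

end BitRAM

/-! ### The pass over all coordinates -/

namespace BitRAM

local notation "R" => AExp.reg
local notation "Mem" => AExp.load

/-- The start of the part of the memory that is used by Euclid's algorithm. -/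
def euclidBase (n d m : ℕ) : ℤ := 4 * n * (d + 1) + 2 * 2 ^ m

/-- The assumptions on the input and on the parameters chosen by the program. -/
structure Setup {n : ℕ} (φ : RatParam n) (d m b : ℕ) (H : ℤ) : Prop where
  num_deg : ∀ i, (φ.num i).natDegree ≤ (φ.den i).natDegree
  den_deg : ∀ i, (φ.den i).natDegree ≤ d
  den_ne : ∀ i, φ.den i ≠ 0
  hd : d < 2 ^ m
  hU : euclidBase n d m + 2 * (d + 1) ≤ 2 ^ b
  hH : 2 ^ b < H
  inp : ∀ i j, |(φ.num i).coeff j| ≤ H ∧ |(φ.den i).coeff j| ≤ H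
  out : ∀ t₀ : ℤ, 0 ≤ t₀ → t₀ < 2 ^ b → ∀ i j,
    |((φ.reparam t₀).num i).coeff j| < H ∧ |((φ.reparam t₀).den i).coeff j| < H

/-- The registers and the copy of the input that do not change after the initialization. -/
structure Base {n : ℕ} (φ : RatParam n) (d m b : ℕ) (H : ℤ) (τ : State) : Prop where
  r1 : τ.reg 1 = d
  r2 : τ.reg 2 = n
  r3 : τ.reg 3 = 2 * n * (d + 1)
  r4 : τ.reg 4 = b
  r6 : τ.reg 6 = H
  r7 : τ.reg 7 = 2 * H
  r8 : τ.reg 8 = (2 ^ m : ℕ)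
  r9 : τ.reg 9 = 4 * n * (d + 1)
  r10 : τ.reg 10 = 4 * n * (d + 1) + 2 ^ m
  num : ∀ (i : Fin n) (j : ℕ), j ≤ d →
    τ.mem (2 * i * (d + 1) + 2 * n * (d + 1) + j) = (φ.num i).coeff j
  den : ∀ (i : Fin n) (j : ℕ), j ≤ d →
    τ.mem (2 * i * (d + 1) + d + 1 + 2 * n * (d + 1) + j) = (φ.den i).coeff j

/-- The state after the first `i` coordinates have been treated. -/
structure IterInv {n : ℕ} (φ : RatParam n) (d m b : ℕ) (H : ℤ) (t₀ : ℤ) (l i : ℕ)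
    (τ : State) : Prop extends Base φ d m b H τ where
  r0 : τ.reg 0 = t₀
  r11 : τ.reg 11 = l
  euc : ∃ a pu pv, EucInv l d (euclidBase n d m) τ.mem (φ.crossIdeal t₀ l i) a 0 pu pv τ
  ok : τ.reg 16 =
    if ∀ k : Fin n, k.val < i → ((φ.reparam t₀).den k).coeff (φ.den k).natDegree ≠ 0 then 1 else 0
  lam0 : 0 ≤ τ.reg 15
  laml : τ.reg 15 < l
  lam_ne : τ.reg 15 ≠ 0 → ∃ k : Fin n, 0 < (φ.den k).natDegree ∧
    ((φ.cross t₀ k).coeff ((φ.den k).natDegree - 1) : ZMod l) = (τ.reg 15 : ℤ)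
  lam_eq : τ.reg 15 = 0 → ∀ k : Fin n, k.val < i → 0 < (φ.den k).natDegree →
    ((φ.cross t₀ k).coeff ((φ.den k).natDegree - 1) : ZMod l) = 0
  num_out : ∀ (k : Fin n) (j : ℕ), k.val < i → j ≤ d →
    τ.mem (2 * k * (d + 1) + j) = ((φ.reparam t₀).num k).coeff j
  den_out : ∀ (k : Fin n) (j : ℕ), k.val < i → j ≤ d →
    τ.mem (2 * k * (d + 1) + d + 1 + j) = ((φ.reparam t₀).den k).coeff j

/-- The treatment of one coordinate. -/
def coordBody : Stm :=
  findDegree ;; (21 <~ R 19 + R 3 ;; 22 <~ R 19) ;; transform ;;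
  (21 <~ R 19 + R 1 + 1 + R 3 ;; 22 <~ R 19 + R 1 + 1) ;; transform ;; crossStage ;; euclid

/-- The bound for the cost of `coordBody`. -/
def coordCost (d m b : ℕ) (H : ℤ) : ℕ :=
  (m + 1) * opc (4 * 2 ^ m * len (2 * H)) + (2 * d + 1) * ((d + 1) * opc (b + 4))

lemma eval_moebius_eq {t₀ x : ℤ} {D m : ℕ} {f : ℤ[X]} (hD : D < 2 ^ m) :
    ∑ i ∈ Finset.range (D + 1), f.coeff i * (t₀ * x + 1) ^ i * (x - t₀) ^ (D - i) =
      ∑ j ∈ Finset.range (2 ^ m), (RatParam.moebius t₀ D f).coeff j * x ^ j := by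
  rw [← RatParam.eval_moebius, eval_eq_sum_range'
    ((RatParam.natDegree_moebius_le t₀ D f).trans_lt hD)]

lemma len_le_of_le_two_pow {z : ℤ} {b : ℕ} (h0 : 0 ≤ z) (h : z ≤ 2 ^ b) : len z ≤ b + 2 := by
  rw [len_le_iff, abs_of_nonneg h0]
  exact h.trans_lt (by gcongr <;> norm_num)

/-- The effect of `coordBody`. -/
structure CoordPost {n : ℕ} (φ : RatParam n) (d m : ℕ) (t₀ : ℤ) (l : ℕ) (i : Fin n)
    (τ τ' : State) : Prop where
  euc : ∃ a pu pv, EucInv l d (euclidBase n d m) τ'.mem (φ.crossIdeal t₀ l (i + 1)) a 0 pu pv τ'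
  low : ∀ x, x < 2 * (i : ℕ) * ((d : ℤ) + 1) → τ'.mem x = τ.mem x
  copy : ∀ x, 2 * n * ((d : ℤ) + 1) ≤ x → x < 4 * n * ((d : ℤ) + 1) → τ'.mem x = τ.mem x
  num : ∀ j : ℕ, j ≤ d → τ'.mem (2 * (i : ℕ) * (d + 1) + j) = ((φ.reparam t₀).num i).coeff j
  den : ∀ j : ℕ, j ≤ d →
    τ'.mem (2 * (i : ℕ) * (d + 1) + d + 1 + j) = ((φ.reparam t₀).den i).coeff j
  r16 : τ'.reg 16 =
    if ((φ.reparam t₀).den i).coeff (φ.den i).natDegree = 0 then 0 else τ.reg 16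
  r15 : ∃ z : ℤ, 0 ≤ z ∧ z < l ∧ (0 < (φ.den i).natDegree →
      ((φ.cross t₀ i).coeff ((φ.den i).natDegree - 1) : ZMod l) = z) ∧
    τ'.reg 15 = if 0 < (φ.den i).natDegree ∧ 0 < z then z else τ.reg 15

-- With `S = 2n(d + 1)`, the cells below `S` receive the output, those from `S` to `2S` hold the
-- copy of the input, those from `2S` to `U` the work array and the table of powers (`2 ^ m` cells
-- each), and the two polynomials of the elimination begin at `U = euclidBase n d m`. Every stage
-- writes only in its own zone, so all frame conditions reduce to comparisons of addresses.
set_option maxHeartbeats 400000 in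
lemma IterInv.coordBody_post {n : ℕ} {φ : RatParam n} {d m b : ℕ} {H t₀ : ℤ} {l : ℕ} {τ : State}
    (hs : Setup φ d m b H) (ht0 : 0 ≤ t₀) (htb : t₀ < 2 ^ b) (hl : 0 < l) (hlb : l ≤ 2 ^ b)
    (i : Fin n) (h : IterInv φ d m b H t₀ l i τ) (r17 : τ.reg 17 = (i : ℕ)) :
    Tr coordBody τ [] (coordBody.κ * coordCost d m b H) (CoordPost φ d m t₀ l i τ) := by
  obtain ⟨a, pu, pv, he⟩ := h.euc
  obtain ⟨D, hDe⟩ : ∃ D, D = (φ.den i).natDegree := ⟨_, rfl⟩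
  have hD : D ≤ d := hDe ▸ hs.den_deg i
  obtain ⟨po, hpo⟩ : ∃ po : ℤ, po = 2 * (i : ℕ) * ((d : ℤ) + 1) := ⟨_, rfl⟩
  obtain ⟨S, hS⟩ : ∃ S : ℤ, S = 2 * n * ((d : ℤ) + 1) := ⟨_, rfl⟩
  have hW : 4 * (n : ℤ) * (d + 1) = 2 * S := by rw [hS]; ring
  obtain ⟨U, hU⟩ : ∃ U, U = euclidBase n d m := ⟨_, rfl⟩
  have hU' : U = 2 * S + 2 * 2 ^ m := by rw [hU, euclidBase, hW]
  have hpo0 : 0 ≤ po := by rw [hpo]; positivity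
  have hpoS : po + 2 * (d + 1) ≤ S := by
    have : ((i : ℕ) : ℤ) + 1 ≤ n := by exact_mod_cast i.2
    rw [hpo, hS]; nlinarith
  have hm0 : (0 : ℤ) < 2 ^ m := by positivity
  have hUb := hs.hU
  rw [← hU] at hUb he
  have hX4 : 4 ≤ 2 * H := by have := hs.hH; omega
  have hXU : U + 2 * (d + 1) ≤ 2 * H := by have := hs.hH; omega
  have hlX : 4 ≤ len (2 * H) := by
    have := len_mono' (x := 4) (y := 2 * H) (by norm_num) (by omega)
    have h4 : len 4 = 4 := rfl
    omega
  have lens : ∀ z : ℤ, 0 ≤ z → z ≤ U + 2 * (d + 1) → len z ≤ len (2 * H) := fun z h0 h1 =>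
    len_mono' h0 (by omega)
  have lenH : ∀ z : ℤ, |z| ≤ H → len z ≤ len (2 * H) := fun z h => len_mono (by
    rw [abs_of_nonneg (show 0 ≤ 2 * H by omega)]; omega)
  obtain ⟨Bc, hBc⟩ : ∃ Bc, Bc = opc (4 * 2 ^ m * len (2 * H)) := ⟨_, rfl⟩
  have hC : coordCost d m b H = (m + 1) * Bc + (2 * d + 1) * ((d + 1) * opc (b + 4)) := by
    rw [coordCost, ← hBc]
  have hC1 : (m + 1) * Bc ≤ coordCost d m b H := by omega
  have hC2 : (2 * d + 1) * ((d + 1) * opc (b + 4)) ≤ coordCost d m b H := by omega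
  have hC3 : (d + 1) * opc (len (2 * H)) ≤ coordCost d m b H := by
    refine le_trans ?_ hC1
    refine le_trans ?_ (Nat.le_mul_of_pos_left _ (Nat.succ_pos m))
    have := hs.hd
    refine (Nat.mul_le_mul_right _ (show d + 1 ≤ 4 * 2 ^ m by omega)).trans ?_
    rw [hBc]
    exact mul_opc_le (by omega)
  have hC4 : opc (len (2 * H)) ≤ coordCost d m b H :=
    (Nat.le_mul_of_pos_left _ (Nat.succ_pos d)).trans hC3
  have ld := lens d (by omega) (by omega)
  have lS := lens S (by omega) (by omega)
  have lpo := lens po (by omega) (by omega)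
  have li : len ((i : ℕ) : ℤ) ≤ len (2 * H) := lens _ (by omega) (by
    have : ((i : ℕ) : ℤ) ≤ n := by exact_mod_cast i.2.le
    nlinarith)
  have hmp : ((2 ^ m : ℕ) : ℤ) = 2 ^ m := by push_cast; rfl
  have r3 : τ.reg 3 = S := h.r3.trans hS.symm
  have hnum : ∀ (k : Fin n) (j : ℕ), j ≤ d → τ.mem (2 * k * (d + 1) + S + j) = (φ.num k).coeff j := by
    rw [hS]; exact h.num
  have hden : ∀ (k : Fin n) (j : ℕ), j ≤ d →
      τ.mem (2 * k * (d + 1) + d + 1 + S + j) = (φ.den k).coeff j := by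
    rw [hS]; exact h.den
  refine Tr.comp (findDegree_tr (D := D) h.r1 r3 r17 hD (f := (φ.den i).coeff) (hden i)
    (by rw [hDe, coeff_natDegree, leadingCoeff_ne_zero]; exact hs.den_ne i)
    (fun j hj _ => coeff_eq_zero_of_natDegree_lt (hDe ▸ hj)) (by omega) ld lS li (hpo ▸ lpo)
    (fun j => lenH _ (hs.inp i j).2) hC3) ?_
  rw [← hpo]
  rintro τ₁ a₁ ⟨m1, e19, e20⟩
  have e1 : τ₁.reg 1 = d := (a₁ 1 (by decide)).trans h.r1
  have e3 : τ₁.reg 3 = S := (a₁ 3 (by decide)).trans r3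
  refine Tr.comp (Q₁ := fun τ' => τ'.mem = τ.mem ∧ τ'.reg 21 = po + S ∧ τ'.reg 22 = po)
    (Tr.basic' rfl (w := len (2 * H)) (by omega) hC4 ?_ ?_) ?_
  · simp [Stm.Fits, Stm.run, e19, e3, lS, lpo]
  · simp [Stm.run, e19, e3, m1]
  rintro τ₂ a₂ ⟨m2, f21, f22⟩
  have A₂ := Agree.trans a₁ a₂
  refine Tr.comp ((transform_tr (d := d) (D := D) (a := (φ.num i).coeff)
    (c := ((φ.reparam t₀).num i).coeff) (Bc := Bc)
    ((A₂ 0 (by decide)).trans h.r0) ((A₂ 1 (by decide)).trans h.r1) ((A₂ 6 (by decide)).trans h.r6)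
    ((A₂ 7 (by decide)).trans h.r7) ((A₂ 8 (by decide)).trans h.r8)
    (((A₂ 9 (by decide)).trans h.r9).trans hW)
    (((A₂ 10 (by decide)).trans h.r10).trans (by rw [hW]))
    ((a₂ 20 (by decide)).trans e20) f21 f22 rfl hX4 hs.hd hD ht0 (by have := hs.hH; omega)
    (by omega) rfl (by omega) (by omega) (by omega) (by omega) (by omega) hBc.symm.le ?_ ?_ ?_ ?_
    ?_).mono (Nat.mul_le_mul_left _ hC1) fun _ _ h => h) ?_
  · intro j hj
    rw [m2, hpo]; exact hnum i j hj
  · exact fun j hj => coeff_eq_zero_of_natDegree_lt ((hs.num_deg i).trans_lt (hDe ▸ hj))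
  · exact fun j => (hs.inp i j).1.trans (by omega)
  · exact (eval_moebius_eq (hD.trans_lt hs.hd)).trans (by rw [hDe]; rfl)
  · exact fun j => (hs.out t₀ ht0 htb i j).1
  rintro τ₃ a₃ ⟨p3, m3⟩
  rw [m2] at m3
  have A₃ := Agree.trans A₂ a₃
  have e19' : τ₃.reg 19 = po := ((Agree.trans a₂ a₃) 19 (by decide)).trans e19
  refine Tr.comp (Q₁ := fun τ' => τ'.mem = τ₃.mem ∧ τ'.reg 21 = po + d + 1 + S ∧
      τ'.reg 22 = po + d + 1)
    (Tr.basic' rfl (w := len (2 * H)) (by omega) hC4 ?_ ?_) ?_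
  · simp [Stm.Fits, Stm.run, e19', (A₃ 3 (by decide)).trans r3, (A₃ 1 (by decide)).trans h.r1, lS,
      lpo, ld]
    omega
  · simp [Stm.run, e19', (A₃ 3 (by decide)).trans r3, (A₃ 1 (by decide)).trans h.r1]
  rintro τ₄ a₄ ⟨m4, f21, f22⟩
  have A₄ := Agree.trans A₃ a₄
  refine Tr.comp ((transform_tr (d := d) (D := D) (a := (φ.den i).coeff)
    (c := ((φ.reparam t₀).den i).coeff) (Bc := Bc)
    ((A₄ 0 (by decide)).trans h.r0) ((A₄ 1 (by decide)).trans h.r1) ((A₄ 6 (by decide)).trans h.r6)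
    ((A₄ 7 (by decide)).trans h.r7) ((A₄ 8 (by decide)).trans h.r8)
    (((A₄ 9 (by decide)).trans h.r9).trans hW)
    (((A₄ 10 (by decide)).trans h.r10).trans (by rw [hW]))
    ((((Agree.trans a₂ a₃).trans a₄) 20 (by decide)).trans e20) f21 f22 rfl hX4 hs.hd hD ht0
    (by have := hs.hH; omega)
    (by omega) rfl (by omega) (by omega) (by omega) (by omega) (by omega) hBc.symm.le ?_ ?_ ?_ ?_
    ?_).mono (Nat.mul_le_mul_left _ hC1) fun _ _ h => h) ?_
  · intro j hj
    rw [m4, m3 _ (by omega) (by omega), hpo]; exact hden i j hj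
  · exact fun j hj => coeff_eq_zero_of_natDegree_lt (hDe ▸ hj)
  · exact fun j => (hs.inp i j).2.trans (by omega)
  · exact (eval_moebius_eq (hD.trans_lt hs.hd)).trans (by rw [hDe]; rfl)
  · exact fun j => (hs.out t₀ ht0 htb i j).2
  rintro τ₅ a₅ ⟨p5, m5⟩
  rw [m4] at m5
  have A₅ := Agree.trans A₄ a₅
  have hl1 : (l : ℤ) ≤ 2 ^ b := by exact_mod_cast hlb
  have hpv : pv ≤ U + (d + 1) ∧ U ≤ pv := by rcases he.ptr with h | h <;> omega
  have lpv := lens (pv + d) (by omega) (by omega)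
  have g11 : τ₅.reg 11 = l := (A₅ 11 (by decide)).trans h.r11
  have g14 : τ₅.reg 14 = pv := (A₅ 14 (by decide)).trans he.r14
  have g15 : τ₅.reg 15 = τ.reg 15 := A₅ 15 (by decide)
  have g16 := (A₅ 16 (by decide)).trans h.ok
  refine Tr.comp (crossStage_tr (D := D) (P := ((φ.reparam t₀).num i).coeff)
    (Q := ((φ.reparam t₀).den i).coeff) ((A₅ 1 (by decide)).trans h.r1)
    (((Agree.trans a₄ a₅) 19 (by decide)).trans e19')
    (((((Agree.trans a₂ a₃).trans a₄).trans a₅) 20 (by decide)).trans e20) g14 g11 g15 g16 hl hD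
    ?_ p5 hpo0 (by omega) hlX lpv
    (len_mono' (by omega) (by have := hs.hH; omega))
    (fun j => lenH _ (hs.out t₀ ht0 htb i j).1.le) (fun j => lenH _ (hs.out t₀ ht0 htb i j).2.le)
    hC3) ?_
  · intro j hj
    rw [m5 _ (by omega) (by omega)]; exact p3 j hj
  rintro τ₆ a₆ ⟨v6, m6, f33, f16, f15⟩
  have A₆ := Agree.trans A₅ a₆
  have hlz : (l : ℤ) ≠ 0 := by omega
  have memU : ∀ x, U ≤ x → (x < pv ∨ pv + D ≤ x) → τ₆.mem x = τ.mem x := fun x hx hx' => by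
    rw [m6 x hx', m5 x (by omega) (by omega), m3 x (by omega) (by omega)]
  have memlow : ∀ x, x < po → τ₆.mem x = τ.mem x := fun x hx => by
    rw [m6 x (by omega), m5 x (by omega) (by omega), m3 x (by omega) (by omega)]
  have memS : ∀ x, S ≤ x → x < 2 * S → τ₆.mem x = τ.mem x := fun x hx hx' => by
    rw [m6 x (by omega), m5 x (by omega) (by omega), m3 x (by omega) (by omega)]
  have hvc : ∀ j : ℕ, j < D → τ₆.mem (pv + j) = (φ.cross t₀ i).coeff j % l := fun j hj => by
    rw [v6 j hj, RatParam.coeff_cross, hDe]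
  have he6 := he.adjoin (D := D) (τ' := τ₆)
    (g := (φ.cross t₀ i).map (Int.castRingHom (ZMod l))) hD (A₆ 11 (by decide)) (A₆ 12 (by decide))
    (A₆ 13 (by decide)) (A₆ 14 (by decide)) f33
    (fun j hj => memU _ (by rcases he.ptr with h | h <;> omega)
      (by have := he.ad; rcases he.ptr with h | h <;> omega))
    (fun j hj => by
      rw [v6 j hj]
      exact ⟨Int.emod_nonneg _ hlz, Int.emod_lt_of_pos _ (by omega)⟩) (by
      ext j
      rw [coeff_pol, coeff_map]
      split_ifs with hj
      · rw [hvc j hj, ZMod.intCast_mod]; rfl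
      · rw [RatParam.coeff_cross_eq_zero _ _ _ (by omega), map_zero])
  rw [← RatParam.crossIdeal_succ] at he6
  refine (he6.euclid_tr (w := b + 4) hl (by omega) (by omega)
    ((len_le_of_le_two_pow (by omega) hUb).trans (by omega))
    ((len_le_of_le_two_pow (by omega) hl1).trans (by omega)) hC2).mono le_rfl ?_
  rintro τ₇ a₇ ⟨a', pu', pv', he7⟩
  have A₇ := Agree.trans A₆ a₇
  have frame : ∀ x, x < U → τ₇.mem x = τ₆.mem x := fun x hx => he7.frame x (Or.inl hx)
  have e15 := (a₇ 15 (by decide)).trans f15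
  have e16 := (a₇ 16 (by decide)).trans f16
  have hlast : 0 < D → ((φ.cross t₀ i).coeff (D - 1) % l) = (((φ.reparam t₀).num i).coeff (D - 1) *
      ((φ.reparam t₀).den i).coeff D - ((φ.reparam t₀).den i).coeff (D - 1) *
      ((φ.reparam t₀).num i).coeff D) % l := fun _ => by rw [RatParam.coeff_cross, hDe]
  obtain ⟨z, hz⟩ : ∃ z, z = (((φ.reparam t₀).num i).coeff (D - 1) *
      ((φ.reparam t₀).den i).coeff D - ((φ.reparam t₀).den i).coeff (D - 1) *
      ((φ.reparam t₀).num i).coeff D) % l := ⟨_, rfl⟩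
  rw [← hz] at hlast e15
  have hz0 : 0 ≤ z := hz ▸ Int.emod_nonneg _ hlz
  have hzl : z < l := hz ▸ Int.emod_lt_of_pos _ (by omega)
  have hcz : 0 < D → ((φ.cross t₀ i).coeff (D - 1) : ZMod l) = (z : ℤ) := fun hD0 => by
    rw [← hlast hD0, ZMod.intCast_mod]
  refine ⟨?_, ?_, ?_, ?_, ?_, ?_, z, hz0, hzl, ?_, ?_⟩
  · obtain ⟨r11, r12, r33, r13, r14, ad, bd, ptr, ub, vb, frame, sound, complete⟩ := he7
    exact ⟨a', pu', pv', r11, r12, r33, r13, r14, ad, bd, hU ▸ ptr, ub, vb, fun _ _ => rfl, sound,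
      complete⟩
  · intro x hx
    rw [← hpo] at hx
    rw [frame _ (by omega), memlow _ hx]
  · intro x hx hx'
    rw [← hS] at hx
    rw [hW] at hx'
    rw [frame _ (by omega), memS _ hx hx']
  · intro j hj
    rw [← hpo, frame _ (by omega), m6 _ (by omega), m5 _ (by omega) (by omega)]
    exact p3 j hj
  · intro j hj
    rw [← hpo, frame _ (by omega), m6 _ (by omega)]
    exact p5 j hj
  · rw [e16, ← hDe, h.ok]
  · rw [← hDe]; exact hcz
  · rw [e15, ← hDe]

lemma CoordPost.iterInv {n : ℕ} {φ : RatParam n} {d m b : ℕ} {H t₀ : ℤ} {l : ℕ} {i : Fin n}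
    {τ τ' : State} (h' : CoordPost φ d m t₀ l i τ τ') (h : IterInv φ d m b H t₀ l i τ)
    (ha : Agree coordBody.writes τ τ') :
    IterInv φ d m b H t₀ l (i + 1) (τ'.setReg 17 ((i : ℕ) + 1)) := by
  obtain ⟨z, hz0, hzl, hcz, e15⟩ := h'.r15
  have hreg : ∀ r, r ≠ 17 → (τ'.setReg 17 ((i : ℕ) + 1)).reg r = τ'.reg r := fun r hr => by
    simp [hr]
  have hblk : ∀ k : Fin n, 0 ≤ 2 * ((k : ℕ) : ℤ) * (d + 1) ∧
      2 * ((k : ℕ) : ℤ) * (d + 1) + 2 * (d + 1) ≤ 2 * n * (d + 1) := fun k => by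
    have : ((k : ℕ) : ℤ) + 1 ≤ n := by exact_mod_cast k.2
    constructor
    · positivity
    · nlinarith
  have hlt : ∀ k : Fin n, k.val < i →
      2 * ((k : ℕ) : ℤ) * (d + 1) + 2 * (d + 1) ≤ 2 * (i : ℕ) * (d + 1) := fun k hk => by
    have : ((k : ℕ) : ℤ) + 1 ≤ (i : ℕ) := by exact_mod_cast hk
    nlinarith
  have h42 : 4 * (n : ℤ) * (d + 1) = 2 * (2 * n * (d + 1)) := by ring
  constructor
  · constructor
    · rw [hreg _ (by decide)]; exact (ha 1 (by decide)).trans h.r1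
    · rw [hreg _ (by decide)]; exact (ha 2 (by decide)).trans h.r2
    · rw [hreg _ (by decide)]; exact (ha 3 (by decide)).trans h.r3
    · rw [hreg _ (by decide)]; exact (ha 4 (by decide)).trans h.r4
    · rw [hreg _ (by decide)]; exact (ha 6 (by decide)).trans h.r6
    · rw [hreg _ (by decide)]; exact (ha 7 (by decide)).trans h.r7
    · rw [hreg _ (by decide)]; exact (ha 8 (by decide)).trans h.r8
    · rw [hreg _ (by decide)]; exact (ha 9 (by decide)).trans h.r9
    · rw [hreg _ (by decide)]; exact (ha 10 (by decide)).trans h.r10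
    · intro k j hj
      have := hblk k
      rw [State.mem_setReg, h'.copy _ (by omega) (by omega)]
      exact h.num k j hj
    · intro k j hj
      have := hblk k
      rw [State.mem_setReg, h'.copy _ (by omega) (by omega)]
      exact h.den k j hj
  · rw [hreg _ (by decide)]; exact (ha 0 (by decide)).trans h.r0
  · rw [hreg _ (by decide)]; exact (ha 11 (by decide)).trans h.r11
  · obtain ⟨a', pu', pv', r11, r12, r33, r13, r14, ad, bd, ptr, ub, vb, frame, sound, complete⟩ :=
      h'.euc
    exact ⟨a', pu', pv', r11, r12, r33, r13, r14, ad, bd, ptr, ub, vb, fun _ _ => rfl, sound,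
      complete⟩
  · rw [hreg _ (by decide), h'.r16, h.ok]
    by_cases h0 : ((φ.reparam t₀).den i).coeff (φ.den i).natDegree = 0
    · rw [if_pos h0, if_neg]
      intro hall
      exact hall i (by omega) h0
    · rw [if_neg h0]
      congr 1
      refine propext ⟨fun hall k hk => ?_, fun hall k hk => hall k (by omega)⟩
      rcases (Nat.lt_succ_iff.mp hk).eq_or_lt with hk | hk
      · rw [Fin.ext hk]; exact h0
      · exact hall k hk
  · rw [hreg _ (by decide), e15]
    split_ifs
    · exact hz0
    · exact h.lam0
  · rw [hreg _ (by decide), e15]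
    split_ifs
    · exact hzl
    · exact h.laml
  · rw [hreg _ (by decide), e15]
    split_ifs with hif
    · exact fun _ => ⟨i, hif.1, hcz hif.1⟩
    · exact h.lam_ne
  · rw [hreg _ (by decide), e15]
    split_ifs with hif
    · intro h0; omega
    · intro h0 k hk hk0
      rcases (Nat.lt_succ_iff.mp hk).eq_or_lt with hk | hk
      · rw [Fin.ext hk] at hk0 ⊢
        rw [hcz hk0, show z = 0 by omega, Int.cast_zero]
      · exact h.lam_eq h0 k hk hk0
  · intro k j hk hj
    rw [State.mem_setReg]
    rcases (Nat.lt_succ_iff.mp hk).eq_or_lt with hk | hk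
    · rw [Fin.ext hk]; exact h'.num j hj
    · have := hlt k hk
      rw [h'.low _ (by omega)]
      exact h.num_out k j hk hj
  · intro k j hk hj
    rw [State.mem_setReg]
    rcases (Nat.lt_succ_iff.mp hk).eq_or_lt with hk | hk
    · rw [Fin.ext hk]; exact h'.den j hj
    · have := hlt k hk
      rw [h'.low _ (by omega)]
      exact h.den_out k j hk hj

lemma IterInv.coordBody_tr {n : ℕ} {φ : RatParam n} {d m b : ℕ} {H t₀ : ℤ} {l : ℕ} {τ : State}
    (hs : Setup φ d m b H) (ht0 : 0 ≤ t₀) (htb : t₀ < 2 ^ b) (hl : 0 < l) (hlb : l ≤ 2 ^ b)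
    (i : Fin n) (h : IterInv φ d m b H t₀ l i τ) (r17 : τ.reg 17 = (i : ℕ)) :
    Tr coordBody τ [] (coordBody.κ * coordCost d m b H) (fun τ' =>
      IterInv φ d m b H t₀ l (i + 1) (τ'.setReg 17 ((i : ℕ) + 1))) :=
  (h.coordBody_post hs ht0 htb hl hlb i r17).mono le_rfl fun _ ha h' => h'.iterInv h ha

end BitRAM

/-! ### Certificates modulo a prime -/

namespace RatParam

variable {n : ℕ}

/-- A prime that shows that the point at infinity of `φ.reparam t₀` is not singular. -/
structure IsCert (φ : RatParam n) (t₀ : ℤ) (r : ℕ) : Prop where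
  prime : r.Prime
  den_ne : ∀ k, ((φ.reparam t₀).den k).coeff (φ.den k).natDegree ≠ 0
  top : φ.crossIdeal t₀ r n = ⊤
  ne : ∃ k, 0 < (φ.den k).natDegree ∧
    ((φ.cross t₀ k).coeff ((φ.den k).natDegree - 1) : ZMod r) ≠ 0

/-- This carries a membership computed modulo `l` over to each prime factor `r` of `l`. -/
lemma map_crossIdeal (φ : RatParam n) (t₀ : ℤ) {l r : ℕ} (h : r ∣ l) (i : ℕ) :
    (φ.crossIdeal t₀ l i).map (mapRingHom (ZMod.castHom h (ZMod r))) = φ.crossIdeal t₀ r i := by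
  rw [crossIdeal, crossIdeal, Ideal.map_span]
  congr 1
  ext f
  simp only [Set.mem_image, Set.mem_ofPred_eq]
  have key : ∀ k, mapRingHom (ZMod.castHom h (ZMod r))
      ((φ.cross t₀ k).map (Int.castRingHom (ZMod l))) =
      (φ.cross t₀ k).map (Int.castRingHom (ZMod r)) := fun k => by
    rw [coe_mapRingHom, Polynomial.map_map]
    congr 1
    exact RingHom.ext_int _ _
  constructor
  · rintro ⟨_, ⟨k, hk, rfl⟩, rfl⟩
    exact ⟨k, hk, key k⟩
  · rintro ⟨k, hk, rfl⟩
    exact ⟨_, ⟨k, hk, rfl⟩, key k⟩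

end RatParam

/-- An integer `l ≤ 2 ^ b` has at most `b` prime factors with multiplicity, so if each of them
divided `z`, then `l` would divide `z ^ b` and hence `z ^ 2 ^ b`. The latter power modulo `l` takes
only `b` squarings: a test for nilpotency without factoring `l`. -/
lemma exists_prime_not_dvd {l b : ℕ} {z : ℤ} (hlb : l ≤ 2 ^ b) (hl : 0 < l)
    (h : ¬ (l : ℤ) ∣ z ^ 2 ^ b) : ∃ r : ℕ, r.Prime ∧ r ∣ l ∧ ¬ (r : ℤ) ∣ z := by
  by_contra! hno
  suffices H : ∀ b l : ℕ, 0 < l → l ≤ 2 ^ b → (∀ r : ℕ, r.Prime → r ∣ l → (r : ℤ) ∣ z) →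
      (l : ℤ) ∣ z ^ b from
    h ((H b l hl hlb hno).trans (pow_dvd_pow _ Nat.lt_two_pow_self.le))
  intro b
  induction b with
  | zero =>
    intro l h0 h1 _
    obtain rfl : l = 1 := by rw [pow_zero] at h1; omega
    simp
  | succ b ih =>
    intro l h0 h1 hr
    rcases eq_or_ne l 1 with rfl | h2
    · simp
    · obtain ⟨l', hl'⟩ := Nat.minFac_dvd l
      have hp := Nat.minFac_prime h2
      obtain ⟨r, hre⟩ : ∃ r, r = l.minFac := ⟨_, rfl⟩
      rw [← hre] at hl' hp
      have h3 := hr r hp ⟨l', hl'⟩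
      have hpos : 0 < l' := Nat.pos_of_ne_zero (by rintro rfl; omega)
      have h4 := ih l' hpos (by
        have := Nat.mul_le_mul_right l' hp.two_le
        rw [pow_succ] at h1; omega) (fun q hq hql => hr q hq (hl' ▸ hql.mul_left r))
      rw [hl', pow_succ']
      push_cast
      exact mul_dvd_mul h3 h4

/-! ### One random attempt -/

namespace BitRAM

local notation "R" => AExp.reg
local notation "Mem" => AExp.load

lemma Tr.comp_tosses {s₁ s₂ : Stm} {σ : State} {l₁ l₂ : List Bool} {B : ℕ} {Q₁ Q₂ : State → Prop}
    (h₁ : Tr s₁ σ l₁ (s₁.κ * B) Q₁)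
    (h₂ : ∀ σ₁, Agree s₁.writes σ σ₁ → Q₁ σ₁ → Tr s₂ σ₁ l₂ (s₂.κ * B) Q₂) :
    Tr (s₁ ;; s₂) σ (l₁ ++ l₂) ((s₁ ;; s₂).κ * B) Q₂ :=
  (h₁.seq h₂).mono (by rw [Stm.κ, add_mul]) fun _ _ h => h

/-- The number with given binary digits, appended to the digits of `x`. -/
def ofBits (x : ℕ) (bs : List Bool) : ℕ := bs.foldl (fun a c => 2 * a + c.toNat) x

lemma ofBits_lt (x : ℕ) (bs : List Bool) : ofBits x bs < (x + 1) * 2 ^ bs.length := by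
  induction bs generalizing x with
  | nil => simp [ofBits]
  | cons c bs ih =>
    refine (ih (2 * x + c.toNat)).trans_le ?_
    rw [List.length_cons, pow_succ']
    have : 2 * x + c.toNat + 1 ≤ (x + 1) * 2 := by cases c <;> simp <;> omega
    calc _ ≤ (x + 1) * 2 * 2 ^ bs.length := Nat.mul_le_mul_right _ this
      _ = _ := by ring

lemma exists_ofBits (b y : ℕ) (h : y < 2 ^ b) : ∃ bs : List Bool, bs.length = b ∧ ofBits 0 bs = y := by
  induction b generalizing y with
  | zero => exact ⟨[], rfl, by simp [ofBits]; omega⟩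
  | succ b ih =>
    obtain ⟨bs, h1, h2⟩ := ih (y / 2) (by rw [pow_succ] at h; omega)
    refine ⟨bs ++ [decide (y % 2 = 1)], by simp [h1], ?_⟩
    rw [ofBits, List.foldl_append, show List.foldl _ 0 bs = ofBits 0 bs from rfl, h2,
      List.foldl_cons, List.foldl_nil]
    rcases Nat.mod_two_eq_zero_or_one y with h | h <;> simp [h] <;> omega

/-- Toss the coin as often as register `23` says. -/
def tossLoop (r : ℕ) : Stm := .iter (R 23) (.coin 24 ;; r <~ 2 * R r + R 24 ;; 23 <~ R 23 - 1)

lemma tossLoop_tr {r b : ℕ} (hr : r ≠ 23) (hr' : r ≠ 24) {bs : List Bool} {x : ℕ} {σ : State}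
    (h23 : σ.reg 23 = bs.length) (hx : σ.reg r = x) (hb : (x + 1) * 2 ^ bs.length ≤ 2 ^ b) :
    Tr (tossLoop r) σ bs ((tossLoop r).κ * ((bs.length + 1) * opc (b + 4))) (fun τ =>
      τ.mem = σ.mem ∧ τ.reg r = ofBits x bs) := by
  have hsmall : bs.length < 2 ^ b := by
    refine lt_of_lt_of_le Nat.lt_two_pow_self (le_trans ?_ hb)
    exact Nat.le_mul_of_pos_left _ (Nat.succ_pos x)
  have lsm : ∀ y : ℕ, y ≤ 2 ^ b → len y ≤ b + 4 := fun y hy =>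
    (len_le_of_le_two_pow (by omega) (by exact_mod_cast hy)).trans (by omega)
  have hf : (R 23).Fits σ (b + 4) := by
    rw [AExp.fits_reg, h23]
    exact lsm _ hsmall.le
  induction bs generalizing x σ with
  | nil =>
    refine ⟨_, _, .whileFalse hf (by simp [h23]), ?_, rfl, hx⟩
    rw [tossLoop, Stm.κ, List.length_nil, zero_add, one_mul, add_mul]
    exact Nat.le_add_right _ _
  | cons c bs ih =>
    have hb' : (2 * x + c.toNat + 1) * 2 ^ bs.length ≤ 2 ^ b := by
      refine le_trans ?_ hb
      rw [List.length_cons, pow_succ', ← mul_assoc]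
      exact Nat.mul_le_mul_right _ (by cases c <;> simp <;> omega)
    have hxb : x ≤ 2 ^ b := by
      refine le_trans ?_ hb
      exact (Nat.le_succ x).trans (Nat.le_mul_of_pos_right _ (by positivity))
    have lx := lsm x hxb
    have lc := lsm (bs.length + 1) hsmall.le
    have hbody : Tr (.coin 24 ;; r <~ 2 * R r + R 24 ;; 23 <~ R 23 - 1) σ [c]
        ((Stm.coin 24 ;; r <~ 2 * R r + R 24 ;; 23 <~ R 23 - 1).κ * opc (b + 4)) (fun τ =>
          τ.mem = σ.mem ∧ τ.reg 23 = bs.length ∧ τ.reg r = (2 * x + c.toNat : ℕ)) := by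
      refine Tr.comp_tosses (l₁ := [c]) (l₂ := [])
        (Q₁ := fun τ => τ.mem = σ.mem ∧ τ.reg 23 = σ.reg 23 ∧ τ.reg r = x ∧
          τ.reg 24 = (c.toNat : ℤ)) ⟨1, _, .coin σ 24 c, ?_, ?_⟩ ?_
      · rw [Stm.κ, one_mul]
        exact le_trans (by omega) (le_opc _)
      · refine ⟨rfl, by simp, by simp [hr', hx], by cases c <;> simp⟩
      · rintro τ - ⟨m1, e23, er, e24⟩
        rw [h23] at e23
        have lc24 : len ((c.toNat : ℕ) : ℤ) ≤ b + 4 := by cases c <;> simp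
        refine Tr.basic' rfl (w := b + 4) (by omega) le_rfl ?_ ?_
        · simp [Stm.Fits, Stm.run, er, e24, e23, hr.symm, lx, lc24]
          exact_mod_cast lc
        · simp [Stm.run, er, e24, e23, hr, hr.symm, m1]
    obtain ⟨k₁, σ₁, h₁, hk₁, m1, e23, er⟩ := hbody
    have hs1 : bs.length < 2 ^ b := by simp only [List.length_cons] at hsmall; omega
    obtain ⟨k₂, σ₂, h₂, hk₂, m2, e2⟩ := ih e23 er hb' hs1
      (by rw [AExp.fits_reg, e23]; exact lsm _ hs1.le)
    refine ⟨_, _, .whileTrue hf (by simp [h23]) h₁ h₂, ?_, m2.trans m1, e2⟩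
    have hk : (R 23).κ * opc (b + 4) + k₁ ≤ (tossLoop r).κ * opc (b + 4) := by
      rw [tossLoop, Stm.κ, add_mul]; omega
    rw [List.length_cons, add_mul _ 1, mul_add, one_mul]
    omega

/-- Decide whether the computed polynomial is a nonzero constant and whether its product with
register `15` is not nilpotent. -/
def finish : Stm :=
  36 <~ 0 ;;
  .iter (R 12 - 1) (12 <~ R 12 - 1 ;; .ite (Mem (R 13 + R 12)) (36 <~ 1) .skip) ;;
  .ite (R 12) (37 <~ R 15 * Mem (R 13) % R 11) (37 <~ 0) ;;
  .for 23 (R 4) (37 <~ R 37 * R 37 % R 11) ;;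
  .ite (R 16 * R 37 * (1 - R 36)) (18 <~ 0) .skip

/-- The scan visits the indices from `a - 1` down to `1` and notes a nonzero entry in register `36`,
because a stored length may exceed the true degree. Register `37` is the power with exponent `2 ^ b`
of `lam` times the constant term. All residues are nonnegative, so the product in the last guard is
positive exactly when every condition holds. -/
lemma finish_tr {σ : State} {a d b l : ℕ} {pu lam ok : ℤ} (r12 : σ.reg 12 = a)
    (r13 : σ.reg 13 = pu) (r11 : σ.reg 11 = l) (r4 : σ.reg 4 = b) (r15 : σ.reg 15 = lam)
    (r16 : σ.reg 16 = ok) (r18 : σ.reg 18 = 1) (had : a ≤ d) (hl : 0 < l) (hlb : l ≤ 2 ^ b)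
    (hpu : 0 ≤ pu) (hpd : pu + d ≤ 2 ^ b) (hok : ok = 0 ∨ ok = 1) (hlam0 : 0 ≤ lam)
    (hlam : lam < l)
    (hu : ∀ j : ℕ, j < a → 0 ≤ σ.mem (pu + j) ∧ σ.mem (pu + j) < l) {B : ℕ}
    (hB : (d + b + 2) * opc (b + 4) ≤ B) :
    Tr finish σ [] (finish.κ * B) (fun τ => τ.mem = σ.mem ∧ (τ.reg 18 = 0 ∨ τ.reg 18 = 1) ∧
      (τ.reg 18 = 0 ↔ 0 < a ∧ (∀ j : ℕ, 1 ≤ j → j < a → σ.mem (pu + j) = 0) ∧ ok = 1 ∧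
        ¬ (l : ℤ) ∣ (lam * σ.mem pu) ^ 2 ^ b)) := by
  have hB1 : opc (b + 4) ≤ B := le_trans (Nat.le_mul_of_pos_left _ (by omega)) hB
  have lsm : ∀ z : ℤ, 0 ≤ z → z ≤ 2 ^ b → len z ≤ b + 4 := fun z h0 h1 =>
    (len_le_of_le_two_pow h0 h1).trans (by omega)
  have hlz : (l : ℤ) ≤ 2 ^ b := by exact_mod_cast hlb
  have ll := lsm l (by omega) hlz
  have lpu := lsm pu hpu (by omega)
  have la := lsm a (by omega) (by omega)
  refine Tr.comp (Q₁ := fun τ => τ.mem = σ.mem ∧ τ.reg 36 = 0)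
    (Tr.basic' rfl (w := b + 4) (by omega) hB1 (by simp [Stm.Fits]) (by simp [Stm.run])) ?_
  rintro τ₁ a₁ ⟨m1, e36⟩
  have e12 := (a₁ 12 (by decide)).trans r12
  have e13 := (a₁ 13 (by decide)).trans r13
  refine Tr.comp ((Tr.loop (w := b + 4) (B := opc (b + 4)) (N := d + 1) (fun τ => τ.mem = σ.mem ∧
    ∃ c : ℕ, c ≤ a ∧ (0 < a → 0 < c) ∧ τ.reg 12 = c ∧ (τ.reg 36 = 0 ∨ τ.reg 36 = 1) ∧
      (τ.reg 36 = 0 ↔ ∀ j : ℕ, c ≤ j → j < a → σ.mem (pu + j) = 0)) (fun τ => (τ.reg 12).toNat)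
    le_rfl (by simp [e12]; omega)
    ⟨m1, a, le_rfl, id, e12, Or.inl e36, by simp [e36]; intro j h1 h2; omega⟩ ?_ ?_).mono
    (Nat.mul_le_mul_left _ ((Nat.mul_le_mul_right _ (by omega)).trans hB)) fun _ _ h => h) ?_
  · rintro τ - ⟨-, c, hc, -, h12, -⟩
    simp [h12]
    exact lsm _ (by omega) (by omega)
  · rintro τ a' ⟨m2, c, hc, hc0, h12, h36, hiff⟩ hcond
    simp [h12] at hcond
    obtain ⟨k, rfl⟩ : ∃ k, c = k + 1 := ⟨c - 1, by omega⟩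
    have g13 := (a' 13 (by decide)).trans e13
    have lk := lsm k (by omega) (by omega)
    have lk1 := lsm (k + 1) (by omega) (by omega)
    have huk := hu k (by omega)
    have lm := lsm _ huk.1 (huk.2.le.trans hlz)
    have hstep : (∀ j : ℕ, k ≤ j → j < a → σ.mem (pu + j) = 0) ↔
        σ.mem (pu + k) = 0 ∧ ∀ j : ℕ, k + 1 ≤ j → j < a → σ.mem (pu + j) = 0 := by
      constructor
      · exact fun h => ⟨h k le_rfl (by omega), fun j h1 h2 => h j (by omega) h2⟩
      · rintro ⟨h0, h⟩ j h1 h2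
        rcases h1.eq_or_lt with rfl | h1
        · exact h0
        · exact h j h1 h2
    refine Tr.basic' rfl (w := b + 4) (by omega) le_rfl ?_ ?_
    · simp [Stm.Fits, Stm.run, g13, h12, lk, lk1, lpu, m2, lm]
    · by_cases hz : 0 < σ.mem (pu + k)
      · refine ⟨⟨?_, k, by omega, by omega, ?_, Or.inr ?_, ?_⟩, ?_⟩
        · simp [Stm.run, g13, h12, m2, hz]
        · simp [Stm.run, g13, h12, m2, hz]
        · simp [Stm.run, g13, h12, m2, hz]
        · rw [hstep]; simp [Stm.run, g13, h12, m2, hz, hz.ne']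
        · simp [Stm.run, g13, h12, m2, hz]
      · have hz0 : σ.mem (pu + k) = 0 := le_antisymm (not_lt.mp hz) huk.1
        refine ⟨⟨?_, k, by omega, by omega, ?_, ?_, ?_⟩, ?_⟩
        · simp [Stm.run, g13, h12, m2, hz0]
        · simp [Stm.run, g13, h12, m2, hz0]
        · simpa [Stm.run, g13, h12, m2, hz0] using h36
        · rw [hstep, ← hiff]; simp [Stm.run, g13, h12, m2, hz0]
        · simp [Stm.run, g13, h12, m2, hz0]
  rintro τ₂ a₂ ⟨⟨m2, c, hc, hc0, h12, h36, hiff⟩, hcond⟩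
  simp [h12] at hcond
  have A₂ := Agree.trans a₁ a₂
  have g13 := (A₂ 13 (by decide)).trans r13
  have g11 := (A₂ 11 (by decide)).trans r11
  have g15 := (A₂ 15 (by decide)).trans r15
  have llam := lsm lam hlam0 (by omega)
  obtain ⟨v, hv⟩ : ∃ v, v = if 0 < a then lam * σ.mem pu else 0 := ⟨_, rfl⟩
  have hmod : ∀ z : ℤ, 0 ≤ z % l ∧ z % l < l := fun z =>
    ⟨Int.emod_nonneg _ (by omega), Int.emod_lt_of_pos _ (by omega)⟩
  refine Tr.comp (Q₁ := fun τ => τ.mem = σ.mem ∧ τ.reg 37 = v % l)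
    (Tr.basic' rfl (w := b + 4) (by omega) hB1 ?_ ?_) ?_
  · by_cases ha : 0 < a
    · have hc1 : c = 1 := by have := hc0 ha; omega
      have hu0 := hu 0 ha
      rw [Nat.cast_zero, add_zero] at hu0
      have lm := lsm _ hu0.1 (hu0.2.le.trans hlz)
      simp [Stm.Fits, h12, hc1, g13, g11, g15, m2, lpu, ll, llam, lm]
    · have hc1 : c = 0 := by omega
      simp [Stm.Fits, h12, hc1]
  · by_cases ha : 0 < a
    · have hc1 : c = 1 := by have := hc0 ha; omega
      simp [Stm.run, h12, hc1, g13, g11, g15, m2, hv, ha]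
    · have hc1 : c = 0 := by omega
      simp [Stm.run, h12, hc1, hv, ha, m2]
  rintro τ₃ a₃ ⟨m3, e37⟩
  have A₃ := Agree.trans A₂ a₃
  have f4 := (A₃ 4 (by decide)).trans r4
  have f11 := (A₃ 11 (by decide)).trans r11
  have lb := lsm b (by omega) (by exact_mod_cast Nat.lt_two_pow_self.le)
  refine Tr.comp ((Tr.for (w := b + 4) (B := opc (b + 4)) (N := b) (fun k τ => τ.mem = σ.mem ∧
      τ.reg 37 = v ^ 2 ^ k % l) (by decide) (by omega) lb le_rfl le_rfl ?_ ?_ ?_).mono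
      (Nat.mul_le_mul_left _ (le_trans (Nat.mul_le_mul_right _ (by omega)) hB))
      fun _ _ h => h) ?_
  · rintro τ' a' hm
    refine ⟨hm.trans m3, ?_⟩
    rw [a' 37 (by decide), e37]; simp
  · rintro τ' a'
    simp only [AExp.eval_reg, AExp.fits_reg, a' 4 (by decide), f4]
    exact ⟨trivial, lb⟩
  · rintro k hk τ' a' hτ hlk ⟨m4, h37⟩
    have g11 := (a' 11 (by decide)).trans f11
    have lz := lsm _ (hmod (v ^ 2 ^ k)).1 ((hmod (v ^ 2 ^ k)).2.le.trans hlz)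
    refine Tr.basic' rfl (w := b + 4) (by omega) le_rfl ?_ ?_
    · simp [Stm.Fits, g11, h37, lz, ll]
    · simp [Stm.run, g11, h37, m4]
      rw [pow_succ, pow_mul, sq, ← Int.mul_emod]
  rintro τ₄ a₄ ⟨m4, e37⟩
  have A₄ := Agree.trans A₃ a₄
  have f18 := (A₄ 18 (by decide)).trans r18
  have f16 := (A₄ 16 (by decide)).trans r16
  have f36 : τ₄.reg 36 = τ₂.reg 36 := (Agree.trans a₃ a₄) 36 (by decide)
  obtain ⟨z, hz⟩ : ∃ z, z = v ^ 2 ^ b % l := ⟨_, rfl⟩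
  rw [← hz] at e37
  have hz0 : 0 ≤ z := hz ▸ (hmod _).1
  have lz := lsm _ hz0 (hz ▸ (hmod (v ^ 2 ^ b)).2.le.trans hlz)
  have hdvd : z = 0 ↔ (l : ℤ) ∣ v ^ 2 ^ b := by
    rw [hz]; exact (Int.dvd_iff_emod_eq_zero).symm
  have hc2 : 0 < a → c = 1 := fun ha => by have := hc0 ha; omega
  have key : 0 < ok * z * (1 - τ₂.reg 36) ↔ 0 < a ∧
      (∀ j : ℕ, 1 ≤ j → j < a → σ.mem (pu + j) = 0) ∧ ok = 1 ∧
        ¬ (l : ℤ) ∣ (lam * σ.mem pu) ^ 2 ^ b := by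
    by_cases ha : 0 < a
    · rw [hc2 ha] at hiff
      rw [hv, if_pos ha] at hdvd
      rw [← hiff, ← hdvd]
      rcases hok with rfl | rfl <;> rcases h36 with h | h <;> simp [h, ha] <;> omega
    · have : z = 0 := hdvd.mpr (by rw [hv, if_neg ha, zero_pow (by positivity)]; simp)
      simp [this, ha]
  refine Tr.basic' rfl (w := b + 4) (by omega) hB1 ?_ ?_
  · simp [Stm.Fits, f16, e37, f36, lz]
    rcases hok with rfl | rfl <;> rcases h36 with h | h <;> simp [h]
  · by_cases hk : 0 < ok * z * (1 - τ₂.reg 36)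
    · simp only [Stm.run, AExp.eval_mul, AExp.eval_sub, AExp.eval_reg, f16, e37, f36,
        AExp.eval_ofNat, Nat.cast_one, if_pos hk]
      exact ⟨m4, Or.inl (by simp), by simp only [← key]; simpa using hk⟩
    · simp only [Stm.run, AExp.eval_mul, AExp.eval_sub, AExp.eval_reg, f16, e37, f36,
        AExp.eval_ofNat, Nat.cast_one, if_neg hk]
      exact ⟨m4, Or.inr f18, by simp only [← key, f18]; simpa using hk⟩

/-- One attempt: choose the parameter and the modulus, and check. -/
def attempt : Stm :=
  (0 <~ 0 ;; 23 <~ R 4) ;; tossLoop 0 ;; (11 <~ 0 ;; 23 <~ R 4) ;; tossLoop 11 ;;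
  (18 <~ 1 ;; 11 <~ R 11 + 1 ;; 12 <~ 0 ;; 33 <~ 0 ;; 15 <~ 0 ;; 16 <~ 1) ;;
  .for 17 (R 2) coordBody ;; finish

/-- The bound for the cost of `attempt`. -/
def attemptCost (n d m b : ℕ) (H : ℤ) : ℕ :=
  (n + 1) * coordCost d m b H + (d + b + 2) * opc (b + 4)

/-- The states between two attempts. -/
structure Ready {n : ℕ} (φ : RatParam n) (d m b : ℕ) (H : ℤ) (τ : State) : Prop
    extends Base φ d m b H τ where
  ptr : (τ.reg 13 = euclidBase n d m ∧ τ.reg 14 = euclidBase n d m + (d + 1)) ∨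
    (τ.reg 13 = euclidBase n d m + (d + 1) ∧ τ.reg 14 = euclidBase n d m)
  r18 : τ.reg 18 = 0 ∨ τ.reg 18 = 1
  result : τ.reg 18 = 0 → ∃ t₀ : ℕ, τ.reg 0 = t₀ ∧ t₀ < 2 ^ b ∧
    (φ.reparam t₀).StoredIn d τ.mem ∧ ∃ r, φ.IsCert t₀ r

lemma Base.of_agree {n : ℕ} {φ : RatParam n} {d m b : ℕ} {H : ℤ} {τ τ' : State}
    (h : Base φ d m b H τ) (hm : τ'.mem = τ.mem) {L : List ℕ} (ha : Agree L τ τ')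
    (hL : [1, 2, 3, 4, 6, 7, 8, 9, 10].all (fun r => !L.contains r)) : Base φ d m b H τ' := by
  simp only [List.all_cons, Bool.and_eq_true, Bool.not_eq_true', List.contains_eq_mem,
    decide_eq_false_iff_not] at hL
  obtain ⟨h1, h2, h3, h4, h6, h7, h8, h9, h10, -⟩ := hL
  exact ⟨(ha _ h1).trans h.r1, (ha _ h2).trans h.r2, (ha _ h3).trans h.r3, (ha _ h4).trans h.r4,
    (ha _ h6).trans h.r6, (ha _ h7).trans h.r7, (ha _ h8).trans h.r8, (ha _ h9).trans h.r9,
    (ha _ h10).trans h.r10, hm ▸ h.num, hm ▸ h.den⟩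

/-- A raised success flag is always justified, whatever `l` is; conversely success is guaranteed
only if `l` itself is a certifying prime. The modulus is the tossed number plus one, so it is never
zero and is at most `2 ^ b`. -/
theorem attempt_tr {n : ℕ} {φ : RatParam n} {d m b : ℕ} {H : ℤ} {σ : State}
    (hs : Setup φ d m b H) (h : Ready φ d m b H σ) {bs cs : List Bool} (hbs : bs.length = b)
    (hcs : cs.length = b) :
    Tr attempt σ (bs ++ cs) (attempt.κ * attemptCost n d m b H) (fun τ => Ready φ d m b H τ ∧
      (φ.IsCert (ofBits 0 bs) (ofBits 0 cs + 1) → τ.reg 18 = 0)) := by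
  obtain ⟨t₀, ht⟩ : ∃ t₀, t₀ = ofBits 0 bs := ⟨_, rfl⟩
  obtain ⟨l, hl⟩ : ∃ l, l = ofBits 0 cs + 1 := ⟨_, rfl⟩
  have htb : t₀ < 2 ^ b := by
    have := ofBits_lt 0 bs
    rw [hbs] at this; omega
  have hlb : l ≤ 2 ^ b := by
    have := ofBits_lt 0 cs
    rw [hcs] at this; omega
  have hl0 : 0 < l := by omega
  obtain ⟨B, hBe⟩ : ∃ B, B = attemptCost n d m b H := ⟨_, rfl⟩
  have hB2 : (d + b + 2) * opc (b + 4) ≤ B := by rw [hBe, attemptCost]; omega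
  have hB3 : (n + 1) * coordCost d m b H ≤ B := by rw [hBe, attemptCost]; omega
  have hB1 : opc (b + 4) ≤ B := le_trans (Nat.le_mul_of_pos_left _ (by omega)) hB2
  have hBb : (b + 1) * opc (b + 4) ≤ B := le_trans (Nat.mul_le_mul_right _ (by omega)) hB2
  have hUb := hs.hU
  have hU0 : 0 ≤ euclidBase n d m := by rw [euclidBase]; positivity
  have hUn : (n : ℤ) ≤ euclidBase n d m := by
    rw [euclidBase]
    have : (0 : ℤ) < 2 ^ m := by positivity
    nlinarith
  have lsm : ∀ z : ℤ, 0 ≤ z → z ≤ 2 ^ b → len z ≤ b + 4 := fun z h0 h1 =>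
    (len_le_of_le_two_pow h0 h1).trans (by omega)
  have lb := lsm b (by omega) (by exact_mod_cast Nat.lt_two_pow_self.le)
  have ln := lsm n (by omega) (by omega)
  rw [← ht, ← hl, ← hBe]
  have hlist : bs ++ cs = [] ++ (bs ++ ([] ++ (cs ++ ([] ++ [])))) := by simp
  rw [hlist]
  refine Tr.comp_tosses (Q₁ := fun τ => τ.mem = σ.mem ∧ τ.reg 0 = (0 : ℕ) ∧ τ.reg 23 = bs.length)
    (Tr.basic' rfl (w := b + 4) (by omega) hB1 ?_ ?_) ?_
  · simp [Stm.Fits, Stm.run, h.r4, lb]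
  · simp [Stm.run, h.r4, hbs]
  rintro τ₁ a₁ ⟨m1, e0, e23⟩
  refine Tr.comp_tosses ((tossLoop_tr (b := b) (by decide) (by decide) e23 e0 (by simp [hbs])).mono
    (Nat.mul_le_mul_left _ (hbs ▸ hBb)) fun _ _ h => h) ?_
  rintro τ₂ a₂ ⟨m2, e0⟩
  have A₂ := Agree.trans a₁ a₂
  have e4 := (A₂ 4 (by decide)).trans h.r4
  refine Tr.comp_tosses (Q₁ := fun τ => τ.mem = τ₂.mem ∧ τ.reg 11 = (0 : ℕ) ∧
    τ.reg 23 = cs.length) (Tr.basic' rfl (w := b + 4) (by omega) hB1 ?_ ?_) ?_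
  · simp [Stm.Fits, Stm.run, e4, lb]
  · simp [Stm.run, e4, hcs]
  rintro τ₃ a₃ ⟨m3, e11, e23⟩
  refine Tr.comp_tosses ((tossLoop_tr (b := b) (by decide) (by decide) e23 e11
    (by simp [hcs])).mono (Nat.mul_le_mul_left _ (hcs ▸ hBb)) fun _ _ h => h) ?_
  rintro τ₄ a₄ ⟨m4, e11⟩
  have l11 := lsm (ofBits 0 cs) (by omega) (by exact_mod_cast (show ofBits 0 cs ≤ 2 ^ b by omega))
  refine Tr.comp_tosses (Q₁ := fun τ => τ.mem = τ₄.mem ∧ τ.reg 18 = 1 ∧ τ.reg 11 = l ∧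
    τ.reg 12 = 0 ∧ τ.reg 33 = 0 ∧ τ.reg 15 = 0 ∧ τ.reg 16 = 1)
    (Tr.basic' rfl (w := b + 4) (by omega) hB1 ?_ ?_) ?_
  · simp [Stm.Fits, Stm.run, e11, l11]
  · simp [Stm.run, e11, hl]
  rintro τ₅ a₅ ⟨m5, e18, e11, e12, e33, e15, e16⟩
  have hm : τ₅.mem = σ.mem := by rw [m5, m4, m3, m2, m1]
  have A := ((((Agree.trans a₁ a₂).trans a₃).trans a₄).trans a₅)
  have hbase : Base φ d m b H τ₅ := h.toBase.of_agree hm A (by decide)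
  have e0 : τ₅.reg 0 = t₀ := by
    rw [((Agree.trans a₃ a₄).trans a₅) 0 (by decide), e0, ht]
  refine Tr.comp ((Tr.for (w := b + 4) (B := coordCost d m b H) (N := n) (fun k τ =>
      IterInv φ d m b H t₀ l k (τ.setReg 17 k) ∧ τ.reg 18 = 1) (by decide) (by omega) ln ?_
      le_rfl ?_ ?_ ?_).mono (Nat.mul_le_mul_left _ hB3) fun _ _ h => h) ?_
  · rw [coordCost]
    refine le_trans ?_ (Nat.le_add_left _ _)
    rw [← mul_assoc]
    exact Nat.le_mul_of_pos_left _ (by positivity)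
  · rintro τ a hm'
    have g : ∀ r, r ≠ 17 → (τ.setReg 17 (0 : ℕ)).reg r = τ₅.reg r := fun r hr => by
      rw [State.reg_setReg, if_neg hr]; exact a r (by simpa using hr)
    have ag : Agree [17] τ₅ (τ.setReg 17 (0 : ℕ)) := fun r hr => g r (by simpa using hr)
    refine ⟨⟨hbase.of_agree hm' ag (by decide), ?_, ?_, ?_, ?_, ?_, ?_, ?_, ?_, ?_, ?_⟩, ?_⟩
    · rw [g _ (by decide), e0]
    · rw [g _ (by decide), e11]
    -- Two empty polynomials generate the zero ideal, so the pointers left by an earlier attempt can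
    -- be used in either order.
    · refine ⟨0, σ.reg 13, σ.reg 14, ?_⟩
      constructor
      · rw [g _ (by decide), e11]
      · rw [g _ (by decide), e12]; rfl
      · rw [g _ (by decide), e33]; rfl
      · rw [g _ (by decide), A 13 (by decide)]
      · rw [g _ (by decide), A 14 (by decide)]
      · omega
      · omega
      · exact h.ptr
      · intro j hj; omega
      · intro j hj; omega
      · exact fun _ _ => rfl
      · simp [RatParam.crossIdeal_zero]
      · simp [RatParam.crossIdeal_zero]
    · rw [g _ (by decide), e16, if_pos]; intro k hk; omega
    · rw [g _ (by decide), e15]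
    · rw [g _ (by decide), e15]; omega
    · rw [g _ (by decide), e15]; intro h; exact absurd rfl h
    · intro _ k hk; omega
    · intro k j hk; omega
    · intro k j hk; omega
    · rw [a 18 (by decide), e18]
  · rintro τ a
    simp only [AExp.eval_reg, AExp.fits_reg, a 2 (by decide), hbase.r2]
    exact ⟨trivial, ln⟩
  · rintro k hk τ a h17 hlk ⟨hi, h18⟩
    have heq : τ.setReg 17 k = τ := by
      cases τ
      simp only [State.setReg] at h17 ⊢
      rw [← h17, Function.update_eq_self]
    rw [heq] at hi
    refine (hi.coordBody_tr hs (by omega) (by exact_mod_cast htb) hl0 hlb ⟨k, hk⟩ h17).mono le_rfl ?_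
    rintro τ' a' h'
    have hss : (τ'.setReg 17 ((k : ℤ) + 1)).setReg 17 ((k + 1 : ℕ) : ℤ) =
        τ'.setReg 17 ((k : ℤ) + 1) := by
      simp [State.setReg]
    refine ⟨?_, ?_⟩
    · rw [hss]; exact h'
    · rw [State.reg_setReg, if_neg (by decide), a' 18 (by decide), h18]
  rintro τ₆ a₆ ⟨hi, h18⟩
  have hreg : ∀ r, r ≠ 17 → (τ₆.setReg 17 (n : ℤ)).reg r = τ₆.reg r := fun r hr => by simp [hr]
  obtain ⟨a, pu, pv, he⟩ := hi.euc
  obtain ⟨lam, hlam⟩ : ∃ lam, lam = τ₆.reg 15 := ⟨_, rfl⟩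
  have q15 : (τ₆.setReg 17 (n : ℤ)).reg 15 = lam := (hreg 15 (by decide)).trans hlam.symm
  have hok := hi.ok
  have hl0' := hi.lam0
  have hll' := hi.laml
  have hlne := hi.lam_ne
  have hleq := hi.lam_eq
  rw [q15] at hl0' hll' hlne hleq
  rw [hreg _ (by decide)] at hok
  have hP : ∀ k : Fin n, k.val < n := fun k => k.2
  have hokp : (∀ k : Fin n, k.val < n →
      ((φ.reparam t₀).den k).coeff (φ.den k).natDegree ≠ 0) ↔ τ₆.reg 16 = 1 := by
    rw [hok]
    split_ifs with h
    · exact ⟨fun _ => rfl, fun _ => h⟩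
    · exact ⟨fun h' => absurd h' h, fun h' => by norm_num at h'⟩
  have hsound := he.sound
  have hcomp := he.complete
  rw [pol_zero, Ideal.span_insert, Ideal.span_singleton_zero, sup_bot_eq] at hsound hcomp
  refine (finish_tr (a := a) (d := d) (b := b) (l := l) (pu := pu) (lam := lam)
    (ok := τ₆.reg 16) ((hreg 12 (by decide)).symm.trans he.r12)
    ((hreg 13 (by decide)).symm.trans he.r13) ((hreg 11 (by decide)).symm.trans he.r11)
    ((hreg 4 (by decide)).symm.trans hi.r4) hlam.symm rfl h18 he.ad hl0 hlb
    (by rcases he.ptr with h | h <;> omega) (by rcases he.ptr with h | h <;> omega)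
    (by rw [hok]; split_ifs <;> simp) hl0' hll' he.ub hB2).mono le_rfl ?_
  rintro τ₇ a₇ ⟨m7, h18, hiff⟩
  have hag : Agree (17 :: finish.writes) (τ₆.setReg 17 (n : ℤ)) τ₇ := fun r hr => by
    simp only [List.mem_cons, not_or] at hr
    rw [a₇ r hr.2, hreg r hr.1]
  refine ⟨⟨hi.toBase.of_agree m7 hag (by decide), ?_, h18, ?_⟩, ?_⟩
  · rw [hag 13 (by decide), hag 14 (by decide), he.r13, he.r14]; exact he.ptr
  · intro h0
    obtain ⟨ha0, hz, hok1, hnd⟩ := hiff.mp h0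
    refine ⟨t₀, ?_, htb, ?_, ?_⟩
    · rw [hag 0 (by decide), hi.r0]
    · intro k j hj
      rw [m7]
      have h1 := hi.num_out k j k.2 hj
      have h2 := hi.den_out k j k.2 hj
      rw [State.mem_setReg] at h1 h2
      push_cast
      refine ⟨h1, ?_⟩
      rw [← h2]
      congr 1
      ring
    -- The prime `r` divides neither `lam` nor the constant term. As the other coefficients are
    -- zero, a constant that is nonzero modulo `r` lies in the ideal.
    · obtain ⟨r, hr, hrl, hrz⟩ := exists_prime_not_dvd hlb hl0 hnd
      have := Fact.mk hr
      have hlamr : ((lam : ℤ) : ZMod r) ≠ 0 := fun h0 => hrz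
        (((ZMod.intCast_zmod_eq_zero_iff_dvd _ _).mp h0).mul_right _)
      have hcr : ((τ₆.mem pu : ℤ) : ZMod r) ≠ 0 := fun h0 => hrz
        (((ZMod.intCast_zmod_eq_zero_iff_dvd _ _).mp h0).mul_left _)
      refine ⟨r, hr, fun k => hokp.mpr hok1 k k.2, ?_, ?_⟩
      · have hpol : pol (ZMod l) τ₆.mem pu a = Polynomial.C ((τ₆.mem pu : ℤ) : ZMod l) := by
          ext j
          rw [coeff_pol, coeff_C]
          rcases Nat.eq_zero_or_pos j with rfl | hj
          · simp [ha0]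
          · rw [if_neg (show j ≠ 0 by omega)]
            split_ifs with hja
            · rw [hz j hj hja, Int.cast_zero]
            · rfl
        have hmem : Polynomial.C ((τ₆.mem pu : ℤ) : ZMod l) ∈ φ.crossIdeal t₀ l n := by
          refine hsound ?_
          rw [← hpol]
          exact Ideal.subset_span rfl
        have h1 := Ideal.mem_map_of_mem (mapRingHom (ZMod.castHom hrl (ZMod r))) hmem
        rw [RatParam.map_crossIdeal, coe_mapRingHom, map_C, map_intCast] at h1
        exact Ideal.eq_top_of_isUnit_mem _ h1 (isUnit_C.mpr (isUnit_iff_ne_zero.mpr hcr))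
      · obtain ⟨k, hk0, hk⟩ := hlne (by rintro rfl; simp at hlamr)
        refine ⟨k, hk0, ?_⟩
        have h1 := congrArg (ZMod.castHom hrl (ZMod r)) hk
        rw [map_intCast, map_intCast] at h1
        rw [h1]; exact hlamr
  -- For prime `l` the remaining polynomial generates the whole ideal, hence is a unit and a nonzero
  -- constant. Residues lie in `[0, l)`, so divisibility by `l` means equality with zero.
  · intro hcert
    have := Fact.mk hcert.prime
    rw [hiff]
    have hspan := hcomp hcert.prime
    rw [hcert.top, top_le_iff, Ideal.span_singleton_eq_top] at hspan
    obtain ⟨c, hcu, hc⟩ := Polynomial.isUnit_iff.mp hspan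
    have hcoef : ∀ j : ℕ, j < a → ((τ₆.mem (pu + j) : ℤ) : ZMod l) = if j = 0 then c else 0 := by
      intro j hj
      have := congrArg (fun f => Polynomial.coeff f j) hc
      simp only [coeff_pol, coeff_C, if_pos hj] at this
      exact this.symm
    have ha0 : 0 < a := by
      by_contra h0
      obtain rfl : a = 0 := by omega
      rw [pol_zero] at hspan
      exact not_isUnit_zero hspan
    have hlp := Nat.prime_iff_prime_int.mp hcert.prime
    refine ⟨ha0, fun j h1 h2 => ?_, hokp.mp fun k _ => hcert.den_ne k, fun hdvd => ?_⟩
    · have h3 := hcoef j h2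
      rw [if_neg (by omega), ZMod.intCast_zmod_eq_zero_iff_dvd] at h3
      have h4 := he.ub j h2
      exact Int.eq_zero_of_dvd_of_nonneg_of_lt h4.1 h4.2 h3
    · rcases hlp.dvd_or_dvd (hlp.dvd_of_dvd_pow hdvd) with h1 | h1
      · have h2 : lam = 0 := Int.eq_zero_of_dvd_of_nonneg_of_lt hl0' hll' h1
        obtain ⟨k, hk0, hk⟩ := hcert.ne
        exact hk (hleq h2 k k.2 hk0)
      · have h2 := hcoef 0 ha0
        rw [Nat.cast_zero, add_zero, if_pos rfl,
          (ZMod.intCast_zmod_eq_zero_iff_dvd _ _).mpr h1] at h2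
        exact hcu.ne_zero h2.symm

end BitRAM

/-! ### Initialization: the copy of the input and the parameters `b`, `m`, `H` -/

namespace BitRAM

local notation "R" => AExp.reg
local notation "Mem" => AExp.load

/-- Compute the least power of two that exceeds register `x`, and its exponent. -/
def powerLoop (x dst cnt : ℕ) : Stm :=
  (dst <~ 1 ;; cnt <~ 0) ;; .iter (R x - R dst + 1) (dst <~ 2 * R dst ;; cnt <~ R cnt + 1)

lemma powerLoop_tr {x dst cnt w c N : ℕ} {σ : State} {z : ℤ} (h₁ : x ≠ dst) (h₂ : x ≠ cnt)
    (h₃ : dst ≠ cnt) (hz : σ.reg x = z) (hc : z < 2 ^ c) (hc' : ∀ j < c, (2 : ℤ) ^ j ≤ z)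
    (hw : 3 ≤ w) (hlen : len (2 ^ c) ≤ w) (lz : len z ≤ w) (hN : c + 1 ≤ N) :
    Tr (powerLoop x dst cnt) σ [] ((powerLoop x dst cnt).κ * (N * opc w)) (fun τ =>
      τ.mem = σ.mem ∧ τ.reg dst = 2 ^ c ∧ τ.reg cnt = c) := by
  have hB1 : opc w ≤ N * opc w := Nat.le_mul_of_pos_left _ (by omega)
  have lpow : ∀ j : ℕ, j ≤ c → len (2 ^ j) ≤ w ∧ len j ≤ w := fun j hj => by
    have h1 : (2 : ℤ) ^ j ≤ 2 ^ c := pow_le_pow_right₀ (by norm_num) hj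
    have h2 : (j : ℤ) ≤ 2 ^ j := by exact_mod_cast Nat.lt_two_pow_self.le
    exact ⟨(len_mono' (by positivity) h1).trans hlen,
      (len_mono' (by omega) (h2.trans h1)).trans hlen⟩
  refine Tr.comp (Q₁ := fun τ => τ.mem = σ.mem ∧ τ.reg dst = 1 ∧ τ.reg cnt = 0)
    (Tr.basic' rfl (w := w) (by omega) hB1 ?_ ?_) ?_
  · simp [Stm.Fits]; omega
  · simp [Stm.run, h₃]
  rintro τ₁ a₁ ⟨m1, e1, e2⟩
  have ex : τ₁.reg x = z := (a₁ x (by simp [Stm.writes, h₁, h₂])).trans hz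
  refine (Tr.loop (w := w) (B := opc w) (N := N) (fun τ => τ.mem = σ.mem ∧ ∃ j : ℕ, j ≤ c ∧
    τ.reg dst = 2 ^ j ∧ τ.reg cnt = j) (fun τ => c - (τ.reg cnt).toNat) le_rfl (by simp [e2]; omega)
    ⟨m1, 0, by omega, by simpa using e1, by simpa using e2⟩ ?_ ?_).mono le_rfl ?_
  · rintro τ a ⟨-, j, hj, f1, f2⟩
    have fx := (a x (by simp [Stm.writes, h₁, h₂])).trans ex
    simp [fx, f1, lz, (lpow j hj).1]; omega
  · rintro τ a ⟨m2, j, hj, f1, f2⟩ hcond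
    have fx := (a x (by simp [Stm.writes, h₁, h₂])).trans ex
    have hjc : j < c := by
      rcases hj.eq_or_lt with rfl | h
      · simp [fx, f1] at hcond; omega
      · exact h
    refine Tr.basic' rfl (w := w) (by omega) le_rfl ?_ ?_
    · simp [Stm.Fits, Stm.run, f1, f2, h₃.symm, (lpow j hj).1, (lpow j hj).2]; omega
    · refine ⟨⟨?_, j + 1, by omega, ?_, ?_⟩, ?_⟩
      · simp [Stm.run, m2]
      · simp [Stm.run, f1, h₃, pow_succ']
      · simp [Stm.run, f2, h₃.symm]
      · simp [Stm.run, f2, h₃.symm]; omega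
  · rintro τ a ⟨⟨m2, j, hj, f1, f2⟩, hcond⟩
    have fx := (a x (by simp [Stm.writes, h₁, h₂])).trans ex
    have hjc : j = c := by
      by_contra hne
      have := hc' j (by omega)
      simp [fx, f1] at hcond; omega
    subst hjc
    exact ⟨m2, f1, f2⟩

/-- Compute a bound for the length of register `41`. -/
def squareLoop : Stm :=
  (42 <~ 1 ;; 43 <~ 2 ;; 36 <~ 0) ;;
  .iter (R 41 - R 43 + 1) (43 <~ R 43 * R 43 ;; 42 <~ 2 * R 42 ;; 36 <~ R 36 + 1)

/-- The size `τ` is not part of the input, so the length of the coefficients has to be measured.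
Repeated squaring reaches it after `c` steps, logarithmic in the length; doubling would take as many
passes over long numbers as there are bits. -/
lemma squareLoop_tr {w c N : ℕ} {σ : State} {z : ℤ} (hz : σ.reg 41 = z) (hc : z < 2 ^ 2 ^ c)
    (hc' : ∀ j < c, (2 : ℤ) ^ 2 ^ j ≤ z) (hw : 3 ≤ w) (hlen : len (2 ^ 2 ^ c) ≤ w) (lz : len z ≤ w)
    (hN : c + 1 ≤ N) :
    Tr squareLoop σ [] (squareLoop.κ * (N * opc w)) (fun τ =>
      τ.mem = σ.mem ∧ τ.reg 42 = 2 ^ c) := by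
  have hB1 : opc w ≤ N * opc w := Nat.le_mul_of_pos_left _ (by omega)
  have lpow : ∀ j : ℕ, j ≤ c → len (2 ^ 2 ^ j) ≤ w ∧ len (2 ^ j) ≤ w ∧ len j ≤ w := fun j hj => by
    have h1 : (2 : ℤ) ^ 2 ^ j ≤ 2 ^ 2 ^ c :=
      pow_le_pow_right₀ (by norm_num) (Nat.pow_le_pow_right (by norm_num) hj)
    have h2 : (2 : ℤ) ^ j ≤ 2 ^ 2 ^ j :=
      pow_le_pow_right₀ (by norm_num) Nat.lt_two_pow_self.le
    have h3 : (j : ℤ) ≤ 2 ^ j := by exact_mod_cast Nat.lt_two_pow_self.le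
    exact ⟨(len_mono' (by positivity) h1).trans hlen,
      (len_mono' (by positivity) (h2.trans h1)).trans hlen,
      (len_mono' (by omega) (h3.trans (h2.trans h1))).trans hlen⟩
  refine Tr.comp (Q₁ := fun τ => τ.mem = σ.mem ∧ τ.reg 42 = 1 ∧ τ.reg 43 = 2 ∧ τ.reg 36 = 0)
    (Tr.basic' rfl (w := w) (by omega) hB1 ?_ ?_) ?_
  · simp [Stm.Fits]; omega
  · simp [Stm.run]
  rintro τ₁ a₁ ⟨m1, e1, e2, e3⟩
  have ex : τ₁.reg 41 = z := (a₁ 41 (by decide)).trans hz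
  refine (Tr.loop (w := w) (B := opc w) (N := N) (fun τ => τ.mem = σ.mem ∧ ∃ j : ℕ, j ≤ c ∧
    τ.reg 42 = 2 ^ j ∧ τ.reg 43 = 2 ^ 2 ^ j ∧ τ.reg 36 = j) (fun τ => c - (τ.reg 36).toNat) le_rfl
    (by simp [e3]; omega)
    ⟨m1, 0, by omega, by simpa using e1, by simpa using e2, by simpa using e3⟩ ?_ ?_).mono le_rfl ?_
  · rintro τ a ⟨-, j, hj, f1, f2, f3⟩
    have fx := (a 41 (by decide)).trans ex
    simp [fx, f2, lz, (lpow j hj).1]; omega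
  · rintro τ a ⟨m2, j, hj, f1, f2, f3⟩ hcond
    have fx := (a 41 (by decide)).trans ex
    have hjc : j < c := by
      rcases hj.eq_or_lt with rfl | h
      · simp [fx, f2] at hcond; omega
      · exact h
    obtain ⟨l1, l2, l3⟩ := lpow j hj
    refine Tr.basic' rfl (w := w) (by omega) le_rfl ?_ ?_
    · simp [Stm.Fits, Stm.run, f1, f2, f3, l1, l2, l3]; omega
    · refine ⟨⟨?_, j + 1, by omega, ?_, ?_, ?_⟩, ?_⟩
      · simp [Stm.run, m2]
      · simp [Stm.run, f1, pow_succ']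
      · simp [Stm.run, f2]; ring
      · simp [Stm.run, f3]
      · simp [Stm.run, f3]; omega
  · rintro τ a ⟨⟨m2, j, hj, f1, f2, f3⟩, hcond⟩
    have fx := (a 41 (by decide)).trans ex
    have hjc : j = c := by
      by_contra hne
      have := hc' j (by omega)
      simp [fx, f2] at hcond; omega
    subst hjc
    exact ⟨m2, f1⟩

/-- Copy the input and compute a number that exceeds the sum of the squares of the coefficients. -/
def copyInput : Stm :=
  (2 <~ R 0 ;; 3 <~ 2 * R 2 * (R 1 + 1) ;; 41 <~ 1) ;;
  .for 23 (R 3) (.st (R 23 + R 3) (Mem (R 23)) ;; 41 <~ R 41 + Mem (R 23) * Mem (R 23))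

/-- The copy is needed since the output overwrites the cells of the input. Squares bound the
absolute values of integers without sign tests, and one sum bounds all coefficients at the same
time. -/
lemma copyInput_tr {σ : State} {n d w N : ℕ} {f : ℤ → ℤ} {M : ℤ} (r0 : σ.reg 0 = n)
    (r1 : σ.reg 1 = d) (hm : σ.mem = f) (hw : 3 ≤ w) (lS : len (2 * n * (d + 1)) ≤ w)
    (hM : M = 1 + ∑ j ∈ Finset.range (2 * n * (d + 1)), f j ^ 2) (lM : len M ≤ w)
    (ln : len n ≤ w) (ld : len d ≤ w) (hN : 2 * n * (d + 1) + 1 ≤ N) :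
    Tr copyInput σ [] (copyInput.κ * (N * opc w)) (fun τ =>
      τ.reg 2 = n ∧ τ.reg 3 = 2 * n * (d + 1) ∧ τ.reg 41 = M ∧
      ∀ j : ℕ, j < 2 * n * (d + 1) → τ.mem (j + 2 * n * (d + 1)) = f j) := by
  have hB1 : opc w ≤ N * opc w := Nat.le_mul_of_pos_left _ (by omega)
  obtain ⟨S, hS⟩ : ∃ S, S = 2 * n * (d + 1) := ⟨_, rfl⟩
  have hSz : 2 * (n : ℤ) * (d + 1) = S := by rw [hS]; push_cast; rfl
  rw [hSz] at lS ⊢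
  rw [← hS] at hM hN ⊢
  have hsum : ∀ k ≤ S, 1 + ∑ j ∈ Finset.range k, f j ^ 2 ≤ M := fun k hk => by
    rw [hM]
    have := Finset.sum_le_sum_of_subset_of_nonneg (f := fun j : ℕ => f j ^ 2)
      (Finset.range_subset_range.mpr hk) fun j _ _ => sq_nonneg (f j)
    linarith
  have hsum0 : ∀ k : ℕ, 0 ≤ ∑ j ∈ Finset.range k, f j ^ 2 := fun k =>
    Finset.sum_nonneg fun j _ => sq_nonneg (f j)
  refine Tr.comp (Q₁ := fun τ => τ.mem = f ∧ τ.reg 2 = n ∧ τ.reg 3 = S ∧ τ.reg 41 = 1)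
    (Tr.basic' rfl (w := w) (by omega) hB1 ?_ ?_) ?_
  · simp [Stm.Fits, Stm.run, r0, r1, ln, ld]; omega
  · simp [Stm.run, r0, r1, hSz, hm]
  rintro τ₁ a₁ ⟨m1, e2, e3, e41⟩
  refine (Tr.for (w := w) (B := opc w) (N := S) (fun k τ => τ.reg 2 = n ∧ τ.reg 3 = S ∧
    τ.reg 41 = 1 + ∑ j ∈ Finset.range k, f j ^ 2 ∧ (∀ j : ℕ, j < S → τ.mem j = f j) ∧
    ∀ j : ℕ, j < k → τ.mem (j + S) = f j) (by decide) hw lS le_rfl hN ?_ ?_ ?_).mono le_rfl ?_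
  · intro τ a hmem
    refine ⟨by rw [a 2 (by decide), e2], by rw [a 3 (by decide), e3], ?_, ?_, ?_⟩
    · rw [a 41 (by decide), e41]; simp
    · intro j _; rw [hmem, m1]
    · intro j hj; omega
  · rintro τ a
    simp only [AExp.eval_reg, AExp.fits_reg, a 3 (by decide), e3]
    exact ⟨trivial, lS⟩
  · rintro k hk τ a h23 hlk ⟨g2, g3, g41, q1, q2⟩
    have hk1 := q1 k hk
    have hkS : (k : ℤ) ≠ k + S := by omega
    have hs1 := hsum k hk.le
    have hs2 := hsum (k + 1) hk
    rw [Finset.sum_range_succ] at hs2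
    have h0 := hsum0 k
    have lx : len (f k) ≤ w := by
      refine le_trans (len_mono ?_) lM
      rw [abs_of_nonneg (show 0 ≤ M by linarith)]
      have := Int.natAbs_le_self_sq (f k)
      rw [Int.natCast_natAbs] at this
      linarith
    have lp : len (1 + ∑ j ∈ Finset.range k, f j ^ 2) ≤ w := (len_mono' (by linarith) hs1).trans lM
    refine Tr.basic' rfl (w := w) (by omega) le_rfl ?_ ?_
    · simp [Stm.Fits, Stm.run, h23, g3, g41, hk1, hlk, lS, lx, lp, hkS]
    · refine ⟨?_, ?_, ?_, ?_, ?_⟩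
      · simp [Stm.run, g2]
      · simp [Stm.run, g3]
      · simp [Stm.run, h23, g3, g41, hk1, hkS, Finset.sum_range_succ]; ring
      · intro j hj
        simp [Stm.run, h23, g3, hk1]
        rw [if_neg (by omega)]; exact q1 j hj
      · intro j hj
        simp [Stm.run, h23, g3, hk1]
        by_cases hjk : j = k
        · rw [if_pos hjk, hjk]
        · rw [if_neg hjk]; exact q2 j (by omega)
  · rintro τ - ⟨g2, g3, g41, -, q2⟩
    exact ⟨g2, g3, g41.trans hM.symm, q2⟩

/-- The computation of the parameters. -/
def parameters : Stm :=
  squareLoop ;;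
  (44 <~ R 2 + R 1 + R 42 + 100 ;; 44 <~ R 44 * R 44 ;; 44 <~ R 44 * R 44 ;; 44 <~ R 44 * R 44) ;;
  powerLoop 44 5 4 ;; 6 <~ R 41 ;; .for 23 (R 1 + 1) (6 <~ R 6 * R 5) ;; powerLoop 1 8 36 ;;
  (7 <~ 2 * R 6 ;; 9 <~ 2 * R 3 ;; 10 <~ R 9 + R 8 ;; 13 <~ R 10 + R 8 ;; 14 <~ R 13 + (R 1 + 1) ;;
    18 <~ 1)

lemma parameters_tr {σ : State} {n d w N c b m : ℕ} {M H : ℤ} (r1 : σ.reg 1 = d)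
    (r2 : σ.reg 2 = n) (r3 : σ.reg 3 = 2 * n * (d + 1)) (r41 : σ.reg 41 = M) (hM : 0 < M)
    (hc : M < 2 ^ 2 ^ c) (hc' : ∀ j < c, (2 : ℤ) ^ 2 ^ j ≤ M)
    (hb : ((n : ℤ) + d + 2 ^ c + 100) ^ 8 < 2 ^ b)
    (hb' : ∀ j < b, (2 : ℤ) ^ j ≤ ((n : ℤ) + d + 2 ^ c + 100) ^ 8)
    (hm : (d : ℤ) < 2 ^ m) (hm' : ∀ j < m, (2 : ℤ) ^ j ≤ d) (hH : H = M * (2 ^ b) ^ (d + 1))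
    (hU : euclidBase n d m + 2 * (d + 1) ≤ 2 ^ b) (hw : w = 2 * len (2 * H))
    (hN : b + d + 4 ≤ N) :
    Tr parameters σ [] (parameters.κ * (N * opc w)) (fun τ => τ.mem = σ.mem ∧
      τ.reg 4 = b ∧ τ.reg 6 = H ∧ τ.reg 7 = 2 * H ∧ τ.reg 8 = (2 ^ m : ℕ) ∧
      τ.reg 9 = 4 * n * (d + 1) ∧ τ.reg 10 = 4 * n * (d + 1) + 2 ^ m ∧
      τ.reg 13 = euclidBase n d m ∧ τ.reg 14 = euclidBase n d m + (d + 1) ∧ τ.reg 18 = 1) := by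
  have hB1 : opc w ≤ N * opc w := Nat.le_mul_of_pos_left _ (by omega)
  have hT1 : (1 : ℤ) ≤ 2 ^ b := one_le_pow₀ (by norm_num)
  have hTd : ∀ k ≤ d + 1, ((2 : ℤ) ^ b) ^ k ≤ (2 ^ b) ^ (d + 1) := fun k hk =>
    pow_le_pow_right₀ hT1 hk
  have hTk0 : ∀ k, 0 < ((2 : ℤ) ^ b) ^ k := fun k => by positivity
  have hMH : M ≤ H := by rw [hH]; exact le_mul_of_one_le_right hM.le (one_le_pow₀ hT1)
  have hTH : (2 : ℤ) ^ b ≤ H := by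
    rw [hH]
    calc (2 : ℤ) ^ b = 1 * (2 ^ b) ^ 1 := by ring
      _ ≤ M * (2 ^ b) ^ (d + 1) := mul_le_mul hM (hTd 1 (by omega)) (by positivity) hM.le
  have lens : ∀ z : ℤ, 0 ≤ z → z ≤ 2 * H → len z ≤ w := fun z h0 h1 => by
    have := len_mono' h0 h1; omega
  have hlen3 : 3 ≤ len (2 * H) := by
    have := len_mono' (x := 2) (y := 2 * H) (by norm_num) (by omega); simpa using this
  have hw3 : 6 ≤ w := by omega
  obtain ⟨Z, hZ⟩ : ∃ Z : ℤ, Z = n + d + 2 ^ c + 100 := ⟨_, rfl⟩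
  have hcz : (c : ℤ) < 2 ^ c := by exact_mod_cast Nat.lt_two_pow_self
  have hZ1 : 1 ≤ Z := by omega
  have hZk : ∀ k, k ≤ 8 → Z ^ k ≤ H := fun k hk => by
    have := pow_le_pow_right₀ hZ1 hk
    rw [← hZ] at hb; omega
  have hZ0 : ∀ k, 0 ≤ Z ^ k := fun k => by positivity
  have hZb : Z ≤ 2 ^ b := by
    have := pow_le_pow_right₀ hZ1 (show 1 ≤ 8 by norm_num)
    rw [pow_one] at this
    rw [← hZ] at hb; omega
  have hbz : (b : ℤ) ≤ 2 ^ b := by exact_mod_cast Nat.lt_two_pow_self.le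
  have hcb : c ≤ b := by
    have h1 : (2 : ℤ) ^ c ≤ 2 ^ b := by omega
    exact (pow_le_pow_iff_right₀ (by norm_num : (1 : ℤ) < 2)).mp h1
  have hmd : m ≤ d := by
    by_contra hlt
    have h1 := hm' d (by omega)
    have h2 : (d : ℤ) < 2 ^ d := by exact_mod_cast Nat.lt_two_pow_self
    omega
  -- For positive `c` the last square computed is the square of a number that is at most `M`, so it
  -- may be about twice as long as `M`; this is the reason for the factor two in `w`.
  have l2c : len (2 ^ 2 ^ c) ≤ w := by
    rcases Nat.eq_zero_or_pos c with rfl | hc0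
    · rw [pow_zero, pow_one, len_two]; omega
    · have h1 := hc' (c - 1) (by omega)
      have h2 : (2 : ℤ) ^ 2 ^ c = 2 ^ 2 ^ (c - 1) * 2 ^ 2 ^ (c - 1) := by
        rw [← pow_add, ← two_mul, ← pow_succ']; congr 2; omega
      have h3 := len_mono' (x := 2 ^ 2 ^ (c - 1)) (y := 2 * H) (by positivity) (by omega)
      have h4 := len_of_abs_le_mul (x := 2 ^ 2 ^ c) (a := 2 ^ 2 ^ (c - 1)) (b := 2 ^ 2 ^ (c - 1))
        (by rw [h2, abs_mul])
      omega
  have hSU : 0 ≤ 2 * (n : ℤ) * (d + 1) := by positivity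
  have hS4 : 4 * (n : ℤ) * (d + 1) = 2 * (2 * n * (d + 1)) := by ring
  have hm0 : (0 : ℤ) < 2 ^ m := by positivity
  have hUe : euclidBase n d m = 2 * (2 * n * (d + 1)) + 2 ^ m + 2 ^ m := by
    rw [euclidBase, hS4]; ring
  obtain ⟨S, hS⟩ : ∃ S : ℤ, S = 2 * n * (d + 1) := ⟨_, rfl⟩
  rw [hS4]
  rw [← hS] at hSU hUe r3 ⊢
  refine Tr.comp ((squareLoop_tr r41 hc hc' (by omega) l2c (lens M hM.le (by omega)) le_rfl).mono
    (Nat.mul_le_mul_left _ (Nat.mul_le_mul_right _ (by omega))) fun _ _ h => h) ?_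
  rintro τ₁ a₁ ⟨m1, e42⟩
  have e1 := (a₁ 1 (by decide)).trans r1
  have e2 := (a₁ 2 (by decide)).trans r2
  have lZ : ∀ k, k ≤ 8 → len (Z ^ k) ≤ w := fun k hk => lens _ (hZ0 k) (by have := hZk k hk; omega)
  have l1 := lZ 1 (by norm_num)
  have l2 := lZ 2 (by norm_num)
  have l4 := lZ 4 (by norm_num)
  have s2 : Z * Z = Z ^ 2 := by ring
  have s4 : Z ^ 2 * Z ^ 2 = Z ^ 4 := by ring
  have s8 : Z ^ 4 * Z ^ 4 = Z ^ 8 := by ring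
  rw [pow_one] at l1
  refine Tr.comp (Q₁ := fun τ => τ.mem = σ.mem ∧ τ.reg 44 = Z ^ 8)
    (Tr.basic' rfl (w := w) (by omega) hB1 ?_ ?_) ?_
  · have ln : len n ≤ w := lens _ (by omega) (by omega)
    have ld : len d ≤ w := lens _ (by omega) (by omega)
    have lc : len (2 ^ c) ≤ w := lens _ (by positivity) (by omega)
    have l100 : len 100 ≤ w := by
      have := lens 100 (by norm_num) (by omega); exact this
    simp [Stm.Fits, Stm.run, e42, e1, e2, ← hZ, s2, s4, l1, l2, l4, ln, ld, lc, l100]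
  · simp [Stm.run, e42, e1, e2, ← hZ, s2, s4, s8, m1]
  rintro τ₂ a₂ ⟨m2, e44⟩
  rw [← hZ] at hb hb'
  refine Tr.comp ((powerLoop_tr (by decide) (by decide) (by decide) e44 hb hb' (by omega)
    (lens _ (by positivity) (by omega)) (lZ 8 le_rfl) le_rfl).mono
    (Nat.mul_le_mul_left _ (Nat.mul_le_mul_right _ (by omega))) fun _ _ h => h) ?_
  rintro τ₃ a₃ ⟨m3, e5, e4⟩
  have A₃ := (Agree.trans a₁ a₂).trans a₃
  have e41 := (A₃ 41 (by decide)).trans r41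
  refine Tr.comp (Q₁ := fun τ => τ.mem = σ.mem ∧ τ.reg 6 = M)
    (Tr.basic' rfl (w := w) (by omega) hB1 ?_ ?_) ?_
  · simp [Stm.Fits, e41, lens M hM.le (by omega)]
  · simp [Stm.run, e41, m3, m2]
  rintro τ₄ a₄ ⟨m4, e6⟩
  have A₄ := A₃.trans a₄
  have f1 := (A₄ 1 (by decide)).trans r1
  have f5 := (a₄ 5 (by decide)).trans e5
  have ld1 : len ((d : ℤ) + 1) ≤ w := lens _ (by omega) (by omega)
  have ld : len d ≤ w := lens _ (by omega) (by omega)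
  refine Tr.comp ((Tr.for (w := w) (B := opc w) (N := d + 1) (fun k τ => τ.mem = σ.mem ∧
      τ.reg 6 = M * (2 ^ b) ^ k) (by decide) (by omega) (by exact_mod_cast ld1) le_rfl le_rfl
      ?_ ?_ ?_).mono (Nat.mul_le_mul_left _ (Nat.mul_le_mul_right _ (by omega)))
      fun _ _ h => h) ?_
  · rintro τ a hmem
    exact ⟨hmem.trans m4, by rw [a 6 (by decide), e6]; simp⟩
  · rintro τ a
    simp [a 1 (by decide), f1, ld]; omega
  · rintro k hk τ a h23 hlk ⟨m5, g6⟩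
    have g5 := (a 5 (by decide)).trans f5
    have hle : M * (2 ^ b) ^ k ≤ H := by
      rw [hH]; exact mul_le_mul_of_nonneg_left (hTd k (by omega)) hM.le
    have l6 := lens (M * (2 ^ b) ^ k) (mul_nonneg hM.le (hTk0 k).le) (by omega)
    have l5 := lens (2 ^ b) (by positivity) (by omega)
    refine Tr.basic' rfl (w := w) (by omega) le_rfl ?_ ?_
    · simp [Stm.Fits, g6, g5, l6, l5]
    · simp [Stm.run, g6, g5, m5, pow_succ]; ring
  rintro τ₅ a₅ ⟨m5, e6⟩
  rw [← hH] at e6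
  have A₅ := A₄.trans a₅
  refine Tr.comp ((powerLoop_tr (by decide) (by decide) (by decide)
    ((A₅ 1 (by decide)).trans r1) hm hm' (by omega)
    (lens _ (by positivity) (by omega)) ld le_rfl).mono
    (Nat.mul_le_mul_left _ (Nat.mul_le_mul_right _ (by omega))) fun _ _ h => h) ?_
  rintro τ₆ a₆ ⟨m6, e8, -⟩
  have A₆ := A₅.trans a₆
  have g1 := (A₆ 1 (by decide)).trans r1
  have g3 := (A₆ 3 (by decide)).trans r3
  have g4 := (((a₄.trans a₅).trans a₆) 4 (by decide)).trans e4
  have g6 := (a₆ 6 (by decide)).trans e6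
  have l6 := lens H (by omega) (by omega)
  have l3 := lens S hSU (by omega)
  have l32 := lens (2 * S) (by omega) (by omega)
  have l8 := lens (2 ^ m) (by positivity) (by omega)
  have l38 := lens (2 * S + 2 ^ m) (by positivity) (by omega)
  have l388 := lens (2 * S + 2 ^ m + 2 ^ m) (by positivity) (by omega)
  refine Tr.basic' rfl (w := w) (by omega) hB1 ?_ ?_
  · simp [Stm.Fits, Stm.run, g1, g3, g6, e8, l6, l3, l32, l8, l38, l388, ld]; omega
  · simp [Stm.run, g1, g3, g4, g6, e8, hUe, m6, m5]

end BitRAM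

/-! ### Coefficient bounds -/

namespace RatParam

/-- The absolute values of the coefficients of `f` are bounded by the coefficients of `F`. -/
def Dominates (F f : ℤ[X]) : Prop := ∀ j, |f.coeff j| ≤ F.coeff j

lemma Dominates.mul {F G f g : ℤ[X]} (hf : Dominates F f) (hg : Dominates G g) :
    Dominates (F * G) (f * g) := fun j => by
  rw [coeff_mul, coeff_mul]
  refine (Finset.abs_sum_le_sum_abs _ _).trans (Finset.sum_le_sum fun x _ => ?_)
  rw [abs_mul]
  exact mul_le_mul (hf _) (hg _) (abs_nonneg _) ((abs_nonneg _).trans (hf _))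

lemma Dominates.pow {F f : ℤ[X]} (hf : Dominates F f) (k : ℕ) : Dominates (F ^ k) (f ^ k) := by
  induction k with
  | zero =>
    intro j
    rw [pow_zero, pow_zero, coeff_one]
    split_ifs <;> simp
  | succ k ih => rw [pow_succ, pow_succ]; exact ih.mul hf

lemma Dominates.sum {ι : Type*} {s : Finset ι} {F f : ι → ℤ[X]}
    (h : ∀ i ∈ s, Dominates (F i) (f i)) : Dominates (∑ i ∈ s, F i) (∑ i ∈ s, f i) := fun j => by
  rw [finsetSum_coeff, finsetSum_coeff]
  exact (Finset.abs_sum_le_sum_abs _ _).trans (Finset.sum_le_sum fun i hi => h i hi j)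

/-- A dominating polynomial has nonnegative coefficients, and its value at `1` is their sum. -/
lemma Dominates.abs_coeff_le {F f : ℤ[X]} (h : Dominates F f) (j : ℕ) :
    |f.coeff j| ≤ F.eval 1 := by
  refine (h j).trans ?_
  have h0 : ∀ i, 0 ≤ F.coeff i := fun i => (abs_nonneg _).trans (h i)
  rw [eval_eq_sum_range]
  simp only [one_pow, mul_one]
  by_cases hj : j ≤ F.natDegree
  · exact Finset.single_le_sum (f := fun i => F.coeff i) (fun i _ => h0 i)
      (Finset.mem_range.mpr (by omega))
  · rw [coeff_eq_zero_of_natDegree_lt (by omega)]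
    exact Finset.sum_nonneg fun i _ => h0 i

/-- After passing to absolute values of coefficients, both linear factors take the value `t₀ + 1` at
`1`, and each term contains exactly `D` of them. -/
lemma abs_coeff_moebius_le {t₀ : ℤ} (ht : 0 ≤ t₀) (D : ℕ) (f : ℤ[X]) (j : ℕ) :
    |(moebius t₀ D f).coeff j| ≤ (∑ i ∈ Finset.range (D + 1), |f.coeff i|) * (t₀ + 1) ^ D := by
  have h1 : Dominates (Polynomial.C t₀ * Polynomial.X + 1)
      (Polynomial.C t₀ * Polynomial.X + 1) := fun j => by
    refine le_of_eq (abs_of_nonneg ?_)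
    rw [coeff_add, coeff_C_mul, coeff_X, coeff_one]
    split_ifs <;> omega
  have h2 : Dominates (Polynomial.X + Polynomial.C t₀) (Polynomial.X - Polynomial.C t₀) := fun j => by
    rw [coeff_sub, coeff_add, coeff_X, coeff_C]
    split_ifs <;> first | omega | simp [abs_of_nonneg ht]
  have h3 : ∀ c : ℤ, Dominates (Polynomial.C |c|) (Polynomial.C c) := fun c j => by
    rw [coeff_C, coeff_C]
    split_ifs <;> simp
  refine (Dominates.abs_coeff_le (Dominates.sum fun i _ =>
    ((h3 (f.coeff i)).mul (h1.pow i)).mul (h2.pow (D - i))) j).trans ?_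
  simp only [eval_finsetSum, eval_mul, eval_pow, eval_add, eval_C, eval_X, eval_one, mul_one]
  rw [Finset.sum_mul]
  refine Finset.sum_le_sum fun i hi => le_of_eq ?_
  have hi := Finset.mem_range.mp hi
  rw [mul_assoc, add_comm 1 t₀, ← pow_add, show i + (D - i) = D by omega]

variable {n : ℕ}

lemma storedIn_inputMem (φ : RatParam n) (d : ℕ) : φ.StoredIn d (φ.inputMem d) := by
  have key : ∀ (k : ℕ) (j : ℕ), j ≤ d → (k * (d + 1) + j) / (d + 1) = k ∧
      (k * (d + 1) + j) % (d + 1) = j := fun k j hj => by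
    constructor
    · rw [mul_comm, Nat.mul_add_div (by omega), Nat.div_eq_of_lt (by omega), add_zero]
    · rw [mul_comm, Nat.mul_add_mod, Nat.mod_eq_of_lt (by omega)]
  intro i j hj
  obtain ⟨h1, h2⟩ := key (2 * i) j hj
  obtain ⟨h3, h4⟩ := key (2 * i + 1) j hj
  constructor
  · have hi : ((2 * (i : ℕ) * (d + 1) + j : ℕ) : ℤ).toNat / (d + 1) / 2 = i := by
      rw [Int.toNat_natCast, h1]; omega
    rw [inputMem, dif_pos ⟨by positivity, hi.symm ▸ i.2⟩, if_pos (by rw [Int.toNat_natCast, h1]; omega),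
      show (⟨_, _⟩ : Fin n) = i from Fin.ext hi, Int.toNat_natCast, h2]
  · have hi : (((2 * (i : ℕ) + 1) * (d + 1) + j : ℕ) : ℤ).toNat / (d + 1) / 2 = i := by
      rw [Int.toNat_natCast, h3]; omega
    rw [inputMem, dif_pos ⟨by positivity, hi.symm ▸ i.2⟩, if_neg (by rw [Int.toNat_natCast, h3]; omega),
      show (⟨_, _⟩ : Fin n) = i from Fin.ext hi, Int.toNat_natCast, h4]

/-- One more than the sum of the squares of the coefficients. -/
noncomputable def sumSq (φ : RatParam n) (d : ℕ) : ℤ :=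
  1 + ∑ j ∈ Finset.range (2 * n * (d + 1)), φ.inputMem d j ^ 2

lemma sumSq_pos (φ : RatParam n) (d : ℕ) : 0 < φ.sumSq d := by
  have := Finset.sum_nonneg (s := Finset.range (2 * n * (d + 1)))
    (f := fun j : ℕ => φ.inputMem d j ^ 2) fun j _ => sq_nonneg _
  rw [sumSq]; omega

/-- Integers satisfy `|x| ≤ x ^ 2`, and the coefficients of `f` occupy part of the summed cells. The
extra one in `sumSq` makes the inequality strict. -/
lemma sum_abs_lt_sumSq {φ : RatParam n} {d : ℕ} {f : ℤ[X]} {p D : ℕ} (hD : D ≤ d)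
    (hp : p + (d + 1) ≤ 2 * n * (d + 1))
    (hf : ∀ j ≤ d, φ.inputMem d ((p + j : ℕ) : ℤ) = f.coeff j) :
    ∑ i ∈ Finset.range (D + 1), |f.coeff i| < φ.sumSq d := by
  have h1 : ∑ i ∈ Finset.range (D + 1), |f.coeff i| ≤
      ∑ i ∈ Finset.range (D + 1), φ.inputMem d ((p + i : ℕ) : ℤ) ^ 2 := by
    refine Finset.sum_le_sum fun i hi => ?_
    have hi := Finset.mem_range.mp hi
    rw [hf i (by omega)]
    have := Int.natAbs_le_self_sq (f.coeff i)
    rwa [Int.natCast_natAbs] at this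
  have h2 : ∑ i ∈ Finset.range (D + 1), φ.inputMem d ((p + i : ℕ) : ℤ) ^ 2 ≤
      ∑ j ∈ Finset.range (2 * n * (d + 1)), φ.inputMem d j ^ 2 := by
    rw [← Finset.sum_image (f := fun j : ℕ => φ.inputMem d j ^ 2) (g := fun i => p + i)
      fun a _ b _ h => by simpa using h]
    refine Finset.sum_le_sum_of_subset_of_nonneg (fun x hx => ?_) fun j _ _ => sq_nonneg _
    obtain ⟨i, hi, rfl⟩ := Finset.mem_image.mp hx
    have hi := Finset.mem_range.mp hi
    exact Finset.mem_range.mpr (show p + i < _ by omega)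
  rw [sumSq]; omega

lemma sum_abs_coeff_lt {φ : RatParam n} {d : ℕ} (i : Fin n) {D : ℕ} (hD : D ≤ d) :
    ∑ j ∈ Finset.range (D + 1), |(φ.num i).coeff j| < φ.sumSq d ∧
    ∑ j ∈ Finset.range (D + 1), |(φ.den i).coeff j| < φ.sumSq d := by
  have hi : (2 * (i : ℕ) + 2) * (d + 1) ≤ 2 * n * (d + 1) :=
    Nat.mul_le_mul_right _ (by have := i.2; omega)
  have h1 : (2 * (i : ℕ) + 2) * (d + 1) = 2 * i * (d + 1) + 2 * (d + 1) := by ring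
  have h2 : (2 * (i : ℕ) + 1) * (d + 1) = 2 * i * (d + 1) + (d + 1) := by ring
  exact ⟨sum_abs_lt_sumSq (p := 2 * i * (d + 1)) hD (by omega)
    fun j hj => (φ.storedIn_inputMem d i j hj).1,
    sum_abs_lt_sumSq (p := (2 * i + 1) * (d + 1)) hD (by omega)
    fun j hj => (φ.storedIn_inputMem d i j hj).2⟩

end RatParam

/-! ### The chosen parameters are large enough -/

namespace BitRAM

/-- A new coefficient is at most the sum of the old absolute values times `(t₀ + 1) ^ D`; the first
factor is below `sumSq` and `t₀ + 1 ≤ 2 ^ b`. The exponent `d + 1` is at least two for positive `d`,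
which also gives `2 ^ b < H`. -/
theorem setup_of_params {n : ℕ} {φ : RatParam n} {d m b : ℕ} {H : ℤ}
    (hnum : ∀ i, (φ.num i).natDegree ≤ (φ.den i).natDegree)
    (hden : ∀ i, (φ.den i).natDegree ≤ d) (hne : ∀ i, φ.den i ≠ 0) (hd0 : 0 < d) (hb : 0 < b)
    (hd : d < 2 ^ m) (hU : euclidBase n d m + 2 * (d + 1) ≤ 2 ^ b)
    (hH : H = φ.sumSq d * (2 ^ b) ^ (d + 1)) : Setup φ d m b H := by
  have hM := φ.sumSq_pos d
  have hT2 : (2 : ℤ) ≤ 2 ^ b := by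
    calc (2 : ℤ) = 2 ^ 1 := by norm_num
      _ ≤ 2 ^ b := pow_le_pow_right₀ (by norm_num) hb
  have hMH : φ.sumSq d ≤ H := by
    rw [hH]; exact le_mul_of_one_le_right hM.le (one_le_pow₀ (by omega))
  have hinp : ∀ i j, |(φ.num i).coeff j| ≤ H ∧ |(φ.den i).coeff j| ≤ H := by
    intro i j
    obtain ⟨h1, h2⟩ := RatParam.sum_abs_coeff_lt (φ := φ) (d := d) i le_rfl
    by_cases hj : j ≤ d
    · have h3 := Finset.single_le_sum (f := fun j => |(φ.num i).coeff j|)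
        (fun _ _ => abs_nonneg _) (Finset.mem_range.mpr (show j < d + 1 by omega))
      have h4 := Finset.single_le_sum (f := fun j => |(φ.den i).coeff j|)
        (fun _ _ => abs_nonneg _) (Finset.mem_range.mpr (show j < d + 1 by omega))
      constructor <;> linarith
    · have := hnum i
      have := hden i
      rw [coeff_eq_zero_of_natDegree_lt (by omega), coeff_eq_zero_of_natDegree_lt (by omega),
        abs_zero]
      constructor <;> omega
  refine ⟨hnum, hden, hne, hd, hU, ?_, hinp, ?_⟩
  · rw [hH]
    calc (2 : ℤ) ^ b < 2 ^ b * 2 ^ b := by nlinarith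
      _ = 1 * (2 ^ b) ^ 2 := by ring
      _ ≤ _ := mul_le_mul hM (pow_le_pow_right₀ (by omega) (by omega)) (by positivity) hM.le
  · intro t₀ h0 h1 i j
    obtain ⟨h2, h3⟩ := RatParam.sum_abs_coeff_lt (φ := φ) (d := d) i (hden i)
    have h4 : (t₀ + 1) ^ (φ.den i).natDegree ≤ (2 ^ b) ^ (d + 1) :=
      (pow_le_pow_left₀ (by omega) (by omega) _).trans
        (pow_le_pow_right₀ (by omega) (by have := hden i; omega))
    have h5 : 0 < ((2 : ℤ) ^ b) ^ (d + 1) := by positivity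
    have h6 : 0 ≤ (t₀ + 1) ^ (φ.den i).natDegree := pow_nonneg (by omega) _
    rw [hH]
    exact ⟨(RatParam.abs_coeff_moebius_le h0 _ _ _).trans_lt
      (mul_lt_mul h2 h4 (pow_pos (by omega) _) hM.le),
      (RatParam.abs_coeff_moebius_le h0 _ _ _).trans_lt
      (mul_lt_mul h3 h4 (pow_pos (by omega) _) hM.le)⟩

/-- The initialization. -/
def prepare : Stm := copyInput ;; parameters

theorem prepare_tr {n : ℕ} {φ : RatParam n} {d m b c w N : ℕ} {H : ℤ}
    (hc : φ.sumSq d < 2 ^ 2 ^ c) (hc' : ∀ j < c, (2 : ℤ) ^ 2 ^ j ≤ φ.sumSq d)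
    (hb : ((n : ℤ) + d + 2 ^ c + 100) ^ 8 < 2 ^ b)
    (hb' : ∀ j < b, (2 : ℤ) ^ j ≤ ((n : ℤ) + d + 2 ^ c + 100) ^ 8)
    (hm' : ∀ j < m, (2 : ℤ) ^ j ≤ d) (hH : H = φ.sumSq d * (2 ^ b) ^ (d + 1))
    (hs : Setup φ d m b H) (hw : w = 2 * len (2 * H)) (hN : 2 * n * (d + 1) + b + d + 4 ≤ N) :
    Tr prepare (φ.input d) [] (prepare.κ * (N * opc w))
      (fun τ => Ready φ d m b H τ ∧ τ.reg 18 = 1) := by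
  have hU := hs.hU
  have hHb := hs.hH
  have hM := φ.sumSq_pos d
  have hMH : φ.sumSq d ≤ H := by
    rw [hH]; exact le_mul_of_one_le_right hM.le (one_le_pow₀ (one_le_pow₀ (by norm_num)))
  have hm0 : (0 : ℤ) < 2 ^ m := by positivity
  have hS4 : 4 * (n : ℤ) * (d + 1) = 2 * (2 * n * (d + 1)) := by ring
  have hS0 : 0 ≤ 2 * (n : ℤ) * (d + 1) := by positivity
  rw [euclidBase, hS4] at hU
  have hnS : (n : ℤ) ≤ 2 * n * (d + 1) := by nlinarith
  have lens : ∀ z : ℤ, 0 ≤ z → z ≤ 2 * H → len z ≤ w := fun z h0 h1 => by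
    have := len_mono' h0 h1; omega
  have hlen3 : 3 ≤ len (2 * H) := by
    have := len_mono' (x := 2) (y := 2 * H) (by norm_num) (by omega); simpa using this
  refine Tr.comp (copyInput_tr (σ := φ.input d) (n := n) (d := d) (M := φ.sumSq d) rfl rfl rfl (by omega)
    (lens _ hS0 (by omega)) rfl (lens _ hM.le (by omega)) (lens _ (by omega) (by omega))
    (lens _ (by omega) (by omega)) (by omega)) ?_
  rintro τ₁ a₁ ⟨e2, e3, e41, hcopy⟩
  have e1 : τ₁.reg 1 = d := a₁ 1 (by decide)
  refine (parameters_tr e1 e2 e3 e41 hM hc hc' hb hb' (by exact_mod_cast hs.hd) hm' hH hs.hU hw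
    (by omega)).mono le_rfl ?_
  rintro τ a ⟨hmem, e4, e6, e7, e8, e9, e10, e13, e14, e18⟩
  refine ⟨⟨⟨(a 1 (by decide)).trans e1, (a 2 (by decide)).trans e2, (a 3 (by decide)).trans e3, e4,
    e6, e7, e8, e9, e10, ?_, ?_⟩, Or.inl ⟨e13, e14⟩, Or.inr e18, fun h => ?_⟩, e18⟩
  · intro i j hj
    have hi : (2 * (i : ℕ) + 2) * (d + 1) ≤ 2 * n * (d + 1) :=
      Nat.mul_le_mul_right _ (by have := i.2; omega)
    have h1 : (2 * (i : ℕ) + 2) * (d + 1) = 2 * i * (d + 1) + 2 * (d + 1) := by ring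
    have h2 := (hcopy (2 * i * (d + 1) + j) (by omega)).trans (φ.storedIn_inputMem d i j hj).1
    rw [hmem, ← h2]
    congr 1; push_cast; ring
  · intro i j hj
    have hi : (2 * (i : ℕ) + 2) * (d + 1) ≤ 2 * n * (d + 1) :=
      Nat.mul_le_mul_right _ (by have := i.2; omega)
    have h1 : (2 * (i : ℕ) + 2) * (d + 1) = 2 * i * (d + 1) + 2 * (d + 1) := by ring
    have h1' : (2 * (i : ℕ) + 1) * (d + 1) = 2 * i * (d + 1) + (d + 1) := by ring
    have h2 := (hcopy ((2 * i + 1) * (d + 1) + j) (by omega)).trans (φ.storedIn_inputMem d i j hj).2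
    rw [hmem, ← h2]
    congr 1; push_cast; ring
  · rw [e18] at h; norm_num at h

end BitRAM

/-! ### Correctness of the reparametrization and of the certificates -/

namespace RatParam

variable {n : ℕ} {φ : RatParam n}

/-- A quotient with the larger degree in the numerator is unbounded at infinity, against the
existence of the limit. -/
lemma natDegree_num_le (hr : φ.IsReduced) {P : Fin n → ℝ} (hP : φ.IsPointAtInfinity P) (i : Fin n) :
    (φ.num i).natDegree ≤ (φ.den i).natDegree := by
  by_contra! hlt
  have hinj : Function.Injective (Int.castRingHom ℝ) := Int.cast_injective
  have hdeg : ((φ.den i).map (Int.castRingHom ℝ)).degree < ((φ.num i).map (Int.castRingHom ℝ)).degree := by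
    rw [degree_map_eq_of_injective hinj, degree_map_eq_of_injective hinj]
    exact degree_lt_degree hlt
  have h1 := abs_div_tendsto_atTop_atTop_of_degree_gt _ _ hdeg
    ((Polynomial.map_ne_zero_iff hinj).mpr (hr i).1)
  have h2 : Tendsto (fun t : ℝ => |aeval t (φ.num i) / aeval t (φ.den i)|) atTop (𝓝 |P i|) :=
    (((tendsto_pi_nhds.mp hP) i).mono_left le_sup_right).abs
  refine not_tendsto_nhds_of_tendsto_atTop (h1.congr fun t => ?_) _ h2
  rw [eval_map, eval_map, aeval_def, aeval_def]
  rfl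

/-- For `n = 0` or `d = 0` there are no poles and the map is constant, so every complex number is an
exceptional parameter. -/
lemma pos_of_isProper (hp : φ.IsProper) (hr : φ.IsReduced) {d : ℕ}
    (hd : ∀ i, (φ.num i).natDegree ≤ d ∧ (φ.den i).natDegree ≤ d) : 0 < n ∧ 0 < d := by
  by_contra hcon
  have hpole : ∀ t, ¬ φ.IsPole t := by
    rintro t ⟨i, hi⟩
    have hd0 : d = 0 := by have := i.2; omega
    have h0 := (hd i).2
    rw [hd0, Nat.le_zero] at h0
    rw [eq_C_of_natDegree_eq_zero h0, aeval_C] at hi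
    have : (φ.den i).coeff 0 = 0 := by simpa using hi
    exact (hr i).1 (by rw [eq_C_of_natDegree_eq_zero h0, this, C_0])
  have hpt : ∀ s t, φ.point s = φ.point t := by
    intro s t
    funext i
    have hd0 : d = 0 := by have := i.2; omega
    have h0 := hd i
    rw [hd0, Nat.le_zero, Nat.le_zero] at h0
    rw [point, point, eq_C_of_natDegree_eq_zero h0.1, eq_C_of_natDegree_eq_zero h0.2]
    simp
  refine Set.infinite_univ (α := ℂ) (hp.subset fun t _ => ⟨hpole t, t + 1, hpole _, by simp, hpt _ _⟩)

lemma aeval_moebius {K : Type*} [Field K] (t₀ : ℤ) {D : ℕ} {f : ℤ[X]} (hf : f.natDegree ≤ D)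
    {t : K} (ht : t ≠ t₀) :
    aeval t (moebius t₀ D f) = (t - t₀) ^ D * aeval ((t₀ * t + 1) / (t - t₀)) f := by
  have ht' : t - t₀ ≠ 0 := sub_ne_zero.mpr ht
  rw [moebius, map_sum, aeval_eq_sum_range' (show f.natDegree < D + 1 by omega), Finset.mul_sum]
  refine Finset.sum_congr rfl fun i hi => ?_
  have hi := Finset.mem_range.mp hi
  simp only [map_mul, map_pow, map_sub, map_add, map_one, aeval_C, aeval_X, algebraMap_int_eq,
    Int.coe_castRingHom, zsmul_eq_mul]
  obtain ⟨e, rfl⟩ : ∃ e, D = i + e := ⟨D - i, by omega⟩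
  rw [Nat.add_sub_cancel_left, div_pow, pow_add]
  field_simp

/-- At `t₀` only the term without the factor `t - t₀` survives. This treats the one parameter that
the formula for the composition leaves out. -/
lemma aeval_moebius_self {K : Type*} [Field K] (t₀ : ℤ) (f : ℤ[X]) :
    aeval (t₀ : K) (moebius t₀ f.natDegree f) = f.leadingCoeff * (t₀ ^ 2 + 1) ^ f.natDegree := by
  rw [moebius, map_sum, Finset.sum_eq_single_of_mem f.natDegree (by simp)]
  · simp only [map_mul, map_pow, map_add, map_one, aeval_C, aeval_X, algebraMap_int_eq,
      Int.coe_castRingHom, Nat.sub_self, pow_zero, mul_one, coeff_natDegree, sq]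
  · intro i hi hne
    have hi := Finset.mem_range.mp hi
    simp only [map_mul, map_pow, map_sub, aeval_C, aeval_X, algebraMap_int_eq,
      Int.coe_castRingHom, sub_self]
    rw [zero_pow (by omega), mul_zero]

/-- The `i`-th term contributes its coefficient times `t₀ ^ i`. Consequently the new point at
infinity is `φ(t₀)` unless `t₀` is a pole. -/
lemma coeff_moebius_top (t₀ : ℤ) {D : ℕ} {f : ℤ[X]} (hf : f.natDegree ≤ D) :
    (moebius t₀ D f).coeff D = f.eval t₀ := by
  rw [moebius, finsetSum_coeff, eval_eq_sum_range' (show f.natDegree < D + 1 by omega)]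
  refine Finset.sum_congr rfl fun i hi => ?_
  have hi := Finset.mem_range.mp hi
  obtain ⟨e, rfl⟩ : ∃ e, D = i + e := ⟨D - i, by omega⟩
  have h1 : ((Polynomial.C t₀ * Polynomial.X + 1 : ℤ[X]) ^ i).natDegree ≤ i := by
    refine natDegree_pow_le.trans ?_
    have : (Polynomial.C t₀ * Polynomial.X + Polynomial.C 1 : ℤ[X]).natDegree ≤ 1 :=
      natDegree_linear_le
    rw [C_1] at this
    nlinarith
  have h2 : ((Polynomial.X - Polynomial.C t₀ : ℤ[X]) ^ e).natDegree ≤ e := by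
    rw [natDegree_pow, natDegree_X_sub_C, mul_one]
  rw [Nat.add_sub_cancel_left, mul_assoc, coeff_C_mul, coeff_mul_add_eq_of_natDegree_le h1 h2]
  have h3 : (Polynomial.C t₀ * Polynomial.X + 1 : ℤ[X]).natDegree ≤ 1 := by
    have : (Polynomial.C t₀ * Polynomial.X + Polynomial.C 1 : ℤ[X]).natDegree ≤ 1 :=
      natDegree_linear_le
    rwa [C_1] at this
  have h4 := coeff_pow_of_natDegree_le (m := i) h3
  have h5 := coeff_pow_of_natDegree_le (m := e) (natDegree_X_sub_C_le t₀)
  rw [mul_one] at h4 h5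
  rw [h4, h5, coeff_add, coeff_C_mul, coeff_sub, coeff_X_one, coeff_one, coeff_C]
  simp

lemma reparam_isReparam (hdeg : ∀ i, (φ.num i).natDegree ≤ (φ.den i).natDegree) (t₀ : ℤ) :
    φ.IsReparam (φ.reparam t₀) t₀ := by
  intro t ht
  have ht' : t - t₀ ≠ 0 := sub_ne_zero.mpr ht
  have h1 : ∀ i, aeval t ((φ.reparam t₀).den i) = _ := fun i => aeval_moebius t₀ le_rfl ht
  have h2 : ∀ i, aeval t ((φ.reparam t₀).num i) = _ := fun i => aeval_moebius t₀ (hdeg i) ht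
  constructor
  · simp only [IsPole, h1, mul_eq_zero, pow_eq_zero_iff', ht', false_and, false_or]
  · intro _
    funext i
    rw [point, point, h1, h2, mul_div_mul_left _ _ (pow_ne_zero _ ht')]

/-- Coprimality over `ℚ` means the absence of common complex roots. A common root other than `t₀`
would be carried to a common root of the original pair, and at `t₀` the new denominator is nonzero,
because `t₀ ^ 2 + 1` is. -/
lemma reparam_isReduced (hr : φ.IsReduced)
    (hdeg : ∀ i, (φ.num i).natDegree ≤ (φ.den i).natDegree) (t₀ : ℤ) :
    (φ.reparam t₀).IsReduced := by
  have hne : (t₀ : ℂ) ^ 2 + 1 ≠ 0 := by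
    have : (0 : ℤ) < t₀ ^ 2 + 1 := by positivity
    exact_mod_cast this.ne'
  have hself : ∀ i, aeval (t₀ : ℂ) ((φ.reparam t₀).den i) ≠ 0 := fun i => by
    rw [reparam, aeval_moebius_self]
    exact mul_ne_zero (by exact_mod_cast leadingCoeff_ne_zero.mpr (hr i).1) (pow_ne_zero _ hne)
  intro i
  refine ⟨fun h0 => hself i (by rw [h0, map_zero]), ?_⟩
  refine (isCoprime_iff_aeval_ne_zero_of_isAlgClosed (k := ℚ) ℂ _ _).mpr fun t => ?_
  have hmap : ∀ f : ℤ[X], aeval t (f.map (Int.castRingHom ℚ)) = aeval t f := fun f =>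
    aeval_map_algebraMap ℚ t f
  rw [hmap, hmap]
  by_cases ht : t = t₀
  · exact Or.inr (ht ▸ hself i)
  · have ht' : t - t₀ ≠ 0 := sub_ne_zero.mpr ht
    have h1 : aeval t ((φ.reparam t₀).den i) = _ := aeval_moebius t₀ le_rfl ht
    have h2 : aeval t ((φ.reparam t₀).num i) = _ := aeval_moebius t₀ (hdeg i) ht
    have h3 := (isCoprime_iff_aeval_ne_zero_of_isAlgClosed (k := ℚ) ℂ _ _).mp (hr i).2
      ((t₀ * t + 1) / (t - t₀))
    have hmap' : ∀ f : ℤ[X], aeval ((t₀ * t + 1) / (t - t₀)) (f.map (Int.castRingHom ℚ)) =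
      aeval ((t₀ * t + 1) / (t - t₀)) f := fun f => aeval_map_algebraMap ℚ _ f
    rw [hmap', hmap'] at h3
    rw [h1, h2]
    exact h3.imp (fun h => mul_ne_zero (pow_ne_zero _ ht') h)
      (fun h => mul_ne_zero (pow_ne_zero _ ht') h)

/-- The common zeros of the polynomials `φ.cross t₀` are excluded by a certificate. -/
lemma IsCert.exists_aeval_ne_zero {t₀ : ℤ} {r : ℕ} (h : φ.IsCert t₀ r) (s : ℂ) :
    ∃ i, aeval s (φ.cross t₀ i) ≠ 0 := by
  by_contra! hs
  obtain ⟨k, hk0, hk⟩ := h.ne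
  obtain ⟨c, hc⟩ : ∃ c, c = (φ.cross t₀ k).coeff ((φ.den k).natDegree - 1) := ⟨_, rfl⟩
  rw [← hc] at hk
  have hc0 : c ≠ 0 := by rintro rfl; simp at hk
  -- The coefficient `c` is nonzero modulo `r`, so it is the leading coefficient of an integer
  -- polynomial that vanishes at `s`. Therefore `c * s` is an algebraic integer.
  have hlead : (φ.cross t₀ k).leadingCoeff = c := by
    have : (φ.cross t₀ k).natDegree = (φ.den k).natDegree - 1 := by
      refine natDegree_eq_of_le_of_coeff_ne_zero ?_ (hc ▸ hc0)
      refine natDegree_le_iff_coeff_eq_zero.mpr fun j hj => ?_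
      exact φ.coeff_cross_eq_zero t₀ k (by omega)
    rw [leadingCoeff, this, hc]
  have hint : IsIntegral ℤ (c • s) := hlead ▸ isIntegral_leadingCoeff_smul _ s (hs k)
  have hsurj : Function.Surjective (mapRingHom (Int.castRingHom (ZMod r))) :=
    map_surjective _ (ZMod.intCast_surjective)
  have hmap : φ.crossIdeal t₀ r n =
      (Ideal.span (Set.range (φ.cross t₀))).map (mapRingHom (Int.castRingHom (ZMod r))) := by
    rw [crossIdeal, Ideal.map_span, ← Set.range_comp]
    congr 1
    ext f
    simp only [Set.mem_ofPred_eq, Set.mem_range, Function.comp_apply, coe_mapRingHom]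
    exact ⟨fun ⟨k, _, hk⟩ => ⟨k, hk.symm⟩, fun ⟨k, hk⟩ => ⟨k, k.2, hk.symm⟩⟩
  have hone : (1 : (ZMod r)[X]) ∈ φ.crossIdeal t₀ r n := by rw [h.top]; trivial
  rw [hmap, Ideal.mem_map_iff_of_surjective _ hsurj] at hone
  obtain ⟨F, hF, hF1⟩ := hone
  have hFs : aeval s F = 0 := by
    have hle : Ideal.span (Set.range (φ.cross t₀)) ≤ RingHom.ker (aeval s : ℤ[X] →ₐ[ℤ] ℂ) := by
      rw [Ideal.span_le]
      rintro _ ⟨i, rfl⟩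
      exact hs i
    exact hle hF
  -- The lift `F` of `1` is a combination of the polynomials `cross` over the integers, so it
  -- vanishes at `s`; evaluating `F - 1 = r * e` there gives `r * e(s) = -1`.
  obtain ⟨e, he⟩ : Polynomial.C (r : ℤ) ∣ F - 1 := by
    rw [C_dvd_iff_dvd_coeff]
    intro j
    rw [← ZMod.intCast_zmod_eq_zero_iff_dvd]
    have := congrArg (fun f => f.coeff j) hF1
    simp only [coe_mapRingHom, coeff_map, coeff_one, eq_intCast] at this
    rw [coeff_sub, Int.cast_sub, this, coeff_one]
    split_ifs <;> simp
  have hes : (r : ℂ) * aeval s e = -1 := by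
    have := congrArg (aeval s) he
    rw [map_sub, hFs, map_one, map_mul, aeval_C] at this
    simpa using this.symm
  -- The power of `c` turns `e(s)` into a polynomial in the algebraic integer `c * s`. The number is
  -- also the rational `-c ^ deg e / r`, hence an integer, and so `r` would divide a power of `c`.
  have hint2 : IsIntegral ℤ ((c : ℂ) ^ e.natDegree * aeval s e) := by
    rw [aeval_eq_sum_range, Finset.mul_sum]
    refine IsIntegral.sum _ fun j hj => ?_
    have hj := Finset.mem_range.mp hj
    obtain ⟨i, hi⟩ : ∃ i, e.natDegree = j + i := ⟨e.natDegree - j, by omega⟩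
    have : (c : ℂ) ^ e.natDegree * e.coeff j • s ^ j =
        ((e.coeff j * c ^ i : ℤ) : ℂ) * (c • s) ^ j := by
      rw [hi, zsmul_eq_mul, zsmul_eq_mul]; push_cast; ring
    rw [this]
    exact (isIntegral_algebraMap (R := ℤ) (A := ℂ) (x := e.coeff j * c ^ i)).mul (hint.pow j)
  have hr0 : (r : ℂ) ≠ 0 := by exact_mod_cast h.prime.ne_zero
  have hq : (c : ℂ) ^ e.natDegree * aeval s e =
      algebraMap ℚ ℂ (-(c : ℚ) ^ e.natDegree / r) := by
    rw [eq_ratCast]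
    push_cast
    rw [eq_div_iff hr0, mul_assoc, mul_comm (aeval s e), hes]
    ring
  rw [hq, isIntegral_algebraMap_iff (algebraMap ℚ ℂ).injective,
    IsIntegrallyClosed.isIntegral_iff] at hint2
  obtain ⟨y, hy⟩ := hint2
  have hrq : (r : ℚ) ≠ 0 := by exact_mod_cast h.prime.ne_zero
  rw [eq_div_iff hrq] at hy
  have hy' : y * r = -c ^ e.natDegree := by
    have : ((y * r : ℤ) : ℚ) = ((-c ^ e.natDegree : ℤ) : ℚ) := by
      push_cast; rw [← hy]; rfl
    exact_mod_cast this
  have hdvd : (r : ℤ) ∣ c ^ e.natDegree := ⟨-y, by linarith⟩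
  exact hk ((ZMod.intCast_zmod_eq_zero_iff_dvd _ _).mpr
    ((Nat.prime_iff_prime_int.mp h.prime).dvd_of_dvd_pow hdvd))

/-- The point at infinity of `φ.reparam t₀`. -/
noncomputable def reparamInfinity (φ : RatParam n) (t₀ : ℤ) : Fin n → ℝ := fun i =>
  ((φ.reparam t₀).num i).coeff (φ.den i).natDegree / ((φ.reparam t₀).den i).coeff (φ.den i).natDegree

lemma aeval_reflect {D : ℕ} {f : ℤ[X]} (hf : f.natDegree ≤ D) {u : ℝ} (hu : u ≠ 0) :
    aeval u (f.reflect D) = u ^ D * aeval u⁻¹ f := by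
  have h1 : (f.reflect D).natDegree < D + 1 := by
    rw [Nat.lt_succ_iff, natDegree_le_iff_coeff_eq_zero]
    intro j hj
    rw [coeff_reflect, revAt_eq_self_of_lt hj, coeff_eq_zero_of_natDegree_lt (by omega)]
  rw [aeval_eq_sum_range' h1, aeval_eq_sum_range' (show f.natDegree < D + 1 by omega),
    Finset.mul_sum, ← Finset.sum_range_reflect]
  refine Finset.sum_congr rfl fun i hi => ?_
  have hi := Finset.mem_range.mp hi
  obtain ⟨e, rfl⟩ : ∃ e, D = i + e := ⟨D - i, by omega⟩
  rw [show i + e + 1 - 1 - i = e by omega, coeff_reflect, revAt_le (by omega),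
    Nat.add_sub_cancel_right, zsmul_eq_mul, zsmul_eq_mul, pow_add, inv_pow]
  field_simp

/-- In the local parameter `u = 1 / t` the coordinates are quotients of reflected polynomials whose
denominators do not vanish at `u = 0`. The quotient rule there has the coefficient of `cross` in
degree `D - 1` as its numerator, and continuity at `0` gives the limit. A finite parameter mapped to
the limit point would be a common root of the polynomials `cross`. -/
theorem IsCert.nonsingular {t₀ : ℤ} {r : ℕ} (h : φ.IsCert t₀ r) :
    (φ.reparam t₀).IsPointAtInfinity (φ.reparamInfinity t₀) ∧
      (φ.reparam t₀).NonsingularAtInfinity (φ.reparamInfinity t₀) := by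
  set ψ := φ.reparam t₀ with hψ
  set P := φ.reparamInfinity t₀ with hP
  have hnd : ∀ i, (ψ.num i).natDegree ≤ (φ.den i).natDegree := fun i => natDegree_moebius_le _ _ _
  have hdd : ∀ i, (ψ.den i).natDegree ≤ (φ.den i).natDegree := fun i => natDegree_moebius_le _ _ _
  have hden : ∀ i, ((ψ.den i).coeff (φ.den i).natDegree : ℝ) ≠ 0 := fun i => by
    exact_mod_cast h.den_ne i
  have hz : ∀ (f : ℤ[X]) (D : ℕ), aeval (0 : ℝ) (f.reflect D) = f.coeff D := fun f D => by
    rw [← coeff_zero_eq_aeval_zero', coeff_reflect, revAt_zero]; rfl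
  have hF : (fun u : ℝ => if u = 0 then P else ψ.realPoint u⁻¹) = fun u i =>
      aeval u ((ψ.num i).reflect (φ.den i).natDegree) /
        aeval u ((ψ.den i).reflect (φ.den i).natDegree) := by
    funext u i
    split_ifs with hu
    · rw [hu, hz, hz, hP, reparamInfinity]
    · rw [aeval_reflect (hnd i) hu, aeval_reflect (hdd i) hu,
        mul_div_mul_left _ _ (pow_ne_zero _ hu), realPoint]
  have hderiv : HasDerivAt (fun u : ℝ => if u = 0 then P else ψ.realPoint u⁻¹)
      (fun i => (aeval (0 : ℝ) (derivative ((ψ.num i).reflect (φ.den i).natDegree)) *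
        (ψ.den i).coeff (φ.den i).natDegree - (ψ.num i).coeff (φ.den i).natDegree *
        aeval (0 : ℝ) (derivative ((ψ.den i).reflect (φ.den i).natDegree))) /
        ((ψ.den i).coeff (φ.den i).natDegree : ℝ) ^ 2) 0 := by
    rw [hF, hasDerivAt_pi]
    intro i
    have := (Polynomial.hasDerivAt_aeval ((ψ.num i).reflect (φ.den i).natDegree) (0 : ℝ)).div
      (Polynomial.hasDerivAt_aeval ((ψ.den i).reflect (φ.den i).natDegree) (0 : ℝ))
      (by rw [hz]; exact hden i)
    rwa [hz, hz] at this
  refine ⟨?_, ?_, _, ?_, hderiv⟩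
  · have hc := hderiv.continuousAt.tendsto
    simp only [if_true] at hc
    have hinv : Tendsto (fun t : ℝ => t⁻¹) (atBot ⊔ atTop) (𝓝 0) :=
      tendsto_inv_atBot_zero.sup tendsto_inv_atTop_zero
    refine (hc.comp hinv).congr' ?_
    have hne : ∀ᶠ t : ℝ in atBot ⊔ atTop, t ≠ 0 :=
      eventually_sup.mpr ⟨eventually_ne_atBot 0, eventually_ne_atTop 0⟩
    filter_upwards [hne] with t ht
    simp [ht]
  · intro s hs heq
    obtain ⟨i, hi⟩ := h.exists_aeval_ne_zero s
    refine hi ?_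
    have h1 := congrFun heq i
    have h2 : aeval s (ψ.den i) ≠ 0 := fun h0 => hs ⟨i, h0⟩
    have h3 : ((ψ.den i).coeff (φ.den i).natDegree : ℂ) ≠ 0 := by exact_mod_cast h.den_ne i
    rw [point, hP, reparamInfinity] at h1
    push_cast at h1
    rw [div_eq_div_iff h2 h3] at h1
    rw [cross, map_sub, map_mul, map_mul, aeval_C, aeval_C, ← hψ]
    simp only [algebraMap_int_eq, eq_intCast]
    rw [h1]; ring
  · obtain ⟨k, hk0, hk⟩ := h.ne
    intro h0
    have h1 := congrFun h0 k
    rw [Pi.zero_apply, div_eq_zero_iff, or_iff_left (pow_ne_zero _ (hden k))] at h1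
    have hd1 : ∀ f : ℤ[X], aeval (0 : ℝ) (derivative (f.reflect (φ.den k).natDegree)) =
        f.coeff ((φ.den k).natDegree - 1) := fun f => by
      rw [← coeff_zero_eq_aeval_zero', coeff_derivative, coeff_reflect, revAt_le (by omega)]
      simp
    rw [hd1, hd1] at h1
    refine hk ?_
    have h2 : (φ.cross t₀ k).coeff ((φ.den k).natDegree - 1) = 0 := by
      rw [coeff_cross, ← hψ]
      have : (((ψ.num k).coeff ((φ.den k).natDegree - 1) * (ψ.den k).coeff (φ.den k).natDegree -
        (ψ.den k).coeff ((φ.den k).natDegree - 1) * (ψ.num k).coeff (φ.den k).natDegree : ℤ) : ℝ) =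
          0 := by push_cast; linarith
      exact_mod_cast this
    rw [h2, Int.cast_zero]

end RatParam

/-! ### A generic parameter is good over the complex numbers -/

namespace RatParam

/-- The polynomial `(X - s) ^ D * f ((s X + 1) / (X - s))` over a ring that contains `s`. -/
noncomputable def gmoebius {A : Type*} [CommRing A] (s : A) (D : ℕ) (f : ℤ[X]) : A[X] :=
  ∑ i ∈ Finset.range (D + 1),
    Polynomial.C (f.coeff i : A) * (Polynomial.C s * Polynomial.X + 1) ^ i *
      (Polynomial.X - Polynomial.C s) ^ (D - i)

lemma gmoebius_int (t₀ : ℤ) (D : ℕ) (f : ℤ[X]) : gmoebius t₀ D f = moebius t₀ D f := by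
  simp [gmoebius, moebius]

lemma map_gmoebius {A B : Type*} [CommRing A] [CommRing B] (g : A →+* B) (s : A) (D : ℕ)
    (f : ℤ[X]) : (gmoebius s D f).map g = gmoebius (g s) D f := by
  simp [gmoebius, Polynomial.map_sum]

/-- The degree of `f` is at most `F`, and its first two coefficients are `a` and `b`. -/
structure HasTop {A : Type*} [CommRing A] (F : ℕ) (f : A[X]) (a b : A) : Prop where
  deg : f.natDegree ≤ F
  top : f.coeff F = a
  next : (f.reflect F).coeff 1 = b

section HasTop
variable {A : Type*} [CommRing A] {F G : ℕ} {f g : A[X]} {a b a' b' : A}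

/-- Reflection turns the two top coefficients into the two lowest ones, to which the product rule
applies. It also gives the second coefficient the value zero for `F = 0`, where `F - 1` would be
misleading. -/
lemma HasTop.mul (hf : HasTop F f a b) (hg : HasTop G g a' b') :
    HasTop (F + G) (f * g) (a * a') (a * b' + b * a') := by
  refine ⟨natDegree_mul_le.trans (add_le_add hf.deg hg.deg), ?_, ?_⟩
  · rw [coeff_mul_add_eq_of_natDegree_le hf.deg hg.deg, hf.top, hg.top]
  · rw [reflect_mul _ _ hf.deg hg.deg, mul_coeff_one, hf.next, hg.next, coeff_reflect,
      coeff_reflect, revAt_zero, revAt_zero, hf.top, hg.top]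

lemma HasTop.pow (hf : HasTop 1 f a b) (k : ℕ) :
    HasTop k (f ^ k) (a ^ k) (k * a ^ (k - 1) * b) := by
  induction k with
  | zero => exact ⟨by simp, by simp, by simp [coeff_one]⟩
  | succ k ih =>
    rw [pow_succ, pow_succ]
    have h := ih.mul hf
    refine ⟨h.deg, h.top, h.next.trans ?_⟩
    rcases k with _ | k
    · simp
    · simp only [Nat.add_sub_cancel]; push_cast; ring

lemma HasTop.C_mul (hf : HasTop F f a b) (c : A) :
    HasTop F (Polynomial.C c * f) (c * a) (c * b) :=
  ⟨(natDegree_C_mul_le _ _).trans hf.deg, by rw [coeff_C_mul, hf.top],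
    by rw [reflect_C_mul, coeff_C_mul, hf.next]⟩

lemma HasTop.sum {ι : Type*} {s : Finset ι} {f : ι → A[X]} {a b : ι → A}
    (h : ∀ i ∈ s, HasTop F (f i) (a i) (b i)) :
    HasTop F (∑ i ∈ s, f i) (∑ i ∈ s, a i) (∑ i ∈ s, b i) := by
  refine ⟨natDegree_sum_le_of_forall_le _ _ fun i hi => (h i hi).deg, ?_, ?_⟩
  · rw [finsetSum_coeff]; exact Finset.sum_congr rfl fun i hi => (h i hi).top
  · rw [coeff_reflect, finsetSum_coeff]
    exact Finset.sum_congr rfl fun i hi => by rw [← coeff_reflect, (h i hi).next]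

end HasTop

/-- To first order in `u = 1 / x`, the `i`-th term is `(s + u) ^ i * (1 - s u) ^ (D - i)`, whose
linear coefficient is `i s ^ (i - 1) - (D - i) s ^ (i + 1) = (1 + s²) i s ^ (i - 1) - D s * s ^ i`.
-/
lemma hasTop_gmoebius {A : Type*} [CommRing A] (s : A) {D : ℕ} {f : ℤ[X]} (hf : f.natDegree ≤ D) :
    HasTop D (gmoebius s D f) (aeval s f)
      ((1 + s ^ 2) * aeval s (derivative f) - D * s * aeval s f) := by
  have h1 : HasTop 1 (Polynomial.C s * Polynomial.X + 1 : A[X]) s 1 := by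
    refine ⟨?_, by simp [coeff_one], ?_⟩
    · have := natDegree_linear_le (a := s) (b := 1)
      simpa using this
    · rw [coeff_reflect, revAt_le le_rfl]; simp
  have h2 : HasTop 1 (Polynomial.X - Polynomial.C s : A[X]) 1 (-s) := by
    refine ⟨natDegree_X_sub_C_le s, by simp, ?_⟩
    rw [coeff_reflect, revAt_le le_rfl]; simp
  have h : HasTop D (gmoebius s D f) _ _ := HasTop.sum fun i hi => by
    have hi := Finset.mem_range.mp hi
    have := ((h1.pow i).mul (h2.pow (D - i))).C_mul (f.coeff i : A)
    rw [show i + (D - i) = D by omega, ← mul_assoc] at this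
    exact this
  have hcoef : ∀ i, (derivative f).coeff i = f.coeff (i + 1) * (i + 1) := coeff_derivative f
  have hd : aeval s (derivative f) = ∑ i ∈ Finset.range (D + 1), (f.coeff i : A) * (i * s ^ (i - 1)) := by
    have hlt : (derivative f).natDegree < D + 1 := by
      have := natDegree_derivative_le f; omega
    rw [aeval_eq_sum_range' hlt, Finset.sum_range_succ, Finset.sum_range_succ', hcoef D,
      coeff_eq_zero_of_natDegree_lt (show f.natDegree < D + 1 by omega)]
    simp only [zero_mul, zero_smul, add_zero, Nat.cast_zero, mul_zero]
    refine Finset.sum_congr rfl fun i _ => ?_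
    rw [hcoef, zsmul_eq_mul, Nat.add_sub_cancel]
    push_cast; ring
  refine ⟨h.deg, h.top.trans ?_, h.next.trans ?_⟩
  · rw [aeval_eq_sum_range' (show f.natDegree < D + 1 by omega)]
    simp [zsmul_eq_mul]
  · rw [hd, aeval_eq_sum_range' (show f.natDegree < D + 1 by omega), Finset.mul_sum, Finset.mul_sum,
      ← Finset.sum_sub_distrib]
    refine Finset.sum_congr rfl fun i hi => ?_
    have hi := Finset.mem_range.mp hi
    obtain ⟨e, rfl⟩ : ∃ e, D = i + e := ⟨D - i, by omega⟩
    rw [Nat.add_sub_cancel_left, zsmul_eq_mul]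
    rcases i with _ | i
    · push_cast; simp; ring
    · rw [Nat.add_sub_cancel]; push_cast; simp only [one_pow]; ring

lemma eval_gmoebius {K : Type*} [Field K] {s x : K} {D : ℕ} {f : ℤ[X]} (hf : f.natDegree ≤ D)
    (hx : x ≠ s) :
    (gmoebius s D f).eval x = (x - s) ^ D * aeval ((s * x + 1) / (x - s)) f := by
  have hx' : x - s ≠ 0 := sub_ne_zero.mpr hx
  rw [gmoebius, eval_finsetSum, aeval_eq_sum_range' (show f.natDegree < D + 1 by omega),
    Finset.mul_sum]
  refine Finset.sum_congr rfl fun i hi => ?_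
  have hi := Finset.mem_range.mp hi
  simp only [eval_mul, eval_pow, eval_add, eval_sub, eval_C, eval_X, eval_one, zsmul_eq_mul]
  obtain ⟨e, rfl⟩ : ∃ e, D = i + e := ⟨D - i, by omega⟩
  rw [Nat.add_sub_cancel_left, div_pow, pow_add]
  field_simp

lemma eval_gmoebius_self {K : Type*} [Field K] (s : K) (D : ℕ) (f : ℤ[X]) :
    (gmoebius s D f).eval s = f.coeff D * (s ^ 2 + 1) ^ D := by
  rw [gmoebius, eval_finsetSum, Finset.sum_eq_single_of_mem D (by simp)]
  · simp only [eval_mul, eval_pow, eval_add, eval_C, eval_X, eval_one,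
      Nat.sub_self, pow_zero, mul_one, sq]
  · intro i hi hne
    have hi := Finset.mem_range.mp hi
    simp only [eval_mul, eval_pow, eval_sub, eval_C, eval_X, sub_self]
    rw [zero_pow (by omega), mul_zero]

variable {n : ℕ}

/-- The polynomial `φ.cross t₀ i` for a parameter in a ring. -/
noncomputable def gcross {A : Type*} [CommRing A] (φ : RatParam n) (s : A) (i : Fin n) : A[X] :=
  gmoebius s (φ.den i).natDegree (φ.num i) *
      Polynomial.C ((gmoebius s (φ.den i).natDegree (φ.den i)).coeff (φ.den i).natDegree) -
    gmoebius s (φ.den i).natDegree (φ.den i) *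
      Polynomial.C ((gmoebius s (φ.den i).natDegree (φ.num i)).coeff (φ.den i).natDegree)

lemma gcross_int (φ : RatParam n) (t₀ : ℤ) (i : Fin n) : φ.gcross t₀ i = φ.cross t₀ i := by
  simp only [gcross, cross, reparam, gmoebius_int]

/-- Compatibility with ring homomorphisms allows one computation over `ℤ[X]`, with `X` as the
parameter, to be specialized to `ℂ`, to `ℤ` and to `ZMod r`. -/
lemma map_gcross {A B : Type*} [CommRing A] [CommRing B] (g : A →+* B) (φ : RatParam n) (s : A)
    (i : Fin n) : (φ.gcross s i).map g = φ.gcross (g s) i := by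
  have key : ∀ (D j : ℕ) (f : ℤ[X]), (gmoebius (g s) D f).coeff j = g ((gmoebius s D f).coeff j) :=
    fun D j f => by rw [← map_gmoebius, coeff_map]
  simp only [gcross, Polynomial.map_sub, Polynomial.map_mul, map_gmoebius, map_C, key]

/-- The terms with `D * s` cancel, and what remains is `1 + s²` times the numerator of the
derivative of the fraction: the new tangent vector at infinity is the old one at `s` up to a scalar.
-/
lemma gcross_coeff_pred {A : Type*} [CommRing A] {φ : RatParam n}
    (hdeg : ∀ i, (φ.num i).natDegree ≤ (φ.den i).natDegree) (s : A) {i : Fin n}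
    (hi : 0 < (φ.den i).natDegree) :
    (φ.gcross s i).coeff ((φ.den i).natDegree - 1) = (1 + s ^ 2) *
      aeval s (derivative (φ.num i) * φ.den i - φ.num i * derivative (φ.den i)) := by
  have h1 := hasTop_gmoebius s (hdeg i)
  have h2 := hasTop_gmoebius s (le_refl (φ.den i).natDegree)
  have h3 := h1.next
  have h4 := h2.next
  rw [coeff_reflect, revAt_le (by omega)] at h3 h4
  rw [gcross, coeff_sub, coeff_mul_C, coeff_mul_C, h3, h4, h1.top, h2.top, map_sub, map_mul, map_mul]
  ring

lemma exists_natDegree_pos {φ : RatParam n} (hp : φ.IsProper) (hr : φ.IsReduced)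
    (hdeg : ∀ i, (φ.num i).natDegree ≤ (φ.den i).natDegree) : ∃ k, 0 < (φ.den k).natDegree := by
  by_contra! h
  have := (pos_of_isProper hp hr (d := 0) fun i => ⟨(hdeg i).trans (h i), h i⟩).2
  omega

/-- If it vanished, coprimality would make the denominator divide its own derivative; by degree the
derivative would be zero and the denominator constant. -/
lemma wronskian_ne_zero {φ : RatParam n} (hr : φ.IsReduced) {k : Fin n}
    (hk : 0 < (φ.den k).natDegree) :
    derivative (φ.num k) * φ.den k - φ.num k * derivative (φ.den k) ≠ 0 := by
  intro h0
  have hinj : Function.Injective (Int.castRingHom ℚ) := Int.cast_injective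
  have hd : (φ.den k).map (Int.castRingHom ℚ) ∣ (derivative (φ.den k)).map (Int.castRingHom ℚ) := by
    refine (hr k).2.symm.dvd_of_dvd_mul_right ⟨(derivative (φ.num k)).map (Int.castRingHom ℚ), ?_⟩
    rw [← Polynomial.map_mul, ← Polynomial.map_mul, mul_comm _ (φ.num k), ← sub_eq_zero.mp h0, mul_comm]
  have h1 : (derivative (φ.den k)).map (Int.castRingHom ℚ) = 0 := by
    by_contra hne
    have h2 := natDegree_le_of_dvd hd hne
    rw [natDegree_map_eq_of_injective hinj, natDegree_map_eq_of_injective hinj] at h2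
    have h3 := natDegree_derivative_lt (p := φ.den k) (by omega)
    omega
  rw [Polynomial.map_eq_zero_iff hinj] at h1
  have h2 := derivative_eq_zero.mp h1
  omega

/-- Otherwise the denominator would divide its leading coefficient and be constant. In other words,
the coordinate is not identically equal to its limit. -/
lemma sub_infinity_ne_zero {φ : RatParam n} (hr : φ.IsReduced) {k : Fin n}
    (hk : 0 < (φ.den k).natDegree) :
    φ.num k * Polynomial.C (φ.den k).leadingCoeff -
      φ.den k * Polynomial.C ((φ.num k).coeff (φ.den k).natDegree) ≠ 0 := by
  intro h0
  have hinj : Function.Injective (Int.castRingHom ℚ) := Int.cast_injective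
  have hd : (φ.den k).map (Int.castRingHom ℚ) ∣
      (Polynomial.C (φ.den k).leadingCoeff).map (Int.castRingHom ℚ) := by
    refine (hr k).2.symm.dvd_of_dvd_mul_left ⟨(Polynomial.C
      ((φ.num k).coeff (φ.den k).natDegree)).map (Int.castRingHom ℚ), ?_⟩
    rw [← Polynomial.map_mul, ← Polynomial.map_mul, sub_eq_zero.mp h0]
  have h1 : (Polynomial.C (φ.den k).leadingCoeff).map (Int.castRingHom ℚ) ≠ 0 := by
    rw [Polynomial.map_ne_zero_iff hinj, C_ne_zero, leadingCoeff_ne_zero]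
    exact (hr k).1
  have h2 := natDegree_le_of_dvd hd h1
  rw [natDegree_map_eq_of_injective hinj, natDegree_map_eq_of_injective hinj, natDegree_C] at h2
  omega

/-- Take `a` outside the exceptional set of properness and outside the zeros of a fixed nonzero
polynomial. A common root `x ≠ a` yields `r = (a x + 1) / (x - a)` with `φ(r) = φ(a)`; here `r` is
no pole by coprimality, and `r ≠ a` because `a² + 1 ≠ 0`, which contradicts the choice of `a`. The
root `x = a` corresponds to `r = ∞` and is excluded by the factor `E`. The factor `W` keeps the
tangent coefficient from vanishing. -/
lemma exists_generic_parameter {φ : RatParam n} (hp : φ.IsProper) (hr : φ.IsReduced)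
    (hdeg : ∀ i, (φ.num i).natDegree ≤ (φ.den i).natDegree) : ∃ (a : ℂ) (k : Fin n),
      0 < (φ.den k).natDegree ∧ (φ.gcross a k).coeff ((φ.den k).natDegree - 1) ≠ 0 ∧
      ∀ x, ∃ i, (φ.gcross a i).eval x ≠ 0 := by
  obtain ⟨k, hk⟩ := exists_natDegree_pos hp hr hdeg
  have hX : (Polynomial.X ^ 2 + Polynomial.C 1 : ℤ[X]) ≠ 0 := X_pow_add_C_ne_zero (by norm_num) 1
  set W := derivative (φ.num k) * φ.den k - φ.num k * derivative (φ.den k) with hW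
  set E := φ.num k * Polynomial.C (φ.den k).leadingCoeff -
    φ.den k * Polynomial.C ((φ.num k).coeff (φ.den k).natDegree) with hE
  have hΩ : (∏ i, φ.den i) * (Polynomial.X ^ 2 + Polynomial.C 1) * W * E ≠ 0 :=
    mul_ne_zero (mul_ne_zero (mul_ne_zero (Finset.prod_ne_zero_iff.mpr fun i _ => (hr i).1) hX)
      (wronskian_ne_zero hr hk)) (sub_infinity_ne_zero hr hk)
  have hfin := Set.Finite.union hp (rootSet_finite
    ((∏ i, φ.den i) * (Polynomial.X ^ 2 + Polynomial.C 1) * W * E) ℂ)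
  obtain ⟨a, ha⟩ := hfin.exists_notMem
  rw [Set.mem_union, not_or, mem_rootSet_of_ne hΩ] at ha
  obtain ⟨ha1, ha2⟩ := ha
  simp only [map_mul, mul_eq_zero, not_or, map_prod, Finset.prod_eq_zero_iff, not_exists, not_and,
    Finset.mem_univ, true_imp_iff, map_add, map_pow, aeval_X, map_one] at ha2
  obtain ⟨⟨⟨hden, hX⟩, hWa⟩, hEa⟩ := ha2
  have hX' : a ^ 2 + 1 ≠ 0 := hX
  have hpole : ¬ φ.IsPole a := fun ⟨i, hi⟩ => hden i hi
  refine ⟨a, k, hk, ?_, fun x => ?_⟩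
  · rw [gcross_coeff_pred hdeg a hk]
    exact mul_ne_zero (by rwa [add_comm]) hWa
  by_contra! hx
  have htop : ∀ i, aeval a (φ.num i) = (gmoebius a (φ.den i).natDegree (φ.num i)).coeff
      (φ.den i).natDegree := fun i => (hasTop_gmoebius a (hdeg i)).top.symm
  have htop' : ∀ i, aeval a (φ.den i) = (gmoebius a (φ.den i).natDegree (φ.den i)).coeff
      (φ.den i).natDegree := fun i => (hasTop_gmoebius a le_rfl).top.symm
  have hx' : ∀ i, (gmoebius a (φ.den i).natDegree (φ.num i)).eval x * aeval a (φ.den i) =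
      (gmoebius a (φ.den i).natDegree (φ.den i)).eval x * aeval a (φ.num i) := fun i => by
    have := hx i
    rw [gcross, eval_sub, eval_mul, eval_mul, eval_C, eval_C, ← htop, ← htop'] at this
    exact sub_eq_zero.mp this
  by_cases hxa : x = a
  · have h1 := hx' k
    rw [hxa, eval_gmoebius_self, eval_gmoebius_self] at h1
    refine hEa ?_
    rw [hE, map_sub, map_mul, map_mul, aeval_C, aeval_C]
    have h2 : (a ^ 2 + 1) ^ (φ.den k).natDegree ≠ 0 := pow_ne_zero _ hX'
    refine mul_left_cancel₀ h2 ?_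
    simp only [algebraMap_int_eq, eq_intCast, leadingCoeff]
    linear_combination -h1
  · have hxa' : x - a ≠ 0 := sub_ne_zero.mpr hxa
    obtain ⟨r, hre⟩ : ∃ r, r = (a * x + 1) / (x - a) := ⟨_, rfl⟩
    have h2 : ∀ i, aeval r (φ.num i) * aeval a (φ.den i) =
        aeval r (φ.den i) * aeval a (φ.num i) := fun i => by
      have := hx' i
      rw [eval_gmoebius (hdeg i) hxa, eval_gmoebius le_rfl hxa, ← hre, mul_assoc, mul_assoc] at this
      exact mul_left_cancel₀ (pow_ne_zero _ hxa') this
    have hrpole : ¬ φ.IsPole r := by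
      rintro ⟨i, hi⟩
      have h3 := h2 i
      rw [hi, zero_mul, mul_eq_zero, or_iff_left (hden i)] at h3
      have h4 := (isCoprime_iff_aeval_ne_zero_of_isAlgClosed (k := ℚ) ℂ _ _).mp (hr i).2 r
      have hmap : ∀ f : ℤ[X], aeval r (f.map (Int.castRingHom ℚ)) = aeval r f := fun f =>
        aeval_map_algebraMap ℚ r f
      rw [hmap, hmap] at h4
      exact h4.elim (fun h => h h3) (fun h => h hi)
    refine ha1 ⟨hpole, r, hrpole, ?_, ?_⟩
    · intro h
      rw [hre, div_eq_iff hxa'] at h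
      exact hX' (by linear_combination h)
    · funext i
      rw [point, point, div_eq_div_iff (fun h => hrpole ⟨i, h⟩) (hden i), h2 i, mul_comm]

end RatParam

/-! ### Determinants that witness the unit ideal -/

namespace RatParam

section Shifts
variable {n : ℕ}

lemma mul_mem_span_shifts {K : Type*} [Field K] {g : Fin n → K[X]} {D : Fin n → ℕ} {M : ℕ}
    {i : Fin n} {q : K[X]} (hq : q ≠ 0 → q.natDegree + D i ≤ M) :
    q * g i ∈ Submodule.span K {p | ∃ i j, j + D i ≤ M ∧ p = Polynomial.X ^ j * g i} := by
  rcases eq_or_ne q 0 with rfl | h0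
  · simp
  have hq := hq h0
  rw [q.as_sum_range_C_mul_X_pow, Finset.sum_mul]
  refine Submodule.sum_mem _ fun j hj => ?_
  rw [mul_assoc, ← smul_eq_C_mul]
  exact Submodule.smul_mem _ _ (Submodule.subset_span
    ⟨i, j, by have := Finset.mem_range.mp hj; omega, rfl⟩)

/-- In a representation of `f` by the `g i`, reduce all multipliers modulo `g k`, whose degree is
exactly `D k - 1`. The remainders have degree at most `D k - 2`, and comparing degrees then bounds
the multiplier collected at `g k`. So multipliers of bounded degree suffice. -/
lemma mem_span_shifts {K : Type*} [Field K] {g : Fin n → K[X]} {D : Fin n → ℕ} {d : ℕ}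
    (hD : ∀ i, D i ≤ d) (hg : ∀ i, (g i).degree < D i) {k : Fin n} (hk : 0 < D k)
    (hgk : (g k).coeff (D k - 1) ≠ 0) (hspan : Ideal.span (Set.range g) = ⊤) {f : K[X]}
    (hf : f.degree < (2 * d : ℕ)) :
    f ∈ Submodule.span K {p | ∃ i j, j + D i ≤ 2 * d ∧ p = Polynomial.X ^ j * g i} := by
  have hfm : f ∈ Ideal.span (Set.range g) := hspan ▸ Submodule.mem_top
  obtain ⟨a, ha⟩ := (Ideal.mem_span_range_iff_exists_fun).mp hfm
  have hg0 : g k ≠ 0 := by rintro h; simp [h] at hgk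
  have hkd : (g k).natDegree = D k - 1 := by
    have h1 := (natDegree_lt_iff_degree_lt hg0).mpr (hg k)
    have h2 := le_natDegree_of_ne_zero hgk
    omega
  have hsplit : f = ∑ i, (a i % g k) * g i + (∑ i, (a i / g k) * g i) * g k := by
    rw [← ha, Finset.sum_mul, ← Finset.sum_add_distrib]
    refine Finset.sum_congr rfl fun i _ => ?_
    conv_lhs => rw [← EuclideanDomain.mod_add_div (a i) (g k)]
    ring
  have hmod : ∀ i, a i % g k ≠ 0 → (a i % g k).natDegree + 2 ≤ D k := fun i h0 => by
    have h1 := (natDegree_lt_natDegree_iff h0).mpr (EuclideanDomain.mod_lt (a i) hg0)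
    omega
  rw [hsplit]
  refine Submodule.add_mem _ (Submodule.sum_mem _ fun i _ => mul_mem_span_shifts fun h0 => ?_)
    (mul_mem_span_shifts fun h0 => ?_)
  · have := hmod i h0
    have := hD i
    have := hD k
    omega
  · have hlt : ((∑ i, (a i / g k) * g i) * g k).degree < (2 * d : ℕ) := by
      rw [← sub_eq_iff_eq_add'.mpr hsplit]
      refine (degree_sub_le _ _).trans_lt (max_lt hf ((degree_sum_le _ _).trans_lt ?_))
      refine (Finset.sup_lt_iff (by exact WithBot.bot_lt_coe _)).mpr fun i _ => ?_
      rcases eq_or_ne (a i % g k * g i) 0 with h1 | h1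
      · rw [h1, degree_zero]; exact WithBot.bot_lt_coe _
      · rw [← natDegree_lt_iff_degree_lt h1, natDegree_mul (left_ne_zero_of_mul h1)
          (right_ne_zero_of_mul h1)]
        have h2 := hmod i (left_ne_zero_of_mul h1)
        have h3 := (natDegree_lt_iff_degree_lt (right_ne_zero_of_mul h1)).mpr (hg i)
        have := hD i
        have := hD k
        omega
    rw [← natDegree_lt_iff_degree_lt (mul_ne_zero h0 hg0), natDegree_mul h0 hg0] at hlt
    omega

/-- The admissible shifts span the `2d`-dimensional space of polynomials of degree below `2d`, so
`2d` of them form a basis; the matrix generalizes that of Sylvester. -/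
lemma exists_det_ne_zero {K : Type*} [Field K] {g : Fin n → K[X]} {D : Fin n → ℕ} {d : ℕ}
    (hD : ∀ i, D i ≤ d) (hg : ∀ i, (g i).degree < D i) {k : Fin n} (hk : 0 < D k)
    (hgk : (g k).coeff (D k - 1) ≠ 0) (hspan : Ideal.span (Set.range g) = ⊤) :
    ∃ e : Fin (2 * d) → Fin n × ℕ, (∀ l, (e l).2 + D (e l).1 ≤ 2 * d) ∧
      (Matrix.of fun l c : Fin (2 * d) =>
        (Polynomial.X ^ (e l).2 * g (e l).1).coeff c).det ≠ 0 := by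
  let ι := {x : Fin n × ℕ // x.2 + D x.1 ≤ 2 * d}
  let L : K[X] →ₗ[K] (Fin (2 * d) → K) := LinearMap.pi fun c => lcoeff K c
  let w : ι → Fin (2 * d) → K := fun x => L (Polynomial.X ^ x.1.2 * g x.1.1)
  have htop : ⊤ ≤ Submodule.span K (Set.range w) := by
    intro v _
    let f : K[X] := ∑ c : Fin (2 * d), Polynomial.C (v c) * Polynomial.X ^ (c : ℕ)
    have hf : f.degree < (2 * d : ℕ) := by
      refine (degree_sum_le _ _).trans_lt ((Finset.sup_lt_iff (WithBot.bot_lt_coe _)).mpr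
        fun c _ => (degree_C_mul_X_pow_le _ _).trans_lt ?_)
      exact_mod_cast c.2
    have hLf : L f = v := by
      funext c
      simp only [L, f, LinearMap.pi_apply, lcoeff_apply, finsetSum_coeff, coeff_C_mul, coeff_X_pow]
      rw [Finset.sum_eq_single c]
      · simp
      · intro b _ hb
        rw [if_neg (fun h => hb (Fin.ext h.symm)), mul_zero]
      · simp
    have h1 := Submodule.mem_map_of_mem (f := L) (mem_span_shifts hD hg hk hgk hspan hf)
    rw [hLf, Submodule.map_span] at h1
    refine Submodule.span_mono ?_ h1
    rintro _ ⟨p, ⟨i, j, hij, rfl⟩, rfl⟩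
    exact ⟨⟨(i, j), hij⟩, rfl⟩
  obtain ⟨κ, a, -, hs, hli⟩ := exists_linearIndependent' K w
  let b := Module.Basis.mk hli (hs.symm ▸ htop)
  let eq := (Pi.basisFun K (Fin (2 * d))).indexEquiv b
  refine ⟨fun l => (a (eq l)).1, fun l => (a (eq l)).2, ?_⟩
  rw [← isUnit_iff_ne_zero, ← Matrix.isUnit_iff_isUnit_det, ← Matrix.linearIndependent_rows_iff_isUnit]
  exact hli.comp eq eq.injective

end Shifts

/-- All the coefficients of a polynomial over `ℤ[X]` have degree at most `e`. -/
def CoeffDegLE (e : ℕ) (p : ℤ[X][X]) : Prop := ∀ j, (p.coeff j).natDegree ≤ e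

namespace CoeffDegLE
variable {e e' : ℕ} {p q : ℤ[X][X]}

lemma mul (hp : CoeffDegLE e p) (hq : CoeffDegLE e' q) : CoeffDegLE (e + e') (p * q) := fun j => by
  rw [coeff_mul]
  exact natDegree_sum_le_of_forall_le _ _ fun x _ =>
    natDegree_mul_le.trans (add_le_add (hp _) (hq _))

lemma pow (hp : CoeffDegLE e p) (k : ℕ) : CoeffDegLE (k * e) (p ^ k) := by
  induction k with
  | zero => intro j; rw [pow_zero, coeff_one]; split_ifs <;> simp
  | succ k ih => rw [pow_succ, Nat.succ_mul]; exact ih.mul hp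

lemma C {c : ℤ[X]} (hc : c.natDegree ≤ e) : CoeffDegLE e (Polynomial.C c) := fun j => by
  rw [coeff_C]; split_ifs <;> simp [hc]

lemma X : CoeffDegLE 0 (Polynomial.X : ℤ[X][X]) := fun j => by
  rw [coeff_X]; split_ifs <;> simp

lemma sub (hp : CoeffDegLE e p) (hq : CoeffDegLE e q) : CoeffDegLE e (p - q) := fun j => by
  rw [coeff_sub]; exact (natDegree_sub_le _ _).trans (max_le (hp j) (hq j))

lemma add (hp : CoeffDegLE e p) (hq : CoeffDegLE e q) : CoeffDegLE e (p + q) := fun j => by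
  rw [coeff_add]; exact natDegree_add_le_of_degree_le (hp j) (hq j)

lemma sum {ι : Type*} {s : Finset ι} {f : ι → ℤ[X][X]} (h : ∀ i ∈ s, CoeffDegLE e (f i)) :
    CoeffDegLE e (∑ i ∈ s, f i) := fun j => by
  rw [finsetSum_coeff]; exact natDegree_sum_le_of_forall_le _ _ fun i hi => h i hi j

lemma mono (hp : CoeffDegLE e p) (h : e ≤ e') : CoeffDegLE e' p := fun j => (hp j).trans h

lemma gmoebius (D : ℕ) (f : ℤ[X]) : CoeffDegLE D (gmoebius (Polynomial.X : ℤ[X]) D f) := by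
  refine sum fun i hi => ?_
  have hi := Finset.mem_range.mp hi
  have h1 : CoeffDegLE 1 (Polynomial.C Polynomial.X * Polynomial.X + 1 : ℤ[X][X]) :=
    ((C natDegree_X_le).mul X).add (C (e := 1) (c := 1) (by simp))
  have h2 : CoeffDegLE 1 (Polynomial.X - Polynomial.C Polynomial.X : ℤ[X][X]) :=
    (X.mono zero_le_one).sub (C natDegree_X_le)
  refine (((C (e := 0) (c := (f.coeff i : ℤ[X])) (by simp)).mul (h1.pow i)).mul
    (h2.pow (D - i))).mono (by omega)

end CoeffDegLE

variable {n : ℕ}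

lemma coeffDegLE_gcross (φ : RatParam n) (i : Fin n) :
    CoeffDegLE (2 * (φ.den i).natDegree) (φ.gcross (Polynomial.X : ℤ[X]) i) := by
  rw [two_mul]
  exact ((CoeffDegLE.gmoebius _ _).mul (.C (CoeffDegLE.gmoebius _ _ _))).sub
    ((CoeffDegLE.gmoebius _ _).mul (.C (CoeffDegLE.gmoebius _ _ _)))

lemma degree_gcross_lt {A : Type*} [CommRing A] {φ : RatParam n}
    (hdeg : ∀ i, (φ.num i).natDegree ≤ (φ.den i).natDegree) (s : A) (i : Fin n) :
    (φ.gcross s i).degree < (φ.den i).natDegree := by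
  rw [degree_lt_iff_coeff_zero]
  intro j hj
  have h1 := hasTop_gmoebius s (hdeg i)
  have h2 := hasTop_gmoebius s (le_refl (φ.den i).natDegree)
  rw [gcross, coeff_sub, coeff_mul_C, coeff_mul_C]
  rcases hj.eq_or_lt with rfl | hj
  · ring
  · rw [coeff_eq_zero_of_natDegree_lt (h1.deg.trans_lt hj),
      coeff_eq_zero_of_natDegree_lt (h2.deg.trans_lt hj)]; ring

/-- A square matrix of coefficients of shifts of the polynomials `φ.gcross s i`. -/
noncomputable def minor {A : Type*} [CommRing A] (φ : RatParam n) (s : A) {M : ℕ}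
    (e : Fin M → Fin n × ℕ) : Matrix (Fin M) (Fin M) A :=
  .of fun l c => (Polynomial.X ^ (e l).2 * φ.gcross s (e l).1).coeff c

lemma map_det_minor {A B : Type*} [CommRing A] [CommRing B] (g : A →+* B) (φ : RatParam n) (s : A)
    {M : ℕ} (e : Fin M → Fin n × ℕ) : g (φ.minor s e).det = (φ.minor (g s) e).det := by
  rw [RingHom.map_det]
  congr 1
  ext l c
  simp [minor, ← map_gcross, ← coeff_map]

lemma natDegree_det_minor_le {φ : RatParam n} {d : ℕ} (hd : ∀ i, (φ.den i).natDegree ≤ d) {M : ℕ}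
    (e : Fin M → Fin n × ℕ) : (φ.minor (Polynomial.X : ℤ[X]) e).det.natDegree ≤ M * (2 * d) := by
  rw [Matrix.det_apply]
  refine natDegree_sum_le_of_forall_le _ _ fun σ _ => (natDegree_smul_le _ _).trans ?_
  refine (natDegree_prod_le _ _).trans ((Finset.sum_le_card_nsmul _ _ (2 * d) fun l _ => ?_).trans ?_)
  · refine (((CoeffDegLE.X.pow _).mul (φ.coeffDegLE_gcross _)) _).trans ?_
    have := hd (e l).1
    have := hd (e (σ l)).1
    omega
  · simp

/-- By Cramer's rule a row of the adjugate combines the shifts to the constant polynomial with value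
the determinant. The degree condition on the shifts ensures that no coefficient beyond the matrix is
lost. -/
lemma span_gcross_eq_top {F : Type*} [Field F] {φ : RatParam n}
    (hdeg : ∀ i, (φ.num i).natDegree ≤ (φ.den i).natDegree) {s : F} {M : ℕ} (hM : 0 < M)
    {e : Fin M → Fin n × ℕ} (he : ∀ l, (e l).2 + (φ.den (e l).1).natDegree ≤ M)
    (h : (φ.minor s e).det ≠ 0) : Ideal.span (Set.range (φ.gcross s)) = ⊤ := by
  refine Ideal.eq_top_of_isUnit_mem _ (x := Polynomial.C (φ.minor s e).det) ?_
    (isUnit_C.mpr (isUnit_iff_ne_zero.mpr h))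
  have key : Polynomial.C (φ.minor s e).det = ∑ l, Polynomial.C ((φ.minor s e).adjugate ⟨0, hM⟩ l) *
      Polynomial.X ^ (e l).2 * φ.gcross s (e l).1 := by
    ext c
    simp only [finsetSum_coeff, mul_assoc, coeff_C_mul]
    rcases lt_or_ge c M with hc | hc
    · have h1 := congrFun (congrFun (φ.minor s e).adjugate_mul ⟨0, hM⟩) ⟨c, hc⟩
      rw [Matrix.mul_apply] at h1
      refine (Eq.trans ?_ h1.symm)
      rw [coeff_C, Matrix.smul_apply, Matrix.one_apply]
      simp [Fin.ext_iff, eq_comm]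
    · rw [coeff_C_of_ne_zero (by omega), Finset.sum_eq_zero]
      intro l _
      rw [coeff_X_pow_mul', if_pos (by have := he l; omega),
        (degree_lt_iff_coeff_zero _ _).mp (degree_gcross_lt hdeg s (e l).1) _
          (by have := he l; omega), mul_zero]
  rw [key]
  exact Ideal.sum_mem _ fun l _ => Ideal.mul_mem_left _ _ (Ideal.subset_span ⟨_, rfl⟩)

lemma crossIdeal_eq_span (φ : RatParam n) (t₀ : ℤ) (r : ℕ) :
    φ.crossIdeal t₀ r n = Ideal.span (Set.range (φ.gcross (t₀ : ZMod r))) := by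
  rw [crossIdeal]
  congr 1
  ext f
  constructor
  · rintro ⟨k, -, rfl⟩
    exact ⟨k, by rw [← gcross_int, map_gcross]; simp⟩
  · rintro ⟨k, rfl⟩
    exact ⟨k, k.2, by rw [← gcross_int, map_gcross]; simp⟩

/-- Outside the zeros of a polynomial of low degree, a parameter is certified by every prime number
that does not divide a certain integer. -/
lemma exists_minor {φ : RatParam n} (hp : φ.IsProper) (hr : φ.IsReduced) {d : ℕ}
    (hdeg : ∀ i, (φ.num i).natDegree ≤ (φ.den i).natDegree) (hd : ∀ i, (φ.den i).natDegree ≤ d) :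
    ∃ Δ E : ℤ[X], Δ ≠ 0 ∧ Δ.natDegree ≤ 4 * d ^ 2 + 2 * d + n * d ∧ ∀ t₀ : ℤ, Δ.eval t₀ ≠ 0 →
      E.eval t₀ ≠ 0 ∧
      (∀ B : ℤ, (∀ i j, |(φ.cross t₀ i).coeff j| ≤ B) →
        |E.eval t₀| ≤ (2 * d).factorial * B ^ (2 * d + 1)) ∧
      ∀ r : ℕ, r.Prime → ¬ (r : ℤ) ∣ E.eval t₀ → φ.IsCert t₀ r := by
  obtain ⟨a, k, hk, hak, hroot⟩ := exists_generic_parameter hp hr hdeg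
  -- Over `ℂ` the ideal has one generator; a nonunit would have a root common to all the
  -- polynomials, unless it is zero, and the same argument covers that case.
  have hspan : Ideal.span (Set.range (φ.gcross a)) = ⊤ := by
    obtain ⟨g, hg⟩ := IsPrincipalIdealRing.principal (Ideal.span (Set.range (φ.gcross a)))
    have hg : Ideal.span (Set.range (φ.gcross a)) = Ideal.span {g} := hg
    rw [hg, Ideal.span_singleton_eq_top]
    by_contra hu
    have hdvd : ∀ i, g ∣ φ.gcross a i := fun i =>
      Ideal.mem_span_singleton.mp (hg ▸ Ideal.subset_span ⟨i, rfl⟩)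
    have hdeg0 : g.degree ≠ 0 := fun h => hu (isUnit_iff_degree_eq_zero.mpr h)
    obtain ⟨x, hx⟩ := IsAlgClosed.exists_root g hdeg0
    obtain ⟨i, hi⟩ := hroot x
    exact hi (eval_eq_zero_of_dvd_of_eval_eq_zero (hdvd i) hx)
  obtain ⟨e, he, hdet⟩ := exists_det_ne_zero hd (degree_gcross_lt hdeg a) hk hak hspan
  have hdpos : 0 < d := hk.trans_le (hd k)
  obtain ⟨δ, hδ⟩ : ∃ δ, δ = (φ.minor (Polynomial.X : ℤ[X]) e).det := ⟨_, rfl⟩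
  obtain ⟨γ, hγ⟩ : ∃ γ, γ = (φ.gcross (Polynomial.X : ℤ[X]) k).coeff ((φ.den k).natDegree - 1) :=
    ⟨_, rfl⟩
  have hδ0 : δ ≠ 0 := by
    intro h
    refine hdet ?_
    have := map_det_minor (aeval a : ℤ[X] →ₐ[ℤ] ℂ).toRingHom φ Polynomial.X e
    rw [← hδ, h, map_zero] at this
    simpa [minor] using this.symm
  have hγ0 : γ ≠ 0 := by
    intro h
    refine hak ?_
    have := map_gcross (aeval a : ℤ[X] →ₐ[ℤ] ℂ).toRingHom φ Polynomial.X k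
    have h2 := congrArg (fun f => f.coeff ((φ.den k).natDegree - 1)) this
    simp only [coeff_map, ← hγ, h, map_zero] at h2
    simpa using h2.symm
  have hδe : ∀ t₀ : ℤ, δ.eval t₀ = (φ.minor t₀ e).det := fun t₀ => by
    have := map_det_minor (evalRingHom t₀) φ Polynomial.X e
    rw [← hδ] at this
    simpa using this
  have hγe : ∀ t₀ : ℤ, γ.eval t₀ = (φ.cross t₀ k).coeff ((φ.den k).natDegree - 1) := fun t₀ => by
    have := map_gcross (evalRingHom t₀) φ Polynomial.X k
    have h2 := congrArg (fun f => f.coeff ((φ.den k).natDegree - 1)) this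
    simp only [coeff_map, ← hγ, coe_evalRingHom, eval_X, gcross_int] at h2
    exact h2
  -- The denominators enter only `Δ`: a certificate requires their values at `t₀` to be nonzero
  -- integers, not units modulo `r`. The minor and the tangent coefficient must survive modulo `r`,
  -- so they form `E`.
  refine ⟨δ * γ * ∏ i, φ.den i, δ * γ, mul_ne_zero (mul_ne_zero hδ0 hγ0)
    (Finset.prod_ne_zero_iff.mpr fun i _ => (hr i).1), ?_, fun t₀ ht => ?_⟩
  · have h1 : δ.natDegree ≤ 2 * d * (2 * d) := hδ ▸ natDegree_det_minor_le hd e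
    have h2 : γ.natDegree ≤ 2 * d := by
      rw [hγ]
      exact (φ.coeffDegLE_gcross k _).trans (by have := hd k; omega)
    have h3 : (∏ i, φ.den i).natDegree ≤ n * d := by
      refine (natDegree_prod_le _ _).trans ((Finset.sum_le_card_nsmul _ _ d fun i _ => hd i).trans ?_)
      simp
    refine natDegree_mul_le.trans (add_le_add (natDegree_mul_le.trans ?_) h3)
    nlinarith
  · rw [eval_mul, eval_prod] at ht
    have hE := left_ne_zero_of_mul ht
    have hden := Finset.prod_ne_zero_iff.mp (right_ne_zero_of_mul ht)
    refine ⟨hE, fun B hB => ?_, fun r hrp hrE => ?_⟩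
    · rw [eval_mul, abs_mul, pow_succ, ← mul_assoc]
      have hB0 : 0 ≤ B := (abs_nonneg _).trans (hB k 0)
      refine mul_le_mul ?_ (hγe t₀ ▸ hB k _) (abs_nonneg _) (by positivity)
      rw [hδe]
      have := Matrix.det_le (A := φ.minor t₀ e) (abv := AbsoluteValue.abs) (x := B) fun l c => by
        rw [minor, Matrix.of_apply, coeff_X_pow_mul', gcross_int]
        split_ifs
        · exact hB _ _
        · simpa using hB0
      simpa using this
    · have := Fact.mk hrp
      rw [eval_mul, (Nat.prime_iff_prime_int.mp hrp).dvd_mul, not_or, hδe, hγe] at hrE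
      refine ⟨hrp, fun i => ?_, ?_, k, hk, ?_⟩
      · rw [show ((φ.reparam t₀).den i) = moebius t₀ (φ.den i).natDegree (φ.den i) from rfl,
          coeff_moebius_top _ le_rfl]
        exact hden i (Finset.mem_univ i)
      · rw [crossIdeal_eq_span]
        refine span_gcross_eq_top hdeg (M := 2 * d) (by omega) he ?_
        have := map_det_minor (Int.castRingHom (ZMod r)) φ t₀ e
        simp only [eq_intCast] at this
        rw [← this, Ne, ZMod.intCast_zmod_eq_zero_iff_dvd]
        exact hrE.1
      · rw [Ne, ZMod.intCast_zmod_eq_zero_iff_dvd]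
        exact hrE.2

end RatParam

/-! ### The probability of success -/

namespace BitRAM

lemma card_primeFactors_le {N K : ℕ} (hN : N ≠ 0) (h : N ≤ 2 ^ K) : N.primeFactors.card ≤ K := by
  rw [← Nat.pow_le_pow_iff_right (a := 2) (by norm_num)]
  calc 2 ^ N.primeFactors.card ≤ ∏ p ∈ N.primeFactors, p :=
        Finset.pow_card_le_prod _ _ _ fun p hp => (Nat.prime_of_mem_primeFactors hp).two_le
    _ ≤ N := Nat.le_of_dvd (Nat.pos_of_ne_zero hN) (Nat.prod_primeFactors_dvd N)
    _ ≤ 2 ^ K := h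

/-- This is Chebyshev's lower bound at `2 ^ b` with the common factor `log 2` cancelled; the
correction `log (2 ^ b + 1) ≤ 2 b log 2` becomes the summand `2 * b`. -/
lemma two_pow_le_primeCounting {b : ℕ} (hb : 0 < b) :
    2 ^ b ≤ b * Nat.primeCounting (2 ^ b) + 2 * b := by
  have h := Chebyshev.pi_ge (2 ^ b)
  have hlog2 : 0 < Real.log 2 := Real.log_pos (by norm_num)
  have hb' : (1 : ℝ) ≤ b := by exact_mod_cast hb
  have hlog : Real.log ((2 ^ b : ℕ) : ℝ) = b * Real.log 2 := by push_cast; rw [Real.log_pow]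
  rw [hlog, div_le_iff₀ (by positivity)] at h
  have h2 : Real.log (((2 ^ b : ℕ) : ℝ) + 1) ≤ 2 * b * Real.log 2 := by
    have : ((2 ^ b : ℕ) : ℝ) + 1 ≤ 2 ^ (2 * b) := by
      have : 2 ^ b + 1 ≤ 2 ^ (2 * b) := by
        rw [two_mul, pow_add]
        have : 2 ≤ 2 ^ b := Nat.le_self_pow (by omega) 2
        nlinarith
      exact_mod_cast this
    refine (Real.log_le_log (by positivity) this).trans ?_
    rw [Real.log_pow]; push_cast; rfl
  have h3 : (((2 ^ b : ℕ) : ℝ)) * Real.log 2 ≤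
      (b * Nat.primeCounting (2 ^ b) + 2 * b) * Real.log 2 := by nlinarith
  exact_mod_cast le_of_mul_le_mul_right h3 hlog2

end BitRAM

namespace RatParam
open BitRAM
variable {n : ℕ}

/-- At least half of the `t < T = 2 ^ b` are no roots of `Δ`, whose degree is at most `7 Z²`. For
such `t` the number `E(t)` has at most `10 b Z²` prime divisors, while there are roughly `T / b`
primes up to `T`. As `T > Z ^ 8`, at least `T / (2b)` primes remain, and so at least `T² / (4b)`
pairs. -/
lemma exists_good_tosses {φ : RatParam n} (hp : φ.IsProper) (hr : φ.IsReduced) {d m b c : ℕ}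
    {H : ℤ} (hs : Setup φ d m b H) (hc : φ.sumSq d < 2 ^ 2 ^ c) (hb : (n + d + 2 ^ c + 100) ^ 8 < 2 ^ b)
    (hb' : 2 ^ b ≤ 2 * (n + d + 2 ^ c + 100) ^ 8) (hH : H = φ.sumSq d * (2 ^ b) ^ (d + 1)) :
    ∃ G : Finset (List.Vector Bool (2 * b)), 2 ^ (2 * b) ≤ 4 * b * G.card ∧ ∀ l ∈ G,
      φ.IsCert (ofBits 0 (l.toList.take b)) (ofBits 0 (l.toList.drop b) + 1) := by
  classical
  obtain ⟨Δ, E, hΔ0, hΔd, hΔ⟩ := exists_minor hp hr hs.num_deg hs.den_deg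
  obtain ⟨T, hT⟩ : ∃ T, T = 2 ^ b := ⟨_, rfl⟩
  obtain ⟨Z, hZ⟩ : ∃ Z, Z = n + d + 2 ^ c + 100 := ⟨_, rfl⟩
  rw [← hZ, ← hT] at hb hb'
  have hZ1 : 101 ≤ Z := by have := Nat.one_le_two_pow (n := c); omega
  have h2c := Nat.one_le_two_pow (n := c)
  have hdZ : d + 1 ≤ Z := by omega
  have hnZ : n ≤ Z := by omega
  have hcZ : 1 + 2 * 2 ^ c ≤ 2 * Z := by omega
  have hb0 : 0 < b := by
    rcases Nat.eq_zero_or_pos b with rfl | h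
    · have := Nat.one_le_pow 8 Z (by omega)
      omega
    · exact h
  have hbZ : b ≤ 9 * Z := by
    rw [← Nat.pow_le_pow_iff_right (a := 2) (by norm_num), ← hT]
    refine hb'.trans ?_
    have : Z ^ 8 ≤ (2 ^ Z) ^ 8 := Nat.pow_le_pow_left Nat.lt_two_pow_self.le 8
    calc 2 * Z ^ 8 ≤ 2 ^ 1 * (2 ^ Z) ^ 8 := by omega
      _ = 2 ^ (1 + Z * 8) := by rw [← pow_mul, ← pow_add]
      _ ≤ 2 ^ (9 * Z) := Nat.pow_le_pow_right (by norm_num) (by omega)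
  -- The loss `10 b² Z² + 2 b` in the count of primes must stay below `T / 2`. With `b ≤ 9 Z`, twice
  -- the loss is at most `1620 Z ^ 4 + 36 Z`, which is where 1656 comes from.
  have hZ4 : 1656 * Z ^ 4 ≤ T := by
    have : 1656 ≤ Z ^ 4 := (by norm_num : 1656 ≤ 101 ^ 4).trans (Nat.pow_le_pow_left hZ1 4)
    calc 1656 * Z ^ 4 ≤ Z ^ 4 * Z ^ 4 := Nat.mul_le_mul_right _ this
      _ = Z ^ 8 := by ring
      _ ≤ T := hb.le
  have hZsq : Z ^ 2 ≤ Z ^ 4 := Nat.pow_le_pow_right (by omega) (by norm_num)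
  have hZone : Z ≤ Z ^ 4 := Nat.le_self_pow (by norm_num) Z
  -- few parameters are bad
  obtain ⟨A, hA⟩ : ∃ A : Finset ℕ, A = (Finset.range T).filter fun t : ℕ => Δ.eval (t : ℤ) ≠ 0 :=
    ⟨_, rfl⟩
  have hAcard : T ≤ 2 * A.card := by
    have h1 := Finset.card_filter_add_card_filter_not (s := Finset.range T)
      (fun t : ℕ => Δ.eval (t : ℤ) ≠ 0)
    rw [← hA, Finset.card_range] at h1
    have h2 : ((Finset.range T).filter fun t : ℕ => ¬ Δ.eval (t : ℤ) ≠ 0).card ≤ Δ.roots.toFinset.card :=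
      Finset.card_le_card_of_injOn (fun t : ℕ => (t : ℤ)) (fun t ht => by
        have := (Finset.mem_filter.mp ht).2
        simpa [hΔ0] using this) (fun _ _ _ _ h => by simpa using h)
    have h3 : Δ.roots.toFinset.card ≤ 4 * d ^ 2 + 2 * d + n * d :=
      (Multiset.toFinset_card_le _).trans ((card_roots' Δ).trans hΔd)
    have h4 : 4 * d ^ 2 + 2 * d + n * d ≤ 7 * Z ^ 2 := by
      nlinarith
    omega
  -- few primes are bad
  obtain ⟨P, hP⟩ : ∃ P : ℕ → Finset ℕ, P = fun t : ℕ => (Finset.range (T + 1)).filter fun r : ℕ =>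
    r.Prime ∧ ¬ (r : ℤ) ∣ E.eval (t : ℤ) := ⟨_, rfl⟩
  -- The coefficients of `cross` are at most `2 H²`, and `E` is at most `(2d)!` times their bound to
  -- the power `2d + 1`; the exponents of two add up to at most `10 b Z²`.
  have hE : ∀ t ∈ A, (E.eval (t : ℤ)).natAbs ≤ 2 ^ (10 * b * Z ^ 2) := by
    intro t ht
    rw [hA, Finset.mem_filter, Finset.mem_range, hT] at ht
    have hH0 : H ≤ 2 ^ (2 ^ c + b * (d + 1)) := by
      rw [hH, pow_add (2 : ℤ) (2 ^ c), pow_mul (2 : ℤ) b]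
      exact mul_le_mul_of_nonneg_right hc.le (by positivity)
    have hHpos : 0 < H := lt_trans (by positivity) hs.hH
    have hB : ∀ i j, |(φ.cross t i).coeff j| ≤ 2 ^ (1 + 2 * (2 ^ c + b * (d + 1))) := by
      intro i j
      have h := hs.out t (by positivity) (by exact_mod_cast ht.1) i
      rw [coeff_cross]
      refine (abs_sub _ _).trans ?_
      rw [abs_mul, abs_mul]
      have h1 := mul_le_mul (h j).1.le (h (φ.den i).natDegree).2.le (abs_nonneg _) hHpos.le
      have h2 := mul_le_mul (h j).2.le (h (φ.den i).natDegree).1.le (abs_nonneg _) hHpos.le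
      have h3 : H * H ≤ 2 ^ (2 ^ c + b * (d + 1)) * 2 ^ (2 ^ c + b * (d + 1)) :=
        mul_le_mul hH0 hH0 hHpos.le (by positivity)
      rw [pow_add, two_mul, pow_add, pow_one]
      linarith
    have h1 := (hΔ t ht.2).2.1 _ hB
    have h2 : ((2 * d).factorial : ℤ) ≤ 2 ^ (b * (2 * d)) := by
      have hd2 : 2 * d ≤ 2 ^ b := by
        rw [← hT]; omega
      rw [pow_mul]
      exact_mod_cast (Nat.factorial_le_pow (2 * d)).trans (Nat.pow_le_pow_left hd2 _)
    have h3 : |E.eval (t : ℤ)| ≤ 2 ^ (10 * b * Z ^ 2) := by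
      refine h1.trans ((mul_le_mul_of_nonneg_right h2 (by positivity)).trans ?_)
      rw [← pow_mul, ← pow_add]
      refine pow_le_pow_right₀ (by norm_num) ?_
      have e3 : 1 + 2 * (2 ^ c + b * (d + 1)) ≤ 2 * Z + 2 * (b * Z) := by nlinarith
      have e4 : Z ≤ b * Z := Nat.le_mul_of_pos_left Z hb0
      have e5 : (1 + 2 * (2 ^ c + b * (d + 1))) * (2 * d + 1) ≤ 4 * (b * Z) * (2 * Z) :=
        Nat.mul_le_mul (by omega) (by omega)
      have e6 : b * (2 * d) ≤ b * (2 * Z) := Nat.mul_le_mul_left _ (by omega)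
      have e7 : b * Z ≤ b * Z * Z := Nat.le_mul_of_pos_right _ (by omega)
      nlinarith
    zify
    exact h3
  have hPcard : ∀ t ∈ A, T ≤ 2 * b * (P t).card := by
    intro t ht
    have hE0 : (E.eval (t : ℤ)).natAbs ≠ 0 :=
      Int.natAbs_ne_zero.mpr (hΔ t (by rw [hA] at ht; exact (Finset.mem_filter.mp ht).2)).1
    have h1 := card_primeFactors_le hE0 (hE t ht)
    have h2 : Nat.primeCounting T ≤ (P t).card + (E.eval (t : ℤ)).natAbs.primeFactors.card := by
      rw [Nat.primeCounting, Nat.primeCounting', Nat.count_eq_card_filter_range]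
      refine (Finset.card_le_card fun r hr => ?_).trans (Finset.card_union_le _ _)
      obtain ⟨hr1, hr2⟩ := Finset.mem_filter.mp hr
      rw [Finset.mem_union, hP]
      by_cases hd : (r : ℤ) ∣ E.eval (t : ℤ)
      · exact Or.inr (Nat.mem_primeFactors.mpr ⟨hr2, Int.natCast_dvd.mp hd, hE0⟩)
      · exact Or.inl (Finset.mem_filter.mpr ⟨hr1, hr2, hd⟩)
    have h3 := two_pow_le_primeCounting hb0
    rw [← hT] at h3
    have h4 : b * Nat.primeCounting T ≤ b * ((P t).card + 10 * b * Z ^ 2) :=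
      Nat.mul_le_mul_left _ (by omega)
    have h5 : b * b ≤ 9 * Z * (9 * Z) := Nat.mul_le_mul hbZ hbZ
    have h6 : b * b * Z ^ 2 ≤ 81 * Z ^ 4 := by
      calc b * b * Z ^ 2 ≤ 9 * Z * (9 * Z) * Z ^ 2 := Nat.mul_le_mul_right _ h5
        _ = 81 * Z ^ 4 := by ring
    have h7 : b * ((P t).card + 10 * b * Z ^ 2) = b * (P t).card + 10 * (b * b * Z ^ 2) := by ring
    have h8 : 2 * b * (P t).card = 2 * (b * (P t).card) := by ring
    omega
  refine ⟨Finset.univ.filter fun l : List.Vector Bool (2 * b) =>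
    φ.IsCert (ofBits 0 (l.toList.take b)) (ofBits 0 (l.toList.drop b) + 1), ?_,
    fun l hl => (Finset.mem_filter.mp hl).2⟩
  have hsurj : (A.sigma P).card ≤ (Finset.univ.filter fun l : List.Vector Bool (2 * b) =>
      φ.IsCert (ofBits 0 (l.toList.take b)) (ofBits 0 (l.toList.drop b) + 1)).card := by
    refine Finset.card_le_card_of_surjOn (fun l : List.Vector Bool (2 * b) =>
      (⟨ofBits 0 (l.toList.take b), ofBits 0 (l.toList.drop b) + 1⟩ : Σ _ : ℕ, ℕ)) ?_
    rintro ⟨t, r⟩ htr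
    obtain ⟨ht, hrP⟩ := Finset.mem_sigma.mp (Finset.mem_coe.mp htr)
    simp only at ht hrP
    have hcert : φ.IsCert t r := by
      rw [hA] at ht
      rw [hP] at hrP
      obtain ⟨-, h1, h2⟩ := Finset.mem_filter.mp hrP
      exact (hΔ t (Finset.mem_filter.mp ht).2).2.2 r h1 h2
    have htT : t < 2 ^ b := by
      rw [hA] at ht; rw [← hT]; exact Finset.mem_range.mp (Finset.mem_filter.mp ht).1
    have hrT : r - 1 < 2 ^ b := by
      rw [hP] at hrP
      have := Finset.mem_range.mp (Finset.mem_filter.mp hrP).1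
      have := hcert.prime.pos
      omega
    obtain ⟨bs, hbs, hbt⟩ := exists_ofBits b t htT
    obtain ⟨cs, hcs, hcr⟩ := exists_ofBits b (r - 1) hrT
    have hr1 : r - 1 + 1 = r := by have := hcert.prime.pos; omega
    refine ⟨⟨bs ++ cs, by rw [List.length_append]; omega⟩, ?_, ?_⟩
    · refine Finset.mem_coe.mpr (Finset.mem_filter.mpr ⟨Finset.mem_univ _, ?_⟩)
      simp only [List.Vector.toList_mk]
      rw [List.take_left' hbs, List.drop_left' hbs, hbt, hcr, hr1]
      exact hcert
    · simp only [List.Vector.toList_mk]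
      rw [List.take_left' hbs, List.drop_left' hbs, hbt, hcr, hr1]
  refine le_trans ?_ (Nat.mul_le_mul_left _ hsurj)
  rw [Finset.card_sigma, two_mul, pow_add, ← hT]
  calc T * T ≤ 2 * A.card * T := Nat.mul_le_mul_right _ hAcard
    _ = 2 * ∑ _ ∈ A, T := by rw [Finset.sum_const, smul_eq_mul, mul_assoc]
    _ ≤ 2 * ∑ t ∈ A, 2 * b * (P t).card := Nat.mul_le_mul_left _ (Finset.sum_le_sum hPcard)
    _ = 4 * b * ∑ t ∈ A, (P t).card := by rw [← Finset.mul_sum]; ring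

end RatParam

/-! ### The complete program -/

namespace BitRAM

/-- The complete program. -/
def program : Cmd := .seq prepare.code (Stm.iter (.reg 18) attempt).code

/-- The cost of the guard of the main loop. -/
def guardCost : ℕ := (AExp.reg 18).κ * opc 2

lemma Sim.exec_guard {σ τ : State} (h : Sim σ τ) (h18 : τ.reg 18 = 0 ∨ τ.reg 18 = 1) :
    ∃ k σ', Exec ((AExp.reg 18).code 100) σ [] k σ' ∧ k ≤ guardCost ∧ Sim σ' τ ∧
      σ'.reg 100 = τ.reg 18 := by
  have hf : (AExp.reg 18).Fits τ 2 := by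
    rw [AExp.fits_reg]; rcases h18 with h | h <;> simp [h]
  obtain ⟨k, σ', he, hk, hr, hs, -⟩ := (AExp.reg 18).exec_code' rfl hf 100 σ le_rfl h
  exact ⟨k, σ', he, by rw [guardCost]; omega, hs, hr⟩

/-- The loop invariant asserts that the machine state simulates some state satisfying `Ready`. A
pass tosses exactly `2 * b` coins and is followed by one more evaluation of the guard; the share of
successful tosses accounts for the factor `4 * b`. -/
theorem isLasVegas_program {n : ℕ} {φ : RatParam n} {d m b B : ℕ} {H : ℤ} {post : State → Prop}
    (hs : Setup φ d m b H) (hb : 0 < b)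
    (hprep : Tr prepare (φ.input d) [] B (fun τ => Ready φ d m b H τ ∧ τ.reg 18 = 1))
    (hG : ∃ G : Finset (List.Vector Bool (2 * b)), 2 ^ (2 * b) ≤ 4 * b * G.card ∧ ∀ l ∈ G,
      φ.IsCert (ofBits 0 (l.toList.take b)) (ofBits 0 (l.toList.drop b) + 1))
    (hpost : ∀ σ τ, Sim σ τ → Ready φ d m b H τ → τ.reg 18 = 0 → post σ) :
    IsLasVegas program (φ.input d) post
      ((B + (guardCost + 4 * b * (attempt.κ * attemptCost n d m b H + guardCost + 2 * 2)) : ℕ)) := by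
  obtain ⟨k₀, τ₀, hev, hk₀, hr₀, h18⟩ := hprep
  obtain ⟨k₁, σ₁, he₁, hk₁, hsim₁⟩ := hev.exec (by decide) (φ.input d) ⟨fun _ _ => rfl, rfl⟩
  obtain ⟨k₂, σ₂, he₂, hk₂, hsim₂, hr₂⟩ := hsim₁.exec_guard hr₀.r18
  obtain ⟨G, hGcard, hG⟩ := hG
  have hloop : IsLasVegas (.loop 100 (.seq attempt.code ((AExp.reg 18).code 100))) σ₂ post
      ((4 * b : ℕ) * ((attempt.κ * attemptCost n d m b H + guardCost : ℕ) + 2 * (2 : ℕ))) := by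
    refine isLasVegas_loop (m := 2 * b)
      (I := fun σ => ∃ τ, Sim σ τ ∧ Ready φ d m b H τ ∧ σ.reg 100 = τ.reg 18) (by omega)
      ⟨τ₀, hsim₂, hr₀, hr₂⟩ ?_ ?_ ?_
    · rintro σ ⟨τ, hsim, hr, -⟩ -
      have key : ∀ l : List.Vector Bool (2 * b), ∃ k σ',
          Exec (.seq attempt.code ((AExp.reg 18).code 100)) σ l.toList k σ' ∧
          k ≤ attempt.κ * attemptCost n d m b H + guardCost ∧
          (∃ τ', Sim σ' τ' ∧ Ready φ d m b H τ' ∧ σ'.reg 100 = τ'.reg 18) ∧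
          (φ.IsCert (ofBits 0 (l.toList.take b)) (ofBits 0 (l.toList.drop b) + 1) →
            σ'.reg 100 = 0) := by
        intro l
        have hl := l.toList_length
        obtain ⟨k, τ', hev, hk, hr', hc⟩ := attempt_tr hs hr (bs := l.toList.take b)
          (cs := l.toList.drop b) (by rw [List.length_take, hl]; omega)
          (by rw [List.length_drop, hl]; omega)
        rw [List.take_append_drop] at hev
        obtain ⟨k', σ', he, hk', hsim'⟩ := hev.exec (by decide) σ hsim
        obtain ⟨k'', σ'', he', hk'', hsim'', h100⟩ := hsim'.exec_guard hr'.r18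
        refine ⟨k' + k'', σ'', ?_, by omega, ⟨τ', hsim'', hr', h100⟩, fun h => h100.trans (hc h)⟩
        have := Exec.seq he he'
        rwa [List.append_nil] at this
      choose cost final hexec hcost hinv hcert using key
      exact ⟨⟨cost, final, hexec⟩, fun l => ⟨hinv l, hcost l⟩, G, hGcard,
        fun l hl => (hcert l (hG l hl)).le⟩
    · rintro σ ⟨τ, -, hr, h⟩
      rw [h]
      rcases hr.r18 with h | h <;> simp [h]
    · rintro σ ⟨τ, hsim, hr, h⟩ h0
      refine hpost σ τ hsim hr ?_
      rcases hr.r18 with h' | h'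
      · exact h'
      · rw [h, h'] at h0; norm_num at h0
  obtain ⟨hh, hc, he⟩ := IsLasVegas.seq he₁ (hloop.seq he₂)
  refine ⟨hh, hc, he.trans ?_⟩
  have h : k₁ + (k₂ + 4 * b * (attempt.κ * attemptCost n d m b H + guardCost + 2 * 2)) ≤
      B + (guardCost + 4 * b * (attempt.κ * attemptCost n d m b H + guardCost + 2 * 2)) := by omega
  exact_mod_cast h

end BitRAM

/-! ### Size of the parameters and total cost -/

namespace RatParam

lemma HasSize.abs_coeff_le {n d τ : ℕ} {φ : RatParam n} (h : φ.HasSize d τ) (i : Fin n) (j : ℕ) :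
    |(φ.num i).coeff j| ≤ 2 ^ τ ∧ |(φ.den i).coeff j| ≤ 2 ^ τ := by
  have h1 := (h i).1.2 j
  have h2 := (h i).2.2 j
  rw [Real.rpow_natCast] at h1 h2
  exact ⟨by exact_mod_cast h1, by exact_mod_cast h2⟩

lemma HasSize.sumSq_le {n d τ : ℕ} {φ : RatParam n} (h : φ.HasSize d τ) :
    φ.sumSq d ≤ (1 + 2 * n * (d + 1)) * 2 ^ (2 * τ) := by
  have h1 : ∀ a, φ.inputMem d a ^ 2 ≤ 2 ^ (2 * τ) := fun a => by
    have h0 : |φ.inputMem d a| ≤ 2 ^ τ := by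
      rw [inputMem]
      split_ifs
      · exact (h.abs_coeff_le _ _).1
      · exact (h.abs_coeff_le _ _).2
      · simp
    rw [mul_comm, pow_mul, ← sq_abs]
    exact pow_le_pow_left₀ (abs_nonneg _) h0 2
  have h2 := Finset.sum_le_card_nsmul (Finset.range (2 * n * (d + 1)))
    (fun j : ℕ => φ.inputMem d j ^ 2) _ fun j _ => h1 j
  rw [Finset.card_range, nsmul_eq_mul] at h2
  push_cast at h2
  have h3 : (1 : ℤ) ≤ 2 ^ (2 * τ) := one_le_pow₀ (by norm_num)
  rw [sumSq]
  linarith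

end RatParam

namespace BitRAM

/-- The parameters of the program, with bounds in terms of the bit length `L` of `n + d + τ + 2`. -/
lemma exists_parameters {n d τ L : ℕ} {φ : RatParam n} (hφ : φ.HasSize d τ) (hn : 0 < n) (hd : 0 < d)
    (hL : L = (n + d + τ + 2).size) : ∃ c b m : ℕ,
      (φ.sumSq d < 2 ^ 2 ^ c ∧ (∀ j < c, (2 : ℤ) ^ 2 ^ j ≤ φ.sumSq d)) ∧
      ((n + d + 2 ^ c + 100) ^ 8 < 2 ^ b ∧ (∀ j < b, 2 ^ j ≤ (n + d + 2 ^ c + 100) ^ 8)) ∧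
      (d < 2 ^ m ∧ ∀ j < m, 2 ^ j ≤ d) ∧
      euclidBase n d m + 2 * (d + 1) ≤ 2 ^ b ∧ 0 < b ∧ b ≤ 24 * L ∧ m ≤ L ∧ 2 ^ m ≤ 2 * d ∧
      φ.sumSq d * (2 ^ b) ^ (d + 1) ≤ 2 ^ (59 * L * (d + τ)) := by
  have hN : n + d + τ + 2 < 2 ^ L := hL ▸ Nat.lt_size_self _
  have hL3 : 3 ≤ L := hL ▸ Nat.lt_size.mpr (by omega)
  have hLN : L ≤ n + d + τ + 2 := by rw [hL, Nat.size_le]; exact Nat.lt_two_pow_self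
  -- the length of the sum of the squares
  have hS : φ.sumSq d ≤ 2 ^ (2 * L + 2 * τ + 1) := by
    refine hφ.sumSq_le.trans ?_
    have h1 : 1 + 2 * n * (d + 1) ≤ 2 ^ (2 * L + 1) := by
      calc 1 + 2 * n * (d + 1) ≤ (n + d + τ + 2) * (n + d + τ + 2) * 2 := by nlinarith
        _ ≤ 2 ^ L * 2 ^ L * 2 := by gcongr
        _ = 2 ^ (2 * L + 1) := by rw [two_mul, pow_succ, pow_add]
    rw [show 2 * L + 2 * τ + 1 = 2 * L + 1 + 2 * τ by ring, pow_add _ _ (2 * τ)]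
    exact mul_le_mul_of_nonneg_right (by exact_mod_cast h1) (by positivity)
  have hex : ∃ c : ℕ, φ.sumSq d < 2 ^ 2 ^ c := by
    refine ⟨2 * L + 2 * τ + 1, hS.trans_lt (pow_lt_pow_right₀ (by norm_num) Nat.lt_two_pow_self)⟩
  classical
  obtain ⟨c, hc⟩ : ∃ c, c = Nat.find hex := ⟨_, rfl⟩
  have hc1 : φ.sumSq d < 2 ^ 2 ^ c := hc ▸ Nat.find_spec hex
  have hc2 : ∀ j < c, (2 : ℤ) ^ 2 ^ j ≤ φ.sumSq d := fun j hj =>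
    not_lt.mp (Nat.find_min hex (hc ▸ hj))
  -- By minimality of `c`, the number `2 ^ 2 ^ (c - 1)` does not exceed the sum of the squares. So
  -- the measured length is at most twice the true one, and `b` remains logarithmic in the input
  -- parameters.
  have hcb : 2 ^ c ≤ 4 * L + 4 * τ + 2 := by
    rcases c with _ | c
    · rw [pow_zero]; omega
    · have h1 := (hc2 c (by omega)).trans hS
      rw [pow_le_pow_iff_right₀ (by norm_num)] at h1
      rw [pow_succ]; omega
  obtain ⟨Z, hZ⟩ : ∃ Z, Z = n + d + 2 ^ c + 100 := ⟨_, rfl⟩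
  have hZ1 : n + d + 100 ≤ Z := by rw [hZ, add_right_comm _ (2 ^ c)]; exact Nat.le_add_right _ _
  have hZL : Z < 2 ^ (L + 6) := by
    rw [pow_add]; omega
  have hb24 : (Z ^ 8).size ≤ 24 * L := by
    rw [Nat.size_le]
    calc Z ^ 8 < (2 ^ (L + 6)) ^ 8 := Nat.pow_lt_pow_left hZL (by norm_num)
      _ = 2 ^ ((L + 6) * 8) := by rw [pow_mul]
      _ ≤ 2 ^ (24 * L) := Nat.pow_le_pow_right (by norm_num) (by omega)
  obtain ⟨b, hb⟩ : ∃ b, b = (Z ^ 8).size := ⟨_, rfl⟩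
  obtain ⟨m, hm⟩ : ∃ m, m = d.size := ⟨_, rfl⟩
  have hb1 : Z ^ 8 < 2 ^ b := hb ▸ Nat.lt_size_self _
  have hm2 : 2 ^ m ≤ 2 * d := by
    have hm0 : 0 < m := hm ▸ Nat.size_pos.mpr hd
    have := Nat.lt_size.mp (show m - 1 < d.size by omega)
    obtain ⟨k, rfl⟩ : ∃ k, m = k + 1 := ⟨m - 1, by omega⟩
    rw [pow_succ]; simp only [Nat.add_sub_cancel] at this; omega
  rw [← hb] at hb24
  refine ⟨c, b, m, ⟨hc1, hc2⟩, ?_, ⟨hm ▸ Nat.lt_size_self _, fun j hj => Nat.lt_size.mp (hm ▸ hj)⟩,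
    ?_, ?_, hb24, ?_, hm2, ?_⟩
  · rw [← hZ]
    exact ⟨hb1, fun j hj => Nat.lt_size.mp (hb ▸ hj)⟩
  · have h1 : 4 * n * (d + 1) + 2 * 2 ^ m + 2 * (d + 1) ≤ 2 ^ b := by
      have h2 : Z ^ 3 ≤ Z ^ 8 := Nat.pow_le_pow_right (by omega) (by norm_num)
      have h3 : 100 * (Z * Z) ≤ Z ^ 3 := by
        rw [pow_succ, sq, mul_comm]; exact Nat.mul_le_mul_left _ (by omega)
      have h4 : n * (d + 1) ≤ Z * Z := Nat.mul_le_mul (by omega) (by omega)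
      have h5 : Z ≤ Z * Z := Nat.le_mul_self Z
      rw [mul_assoc]
      omega
    rw [euclidBase]
    exact_mod_cast h1
  · rw [hb]; exact Nat.size_pos.mpr (Nat.pow_pos (by omega))
  · rw [hm, hL]; exact Nat.size_le_size (by omega)
  · refine (mul_le_mul_of_nonneg_right hS (by positivity)).trans ?_
    rw [← pow_mul, ← pow_add]
    -- The exponent is `2 L + 2 τ + 1 + b (d + 1)`, where `b (d + 1) ≤ 48 L d`; positivity of `d`
    -- and `L` absorbs the rest into `59 L (d + τ)`.
    refine pow_le_pow_right₀ (by norm_num) ?_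
    have h1 : b * (d + 1) ≤ 24 * L * (2 * d) := Nat.mul_le_mul hb24 (by omega)
    have h2 : L ≤ L * d := Nat.le_mul_of_pos_right _ hd
    have h3 : τ ≤ L * τ := Nat.le_mul_of_pos_left _ (by omega)
    nlinarith

/-- A bound by a fixed power of `2 ^ L` turns the logarithmic factor of `opc` into a multiple of
`L`. -/
lemma opc_le {x y s L : ℕ} (h : x ≤ y) (hy : y < 2 ^ (s * L)) : opc x ≤ y * (s * L + 1) :=
  (opc_mono h).trans (Nat.mul_le_mul_left _ (Nat.add_le_add_right (Nat.size_le.mpr hy) 1))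

/-- The cost of the program in terms of the bit length `L` of `n + d + τ + 2`. -/
lemma cost_le {n d τ L m b p g a : ℕ} {H : ℤ} (hn : 0 < n) (hd : 0 < d)
    (hL : L = (n + d + τ + 2).size) (hb : b ≤ 24 * L) (hm : m ≤ L) (hm2 : 2 ^ m ≤ 2 * d)
    (hlen : len (2 * H) ≤ 60 * L * (d + τ)) :
    p * ((2 * n * (d + 1) + b + d + 4) * opc (2 * len (2 * H))) +
      (g + 4 * b * (a * attemptCost n d m b H + g + 2 * 2)) ≤
    (10 ^ 6 * p + 10 ^ 7 * a + 1000 * g + 1000) * (n * (d ^ 2 + d * τ) * L ^ 4) := by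
  have hN : n + d + τ + 2 < 2 ^ L := hL ▸ Nat.lt_size_self _
  have hL3 : 3 ≤ L := hL ▸ Nat.lt_size.mpr (by omega)
  have hLL : L < 2 ^ L := Nat.lt_two_pow_self
  obtain ⟨e, he⟩ : ∃ e, e = d + τ := ⟨_, rfl⟩
  have h8 : 8 ≤ 2 ^ L := (by norm_num : 8 = 2 ^ 3) ▸ Nat.pow_le_pow_right (by norm_num) hL3
  have heL : e < 2 ^ L := by omega
  have hdL : d < 2 ^ L := by omega
  have he0 : 0 < e := by omega
  rw [← he] at hlen
  have hde : d ^ 2 + d * τ = d * e := by rw [he]; ring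
  rw [hde]
  obtain ⟨W, hW⟩ : ∃ W, W = n * (d * e) := ⟨_, rfl⟩
  have p1 : opc (2 * len (2 * H)) ≤ 120 * L * e * (5 * L + 1) := by
    refine opc_le (by nlinarith) ?_
    calc 120 * L * e = 120 * (L * e) := by ring
      _ ≤ 8 * 8 * 8 * (L * e) := Nat.mul_le_mul_right _ (by norm_num)
      _ ≤ 2 ^ L * 2 ^ L * 2 ^ L * (L * e) := by gcongr
      _ < 2 ^ L * 2 ^ L * 2 ^ L * (2 ^ L * 2 ^ L) := by
        gcongr
      _ = 2 ^ (5 * L) := by ring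
  have p2 : opc (4 * 2 ^ m * len (2 * H)) ≤ 480 * L * e * d * (6 * L + 1) := by
    refine opc_le ((Nat.mul_le_mul (Nat.mul_le_mul_left 4 hm2) hlen).trans (le_of_eq (by ring))) ?_
    calc 480 * L * e * d = 480 * (L * e * d) := by ring
      _ ≤ 8 * 8 * 8 * (L * e * d) := Nat.mul_le_mul_right _ (by norm_num)
      _ ≤ 2 ^ L * 2 ^ L * 2 ^ L * (L * e * d) := by gcongr
      _ < 2 ^ L * 2 ^ L * 2 ^ L * (2 ^ L * 2 ^ L * 2 ^ L) := by
        gcongr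
      _ = 2 ^ (6 * L) := by ring
  have p3 : opc (b + 4) ≤ 26 * L * (3 * L + 1) := by
    refine opc_le (by omega) ?_
    calc 26 * L ≤ 8 * 8 * L := Nat.mul_le_mul_right _ (by norm_num)
      _ ≤ 2 ^ L * 2 ^ L * L := by gcongr
      _ < 2 ^ L * 2 ^ L * 2 ^ L := by gcongr
      _ = 2 ^ (3 * L) := by ring
  have q1 : opc (2 * len (2 * H)) ≤ 720 * (L ^ 2 * e) := p1.trans (by
    calc 120 * L * e * (5 * L + 1) ≤ 120 * L * e * (6 * L) := by gcongr; omega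
      _ = _ := by ring)
  have q2 : opc (4 * 2 ^ m * len (2 * H)) ≤ 3360 * (L ^ 2 * (d * e)) := p2.trans (by
    calc 480 * L * e * d * (6 * L + 1) ≤ 480 * L * e * d * (7 * L) := by gcongr; omega
      _ = _ := by ring)
  have q3 : opc (b + 4) ≤ 104 * L ^ 2 := p3.trans (by
    calc 26 * L * (3 * L + 1) ≤ 26 * L * (4 * L) := by gcongr; omega
      _ = _ := by ring)
  have r1 : (2 * n * (d + 1) + b + d + 4) * opc (2 * len (2 * H)) ≤ 10 ^ 6 * (W * L ^ 4) := by
    have h1 : 2 * n * (d + 1) + b + d + 4 ≤ 40 * (L * (n * d)) := by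
      have h2 : 0 < n * d := Nat.mul_pos hn hd
      have h3 : n ≤ n * d := Nat.le_mul_of_pos_right _ hd
      have h4 : d ≤ n * d := Nat.le_mul_of_pos_left _ hn
      have h5 : L ≤ L * (n * d) := Nat.le_mul_of_pos_right _ h2
      have h6 : 3 * (n * d) ≤ L * (n * d) := Nat.mul_le_mul_right _ hL3
      nlinarith
    calc _ ≤ 40 * (L * (n * d)) * (720 * (L ^ 2 * e)) := Nat.mul_le_mul h1 q1
      _ = 28800 * (n * (d * e)) * (L ^ 3 * 1) := by ring
      _ ≤ 10 ^ 6 * (n * (d * e)) * (L ^ 3 * L) := by gcongr <;> omega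
      _ = _ := by rw [hW]; ring
  -- One factor `L` comes from the length of `H`, one from the logarithm in the cost of a
  -- multiplication, and one from the number of levels. The fourth arises later from the expected
  -- number of attempts.
  have r2 : coordCost d m b H ≤ 10 ^ 4 * (d * e * L ^ 3) := by
    rw [coordCost]
    have h1 : (m + 1) * opc (4 * 2 ^ m * len (2 * H)) ≤ 2 * L * (3360 * (L ^ 2 * (d * e))) :=
      Nat.mul_le_mul (by omega) q2
    have h2 : (2 * d + 1) * ((d + 1) * opc (b + 4)) ≤ 3 * d * (2 * e * (104 * (L ^ 2 * L))) :=
      Nat.mul_le_mul (by omega) (Nat.mul_le_mul (by omega) (q3.trans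
        (Nat.mul_le_mul_left _ (Nat.le_mul_of_pos_right _ (by omega)))))
    nlinarith
  have r3 : attemptCost n d m b H ≤ 10 ^ 5 * (W * L ^ 3) := by
    rw [attemptCost]
    have h1 : (n + 1) * coordCost d m b H ≤ 2 * n * (10 ^ 4 * (d * e * L ^ 3)) :=
      Nat.mul_le_mul (by omega) r2
    have h2 : d + b + 2 ≤ 30 * (L * d) := by
      have h5 : L ≤ L * d := Nat.le_mul_of_pos_right _ hd
      have h6 : 3 * d ≤ L * d := Nat.mul_le_mul_right _ hL3
      omega
    have h3 : (d + b + 2) * opc (b + 4) ≤ 30 * (L * d) * (104 * L ^ 2) := Nat.mul_le_mul h2 q3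
    have h4 : d * L ^ 3 ≤ W * L ^ 3 := Nat.mul_le_mul_right _ (by
      rw [hW]
      exact (Nat.le_mul_of_pos_right d he0).trans (Nat.le_mul_of_pos_left _ hn))
    have h5 : 2 * n * (10 ^ 4 * (d * e * L ^ 3)) = 20000 * (W * L ^ 3) := by rw [hW]; ring
    have h6 : 30 * (L * d) * (104 * L ^ 2) = 3120 * (d * L ^ 3) := by ring
    omega
  have hW0 : 0 < W := hW ▸ Nat.mul_pos hn (Nat.mul_pos hd he0)
  have hL4 : L ≤ L ^ 4 := Nat.le_self_pow (by norm_num) L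
  have hWL : L ≤ W * L ^ 4 := hL4.trans (Nat.le_mul_of_pos_left _ hW0)
  rw [← hW]
  obtain ⟨x, hx⟩ : ∃ x, x = W * L ^ 4 := ⟨_, rfl⟩
  rw [← hx] at r1 hWL ⊢
  have s1 := Nat.mul_le_mul_left p r1
  have s2 : 4 * b * (a * attemptCost n d m b H + g + 2 * 2) ≤
      96 * L * (a * (10 ^ 5 * (W * L ^ 3)) + g + 2 * 2) :=
    Nat.mul_le_mul (by omega) (by gcongr)
  have s3 : 96 * L * (a * (10 ^ 5 * (W * L ^ 3)) + g + 2 * 2) =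
      9600000 * (a * x) + 96 * (g * L) + 384 * L := by rw [hx]; ring
  have s4 : g * L ≤ g * x := Nat.mul_le_mul_left _ hWL
  have s5 : g * 1 ≤ g * x := Nat.mul_le_mul_left _ (by omega)
  have s6 : (10 ^ 6 * p + 10 ^ 7 * a + 1000 * g + 1000) * x =
      10 ^ 6 * (p * x) + 10 ^ 7 * (a * x) + 1000 * (g * x) + 1000 * x := by ring
  have s7 : p * (10 ^ 6 * x) = 10 ^ 6 * (p * x) := by ring
  rw [s6]
  rw [s7] at s1
  rw [s3] at s2
  omega

/-- The size is at most `1 + log₂ x ≤ 2 log₂ x`, and `2 / log 2 < 3`. -/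
lemma size_le_log {x : ℕ} (hx : 2 ≤ x) : (x.size : ℝ) ≤ 3 * Real.log x := by
  have h1 : 2 ^ (x.size - 1) ≤ x := Nat.lt_size.mp (by
    have := Nat.size_pos.mpr (show 0 < x by omega); omega)
  have h2 : (x.size - 1 : ℕ) * Real.log 2 ≤ Real.log x := by
    rw [← Real.log_pow]
    exact Real.log_le_log (by positivity) (by exact_mod_cast h1)
  have h3 : Real.log 2 ≤ Real.log x := Real.log_le_log (by norm_num) (by exact_mod_cast hx)
  have h4 := Real.log_two_gt_d9
  have h5 := Nat.size_pos.mpr (show 0 < x by omega)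
  rw [Nat.cast_sub h5] at h2
  have h6 : (1 : ℝ) ≤ x.size := by exact_mod_cast h5
  push_cast at h2
  nlinarith

end BitRAM

lemma RatParam.hasSize_reparam {n d : ℕ} {φ : RatParam n} (hφ : ∀ i, (φ.den i).natDegree ≤ d)
    {t₀ : ℤ} {s : ℕ} {r : ℝ} (hr : (s : ℝ) ≤ r)
    (h : ∀ i j, |((φ.reparam t₀).num i).coeff j| ≤ 2 ^ s ∧ |((φ.reparam t₀).den i).coeff j| ≤ 2 ^ s) :
    (φ.reparam t₀).HasSize d r := by
  have key : ∀ z : ℤ, |z| ≤ 2 ^ s → |(z : ℝ)| ≤ (2 : ℝ) ^ r := fun z hz => by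
    refine le_trans ?_ (Real.rpow_le_rpow_of_exponent_le (by norm_num) hr)
    rw [Real.rpow_natCast]
    exact_mod_cast hz
  exact fun i => ⟨⟨(natDegree_moebius_le _ _ _).trans (hφ i), fun j => key _ (h i j).1⟩,
    (natDegree_moebius_le _ _ _).trans (hφ i), fun j => key _ (h i j).2⟩

/-! ### Assembly of correctness and cost -/

namespace BitRAM
open RatParam

theorem isLasVegas_reparam {n d τ : ℕ} {φ : RatParam n} (hsize : φ.HasSize d τ) (hr : φ.IsReduced)
    (hp : φ.IsProper) {P : Fin n → ℝ} (hP : φ.IsPointAtInfinity P)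
    {p a g K : ℕ} (hcp : prepare.κ = p) (hca : attempt.κ = a) (hcg : guardCost = g)
    (hK : K = 10 ^ 6 * p + 10 ^ 7 * a + 1000 * g + 1000) :
    IsLasVegas program (φ.input d)
      (fun σ => ∃ (t₀ : ℤ) (ψ : RatParam n),
        σ.reg 0 = t₀ ∧ ψ.StoredIn d σ.mem ∧
        φ.IsReparam ψ t₀ ∧ ψ.IsReduced ∧
        (∃ P, ψ.IsPointAtInfinity P ∧ ψ.NonsingularAtInfinity P) ∧
        ψ.HasSize d (K * 3 ^ 4 * (d + τ) * Real.log (n + d + τ + 2) ^ 4))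
      (ENNReal.ofReal (K * 3 ^ 4 * (n * (d ^ 2 + d * τ)) *
        Real.log (n + d + τ + 2) ^ 4)) := by
  have hK1 : 59 ≤ K := by omega
  have hnum := fun i => natDegree_num_le hr hP i
  obtain ⟨hn, hd⟩ := pos_of_isProper hp hr fun i => ⟨(hsize i).1.1, (hsize i).2.1⟩
  obtain ⟨L, hL⟩ : ∃ L, L = (n + d + τ + 2).size := ⟨_, rfl⟩
  have hL1 : 1 ≤ L := hL ▸ Nat.size_pos.mpr (by omega)
  have hlog : (L : ℝ) ≤ 3 * Real.log (n + d + τ + 2) := by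
    have := size_le_log (x := n + d + τ + 2) (by omega)
    rw [← hL] at this
    exact_mod_cast this
  have hlog4 : (L : ℝ) ^ 4 ≤ 3 ^ 4 * Real.log (n + d + τ + 2) ^ 4 := by
    rw [← mul_pow]; exact pow_le_pow_left₀ (by positivity) hlog 4
  obtain ⟨c, b, m, ⟨hc, hc'⟩, ⟨hb, hb'⟩, ⟨hm, hm'⟩, hU, hb0, hbL, hmL, hm2, hHL⟩ :=
    exists_parameters hsize hn hd hL
  obtain ⟨H, hH⟩ : ∃ H, H = φ.sumSq d * (2 ^ b) ^ (d + 1) := ⟨_, rfl⟩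
  rw [← hH] at hHL
  have hs := setup_of_params hnum (fun i => (hsize i).2.1) (fun i => (hr i).1) hd hb0 hm hU hH
  have hH0 : 0 < H := lt_trans (by positivity) hs.hH
  have hlen : len (2 * H) ≤ 60 * L * (d + τ) := by
    have h1 : len (2 * H) ≤ (59 * L * (d + τ) + 2) + 1 := by
      rw [len_le_iff, abs_of_pos (by omega), pow_add]
      have : (0 : ℤ) < 2 ^ (59 * L * (d + τ)) := by positivity
      omega
    have h2 : 3 ≤ L := hL ▸ Nat.lt_size.mpr (by omega)
    have h3 : L * 1 ≤ L * (d + τ) := Nat.mul_le_mul_left _ (by omega)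
    have h4 : 60 * L * (d + τ) = 59 * L * (d + τ) + L * (d + τ) := by ring
    omega
  -- Minimality of `b` bounds `2 ^ (b - 1)`. The upper bound on `2 ^ b` is what keeps `b` linear in
  -- `Z` in the count of good tosses.
  have hb2 : 2 ^ b ≤ 2 * (n + d + 2 ^ c + 100) ^ 8 := by
    have := hb' (b - 1) (by omega)
    obtain ⟨k, rfl⟩ : ∃ k, b = k + 1 := ⟨b - 1, by omega⟩
    rw [pow_succ]
    simp only [Nat.add_sub_cancel] at this
    omega
  have hprep := prepare_tr hc hc' (by exact_mod_cast hb) (fun j hj => by exact_mod_cast hb' j hj)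
    (fun j hj => by exact_mod_cast hm' j hj) hH hs rfl le_rfl
  have hmain := isLasVegas_program (post := fun σ => ∃ (t₀ : ℤ) (ψ : RatParam n),
      σ.reg 0 = t₀ ∧ ψ.StoredIn d σ.mem ∧ φ.IsReparam ψ t₀ ∧ ψ.IsReduced ∧
      (∃ P, ψ.IsPointAtInfinity P ∧ ψ.NonsingularAtInfinity P) ∧
      ψ.HasSize d (K * 3 ^ 4 * (d + τ) * Real.log (n + d + τ + 2) ^ 4)) hs hb0 hprep
    (exists_good_tosses hp hr hs hc hb hb2 hH) fun σ τ' hsim hready h18 => by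
      obtain ⟨t₀, h0, ht, hst, r, hcert⟩ := hready.result h18
      refine ⟨t₀, φ.reparam t₀, (hsim.1 0 (by norm_num)).trans h0, hsim.2 ▸ hst,
        reparam_isReparam hnum t₀, reparam_isReduced hr hnum t₀, ⟨_, hcert.nonsingular⟩,
        hasSize_reparam (fun i => (hsize i).2.1) (s := 59 * L * (d + τ)) ?_ fun i j => ?_⟩
      · have h1 : (59 * L * (d + τ) : ℕ) ≤ K * L ^ 4 * (d + τ) :=
          Nat.mul_le_mul_right _ (Nat.mul_le_mul hK1 (Nat.le_self_pow (by norm_num) L))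
        calc ((59 * L * (d + τ) : ℕ) : ℝ) ≤ K * L ^ 4 * (d + τ) := by exact_mod_cast h1
          _ ≤ K * (3 ^ 4 * Real.log (n + d + τ + 2) ^ 4) * (d + τ) := by gcongr
          _ = _ := by ring
      · have h1 := hs.out t₀ (by positivity) (by exact_mod_cast ht) i j
        exact ⟨h1.1.le.trans hHL, h1.2.le.trans hHL⟩
  rw [hcp, hca, hcg] at hmain
  refine ⟨hmain.halts, hmain.correct, hmain.expected_cost.trans ?_⟩
  have hcost := cost_le (p := p) (g := g) (a := a) (H := H) hn hd hL hbL hmL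
    hm2 hlen
  rw [← hK] at hcost
  rw [← ENNReal.ofReal_natCast]
  refine ENNReal.ofReal_le_ofReal ?_
  calc _ ≤ ((K * (n * (d ^ 2 + d * τ) * L ^ 4) : ℕ) : ℝ) := by exact_mod_cast hcost
    _ = K * (n * (d ^ 2 + d * τ) * (L : ℝ) ^ 4) := by push_cast; ring
    _ ≤ K * (n * (d ^ 2 + d * τ) * (3 ^ 4 * Real.log (n + d + τ + 2) ^ 4)) := by gcongr
    _ = _ := by ring

end BitRAM

theorem mainTheorem11 :
    ∃ (prog : BitRAM.Cmd) (C : ℝ) (k : ℕ),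
      ∀ (n d τ : ℕ) (φ : RatParam n),
        φ.HasSize d τ → φ.IsReduced → φ.IsProper → (∃ P, φ.IsPointAtInfinity P) →
          BitRAM.IsLasVegas prog (φ.input d)
            (fun σ => ∃ (t₀ : ℤ) (ψ : RatParam n),
              σ.reg 0 = t₀ ∧ ψ.StoredIn d σ.mem ∧
              φ.IsReparam ψ t₀ ∧ ψ.IsReduced ∧
              (∃ P, ψ.IsPointAtInfinity P ∧ ψ.NonsingularAtInfinity P) ∧
              ψ.HasSize d (C * (d + τ) * Real.log (n + d + τ + 2) ^ k))
            (ENNReal.ofReal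
              (C * (n * (d ^ 2 + d * τ)) * Real.log (n + d + τ + 2) ^ k)) := by
  -- The final constant depends only on the text of the program; the numerical values of these cost
  -- constants are irrelevant and remain unspecified.
  obtain ⟨p, hcp⟩ := exists_eq' (a' := BitRAM.Stm.κ BitRAM.prepare)
  obtain ⟨a, hca⟩ := exists_eq' (a' := BitRAM.Stm.κ BitRAM.attempt)
  obtain ⟨g, hcg⟩ := exists_eq' (a' := BitRAM.guardCost)
  obtain ⟨K, hK⟩ := exists_eq (a' := 10 ^ 6 * p + 10 ^ 7 * a + 1000 * g + 1000)
  exact ⟨BitRAM.program, K * 3 ^ 4, 4, fun _ _ _ _ hsize hr hp ⟨_, hP⟩ =>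
    BitRAM.isLasVegas_reparam hsize hr hp hP hcp hca hcg hK⟩
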